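/- **Lemma 6.3 (full symbol of the identity, real-valued Levi-Civita phase).** Let $(M,g)$ be a connected closed Riemannian manifold of dimension $d\ge1$, let $T'M=T^*M\setminus\{0\}$, $h(y,\eta)=(g^{\alpha\beta}(y)\eta_\alpha\eta_\beta)^{1/2}$, $\rho=\sqrt{\det g_{\mu\nu}}$, and let $r>0$ be a number not exceeding the injectivity radius of $M$. Let $\varphi:M\times T'M\to\mathbb R$ be the real-valued ($\epsilon=0$) Levi-Civita phase function at time zero: $\varphi(x;y,\eta)$ is infinitely smooth, positively homogeneous in $\eta$ of degree $1$, and $$\varphi(x;y,\eta)=\int_\gamma\zeta\,\mathrm dz\qquad\text{for } \operatorname{dist}(x,y)<r,$$ where $\gamma$ is the shortest geodesic from $y$ to $x$ and $\zeta$ is the parallel transport of $\eta$ along $\gamma$; for $\operatorname{dist}(x,y)\ge r$ the function $\varphi$ is an arbitrary smooth real continuation. Let $\chi\in C^\infty(M\times T'M)$ be a cut-off: $\chi=0$ for $h(y,\eta)\le 1/2$; $\chi=1$ on the intersection of $\{h(y,\eta)\ge1\}$ with a conical neighbourhood of $\{x=y\}$; $\chi(x;y,\alpha\eta)=\chi(x;y,\eta)$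 for $\alpha\ge1$, $h(y,\eta)\ge1$; and $\chi(x;y,\eta)=0$ unless $\operatorname{dist}(x,y)\le r'$, for some $r'<r$. For a polyhomogeneous symbol $\mathfrak s\in S^0_{\mathrm{ph}}(T'M)$, $\mathfrak s\sim\sum_{k\ge0}\mathfrak s_{-k}$, where $\mathfrak s_{-k}$ is smooth on $T'M$ and positively homogeneous in $\eta$ of degree $-k$, consider the pseudodifferential operator $$(\mathfrak I_{\varphi,\mathfrak s}f)(x)=(2\pi)^{-d}\int_{T'M}e^{\mathrm i\varphi(x;y,\eta)}\,\mathfrak s(y,\eta)\,\chi(x;y,\eta)\,v(x;y,\eta)\,f(y)\,\mathrm dy\,\mathrm d\eta,\qquad f\in C^\infty(M),$$ $$v(x;y,\eta)=\rho(x)^{-1/2}\rho(y)^{1/2}\bigl[{\det}^2\varphi_{x^\alpha\eta_\beta}(x;y,\eta)\bigr]^{1/4}$$ (nonnegative real root), the integral being understood as an oscillatory integral, that is, as the limit as $\delta\to0^+$ of the integrals with the additional factor $e^{-\delta h(y,\eta)^2}$. Then the full symbol of the identity operator is identically $1$: the operator $\mathfrak I_{\varphi,1}-\operatorname{Id}$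 is infinitely smoothing (an integral operator with kernel in $C^\infty(M\times M)$), and, for every $\mathfrak s\sim\sum_{k\ge0}\mathfrak s_{-k}$ as above, $\mathfrak I_{\varphi,\mathfrak s}-\operatorname{Id}$ is infinitely smoothing if and only if $\mathfrak s_0=1$ and $\mathfrak s_{-k}=0$ for all $k\ge1$ on $T'M$. -/

import Mathlib

open MeasureTheory Filter Set
open scoped Manifold ContDiff Topology Bundle

noncomputable section

namespace LeviCivitaPhase

/-- The coordinate space `ℝᵈ`. -/
abbrev Coord (d : ℕ) : Type := EuclideanSpace ℝ (Fin d)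

/-- The `i`-th standard basis vector of `ℝᵈ`. -/
def stdVec {d : ℕ} (i : Fin d) : Coord d := EuclideanSpace.single i (1 : ℝ)

section Coordinates

variable {d : ℕ} {M : Type*} [TopologicalSpace M] [ChartedSpace (Coord d) M]

/-- The cotangent space `T_y^* M`. -/
abbrev Cotangent (d : ℕ) {M : Type*} [TopologicalSpace M] [ChartedSpace (Coord d) M] (y : M) :
    Type :=
  TangentSpace (𝓡 d) y →L[ℝ] ℝ

variable [IsManifold (𝓡 d) ∞ M]

/-- Coordinate charts are indexed by points: "the chart at `p`" is the preferred chart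
`chartAt (Coord d) p`.  `frame p y i` is the coordinate vector `∂/∂xⁱ` at `y`, for the chart at `p`
(meaningful when `y` lies in the domain of that chart).  Mathlib represents a vector of `T_y M` by
its components in the chart at `y`, so this is a column of a Jacobian matrix of a change of
coordinates. -/
def frame (p y : M) (i : Fin d) : TangentSpace (𝓡 d) y :=
  (tangentCoordChange (𝓡 d) p y y (stdVec i) : Coord d)

/-- `covec p y ξ` is the covector `∑ₖ ξₖ dxᵏ` at `y`, for the chart at `p`. -/
def covec (p y : M) (ξ : Coord d) : Cotangent d y :=
  (innerSL ℝ ξ).comp (tangentCoordChange (𝓡 d) y p y)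

/-- The point with coordinates `z` in the chart at `p`. -/
def pt (p : M) (z : Coord d) : M := (chartAt (Coord d) p).symm z

/-! ### Smoothness on `T'M` and on `M × T'M`, where `T'M` is `T^*M` without its zero section -/

/-- `a : T'M → V` is smooth, i.e. smooth in local coordinates `(y, η)`. Values at `η = 0` are
irrelevant. -/
def SmoothOnCot {V : Type*} [NormedAddCommGroup V] [NormedSpace ℝ V]
    (a : (y : M) → Cotangent d y → V) : Prop :=
  ∀ p : M, ContDiffOn ℝ ∞
    (fun q : Coord d × Coord d => a (pt p q.1) (covec p (pt p q.1) q.2))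
    ((chartAt (Coord d) p).target ×ˢ {0}ᶜ)

/-- `a : M × T'M → V` is smooth, i.e. smooth in local coordinates `(x, y, η)`, where the coordinate
systems for `x` and `y` may be different. -/
def SmoothOnProdCot {V : Type*} [NormedAddCommGroup V] [NormedSpace ℝ V]
    (a : M → (y : M) → Cotangent d y → V) : Prop :=
  ∀ p₁ p₂ : M, ContDiffOn ℝ ∞
    (fun q : Coord d × Coord d × Coord d =>
      a (pt p₁ q.1) (pt p₂ q.2.1) (covec p₂ (pt p₂ q.2.1) q.2.2))
    ((chartAt (Coord d) p₁).target ×ˢ (chartAt (Coord d) p₂).target ×ˢ {0}ᶜ)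

/-! ### Symbols -/

/-- `a ∈ S^m`: in local coordinates, for `y` in a compact set and `|η| ≥ 1`,
`|∂_y^α ∂_η^β a| ≤ C |η|^(m - |β|)`. -/
def IsSymbolOfOrder (m : ℤ) (a : (y : M) → Cotangent d y → ℂ) : Prop :=
  SmoothOnCot a ∧
  ∀ (p : M) (Q : Set (Coord d)), IsCompact Q → Q ⊆ (chartAt (Coord d) p).target →
    ∀ i j : ℕ, ∃ C : ℝ, ∀ z ∈ Q, ∀ ξ : Coord d, 1 ≤ ‖ξ‖ →
      ‖iteratedFDeriv ℝ j
          (fun ξ' => iteratedFDeriv ℝ i (fun z' => a (pt p z') (covec p (pt p z') ξ')) z) ξ‖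
        ≤ C * ‖ξ‖ ^ (m - (j : ℤ))

/-- `s ∈ S⁰_ph(T'M)` with asymptotic expansion `s ∼ ∑ₖ c k`, where `c k` is smooth on `T'M` and
positively homogeneous in momentum of degree `-k`. -/
structure IsPolyhomogeneous (s : (y : M) → Cotangent d y → ℂ)
    (c : ℕ → (y : M) → Cotangent d y → ℂ) : Prop where
  smooth : SmoothOnCot s
  smooth_comp : ∀ k, SmoothOnCot (c k)
  homogeneous : ∀ (k : ℕ) (y : M) (η : Cotangent d y), η ≠ 0 → ∀ lam : ℝ, 0 < lam →
    c k y (lam • η) = ((lam ^ (-(k : ℤ)) : ℝ) : ℂ) * c k y η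
  expansion : ∀ N : ℕ,
    IsSymbolOfOrder (-(N : ℤ)) (fun y η => s y η - ∑ k ∈ Finset.range N, c k y η)

end Coordinates

section Riemannian

variable {d : ℕ} {M : Type*} [TopologicalSpace M] [ChartedSpace (Coord d) M]
  [IsManifold (𝓡 d) ∞ M]

/-- Smooth Riemannian metrics on `M`. -/
abbrev Metric (d : ℕ) (M : Type*) [TopologicalSpace M] [ChartedSpace (Coord d) M]
    [IsManifold (𝓡 d) ∞ M] :=
  Bundle.ContMDiffRiemannianMetric (𝓡 d) ∞ (Coord d) (fun x : M => TangentSpace (𝓡 d) x)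

variable (g : Metric d M)

/-- `|v|_g` for `v ∈ T_y M`. -/
def normOf (y : M) (v : TangentSpace (𝓡 d) y) : ℝ := Real.sqrt (g.inner y v v)

/-- The matrix `g_{ij}` in the chart at `p`, at the point with coordinates `z`. -/
def gram (p : M) (z : Coord d) : Matrix (Fin d) (Fin d) ℝ :=
  Matrix.of fun i j => g.inner (pt p z) (frame p (pt p z) i) (frame p (pt p z) j)

/-- The Riemannian density `ρ = √(det g_{ij})` in the chart at `p`. -/
def density (p : M) (z : Coord d) : ℝ := Real.sqrt (gram g p z).det

/-- `h(y, η) = (g^{αβ}(y) η_α η_β)^{1/2}`. -/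
def hamiltonian (y : M) (η : Cotangent d y) : ℝ :=
  Real.sqrt (∑ α, ∑ β, (gram g y (chartAt (Coord d) y y))⁻¹ α β *
    η (frame y y α) * η (frame y y β))

/-- The partial derivative `∂_k g_{ij}` in the chart at `p`. -/
def dGram (p : M) (k i j : Fin d) (z : Coord d) : ℝ :=
  fderiv ℝ (fun z' => gram g p z' i j) z (stdVec k)

/-- The Christoffel symbol `Γ^k_{ij}` in the chart at `p`. -/
def christoffel (p : M) (k i j : Fin d) (z : Coord d) : ℝ :=
  (1 / 2) * ∑ l, (gram g p z)⁻¹ k l *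
    (dGram g p i j l z + dGram g p j i l z - dGram g p l i j z)

/-! ### Geodesics, parallel transport of covectors, exponential map -/

/-- The velocity vector of a curve. -/
def velocity (d : ℕ) {M : Type*} [TopologicalSpace M] [ChartedSpace (Coord d) M]
    (γ : ℝ → M) (t : ℝ) : TangentSpace (𝓡 d) (γ t) :=
  mfderiv 𝓘(ℝ, ℝ) (𝓡 d) γ t (1 : ℝ)

/-- The curve `γ` near `t`, in the chart at `γ t`. -/
def inChart (d : ℕ) {M : Type*} [TopologicalSpace M] [ChartedSpace (Coord d) M]
    (γ : ℝ → M) (t : ℝ) : ℝ → Coord d :=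
  fun τ => chartAt (Coord d) (γ t) (γ τ)

/-- `γ` solves the geodesic equation; at each time `t` it is written in the chart at `γ t`. -/
def IsGeodesic (γ : ℝ → M) : Prop :=
  ContMDiff 𝓘(ℝ, ℝ) (𝓡 d) ∞ γ ∧
  ∀ (t : ℝ) (k : Fin d),
    (deriv (deriv (inChart d γ t)) t) k
      + ∑ i, ∑ j, christoffel g (γ t) k i j (inChart d γ t t) *
          (deriv (inChart d γ t) t) i * (deriv (inChart d γ t) t) j = 0

/-- The covector field `ζ` along `γ` is parallel: `ζ_k' = Γ^j_{ik} γ'^i ζ_j`; at each time `t` the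
equation is written in the chart at `γ t`. -/
def IsParallelAlong (γ : ℝ → M) (ζ : (t : ℝ) → Cotangent d (γ t)) : Prop :=
  ∀ (t : ℝ) (k : Fin d),
    HasDerivAt (fun τ => ζ τ (frame (γ t) (γ τ) k))
      (∑ i, ∑ j, christoffel g (γ t) j i k (inChart d γ t t) *
        (deriv (inChart d γ t) t) i * ζ t (frame (γ t) (γ t) j)) t

open Classical in
/-- The exponential map `exp_y : T_y M → M`: the value at time `1` of the geodesic which starts at
`y` with velocity `v` (such a geodesic is unique, and exists for all time on closed manifolds). -/
def expMap (y : M) (v : TangentSpace (𝓡 d) y) : M :=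
  if H : ∃ γ : ℝ → M, IsGeodesic g γ ∧
      (⟨γ 0, velocity d γ 0⟩ : TangentBundle (𝓡 d) M) = ⟨y, v⟩
  then H.choose 1 else y

/-- `r` does not exceed the injectivity radius of `M`: for every `y`, the map `exp_y` is a
diffeomorphism of the open `r`-ball of `T_y M` onto its image. -/
def LeInjectivityRadius (r : ℝ) : Prop :=
  ∀ y : M,
    InjOn (fun v : Coord d => expMap g y v) {v : Coord d | normOf g y v < r} ∧
    IsLocalDiffeomorphOn 𝓘(ℝ, Coord d) (𝓡 d) ∞
      (fun v : Coord d => expMap g y v) {v : Coord d | normOf g y v < r}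

/-! ### The real-valued phase function at time zero -/

/-- `c = ∫_γ ζ dz`, where `γ : [0,1] → M` is the geodesic with `γ(0) = y`, `γ'(0) = v`, ending at
`γ(1) = x`, and `ζ` is the result of the parallel transport of `η` along `γ`. -/
def IsTransportIntegral (x y : M) (v : TangentSpace (𝓡 d) y) (η : Cotangent d y) (c : ℝ) : Prop :=
  ∃ (γ : ℝ → M) (ζ : (t : ℝ) → Cotangent d (γ t)),
    IsGeodesic g γ ∧
    (⟨γ 0, velocity d γ 0⟩ : TangentBundle (𝓡 d) M) = ⟨y, v⟩ ∧
    γ 1 = x ∧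
    IsParallelAlong g γ ζ ∧
    (⟨γ 0, ζ 0⟩ : Σ q : M, Cotangent d q) = ⟨y, η⟩ ∧
    c = ∫ t in (0 : ℝ)..1, ζ t (velocity d γ t)

/-- `φ` is the real-valued Levi-Civita phase function `φ(0, x; y, η; 0)`: a smooth real function
on `M × T'M`, positively homogeneous in momentum of degree one, which equals `∫_γ ζ dz` when `x`
lies in the geodesic ball of radius `r` about `y`, and is an arbitrary smooth continuation
elsewhere. For `r` not exceeding the injectivity radius, the radial geodesic `γ` of that ball is
the unique shortest geodesic from `y` to `x`. -/
structure IsLeviCivitaPhase (r : ℝ) (φ : M → (y : M) → Cotangent d y → ℝ) : Prop where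
  smooth : SmoothOnProdCot φ
  homogeneous : ∀ (x y : M) (η : Cotangent d y), η ≠ 0 → ∀ lam : ℝ, 0 < lam →
    φ x y (lam • η) = lam * φ x y η
  eq_integral : ∀ (y : M) (v : TangentSpace (𝓡 d) y) (η : Cotangent d y), η ≠ 0 →
    normOf g y v < r → IsTransportIntegral g (expMap g y v) y v η (φ (expMap g y v) y η)

/-- Cut-offs. They are supported in a closed geodesic ball `x ∈ exp_y {|v| ≤ r'}` with `r' < r`,
that is, away from the part of `M × T'M` where the phase function has been continued arbitrarily.
Since `M` is compact, every conical neighbourhood of `{x = y}` contains one of the form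
`{(x, y) ∈ O}`. -/
structure IsCutoff (r : ℝ) (χ : M → (y : M) → Cotangent d y → ℂ) : Prop where
  smooth : SmoothOnProdCot χ
  zero_of_le : ∀ (x y : M) (η : Cotangent d y), hamiltonian g y η ≤ 1 / 2 → χ x y η = 0
  one_near_diagonal : ∃ O : Set (M × M), IsOpen O ∧ (∀ y : M, (y, y) ∈ O) ∧
    ∀ (x y : M) (η : Cotangent d y), (x, y) ∈ O → 1 ≤ hamiltonian g y η → χ x y η = 1
  homogeneous : ∀ (x y : M) (η : Cotangent d y), 1 ≤ hamiltonian g y η →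
    ∀ α : ℝ, 1 ≤ α → χ x y (α • η) = χ x y η
  support : ∃ r' < r, ∀ (x y : M) (η : Cotangent d y), χ x y η ≠ 0 →
    ∃ v : TangentSpace (𝓡 d) y, normOf g y v ≤ r' ∧ expMap g y v = x

/-! ### The oscillatory integral -/

/-- The matrix `φ_{x^α η_β}` at `(x; y, ∑ ξ_β dy^β)`, in the chart at `x` for `x` and the chart at
`y` for `(y, η)`. -/
def mixedHessian (φ : M → (y : M) → Cotangent d y → ℝ) (x y : M) (ξ : Coord d) :
    Matrix (Fin d) (Fin d) ℝ :=
  Matrix.of fun α β =>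
    fderiv ℝ (fun z : Coord d => fderiv ℝ (fun ξ' : Coord d => φ (pt x z) y (covec y y ξ')) ξ
      (stdVec β)) (chartAt (Coord d) x x) (stdVec α)

/-- The weight `w = ρ(x)^{-1/2} ρ(y)^{-1/2} [det² φ_{xη}]^{1/4}`, in the chart at `x` for `x` and
the chart at `y` for `(y, η)`. It is independent of the coordinates for `x`, and a `(-1)`-density
in `y`. In terms of it, `v = w ρ(y)` is the scalar weight
`ρ(x)^{-1/2} ρ(y)^{1/2} [det² φ_{xη}]^{1/4}`, equal to `1` for `x = y`, and
`v dy dη = w dη ρ(y) dy`. -/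
def weight (φ : M → (y : M) → Cotangent d y → ℝ) (x y : M) (ξ : Coord d) : ℝ :=
  (density g x (chartAt (Coord d) x x)) ^ (-(1 / 2) : ℝ) *
  (density g y (chartAt (Coord d) y y)) ^ (-(1 / 2) : ℝ) *
  ((mixedHessian φ x y ξ).det ^ 2) ^ (1 / 4 : ℝ)

variable [MeasurableSpace M] [BorelSpace M]

/-- The measure `ρ(y) dy` on the domain of the chart at `p`, extended by zero. -/
def chartVolume (p : M) : Measure M :=
  ((volume.restrict (chartAt (Coord d) p).target).withDensity
    (fun z => ENNReal.ofReal (density g p z))).map (pt p)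

/-- The Riemannian measure `ρ(y) dy` on `M`: the smallest measure that dominates the measures
`ρ(y) dy` of all charts. (As these agree on overlaps, it coincides with each of them on the
domain of the respective chart.) -/
def riemannianMeasure : Measure M := ⨆ p : M, chartVolume g p

/-- The absolutely convergent integral
`∫_{T'M} e^{iφ(x;y,η)} s(y,η) χ(x;y,η) v(x;y,η) e^{-δ h(y,η)²} f(y) dy đη`,
with `đη = (2π)^{-d} dη`. -/
def regularizedIntegral (φ : M → (y : M) → Cotangent d y → ℝ)
    (χ : M → (y : M) → Cotangent d y → ℂ) (s : (y : M) → Cotangent d y → ℂ)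
    (f : M → ℂ) (x : M) (δ : ℝ) : ℂ :=
  ∫ y : M, (∫ ξ : Coord d,
      Complex.exp (Complex.I * (φ x y (covec y y ξ) : ℂ)) * s y (covec y y ξ) *
      χ x y (covec y y ξ) * (weight g φ x y ξ : ℂ) *
      (Real.exp (-δ * hamiltonian g y (covec y y ξ) ^ 2) : ℂ) *
      (((2 * Real.pi) ^ d)⁻¹ : ℝ)) * f y ∂(riemannianMeasure g)

/-- `(𝔍_{φ,s} f)(x) = c`, where
`(𝔍_{φ,s} f)(x) = ∫_{T'M} e^{iφ(x;y,η)} s(y,η) χ(x;y,η) v(x;y,η) f(y) dy đη`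
is understood as an oscillatory integral: the limit of the integrals regularised at infinity in
momentum. -/
def HasOscillatoryValue (φ : M → (y : M) → Cotangent d y → ℝ)
    (χ : M → (y : M) → Cotangent d y → ℂ) (s : (y : M) → Cotangent d y → ℂ)
    (f : M → ℂ) (x : M) (c : ℂ) : Prop :=
  Tendsto (regularizedIntegral g φ χ s f x) (𝓝[>] (0 : ℝ)) (𝓝 c)

/-- `𝔍_{φ,s} - Id` is an infinitely smoothing operator: an integral operator with infinitely
smooth kernel. -/
def IsIdentityModSmoothing (φ : M → (y : M) → Cotangent d y → ℝ)
    (χ : M → (y : M) → Cotangent d y → ℂ) (s : (y : M) → Cotangent d y → ℂ) : Prop :=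
  ∃ K : M → M → ℂ,
    ContMDiff ((𝓡 d).prod (𝓡 d)) 𝓘(ℝ, ℂ) ∞ (fun q : M × M => K q.1 q.2) ∧
    ∀ f : M → ℂ, ContMDiff (𝓡 d) 𝓘(ℝ, ℂ) ∞ f → ∀ x : M,
      HasOscillatoryValue g φ χ s f x (f x + ∫ y : M, K x y * f y ∂(riemannianMeasure g))

end Riemannian

end LeviCivitaPhase

end

/-! Along a geodesic the velocity is parallel, so its pairing with a parallel covector is constant,
and the phase at x = exp_y v is simply η(v) (`IsLeviCivitaPhase.apply_expMap`). Hence, where the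
cut-off lives, the phase is linear in momentum: φ = ⟨ξ, V(x, y)⟩, with V = `phaseVec` the components
of exp_y⁻¹ x. Every kernel is thus a Fourier integral in ξ at the frequency V, and V vanishes on the
closed support of the cut-off only for x = y.

For the amplitude 1 the regularised kernel is an explicit Gaussian, a factor times δ^(-d/2)
exp(-|V|²/(4δ)) (`kernelIntegral_one`). On the diagonal V has differential -id in y and the weight
is 1/ρ, so this Gaussian concentrates at x with mass exactly one (`IsCutoff.tendsto_gaussian`). The
cut-off changes the result by a smooth kernel only. Near the diagonal χ - 1 vanishes for large
momenta. Off the diagonal V ≠ 0, and integration by parts along V/|V|², repeated as often as needed,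
makes the integral and its derivatives absolutely convergent (`exists_smooth_limit_of_homAmp`). The
two descriptions glue to `remainderKernel`, and `IsCutoff.tendsto_kernelIntegral` identifies the
operator with amplitude χ as the identity plus a smoothing operator.

If the expansion of s reduces to 1, then s - 1 is of order -N for all N and contributes a smooth
kernel. Conversely, let the difference from the identity be smoothing, and suppose by induction that
s - 1 has order -m with leading part e. Take u = V(x, ·) as coordinate about x and test against a
bump function times the plane wave e^(-iτ⟨θ,u⟩). A smooth kernel gives a rapidly decreasing function
of τ, whereas τ^m times the oscillatory integral converges to the integral of the Fourier transform
of a function whose value at u = 0 is a nonzero multiple of e(x, θ). By Fourier inversion this value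
vanishes (`leading_coefficient_eq_zero`, `IsCutoff.principal_symbol_eq_zero`,
`IsCutoff.coefficient_eq`).

No existence or uniqueness theorem for the geodesic equation is used. Geodesics reaching exp_y v are
supplied by the definition of the phase, the first-order behaviour of exp_y at 0 comes from an
energy estimate (`IsGeodesic.exists_estimate`), and the joint continuity of the exponential map is
recovered from the smoothness of φ (`IsLeviCivitaPhase.continuousAt_expCoord`). -/

noncomputable section

namespace LeviCivitaPhase

/-! ### Parametric integrals with smooth dependence on the parameter -/

section ParametricIntegral

variable {P V : Type} {X : Type*} [NormedAddCommGroup P] [NormedSpace ℝ P]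
  [NormedAddCommGroup X] [NormedSpace ℝ X]

theorem fderiv_partial_eq [NormedAddCommGroup V] [NormedSpace ℝ V] {Ω : Set P} (hΩ : IsOpen Ω)
    {F : P → X → V} (hF : ContDiffOn ℝ ∞ (fun p : P × X => F p.1 p.2) (Ω ×ˢ univ))
    {q : P} (hq : q ∈ Ω) (x : X) :
    HasFDerivAt (fun p => F p x)
      ((fderiv ℝ (fun p : P × X => F p.1 p.2) (q, x)).comp (ContinuousLinearMap.inl ℝ P X)) q := by
  have h1 : DifferentiableAt ℝ (fun p : P × X => F p.1 p.2) (q, x) :=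
    (hF.contDiffAt ((hΩ.prod isOpen_univ).mem_nhds ⟨hq, mem_univ _⟩)).differentiableAt (by simp)
  have h2 : HasFDerivAt (fun p : P => (p, x)) (ContinuousLinearMap.inl ℝ P X) q :=
    hasFDerivAt_prodMk_left q x
  exact h1.hasFDerivAt.comp q h2

theorem contDiffOn_fderiv_partial [NormedAddCommGroup V] [NormedSpace ℝ V]
    {Ω : Set P} (hΩ : IsOpen Ω)
    {F : P → X → V} (hF : ContDiffOn ℝ ∞ (fun p : P × X => F p.1 p.2) (Ω ×ˢ univ)) :
    ContDiffOn ℝ ∞ (fun p : P × X => fderiv ℝ (fun q => F q p.2) p.1) (Ω ×ˢ univ) := by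
  have h1 : ContDiffOn ℝ ∞ (fderiv ℝ (fun p : P × X => F p.1 p.2)) (Ω ×ˢ univ) :=
    hF.fderiv_of_isOpen (hΩ.prod isOpen_univ) (by simp)
  have h2 : ContDiffOn ℝ ∞ (fun p : P × X => (fderiv ℝ (fun p : P × X => F p.1 p.2) p).comp
      (ContinuousLinearMap.inl ℝ P X)) (Ω ×ˢ univ) :=
    h1.clm_comp contDiffOn_const
  refine h2.congr fun p hp => ?_
  exact (fderiv_partial_eq hΩ hF hp.1 p.2).fderiv

/-- Induction on the order, passing to the partial differential as a new function with values in
linear maps. Norms are compared because the two iterated derivatives live in different spaces and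
only their norms coincide. -/
theorem continuousOn_iteratedFDeriv_partial [NormedAddCommGroup V] [NormedSpace ℝ V]
    {Ω : Set P} (hΩ : IsOpen Ω)
    {F : P → X → V} (hF : ContDiffOn ℝ ∞ (fun p : P × X => F p.1 p.2) (Ω ×ˢ univ)) (i : ℕ) :
    ContinuousOn (fun p : P × X => ‖iteratedFDeriv ℝ i (fun q => F q p.2) p.1‖) (Ω ×ˢ univ) := by
  induction i generalizing V with
  | zero => simpa using hF.continuousOn.norm
  | succ n ih =>
    have := ih (F := fun p x => fderiv ℝ (fun q => F q x) p) (contDiffOn_fderiv_partial hΩ hF)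
    simpa only [norm_iteratedFDeriv_fderiv] using this

/-- Differentiation under the integral sign, iterated: the partial differential takes the place of
the integrand, so the value space `V` must be free in the induction. Domination is needed only
locally in the parameter. -/
theorem contDiffOn_integral_of_dominated [MeasurableSpace X] [BorelSpace X]
    [SecondCountableTopology X] (μ : Measure X)
    [NormedAddCommGroup V] [NormedSpace ℝ V] {Ω : Set P} (hΩ : IsOpen Ω) (F : P → X → V) (k : ℕ)
    (hF : ContDiffOn ℝ ∞ (fun p : P × X => F p.1 p.2) (Ω ×ˢ univ))
    (hb : ∀ j ≤ k, ∀ q ∈ Ω, ∃ U ∈ 𝓝 q, ∃ B : X → ℝ, Integrable B μ ∧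
      ∀ q' ∈ U, ∀ x, ‖iteratedFDeriv ℝ j (fun p => F p x) q'‖ ≤ B x) :
    ContDiffOn ℝ k (fun q => ∫ x, F q x ∂μ) Ω := by
  have hmeas : ∀ {W : Type} [NormedAddCommGroup W] [NormedSpace ℝ W] (G : P → X → W),
      ContDiffOn ℝ ∞ (fun p : P × X => G p.1 p.2) (Ω ×ˢ univ) → ∀ q ∈ Ω,
      AEStronglyMeasurable (G q) μ := by
    intro W _ _ G hG q hq
    have : Continuous (G q) := by
      rw [← continuousOn_univ]
      exact ContinuousOn.comp (g := fun p : P × X => G p.1 p.2) (f := fun x : X => ((q, x) : P × X))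
        hG.continuousOn (by fun_prop)
        (fun x _ => ⟨hq, mem_univ _⟩)
    exact this.aestronglyMeasurable
  induction k generalizing V with
  | zero =>
    simp only [CharP.cast_eq_zero, contDiffOn_zero]
    intro q hq
    apply ContinuousAt.continuousWithinAt
    obtain ⟨U, hU, B, hB, hUB⟩ := hb 0 le_rfl q hq
    refine continuousAt_of_dominated (bound := B) ?_ ?_ hB ?_
    · filter_upwards [hΩ.mem_nhds hq] with q' hq' using hmeas F hF q' hq'
    · filter_upwards [hU] with q' hq'
      exact Eventually.of_forall fun x => by simpa using hUB q' hq' x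
    · exact Eventually.of_forall fun x => (fderiv_partial_eq hΩ hF hq x).continuousAt
  | succ n ih =>
    have hder : ∀ q ∈ Ω, HasFDerivAt (fun q => ∫ x, F q x ∂μ)
        (∫ x, fderiv ℝ (fun p => F p x) q ∂μ) q := by
      intro q hq
      obtain ⟨U, hU, B, hB, hUB⟩ := hb 1 (by omega) q hq
      obtain ⟨U0, hU0, B0, hB0, hUB0⟩ := hb 0 (by omega) q hq
      refine hasFDerivAt_integral_of_dominated_of_fderiv_le (𝕜 := ℝ) (s := U ∩ Ω) (bound := B)
        (F' := fun q x => fderiv ℝ (fun p => F p x) q)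
        (inter_mem hU (hΩ.mem_nhds hq)) ?_ ?_ ?_ ?_ hB ?_
      · filter_upwards [hΩ.mem_nhds hq] with q' hq' using hmeas F hF q' hq'
      · exact hB0.mono' (hmeas F hF q hq)
          (Eventually.of_forall fun x => by simpa using hUB0 q (mem_of_mem_nhds hU0) x)
      · exact hmeas (fun q x => fderiv ℝ (fun p => F p x) q) (contDiffOn_fderiv_partial hΩ hF) q hq
      · refine Eventually.of_forall fun x q' hq' => ?_
        have := hUB q' hq'.1 x
        rwa [← norm_iteratedFDeriv_fderiv, norm_iteratedFDeriv_zero] at this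
      · exact Eventually.of_forall fun x q' hq' =>
          (fderiv_partial_eq hΩ hF hq'.2 x).differentiableAt.hasFDerivAt
    have h2 := ih (fun q x => fderiv ℝ (fun p => F p x) q) (contDiffOn_fderiv_partial hΩ hF)
      (fun j hj q hq => by
        obtain ⟨U, hU, B, hB, hUB⟩ := hb (j + 1) (by omega) q hq
        exact ⟨U, hU, B, hB, fun q' hq' x => by
          rw [norm_iteratedFDeriv_fderiv]; exact hUB q' hq' x⟩)
    rw [show ((n + 1 : ℕ) : WithTop ℕ∞) = (n : WithTop ℕ∞) + 1 by simp,
      contDiffOn_succ_iff_fderiv_of_isOpen hΩ]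
    refine ⟨fun q hq => (hder q hq).differentiableAt.differentiableWithinAt, by simp, ?_⟩
    exact h2.congr fun q hq => (hder q hq).fderiv

end ParametricIntegral

/-! ### Amplitudes with polynomial bounds in the momentum -/

section Growth

variable {P P' E : Type} [NormedAddCommGroup P] [NormedSpace ℝ P]
  [NormedAddCommGroup P'] [NormedSpace ℝ P'] [NormedAddCommGroup E] [InnerProductSpace ℝ E]

/-- `a(q, ξ)` is smooth and its derivatives in `q` up to order `k` are `O((1 + |ξ|)^m)`, locally
uniformly in `q`. -/
structure GrowthBound (Ω : Set P) (k : ℕ) (m : ℝ) (a : P → E → ℂ) : Prop where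
  smooth : ContDiffOn ℝ ∞ (fun p : P × E => a p.1 p.2) (Ω ×ˢ univ)
  bound : ∀ q₀ ∈ Ω, ∃ U ∈ 𝓝 q₀, ∃ C : ℝ, 0 ≤ C ∧ ∀ q ∈ U, ∀ ξ : E, ∀ i ≤ k,
    ‖iteratedFDeriv ℝ i (fun q => a q ξ) q‖ ≤ C * (1 + ‖ξ‖) ^ m

theorem contDiffOn_slice {X V : Type*} [NormedAddCommGroup X] [NormedSpace ℝ X]
    [NormedAddCommGroup V] [NormedSpace ℝ V] {Ω : Set P} {a : P → X → V}
    (ha : ContDiffOn ℝ ∞ (fun p : P × X => a p.1 p.2) (Ω ×ˢ univ)) (ξ : X) :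
    ContDiffOn ℝ ∞ (fun q => a q ξ) Ω :=
  ha.comp (f := fun q : P => (q, ξ)) (by fun_prop) (fun q hq => ⟨hq, mem_univ _⟩)

theorem contDiff_slice_right {X V : Type*} [NormedAddCommGroup X] [NormedSpace ℝ X]
    [NormedAddCommGroup V] [NormedSpace ℝ V] {Ω : Set P} {a : P → X → V}
    (ha : ContDiffOn ℝ ∞ (fun p : P × X => a p.1 p.2) (Ω ×ˢ univ)) {q : P} (hq : q ∈ Ω) :
    ContDiff ℝ ∞ (a q) := by
  rw [← contDiffOn_univ]
  exact ha.comp (f := fun x : X => (q, x)) (by fun_prop) (fun q _ => ⟨hq, mem_univ _⟩)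

theorem GrowthBound.mono {Ω : Set P} {k : ℕ} {m n : ℝ} {a : P → E → ℂ}
    (ha : GrowthBound Ω k m a) (hmn : m ≤ n) : GrowthBound Ω k n a := by
  refine ⟨ha.smooth, fun q hq => ?_⟩
  obtain ⟨U, hU, C, hC, h⟩ := ha.bound q hq
  refine ⟨U, hU, C, hC, fun q hq ξ i hi => (h q hq ξ i hi).trans ?_⟩
  gcongr
  linarith [norm_nonneg ξ]

theorem GrowthBound.restrict {Ω Ω' : Set P} {k : ℕ} {m : ℝ} {a : P → E → ℂ}
    (ha : GrowthBound Ω k m a) (h : Ω' ⊆ Ω) : GrowthBound Ω' k m a :=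
  ⟨ha.smooth.mono (prod_mono h subset_rfl), fun q hq => ha.bound q (h hq)⟩

/-- Leibniz rule; `2 ^ k` bounds the sum of the binomial coefficients. -/
theorem GrowthBound.mul {Ω : Set P} (hΩ : IsOpen Ω) {k : ℕ} {m n : ℝ} {a b : P → E → ℂ}
    (ha : GrowthBound Ω k m a) (hb : GrowthBound Ω k n b) :
    GrowthBound Ω k (m + n) (fun q ξ => a q ξ * b q ξ) := by
  refine ⟨ha.smooth.mul hb.smooth, fun q hq => ?_⟩
  obtain ⟨U, hU, C, hC, h⟩ := ha.bound q hq
  obtain ⟨U', hU', C', hC', h'⟩ := hb.bound q hq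
  refine ⟨U ∩ U' ∩ Ω, inter_mem (inter_mem hU hU') (hΩ.mem_nhds hq), 2 ^ k * (C * C'), by positivity,
    fun q hq ξ i hi => ?_⟩
  have h1 := norm_iteratedFDerivWithin_mul_le (contDiffOn_slice ha.smooth ξ)
    (contDiffOn_slice hb.smooth ξ) hΩ.uniqueDiffOn hq.2 (n := i) (by exact_mod_cast le_top)
  simp only [iteratedFDerivWithin_of_isOpen _ hΩ hq.2] at h1
  refine h1.trans ?_
  have hpos : (0 : ℝ) < 1 + ‖ξ‖ := by positivity
  calc _ ≤ ∑ j ∈ Finset.range (i + 1), (i.choose j : ℝ) * (C * (1 + ‖ξ‖) ^ m) *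
        (C' * (1 + ‖ξ‖) ^ n) := by
        refine Finset.sum_le_sum fun j hj => ?_
        have hj' : j ≤ i := by simpa [Nat.lt_succ_iff] using hj
        gcongr
        · exact h q hq.1.1 ξ j (by omega)
        · exact h' q hq.1.2 ξ (i - j) (by omega)
    _ = 2 ^ i * (C * C') * (1 + ‖ξ‖) ^ (m + n) := by
        rw [← Finset.sum_mul, ← Finset.sum_mul, Real.rpow_add hpos]
        have : (∑ j ∈ Finset.range (i + 1), (i.choose j : ℝ)) = 2 ^ i := by
          exact_mod_cast Nat.sum_range_choose i
        rw [this]; ring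
    _ ≤ _ := by
        gcongr
        norm_num

theorem GrowthBound.comp {Ω : Set P} (hΩ : IsOpen Ω) {Ω' : Set P'} (hΩ' : IsOpen Ω')
    {k : ℕ} {m : ℝ} {a : P → E → ℂ}
    (ha : GrowthBound Ω k m a) {κ : P' → P} (hκ : ContDiffOn ℝ ∞ κ Ω') (hmaps : MapsTo κ Ω' Ω) :
    GrowthBound Ω' k m (fun q ξ => a (κ q) ξ) := by
  refine ⟨ha.smooth.comp (f := fun p : P' × E => (κ p.1, p.2))
    ((hκ.comp contDiffOn_fst fun p hp => hp.1).prodMk contDiffOn_snd)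
    (fun p hp => ⟨hmaps hp.1, mem_univ _⟩), fun q hq => ?_⟩
  obtain ⟨U, hU, C, hC, h⟩ := ha.bound (κ q) (hmaps hq)
  have hcont : ∀ i, ContinuousAt (fun q' => ‖iteratedFDeriv ℝ i κ q'‖) q := fun i => by
    have h2 : ContinuousOn (fun q' => ‖iteratedFDeriv ℝ i κ q'‖) Ω' :=
      ((hκ.continuousOn_iteratedFDerivWithin (m := i) (by exact_mod_cast le_top)
        hΩ'.uniqueDiffOn).congr fun y hy =>
          (iteratedFDerivWithin_of_isOpen i hΩ' hy).symm).norm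
    exact h2.continuousAt (hΩ'.mem_nhds hq)
  -- A common bound, at least one, for all derivatives of `κ` near `q`: the composition estimate
  -- wants the derivative of order `j` bounded by `D ^ j`.
  set D : ℝ := 1 + ∑ i ∈ Finset.range (k + 1), (‖iteratedFDeriv ℝ i κ q‖ + 1) with hD
  have hD1 : 1 ≤ D := by
    have : 0 ≤ ∑ i ∈ Finset.range (k + 1), (‖iteratedFDeriv ℝ i κ q‖ + 1) :=
      Finset.sum_nonneg fun i _ => by positivity
    linarith
  have hev : ∀ᶠ q' in 𝓝 q, ∀ i ∈ Finset.range (k + 1), ‖iteratedFDeriv ℝ i κ q'‖ ≤ D := by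
    rw [eventually_all_finset]
    intro i hi
    filter_upwards [(hcont i).eventually (gt_mem_nhds (lt_add_one _))] with q' hq'
    have : ‖iteratedFDeriv ℝ i κ q‖ + 1 ≤
        ∑ i ∈ Finset.range (k + 1), (‖iteratedFDeriv ℝ i κ q‖ + 1) :=
      Finset.single_le_sum (f := fun i => ‖iteratedFDeriv ℝ i κ q‖ + 1)
        (fun i _ => by positivity) hi
    linarith
  have hpre : ∀ᶠ q' in 𝓝 q, κ q' ∈ U := (hκ.continuousOn.continuousAt (hΩ'.mem_nhds hq)) hU
  refine ⟨_, hev.and (hpre.and (hΩ'.mem_nhds hq)), k.factorial * C * D ^ k, by positivity, ?_⟩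
  rintro q' ⟨h1, h2, h3⟩ ξ i hi
  have h4 := norm_iteratedFDerivWithin_comp_le (g := fun q => a q ξ) (f := κ) (n := i) (x := q')
    (contDiffOn_slice ha.smooth ξ) hκ (by exact_mod_cast le_top) hΩ.uniqueDiffOn
    hΩ'.uniqueDiffOn hmaps h3 (C := C * (1 + ‖ξ‖) ^ m) (D := D)
    (fun j hj => by
      rw [iteratedFDerivWithin_of_isOpen _ hΩ (hmaps h3)]
      exact h _ h2 ξ j (by omega))
    (fun j hj1 hj => by
      rw [iteratedFDerivWithin_of_isOpen _ hΩ' h3]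
      exact (h1 j (by simp; omega)).trans (le_self_pow₀ hD1 (by omega)))
  rw [iteratedFDerivWithin_of_isOpen _ hΩ' h3] at h4
  refine h4.trans ?_
  have : (i.factorial : ℝ) ≤ k.factorial := by exact_mod_cast Nat.factorial_le hi
  calc _ ≤ (k.factorial : ℝ) * (C * (1 + ‖ξ‖) ^ m) * D ^ k := by gcongr
    _ = _ := by ring

theorem GrowthBound.contDiffOn_integral [FiniteDimensional ℝ E] [MeasurableSpace E] [BorelSpace E]
    {Ω : Set P} (hΩ : IsOpen Ω) {k : ℕ} {m : ℝ} {a : P → E → ℂ} (ha : GrowthBound Ω k m a)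
    (hm : m < -(Module.finrank ℝ E : ℝ)) :
    ContDiffOn ℝ k (fun q => ∫ ξ, a q ξ) Ω := by
  refine contDiffOn_integral_of_dominated volume hΩ a k ha.smooth fun j hj q hq => ?_
  obtain ⟨U, hU, C, hC, h⟩ := ha.bound q hq
  refine ⟨U, hU, fun ξ : E => C * (1 + ‖ξ‖) ^ m, ?_, fun q' hq' x => h q' hq' x j hj⟩
  have := integrable_one_add_norm (μ := (volume : Measure E)) (r := -m) (by linarith)
  simpa using this.const_mul C

/-- The real differential of exp is multiplication by exp itself, and multiplication, as a map from
ℂ to operators, has norm at most one. -/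
theorem norm_iteratedFDeriv_cexp_le (j : ℕ) (z : ℂ) :
    ‖iteratedFDeriv ℝ j Complex.exp z‖ ≤ ‖Complex.exp z‖ := by
  induction j generalizing z with
  | zero => simp
  | succ n ih =>
    have h1 : fderiv ℝ Complex.exp = fun z => ContinuousLinearMap.mul ℝ ℂ (Complex.exp z) := by
      funext z
      rw [((Complex.hasDerivAt_exp z).hasFDerivAt.restrictScalars ℝ).fderiv]
      ext; simp [mul_comm]
    rw [← norm_iteratedFDeriv_fderiv, h1]
    refine ((ContinuousLinearMap.mul ℝ ℂ).norm_iteratedFDeriv_comp_left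
      (f := Complex.exp) (x := z) (N := ∞) Complex.contDiff_exp.contDiffAt
      (by exact_mod_cast le_top)).trans ?_
    calc _ ≤ 1 * ‖Complex.exp z‖ := by
          gcongr
          · exact ContinuousLinearMap.opNorm_mul_le _ _
          · exact ih z
      _ = _ := one_mul _

/-- Exponentials of smooth functions with nonpositive real part. -/
theorem growthBound_exp {Ω : Set P} (hΩ : IsOpen Ω) {ψ : P → E → ℂ} {k : ℕ} {l : ℕ}
    (hψ : GrowthBound Ω k l ψ) (hre : ∀ q ∈ Ω, ∀ ξ, (ψ q ξ).re ≤ 0) :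
    GrowthBound Ω k (l * k : ℕ) (fun q ξ => Complex.exp (ψ q ξ)) := by
  refine ⟨Complex.contDiff_exp.comp_contDiffOn hψ.smooth, fun q hq => ?_⟩
  obtain ⟨U, hU, C, hC, h⟩ := hψ.bound q hq
  refine ⟨U ∩ Ω, inter_mem hU (hΩ.mem_nhds hq), k.factorial * (1 + C) ^ k, by positivity,
    fun q' hq' ξ i hi => ?_⟩
  have hone : (1 : ℝ) ≤ 1 + ‖ξ‖ := by linarith [norm_nonneg ξ]
  -- Enlarging `C` to `1 + C` makes the bound at least one, hence dominated by its `j`-th power for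
  -- every `j ≥ 1`.
  have hD1 : 1 ≤ (1 + C) * (1 + ‖ξ‖) ^ l := by
    have := one_le_pow₀ hone (n := l)
    nlinarith
  have h4 := norm_iteratedFDerivWithin_comp_le (g := Complex.exp) (f := fun q => ψ q ξ) (n := i)
    (x := q') (Complex.contDiff_exp (𝕜 := ℝ) (n := ∞)).contDiffOn (contDiffOn_slice hψ.smooth ξ)
    (by exact_mod_cast le_top)
    uniqueDiffOn_univ hΩ.uniqueDiffOn (mapsTo_univ _ _) hq'.2 (C := 1)
    (D := (1 + C) * (1 + ‖ξ‖) ^ l)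
    (fun j hj => by
      rw [iteratedFDerivWithin_univ]
      have : ‖iteratedFDeriv ℝ j Complex.exp (ψ q' ξ)‖ ≤ ‖Complex.exp (ψ q' ξ)‖ := by
        exact norm_iteratedFDeriv_cexp_le j _
      refine this.trans ?_
      rw [Complex.norm_exp]
      exact Real.exp_le_one_iff.2 (hre q' hq'.2 ξ))
    (fun j hj1 hj => by
      rw [iteratedFDerivWithin_of_isOpen _ hΩ hq'.2]
      refine (h q' hq'.1 ξ j (by omega)).trans (le_trans ?_ (le_self_pow₀ hD1 (by omega)))
      rw [Real.rpow_natCast]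
      gcongr
      linarith)
  rw [iteratedFDerivWithin_of_isOpen _ hΩ hq'.2] at h4
  refine h4.trans ?_
  have : (i.factorial : ℝ) ≤ k.factorial := by exact_mod_cast Nat.factorial_le hi
  calc _ ≤ (k.factorial : ℝ) * 1 * ((1 + C) * (1 + ‖ξ‖) ^ l) ^ k := by gcongr
    _ = _ := by rw [Real.rpow_natCast, pow_mul, mul_one, mul_pow, mul_assoc]

end Growth

/-! ### Oscillatory integrals away from the critical points of the phase -/

section Homogeneous

variable {P E : Type} [NormedAddCommGroup P] [NormedSpace ℝ P]
  [NormedAddCommGroup E] [InnerProductSpace ℝ E]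

/-- Smooth amplitudes which are positively homogeneous in the momentum outside a ball. -/
structure HomAmp (Ω : Set P) (R : ℝ) (m : ℤ) (a : P → E → ℂ) : Prop where
  smooth : ContDiffOn ℝ ∞ (fun p : P × E => a p.1 p.2) (Ω ×ˢ univ)
  homog : ∀ q ∈ Ω, ∀ ξ : E, R < ‖ξ‖ → ∀ lam : ℝ, 1 ≤ lam →
    a q (lam • ξ) = ((lam ^ m : ℝ) : ℂ) * a q ξ

/-- Tube argument: a strict bound on the compact slice over `q₀` persists for all nearby parameters.
-/
theorem exists_eventually_le_of_isCompact {X : Type*} [TopologicalSpace X] {Ω : Set P}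
    (hΩ : IsOpen Ω) {f : P × X → ℝ} (hf : ContinuousOn f (Ω ×ˢ univ)) {q₀ : P} (hq : q₀ ∈ Ω)
    {K : Set X} (hK : IsCompact K) : ∃ C : ℝ, 0 ≤ C ∧ ∀ᶠ q in 𝓝 q₀, ∀ ξ ∈ K, f (q, ξ) ≤ C := by
  have hslice : Continuous (fun ξ => f (q₀, ξ)) := by
    rw [← continuousOn_univ]
    exact hf.comp (f := fun ξ : X => (q₀, ξ)) (by fun_prop) (fun x _ => ⟨hq, mem_univ _⟩)
  obtain ⟨C, hC⟩ := hK.bddAbove_image hslice.continuousOn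
  refine ⟨max (C + 1) 0, le_max_right _ _, ?_⟩
  refine hK.eventually_forall_of_forall_eventually (fun ξ hξ => ?_)
  have h1 : f (q₀, ξ) < max (C + 1) 0 :=
    lt_of_lt_of_le (lt_of_le_of_lt (hC (mem_image_of_mem _ hξ)) (lt_add_one C)) (le_max_left _ _)
  have h2 : ContinuousAt f (q₀, ξ) :=
    hf.continuousAt ((hΩ.prod isOpen_univ).mem_nhds ⟨hq, mem_univ _⟩)
  exact (h2.eventually (gt_mem_nhds h1)).mono fun z hz => le_of_lt hz

/-- Compactness bounds the derivatives for momenta in the ball of radius `R + 1`. A larger momentum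
is scaled back to the sphere of that radius; the scaling factor does not depend on `q`, so
homogeneity is inherited by the derivatives in `q`. -/
theorem HomAmp.growthBound [FiniteDimensional ℝ E] {Ω : Set P} (hΩ : IsOpen Ω) {R : ℝ} (hR : 0 ≤ R)
    {m : ℤ} {a : P → E → ℂ} (ha : HomAmp Ω R m a) (k : ℕ) : GrowthBound Ω k m a := by
  refine ⟨ha.smooth, fun q₀ hq₀ => ?_⟩
  have h1 : ∀ i, ∃ C : ℝ, 0 ≤ C ∧ ∀ᶠ q in 𝓝 q₀, ∀ ξ ∈ Metric.closedBall (0 : E) (R + 1),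
      ‖iteratedFDeriv ℝ i (fun q => a q ξ) q‖ ≤ C := fun i =>
    exists_eventually_le_of_isCompact (X := E) hΩ
      (continuousOn_iteratedFDeriv_partial hΩ ha.smooth i) hq₀ (isCompact_closedBall _ _)
  choose C hC0 hC using h1
  set D := ∑ i ∈ Finset.range (k + 1), C i with hD
  have hCD : ∀ i ≤ k, C i ≤ D := fun i hi =>
    Finset.single_le_sum (f := C) (fun i _ => hC0 i) (by simp; omega)
  have hD0 : 0 ≤ D := Finset.sum_nonneg fun i _ => hC0 i
  -- A lower bound for `t ^ m` on `1 ≤ t ≤ R + 2`, whatever the sign of `m`. It converts constants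
  -- on the ball, and the bounded ratio `(1 + ‖ξ‖) / lam` outside it, into powers of `1 + ‖ξ‖`.
  set c : ℝ := min 1 ((1 + (R + 1)) ^ m) with hc
  have hcpos : 0 < c := by positivity
  have hratio : ∀ t : ℝ, 1 ≤ t → t ≤ 1 + (R + 1) → c ≤ t ^ m := by
    intro t ht1 ht2
    rcases le_or_gt 0 m with hm | hm
    · exact (min_le_left _ _).trans (one_le_zpow₀ ht1 hm)
    · refine (min_le_right _ _).trans ?_
      obtain ⟨n, hn⟩ := Int.eq_ofNat_of_zero_le (neg_nonneg.2 hm.le)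
      have hmn : m = -(n : ℤ) := by omega
      rw [hmn, zpow_neg, zpow_neg, zpow_natCast, zpow_natCast]
      gcongr
  have hev : ∀ᶠ q in 𝓝 q₀, ∀ i ∈ Finset.range (k + 1), ∀ ξ ∈ Metric.closedBall (0 : E) (R + 1),
      ‖iteratedFDeriv ℝ i (fun q => a q ξ) q‖ ≤ C i :=
    (eventually_all_finset _).2 fun i _ => hC i
  refine ⟨_, hev.and (hΩ.mem_nhds hq₀), D / c, by positivity, ?_⟩
  rintro q ⟨hq, hqΩ⟩ ξ i hi
  rw [Real.rpow_intCast, div_mul_eq_mul_div, le_div_iff₀ hcpos]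
  have hmem : i ∈ Finset.range (k + 1) := by simp; omega
  rcases le_or_gt ‖ξ‖ (R + 1) with hξ | hξ
  · have := (hq i hmem ξ (by simpa using hξ)).trans (hCD i hi)
    have h2 := hratio (1 + ‖ξ‖) (by linarith [norm_nonneg ξ]) (by linarith)
    gcongr
  · set lam := ‖ξ‖ / (R + 1) with hlam
    have hR1 : 0 < R + 1 := by linarith
    have hlam1 : 1 ≤ lam := by rw [hlam, le_div_iff₀ hR1]; linarith
    have hlam0 : 0 < lam := by linarith
    set θ := lam⁻¹ • ξ with hθ
    have hξθ : ξ = lam • θ := by rw [hθ, smul_inv_smul₀ hlam0.ne']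
    have hθn : ‖θ‖ = R + 1 := by
      rw [hθ, norm_smul, norm_inv, Real.norm_of_nonneg hlam0.le, hlam]
      have : ‖ξ‖ ≠ 0 := by linarith [norm_nonneg ξ]
      field_simp
    have heq : (fun q => a q ξ) =ᶠ[𝓝 q] fun q => ((lam ^ m : ℝ)) • a q θ := by
      filter_upwards [hΩ.mem_nhds hqΩ] with q' hq'
      rw [hξθ, ha.homog q' hq' θ (by rw [hθn]; linarith) lam hlam1]
      simp
    have h3 : ‖iteratedFDeriv ℝ i (fun q => a q ξ) q‖
        = lam ^ m * ‖iteratedFDeriv ℝ i (fun q => a q θ) q‖ := by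
      rw [(heq.iteratedFDeriv ℝ i).eq_of_nhds]
      have h4 : ContDiffAt ℝ i (fun q => a q θ) q :=
        ((contDiffOn_slice ha.smooth θ).contDiffAt (hΩ.mem_nhds hqΩ)).of_le
          (by exact_mod_cast le_top)
      have := iteratedFDeriv_const_smul_apply (𝕜 := ℝ) (a := lam ^ m) h4
      rw [show (fun q => (lam ^ m) • a q θ) = (lam ^ m) • fun q => a q θ from rfl, this,
        norm_smul, Real.norm_of_nonneg (by positivity)]
    rw [h3]
    have h5 := (hq i hmem θ (by simp [hθn])).trans (hCD i hi)
    have h6 := hratio ((1 + ‖ξ‖) / lam) (by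
        rw [le_div_iff₀ hlam0, hlam, one_mul, div_le_iff₀ hR1]; nlinarith [norm_nonneg ξ]) (by
        rw [div_le_iff₀ hlam0]
        have : lam * (R + 1) = ‖ξ‖ := by rw [hlam]; field_simp
        nlinarith)
    rw [div_zpow, le_div_iff₀ (by positivity)] at h6
    calc _ ≤ lam ^ m * D * c := by gcongr
      _ = D * (c * lam ^ m) := by ring
      _ ≤ _ := by gcongr

theorem HomAmp.mul {Ω : Set P} {R : ℝ} {m n : ℤ} {a b : P → E → ℂ} (ha : HomAmp Ω R m a)
    (hb : HomAmp Ω R n b) : HomAmp Ω R (m + n) (fun q ξ => a q ξ * b q ξ) := by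
  refine ⟨ha.smooth.mul hb.smooth, fun q hq ξ hξ lam hlam => ?_⟩
  rw [ha.homog q hq ξ hξ lam hlam, hb.homog q hq ξ hξ lam hlam, zpow_add₀ (by linarith)]
  push_cast; ring

/-- The derivative of an amplitude in the momentum, along a vector field depending on `q`. -/
def momentumDeriv (v : P → E) (a : P → E → ℂ) (q : P) (ξ : E) : ℂ := fderiv ℝ (a q) ξ (v q)

/-- Differentiating the homogeneity relation costs one factor `lam`, since the field `v` does not
depend on the momentum. This drop of the degree is the gain of each integration by parts. -/
theorem HomAmp.momentumDeriv {Ω : Set P} (hΩ : IsOpen Ω) {R : ℝ} {m : ℤ} {a : P → E → ℂ}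
    (ha : HomAmp Ω R m a) {v : P → E} (hv : ContDiffOn ℝ ∞ v Ω) :
    HomAmp Ω R (m - 1) (momentumDeriv v a) := by
  refine ⟨?_, fun q hq ξ hξ lam hlam => ?_⟩
  · have h1 : ContDiffOn ℝ ∞ (fderiv ℝ (fun p : P × E => a p.1 p.2)) (Ω ×ˢ univ) :=
      ha.smooth.fderiv_of_isOpen (hΩ.prod isOpen_univ) (by simp)
    have h2 : ContDiffOn ℝ ∞ (fun p : P × E => fderiv ℝ (fun p : P × E => a p.1 p.2) p
        ((0 : P), v p.1)) (Ω ×ˢ univ) :=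
      h1.clm_apply (contDiffOn_const.prodMk (hv.comp contDiffOn_fst fun p hp => hp.1))
    refine h2.congr fun p hp => ?_
    have h3 : DifferentiableAt ℝ (fun p : P × E => a p.1 p.2) (p.1, p.2) :=
      (ha.smooth.contDiffAt ((hΩ.prod isOpen_univ).mem_nhds hp)).differentiableAt (by simp)
    have h4 : HasFDerivAt (a p.1) _ p.2 := h3.hasFDerivAt.comp p.2 (hasFDerivAt_prodMk_right p.1 p.2)
    simp [LeviCivitaPhase.momentumDeriv, h4.fderiv]
  · have hlam0 : 0 < lam := by linarith
    have hd : ∀ ξ, DifferentiableAt ℝ (a q) ξ := fun ξ =>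
      (contDiff_slice_right ha.smooth hq).differentiable (by simp) ξ
    have heq : (fun ξ => a q (lam • ξ)) =ᶠ[𝓝 ξ] fun ξ => ((lam ^ m : ℝ)) • a q ξ := by
      filter_upwards [(isOpen_lt continuous_const continuous_norm).mem_nhds hξ] with ξ' hξ'
      rw [ha.homog q hq ξ' hξ' lam hlam]; simp
    have h1 : HasFDerivAt (fun ξ => a q (lam • ξ))
        ((fderiv ℝ (a q) (lam • ξ)).comp (lam • ContinuousLinearMap.id ℝ E)) ξ :=
      (hd (lam • ξ)).hasFDerivAt.comp ξ ((hasFDerivAt_id ξ).const_smul lam)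
    have h2 : HasFDerivAt (fun ξ => a q (lam • ξ)) ((lam ^ m : ℝ) • fderiv ℝ (a q) ξ) ξ :=
      ((hd ξ).hasFDerivAt.const_smul (lam ^ m)).congr_of_eventuallyEq heq
    have h3 := congrArg (fun L : E →L[ℝ] ℂ => L (v q)) (h1.unique h2)
    simp only [ContinuousLinearMap.comp_apply, smul_apply,
      ContinuousLinearMap.id_apply, map_smul] at h3
    unfold LeviCivitaPhase.momentumDeriv
    rw [zpow_sub_one₀ hlam0.ne']
    have h4 : (lam : ℂ) ≠ 0 := by exact_mod_cast hlam0.ne'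
    simp only [Complex.real_smul] at h3
    push_cast at h3 ⊢
    rw [mul_right_comm, ← h3]
    field_simp

end Homogeneous

section Oscillatory

variable {P E : Type} [NormedAddCommGroup P] [NormedSpace ℝ P]
  [NormedAddCommGroup E] [InnerProductSpace ℝ E]

/-- The regularised integrand `e^{i⟨ξ,V(q)⟩} b(q,ξ) e^{-δH(q,ξ)}`. -/
def oscIntegrand (V : P → E) (H : P → E → ℝ) (b : P → E → ℂ) (δ : ℝ) (q : P) (ξ : E) : ℂ :=
  Complex.exp (Complex.I * (inner ℝ ξ (V q) : ℝ)) * b q ξ * (Real.exp (-δ * H q ξ) : ℂ)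

/-- The regularised oscillatory integral. -/
def oscIntegral [MeasurableSpace E] [BorelSpace E] [FiniteDimensional ℝ E] (V : P → E)
    (H : P → E → ℝ) (b : P → E → ℂ) (δ : ℝ) (q : P) : ℂ :=
  ∫ ξ, oscIntegrand V H b δ q ξ

/-- `H(q, ξ)` is smooth, homogeneous of degree two, and locally uniformly elliptic. -/
structure Elliptic (Ω : Set P) (H : P → E → ℝ) : Prop where
  smooth : ContDiffOn ℝ ∞ (fun p : P × E => H p.1 p.2) (Ω ×ˢ univ)
  homog : ∀ q ∈ Ω, ∀ ξ : E, ∀ lam : ℝ, H q (lam • ξ) = lam ^ 2 * H q ξ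
  lower : ∀ q₀ ∈ Ω, ∃ U ∈ 𝓝 q₀, ∃ c : ℝ, 0 < c ∧ ∀ q ∈ U, ∀ ξ, c * ‖ξ‖ ^ 2 ≤ H q ξ

/-- Pointwise convergence as `δ → 0+`, with locally uniform bounds. -/
def ConvBdd (Ω : Set P) (F : ℝ → P → ℂ) (K : P → ℂ) : Prop :=
  (∀ q ∈ Ω, Tendsto (fun δ => F δ q) (𝓝[>] 0) (𝓝 (K q))) ∧
  ∀ q₀ ∈ Ω, ∃ U ∈ 𝓝 q₀, ∃ C : ℝ, ∀ q ∈ U, ∀ δ ∈ Ioc (0 : ℝ) 1, ‖F δ q‖ ≤ C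

theorem Elliptic.homAmp {Ω : Set P} {H : P → E → ℝ} (hH : Elliptic Ω H) (R : ℝ) :
    HomAmp Ω R 2 (fun q ξ => (H q ξ : ℂ)) :=
  ⟨Complex.ofRealCLM.contDiff.comp_contDiffOn hH.smooth, fun q hq ξ _ lam _ => by
    rw [hH.homog q hq]; push_cast; rfl⟩

/-- The exponential beats the polynomial at infinity, and compactness covers the rest. The form `2 +
2 * s` is what `δ(1 + t)² ≤ 2 + 2δt²` produces with `s = δt²`. -/
theorem exists_polynomial_mul_exp_le (j : ℕ) {c : ℝ} (hc : 0 < c) :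
    ∃ C : ℝ, ∀ s : ℝ, 0 ≤ s → (2 + 2 * s) ^ j * Real.exp (-(c * s)) ≤ C := by
  have h1 : Tendsto (fun s : ℝ => (2 + 2 * s) ^ j * Real.exp (-(c * s))) atTop (𝓝 0) := by
    have h2 := (Polynomial.tendsto_div_exp_atTop
      (((2 : Polynomial ℝ) + Polynomial.C (2 / c) * Polynomial.X) ^ j)).comp
      (tendsto_id.const_mul_atTop hc)
    refine h2.congr fun s => ?_
    simp only [Function.comp, id, Polynomial.eval_pow, Polynomial.eval_add, Polynomial.eval_mul,
      Polynomial.eval_C, Polynomial.eval_X, Polynomial.eval_ofNat, Real.exp_neg]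
    rw [div_mul_eq_mul_div, ← mul_assoc, mul_comm 2 c, mul_assoc, mul_div_cancel_left₀ _ hc.ne']
    rfl
  obtain ⟨s₀, hs₀⟩ := (h1.eventually (gt_mem_nhds one_pos)).exists_forall_of_atTop
  obtain ⟨C, hC⟩ := (isCompact_Icc (a := (0 : ℝ)) (b := s₀)).bddAbove_image
    (f := fun s : ℝ => (2 + 2 * s) ^ j * Real.exp (-(c * s))) (by fun_prop)
  refine ⟨max C 1, fun s hs => ?_⟩
  rcases le_total s s₀ with h | h
  · exact (hC (mem_image_of_mem _ ⟨hs, h⟩)).trans (le_max_left _ _)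
  · exact (hs₀ s h).le.trans (le_max_right _ _)

/-- A factor `δ` is worth two powers of the momentum: `δ(1 + t)² ≤ 2 + 2δt²` for `δ ≤ 1`, and the
Gaussian absorbs every power of `δt²`. -/
theorem exists_pow_mul_exp_le (j : ℕ) {c : ℝ} (hc : 0 < c) :
    ∃ C : ℝ, 0 < C ∧ ∀ δ ∈ Ioc (0 : ℝ) 1, ∀ t : ℝ, 0 ≤ t →
      δ ^ j * Real.exp (-δ * (c * t ^ 2)) ≤ C * (1 + t) ^ (-(2 * j : ℝ)) := by
  obtain ⟨C, hC⟩ := exists_polynomial_mul_exp_le j hc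
  have hCpos : 0 < C := lt_of_lt_of_le (by positivity) (hC 0 le_rfl)
  refine ⟨C, hCpos, fun δ hδ t ht => ?_⟩
  rw [Real.rpow_neg (by positivity), ← div_eq_mul_inv, le_div_iff₀ (by positivity),
    show (2 * j : ℝ) = ((2 * j : ℕ) : ℝ) by push_cast; ring, Real.rpow_natCast]
  refine le_trans ?_ (hC (δ * t ^ 2) (mul_nonneg hδ.1.le (sq_nonneg _)))
  have h3 : δ * (1 + t) ^ 2 ≤ 2 + 2 * (δ * t ^ 2) := by
    have := hδ.1; have := hδ.2
    nlinarith [sq_nonneg (1 - t)]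
  have h4 : 0 ≤ δ * (1 + t) ^ 2 := mul_nonneg hδ.1.le (sq_nonneg _)
  calc _ = (δ * (1 + t) ^ 2) ^ j * Real.exp (-(c * (δ * t ^ 2))) := by
        rw [mul_pow, ← pow_mul]; ring_nf
    _ ≤ _ := by gcongr

theorem norm_oscIntegrand {V : P → E} {H : P → E → ℝ} {b : P → E → ℂ} {δ : ℝ} {q : P} {ξ : E} :
    ‖oscIntegrand V H b δ q ξ‖ = ‖b q ξ‖ * Real.exp (-δ * H q ξ) := by
  unfold oscIntegrand
  rw [norm_mul, norm_mul, mul_comm Complex.I, Complex.norm_exp_ofReal_mul_I, one_mul,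
    Complex.norm_real, Real.norm_of_nonneg (Real.exp_pos _).le]

variable {Ω : Set P} {V : P → E} {H : P → E → ℝ}

/-- The accounting rule for all that follows: ellipticity lets the regularising factor turn `δ ^ j`
into `2 * j` powers of decay, uniformly in `δ`. -/
theorem exists_norm_oscIntegrand_le (hH : Elliptic Ω H) {m : ℝ} {k : ℕ}
    {b : P → E → ℂ} (hb : GrowthBound Ω k m b) (j : ℕ) {q₀ : P} (hq₀ : q₀ ∈ Ω) :
    ∃ U ∈ 𝓝 q₀, ∃ C : ℝ, ∀ q ∈ U, ∀ δ ∈ Ioc (0 : ℝ) 1, ∀ ξ,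
      ‖(δ : ℂ) ^ j * oscIntegrand V H b δ q ξ‖ ≤ C * (1 + ‖ξ‖) ^ (m - 2 * j) := by
  obtain ⟨U, hU, C, hC0, hC⟩ := hb.bound q₀ hq₀
  obtain ⟨U', hU', c, hc0, hc⟩ := hH.lower q₀ hq₀
  obtain ⟨D, hD0, hD⟩ := exists_pow_mul_exp_le j hc0
  refine ⟨U ∩ U', inter_mem hU hU', C * D, fun q hq δ hδ ξ => ?_⟩
  rw [norm_mul, norm_oscIntegrand, norm_pow, Complex.norm_real, Real.norm_of_nonneg hδ.1.le]
  have h1 : ‖b q ξ‖ ≤ C * (1 + ‖ξ‖) ^ m := by simpa using hC q hq.1 ξ 0 (by omega)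
  have h2 : Real.exp (-δ * H q ξ) ≤ Real.exp (-δ * (c * ‖ξ‖ ^ 2)) := by
    apply Real.exp_le_exp.2
    have := hc q hq.2 ξ
    nlinarith [hδ.1]
  have hpos : (0 : ℝ) < 1 + ‖ξ‖ := by positivity
  have hδ0 := hδ.1.le
  calc _ ≤ δ ^ j * (C * (1 + ‖ξ‖) ^ m * Real.exp (-δ * (c * ‖ξ‖ ^ 2))) := by gcongr
    _ = C * (1 + ‖ξ‖) ^ m * (δ ^ j * Real.exp (-δ * (c * ‖ξ‖ ^ 2))) := by ring
    _ ≤ C * (1 + ‖ξ‖) ^ m * (D * (1 + ‖ξ‖) ^ (-(2 * j : ℝ))) := by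
        exact mul_le_mul_of_nonneg_left (hD δ hδ ‖ξ‖ (norm_nonneg ξ)) (by positivity)
    _ = _ := by rw [sub_eq_add_neg, Real.rpow_add hpos]; ring

theorem continuous_oscIntegrand (hH : Elliptic Ω H)
    {b : P → E → ℂ} (hb : ContDiffOn ℝ ∞ (fun p : P × E => b p.1 p.2) (Ω ×ˢ univ))
    (δ : ℝ) {q : P} (hq : q ∈ Ω) :
    Continuous (oscIntegrand V H b δ q) := by
  have h1 := (contDiff_slice_right hb hq).continuous
  have h2 := (contDiff_slice_right hH.smooth hq).continuous
  unfold oscIntegrand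
  fun_prop

variable [MeasurableSpace E] [BorelSpace E] [FiniteDimensional ℝ E]

theorem integrable_oscIntegrand (hH : Elliptic Ω H) {m : ℝ} {k : ℕ}
    {b : P → E → ℂ} (hb : GrowthBound Ω k m b) {δ : ℝ} (hδ : 0 < δ) {q : P} (hq : q ∈ Ω) :
    Integrable (oscIntegrand V H b δ q) := by
  obtain ⟨j, hj⟩ := exists_nat_gt ((m + Module.finrank ℝ E) / 2)
  -- The estimate covers only `δ ≤ 1`; replacing `δ` by the minimum is harmless because `H ≥ 0`
  -- makes the regularising factor decrease with `δ`.
  have hδ' : min δ 1 ∈ Ioc (0 : ℝ) 1 := ⟨by positivity, min_le_right _ _⟩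
  obtain ⟨U, hU, C, hC⟩ := exists_norm_oscIntegrand_le (V := V) hH hb j hq
  have h1 : Integrable (fun ξ : E => C / (min δ 1) ^ j * (1 + ‖ξ‖) ^ (m - 2 * j)) := by
    have := integrable_one_add_norm (μ := (volume : Measure E)) (r := -(m - 2 * j)) (by linarith)
    simp only [neg_neg] at this
    exact this.const_mul _
  obtain ⟨U', hU', c, hc0, hc⟩ := hH.lower q hq
  refine h1.mono' (continuous_oscIntegrand hH hb.smooth δ hq).aestronglyMeasurable ?_
  refine Eventually.of_forall fun ξ => ?_
  have h2 := hC q (mem_of_mem_nhds hU) _ hδ' ξ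
  rw [norm_mul, norm_pow, Complex.norm_real, Real.norm_of_nonneg hδ'.1.le] at h2
  rw [div_mul_eq_mul_div, le_div_iff₀ (pow_pos hδ'.1 j), mul_comm]
  refine le_trans ?_ h2
  rw [norm_oscIntegrand, norm_oscIntegrand]
  have h3 : 0 ≤ H q ξ := le_trans (by positivity) (hc q (mem_of_mem_nhds hU') ξ)
  have h4 : Real.exp (-δ * H q ξ) ≤ Real.exp (-(min δ 1) * H q ξ) := by
    apply Real.exp_le_exp.2
    nlinarith [min_le_left δ 1]
  have := pow_pos hδ'.1 j
  gcongr

/-- Absolutely convergent oscillatory integrals. -/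
theorem convBdd_of_growthBound (hH : Elliptic Ω H) {m : ℝ} {k : ℕ}
    {b : P → E → ℂ} (hb : GrowthBound Ω k m b) (j : ℕ)
    (hm : m - 2 * j < -(Module.finrank ℝ E : ℝ)) :
    ConvBdd Ω (fun δ q => (δ : ℂ) ^ j * oscIntegral V H b δ q)
      (fun q => 0 ^ j * oscIntegral V H b 0 q) := by
  have hint : ∀ C : ℝ, Integrable (fun ξ : E => C * (1 + ‖ξ‖) ^ (m - 2 * j)) := fun C => by
    have := integrable_one_add_norm (μ := (volume : Measure E)) (r := -(m - 2 * j)) (by linarith)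
    simp only [neg_neg] at this
    exact this.const_mul _
  refine ⟨fun q hq => ?_, fun q₀ hq₀ => ?_⟩
  · obtain ⟨U, hU, C, hC⟩ := exists_norm_oscIntegrand_le (V := V) hH hb j hq
    simp only [oscIntegral, ← integral_const_mul]
    refine tendsto_integral_filter_of_dominated_convergence
      (fun ξ : E => C * (1 + ‖ξ‖) ^ (m - 2 * j)) ?_ ?_ (hint C) ?_
    · exact Eventually.of_forall fun δ =>
        (continuous_const.mul (continuous_oscIntegrand hH hb.smooth δ hq)).aestronglyMeasurable
    · filter_upwards [Ioc_mem_nhdsGT (zero_lt_one' ℝ)] with δ hδ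
      exact Eventually.of_forall fun ξ => hC q (mem_of_mem_nhds hU) δ hδ ξ
    · refine Eventually.of_forall fun ξ => ?_
      have : Continuous fun δ : ℝ => (δ : ℂ) ^ j * oscIntegrand V H b δ q ξ := by
        unfold oscIntegrand; fun_prop
      simpa using (this.tendsto 0).mono_left (nhdsWithin_le_nhds (s := Ioi 0))
  · obtain ⟨U, hU, C, hC⟩ := exists_norm_oscIntegrand_le (V := V) hH hb j hq₀
    refine ⟨U, hU, ∫ ξ : E, C * (1 + ‖ξ‖) ^ (m - 2 * j), fun q hq δ hδ => ?_⟩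
    simp only [oscIntegral, ← integral_const_mul]
    exact norm_integral_le_of_norm_le (hint C) (Eventually.of_forall fun ξ => hC q hq δ hδ ξ)

end Oscillatory

section NonStationary

variable {P E : Type} [NormedAddCommGroup P] [NormedSpace ℝ P]
  [NormedAddCommGroup E] [InnerProductSpace ℝ E]
  [MeasurableSpace E] [BorelSpace E] [FiniteDimensional ℝ E]
  {Ω : Set P} {V : P → E} {H : P → E → ℝ}

theorem ConvBdd.add {F G : ℝ → P → ℂ} {K L : P → ℂ} (hF : ConvBdd Ω F K) (hG : ConvBdd Ω G L) :
    ConvBdd Ω (fun δ q => F δ q + G δ q) (fun q => K q + L q) := by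
  refine ⟨fun q hq => (hF.1 q hq).add (hG.1 q hq), fun q hq => ?_⟩
  obtain ⟨U, hU, C, hC⟩ := hF.2 q hq
  obtain ⟨U', hU', C', hC'⟩ := hG.2 q hq
  exact ⟨U ∩ U', inter_mem hU hU', C + C', fun q hq δ hδ =>
    (norm_add_le _ _).trans (add_le_add (hC q hq.1 δ hδ) (hC' q hq.2 δ hδ))⟩

theorem ConvBdd.const_mul {F : ℝ → P → ℂ} {K : P → ℂ} (hF : ConvBdd Ω F K) (c : ℂ) :
    ConvBdd Ω (fun δ q => c * F δ q) (fun q => c * K q) := by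
  refine ⟨fun q hq => (hF.1 q hq).const_mul c, fun q hq => ?_⟩
  obtain ⟨U, hU, C, hC⟩ := hF.2 q hq
  refine ⟨U, hU, ‖c‖ * C, fun q hq δ hδ => ?_⟩
  rw [norm_mul]
  exact mul_le_mul_of_nonneg_left (hC q hq δ hδ) (norm_nonneg _)

theorem ConvBdd.congr {F G : ℝ → P → ℂ} {K L : P → ℂ} (hF : ConvBdd Ω F K) (hΩ : IsOpen Ω)
    (hFG : ∀ q ∈ Ω, ∀ δ > 0, F δ q = G δ q) (hKL : ∀ q ∈ Ω, K q = L q) : ConvBdd Ω G L := by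
  refine ⟨fun q hq => ?_, fun q hq => ?_⟩
  · rw [← hKL q hq]
    refine (hF.1 q hq).congr' ?_
    filter_upwards [self_mem_nhdsWithin] with δ hδ using hFG q hq δ hδ
  · obtain ⟨U, hU, C, hC⟩ := hF.2 q hq
    exact ⟨U ∩ Ω, inter_mem hU (hΩ.mem_nhds hq), C, fun q hq δ hδ =>
      hFG q hq.2 δ hδ.1 ▸ hC q hq.1 δ hδ⟩

/-- Integration by parts in the momentum, along `v = V / |V|²`. -/
theorem oscIntegral_eq_momentumDeriv (hΩ : IsOpen Ω) (hH : Elliptic Ω H) {R : ℝ} (hR : 0 ≤ R)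
    {m : ℤ} {b : P → E → ℂ} (hb : HomAmp Ω R m b) {v : P → E} (hv : ContDiffOn ℝ ∞ v Ω)
    (hvV : ∀ q ∈ Ω, inner ℝ (v q) (V q) = 1) {δ : ℝ} (hδ : 0 < δ) {q : P} (hq : q ∈ Ω) :
    oscIntegral V H b δ q = Complex.I * oscIntegral V H (momentumDeriv v b) δ q -
      Complex.I * δ * oscIntegral V H
        (fun q ξ => b q ξ * momentumDeriv v (fun q ξ => (H q ξ : ℂ)) q ξ) δ q := by
  set f : E → ℂ := fun ξ => Complex.exp (Complex.I * (inner ℝ ξ (V q) : ℝ)) with hf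
  set e : E → ℂ := fun ξ => (Real.exp (-δ * H q ξ) : ℂ) with he
  set TH := momentumDeriv v (fun q ξ => (H q ξ : ℂ)) with hTH
  have hHamp := hH.homAmp R
  have hTb := hb.momentumDeriv hΩ hv
  have hTHamp := hHamp.momentumDeriv hΩ hv
  have hbd := (contDiff_slice_right hb.smooth hq).differentiable (by simp)
  have hHd := (contDiff_slice_right (a := fun q ξ => (H q ξ : ℂ)) hHamp.smooth hq).differentiable (by simp)
  have hfd : ∀ ξ, HasFDerivAt f (f ξ • (Complex.I • Complex.ofRealCLM.comp
      ((innerSL ℝ (V q)) : E →L[ℝ] ℝ))) ξ := fun ξ => by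
    have h1 : HasFDerivAt (fun ξ : E => Complex.I * ((inner ℝ ξ (V q) : ℝ) : ℂ))
        (Complex.I • Complex.ofRealCLM.comp ((innerSL ℝ (V q)) : E →L[ℝ] ℝ)) ξ := by
      have h0 : HasFDerivAt (fun ξ : E => ((inner ℝ ξ (V q) : ℝ) : ℂ))
        (Complex.ofRealCLM.comp ((innerSL ℝ (V q)) : E →L[ℝ] ℝ)) ξ := by
        refine (Complex.ofRealCLM.comp ((innerSL ℝ (V q)) : E →L[ℝ] ℝ)).hasFDerivAt.congr_of_eventuallyEq
          (Eventually.of_forall fun ξ => ?_)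
        simp [real_inner_comm]
      exact h0.const_smul Complex.I
    exact h1.cexp
  have hed : ∀ ξ, HasFDerivAt e (e ξ • ((-(δ : ℂ)) • fderiv ℝ (fun ξ => (H q ξ : ℂ)) ξ)) ξ :=
    fun ξ => by
      have h1 := ((hHd ξ).hasFDerivAt.const_smul (-(δ : ℂ))).cexp
      refine (h1.congr_of_eventuallyEq (Eventually.of_forall fun ξ => ?_)).congr_fderiv ?_
      · simp [he]
      · ext w; simp [he]
  -- Since `⟨v, V⟩ = 1`, the derivative of the phase factor along `v` reproduces it up to the factor
  -- `i`.
  have hfv : ∀ ξ, fderiv ℝ f ξ (v q) = Complex.I * f ξ := fun ξ => by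
    rw [(hfd ξ).fderiv]
    have h1 : inner ℝ (V q) (v q) = 1 := by rw [real_inner_comm, hvV q hq]
    simp [h1, mul_comm]
  have hgv : ∀ ξ, fderiv ℝ (fun ξ => b q ξ * e ξ) ξ (v q) =
      momentumDeriv v b q ξ * e ξ - δ * (b q ξ * TH q ξ * e ξ) := fun ξ => by
    rw [((hbd ξ).hasFDerivAt.fun_mul (hed ξ)).fderiv]
    simp [momentumDeriv, hTH]
    ring
  have i1 := integrable_oscIntegrand (V := V) hH (hb.growthBound hΩ hR 0) hδ hq
  have i2 := integrable_oscIntegrand (V := V) hH (hTb.growthBound hΩ hR 0) hδ hq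
  have i3 := integrable_oscIntegrand (V := V) hH ((hb.mul hTHamp).growthBound hΩ hR 0) hδ hq
  have e1 : ∀ ξ, f ξ * fderiv ℝ (fun ξ => b q ξ * e ξ) ξ (v q) =
      oscIntegrand V H (momentumDeriv v b) δ q ξ -
        δ * oscIntegrand V H (fun q ξ => b q ξ * TH q ξ) δ q ξ := fun ξ => by
    rw [hgv]; simp only [oscIntegrand, hf, he]; ring
  have e2 : ∀ ξ, fderiv ℝ f ξ (v q) * (b q ξ * e ξ) =
      Complex.I * oscIntegrand V H b δ q ξ := fun ξ => by
    rw [hfv]; simp only [oscIntegrand, hf, he]; ring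
  have e3 : ∀ ξ, f ξ * (b q ξ * e ξ) = oscIntegrand V H b δ q ξ := fun ξ => by
    simp only [oscIntegrand, hf, he]; ring
  have key := integral_mul_fderiv_eq_neg_fderiv_mul_of_integrable (μ := (volume : Measure E))
    (f := f) (g := fun ξ => b q ξ * e ξ) (v := v q)
    (by simp_rw [e2]; exact i1.const_mul _)
    (by simp_rw [e1]; exact i2.sub (i3.const_mul _))
    (by simp_rw [e3]; exact i1)
    (fun ξ _ => (hfd ξ).differentiableAt)
    (fun ξ _ => ((hbd ξ).hasFDerivAt.fun_mul (hed ξ)).differentiableAt)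
  simp_rw [e1, e2] at key
  rw [integral_sub i2 (i3.const_mul _), integral_const_mul, integral_const_mul] at key
  unfold oscIntegral
  linear_combination -Complex.I * key + (∫ ξ, oscIntegrand V H b δ q ξ) * Complex.I_sq

/-- Regularised oscillatory integrals with nonvanishing phase converge. -/
theorem exists_convBdd_of_homAmp (hΩ : IsOpen Ω) (hH : Elliptic Ω H) {R : ℝ} (hR : 0 ≤ R)
    {v : P → E} (hv : ContDiffOn ℝ ∞ v Ω) (hvV : ∀ q ∈ Ω, inner ℝ (v q) (V q) = 1) (n : ℕ) :
    ∀ (j : ℕ) (m : ℤ) (b : P → E → ℂ), HomAmp Ω R m b →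
      (m : ℝ) - 2 * j < -(Module.finrank ℝ E : ℝ) + n →
      ∃ K : P → ℂ, ConvBdd Ω (fun δ q => (δ : ℂ) ^ j * oscIntegral V H b δ q) K ∧
        (0 < j → ∀ q, K q = 0) := by
  -- The effective order is `m - 2 * j`. Integration by parts replaces `(j, m)` by `(j, m - 1)` and
  -- `(j + 1, m + 1)`, both of effective order one lower; `n` bounds the number of steps left before
  -- absolute convergence.
  induction n with
  | zero =>
    intro j m b hb hm
    refine ⟨_, convBdd_of_growthBound hH (hb.growthBound hΩ hR 0) j (by simpa using hm), ?_⟩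
    intro hj q
    simp [hj.ne']
  | succ n ih =>
    intro j m b hb hm
    have hTb := hb.momentumDeriv hΩ hv
    have hTH := hb.mul ((hH.homAmp R).momentumDeriv hΩ hv)
    obtain ⟨K, hK, hK0⟩ := ih j _ _ hTb (by push_cast at hm ⊢; linarith)
    obtain ⟨L, hL, hL0⟩ := ih (j + 1) _ _ hTH (by push_cast at hm ⊢; linarith)
    refine ⟨_, ((hK.const_mul Complex.I).add (hL.const_mul (-Complex.I))).congr hΩ
      (L := fun q => Complex.I * K q + -Complex.I * L q) ?_ fun q _ => rfl, ?_⟩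
    · intro q hq δ hδ
      rw [oscIntegral_eq_momentumDeriv hΩ hH hR hb hv hvV hδ hq]
      ring
    · intro hj q
      simp [hK0 hj, hL0 (Nat.succ_pos j)]

theorem growthBound_phase (hΩ : IsOpen Ω) (hV : ContDiffOn ℝ ∞ V Ω) (k : ℕ) :
    GrowthBound Ω k (1 : ℕ) (fun q (ξ : E) => Complex.I * ((inner ℝ ξ (V q) : ℝ) : ℂ)) := by
  refine ⟨contDiffOn_const.mul (Complex.ofRealCLM.contDiff.comp_contDiffOn
    (contDiffOn_snd.inner ℝ (hV.comp contDiffOn_fst fun p hp => hp.1))), fun q₀ hq₀ => ?_⟩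
  have h1 : ∀ i, ∃ C : ℝ, 0 ≤ C ∧ ∀ᶠ q in 𝓝 q₀, ‖iteratedFDeriv ℝ i V q‖ ≤ C := fun i => by
    have h2 : ContinuousOn (fun q' => ‖iteratedFDeriv ℝ i V q'‖) Ω :=
      ((hV.continuousOn_iteratedFDerivWithin (m := i) (by exact_mod_cast le_top)
        hΩ.uniqueDiffOn).congr fun y hy =>
          (iteratedFDerivWithin_of_isOpen i hΩ hy).symm).norm
    have h3 := (h2.continuousAt (hΩ.mem_nhds hq₀)).eventually (gt_mem_nhds (lt_add_one _))
    exact ⟨_, by positivity, h3.mono fun q hq => le_of_lt hq⟩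
  choose C hC0 hC using h1
  have hev : ∀ᶠ q in 𝓝 q₀, ∀ i ∈ Finset.range (k + 1), ‖iteratedFDeriv ℝ i V q‖ ≤ C i :=
    (eventually_all_finset _).2 fun i _ => hC i
  refine ⟨_, hev.and (hΩ.mem_nhds hq₀), ∑ i ∈ Finset.range (k + 1), C i,
    Finset.sum_nonneg fun i _ => hC0 i, ?_⟩
  rintro q ⟨hq, hqΩ⟩ ξ i hi
  set L : E →L[ℝ] ℂ := Complex.I • Complex.ofRealCLM.comp ((innerSL ℝ ξ) : E →L[ℝ] ℝ) with hL
  have h4 : (fun q => Complex.I * ((inner ℝ ξ (V q) : ℝ) : ℂ)) = L ∘ V := by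
    funext q; simp [hL]
  have h5 : ‖L‖ ≤ ‖ξ‖ := by
    refine L.opNorm_le_bound (norm_nonneg _) fun w => ?_
    simp only [hL, smul_apply, ContinuousLinearMap.comp_apply, innerSL_apply_apply,
      Complex.ofRealCLM_apply, smul_eq_mul, norm_mul, Complex.norm_I, one_mul, Complex.norm_real]
    exact norm_inner_le_norm _ _
  rw [h4]
  refine (L.norm_iteratedFDeriv_comp_left (hV.contDiffAt (hΩ.mem_nhds hqΩ))
    (by exact_mod_cast le_top)).trans ?_
  have h6 : C i ≤ ∑ i ∈ Finset.range (k + 1), C i :=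
    Finset.single_le_sum (f := C) (fun i _ => hC0 i) (by simp; omega)
  have h7 : ‖iteratedFDeriv ℝ i V q‖ ≤ C i := hq i (by simp; omega)
  rw [Nat.cast_one, Real.rpow_one, mul_comm]
  have h8 : ‖ξ‖ ≤ 1 + ‖ξ‖ := by linarith
  exact mul_le_mul (h7.trans h6) (h5.trans h8) (norm_nonneg _) (Finset.sum_nonneg fun i _ => hC0 i)

/-- Each derivative in `q` falling on the phase factor brings down one power of the momentum, whence
the loss of `k`. -/
theorem growthBound_oscIntegrand_zero (hΩ : IsOpen Ω) (hV : ContDiffOn ℝ ∞ V Ω) {m : ℝ} {k : ℕ}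
    {b : P → E → ℂ} (hb : GrowthBound Ω k m b) :
    GrowthBound Ω k (m + k) (oscIntegrand V H b 0) := by
  have h1 := growthBound_exp hΩ (growthBound_phase (E := E) hΩ hV k) (fun q _ ξ => by simp)
  have h2 := (h1.mul hΩ hb).mono (n := m + k) (by push_cast; linarith)
  unfold oscIntegrand
  simpa using h2

/-- The limit of a nonstationary regularised oscillatory integral is smooth. -/
theorem contDiffOn_of_tendsto_oscIntegral (hΩ : IsOpen Ω) (hH : Elliptic Ω H) {R : ℝ} (hR : 0 ≤ R)
    (hV : ContDiffOn ℝ ∞ V Ω)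
    {v : P → E} (hv : ContDiffOn ℝ ∞ v Ω) (hvV : ∀ q ∈ Ω, inner ℝ (v q) (V q) = 1) (k n : ℕ) :
    ∀ (m : ℤ) (b : P → E → ℂ) (K : P → ℂ), HomAmp Ω R m b →
      (m : ℝ) + k < -(Module.finrank ℝ E : ℝ) + n →
      (∀ q ∈ Ω, Tendsto (fun δ => oscIntegral V H b δ q) (𝓝[>] 0) (𝓝 (K q))) →
      ContDiffOn ℝ k K Ω := by
  induction n with
  | zero =>
    intro m b K hb hm hK
    have h1 := convBdd_of_growthBound (V := V) hH (hb.growthBound hΩ hR k) 0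
      (by push_cast at hm ⊢; linarith [(Nat.cast_nonneg k : (0 : ℝ) ≤ k)])
    have h2 := (growthBound_oscIntegrand_zero (H := H) hΩ hV
      (hb.growthBound hΩ hR k)).contDiffOn_integral hΩ (by push_cast at hm ⊢; linarith)
    refine h2.congr fun q hq => tendsto_nhds_unique (hK q hq) ?_
    simpa [oscIntegral] using h1.1 q hq
  | succ n ih =>
    intro m b K hb hm hK
    have hTb := hb.momentumDeriv hΩ hv
    have hTH := hb.mul ((hH.homAmp R).momentumDeriv hΩ hv)
    obtain ⟨N, hN⟩ := exists_nat_gt ((m : ℝ) + Module.finrank ℝ E)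
    obtain ⟨L, hL, hL0⟩ := exists_convBdd_of_homAmp hΩ hH hR hv hvV N 1 _ _ hTH
      (by push_cast at hN ⊢; linarith)
    -- The term carrying `δ` has limit zero, so the amplitude `momentumDeriv v b` has the limit
    -- `-iK`. Its order is lower by one, hence after finitely many steps `k` derivatives may be
    -- taken under the integral.
    have h1 := ih _ _ (fun q => -Complex.I * K q) hTb (by push_cast at hm ⊢; linarith) ?_
    · refine (contDiffOn_const (c := Complex.I)).mul h1 |>.congr fun q hq => ?_
      rw [← mul_assoc, mul_neg, Complex.I_mul_I]; simp
    · intro q hq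
      have h3 := hL.1 q hq
      rw [hL0 one_pos q] at h3
      have h4 := ((hK q hq).const_mul (-Complex.I)).add h3
      rw [add_zero] at h4
      refine h4.congr' ?_
      filter_upwards [self_mem_nhdsWithin] with δ hδ
      rw [oscIntegral_eq_momentumDeriv hΩ hH hR hb hv hvV hδ hq]
      linear_combination (-oscIntegral V H (momentumDeriv v b) δ q +
        δ * oscIntegral V H (fun q ξ => b q ξ *
          momentumDeriv v (fun q ξ => (H q ξ : ℂ)) q ξ) δ q) * Complex.I_mul_I

/-- Nonstationary oscillatory integrals have smooth limits. -/
theorem exists_smooth_limit_of_homAmp (hΩ : IsOpen Ω) (hH : Elliptic Ω H) {R : ℝ} (hR : 0 ≤ R)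
    (hV : ContDiffOn ℝ ∞ V Ω) (hV0 : ∀ q ∈ Ω, V q ≠ 0) {m : ℤ} {b : P → E → ℂ}
    (hb : HomAmp Ω R m b) :
    ∃ K : P → ℂ, ContDiffOn ℝ ∞ K Ω ∧ ConvBdd Ω (oscIntegral V H b) K := by
  set v : P → E := fun q => (‖V q‖ ^ 2)⁻¹ • V q with hv
  have hvs : ContDiffOn ℝ ∞ v Ω :=
    ((hV.norm_sq ℝ).inv fun q hq => by have := hV0 q hq; positivity).smul hV
  have hvV : ∀ q ∈ Ω, inner ℝ (v q) (V q) = 1 := fun q hq => by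
    have := hV0 q hq
    rw [hv, real_inner_smul_left, real_inner_self_eq_norm_sq]
    field_simp
  obtain ⟨N, hN⟩ := exists_nat_gt ((m : ℝ) + Module.finrank ℝ E)
  obtain ⟨K, hK, -⟩ := exists_convBdd_of_homAmp hΩ hH hR hvs hvV N 0 m b hb
    (by push_cast; linarith)
  refine ⟨K, ?_, by simpa using hK⟩
  rw [contDiffOn_infty]
  intro k
  obtain ⟨n, hn⟩ := exists_nat_gt ((m : ℝ) + k + Module.finrank ℝ E)
  exact contDiffOn_of_tendsto_oscIntegral hΩ hH hR hV hvs hvV k n m b K hb (by linarith)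
    (by simpa using hK.1)

/-- Oscillatory integrals of rapidly decreasing amplitudes have smooth limits. -/
theorem exists_smooth_limit_of_growthBound (hΩ : IsOpen Ω) (hH : Elliptic Ω H)
    (hV : ContDiffOn ℝ ∞ V Ω) {b : P → E → ℂ} (hb : ∀ k N : ℕ, GrowthBound Ω k (-(N : ℝ)) b) :
    ContDiffOn ℝ ∞ (oscIntegral V H b 0) Ω ∧
      ConvBdd Ω (oscIntegral V H b) (oscIntegral V H b 0) := by
  constructor
  · rw [contDiffOn_infty]
    intro k
    obtain ⟨N, hN⟩ := exists_nat_gt ((k : ℝ) + Module.finrank ℝ E)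
    exact (growthBound_oscIntegrand_zero (H := H) hΩ hV (hb k N)).contDiffOn_integral hΩ
      (by linarith)
  · obtain ⟨N, hN⟩ := exists_nat_gt (Module.finrank ℝ E : ℝ)
    simpa using convBdd_of_growthBound (V := V) hH (hb 0 N) 0 (by simpa using hN)

/-- Serves to make the regularised kernels measurable and integrable over the compact manifold. For
`δ > 0` the Gaussian factor dominates an amplitude of any order. -/
theorem continuousOn_oscIntegral (hΩ : IsOpen Ω) (hH : Elliptic Ω H)
    (hV : ContDiffOn ℝ ∞ V Ω) {m : ℝ} {b : P → E → ℂ} (hb : GrowthBound Ω 0 m b) {δ : ℝ}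
    (hδ : 0 < δ) : ContinuousOn (oscIntegral V H b δ) Ω := by
  intro q₀ hq₀
  apply ContinuousAt.continuousWithinAt
  obtain ⟨j, hj⟩ := exists_nat_gt ((m + Module.finrank ℝ E) / 2)
  have hδ' : min δ 1 ∈ Ioc (0 : ℝ) 1 := ⟨by positivity, min_le_right _ _⟩
  obtain ⟨U, hU, C, hC⟩ := exists_norm_oscIntegrand_le (V := V) hH hb j hq₀
  obtain ⟨U', hU', c, hc0, hc⟩ := hH.lower q₀ hq₀
  refine continuousAt_of_dominated (bound := fun ξ : E =>
    C / (min δ 1) ^ j * (1 + ‖ξ‖) ^ (m - 2 * j)) ?_ ?_ ?_ ?_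
  · filter_upwards [hΩ.mem_nhds hq₀] with q hq
    exact (continuous_oscIntegrand hH hb.smooth δ hq).aestronglyMeasurable
  · filter_upwards [hU, hU'] with q hq hq'
    refine Eventually.of_forall fun ξ => ?_
    have h2 := hC q hq _ hδ' ξ
    rw [norm_mul, norm_pow, Complex.norm_real, Real.norm_of_nonneg hδ'.1.le] at h2
    rw [div_mul_eq_mul_div, le_div_iff₀ (pow_pos hδ'.1 j), mul_comm]
    refine le_trans ?_ h2
    rw [norm_oscIntegrand, norm_oscIntegrand]
    have h3 : 0 ≤ H q ξ := le_trans (by positivity) (hc q hq' ξ)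
    have h4 : Real.exp (-δ * H q ξ) ≤ Real.exp (-(min δ 1) * H q ξ) := by
      apply Real.exp_le_exp.2
      nlinarith [min_le_left δ 1]
    have := pow_pos hδ'.1 j
    gcongr
  · have := integrable_one_add_norm (μ := (volume : Measure E)) (r := -(m - 2 * j)) (by linarith)
    simp only [neg_neg] at this
    exact this.const_mul _
  · refine Eventually.of_forall fun ξ => ?_
    have h1 := ((contDiffOn_slice hb.smooth ξ).contDiffAt (hΩ.mem_nhds hq₀)).continuousAt
    have h2 := ((contDiffOn_slice hH.smooth ξ).contDiffAt (hΩ.mem_nhds hq₀)).continuousAt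
    have h3 := (hV.contDiffAt (hΩ.mem_nhds hq₀)).continuousAt
    unfold oscIntegrand
    fun_prop

end NonStationary

/-! ### Gaussian integrals and their concentration. -/

section Gaussian

open scoped Matrix MatrixOrder

variable {d : ℕ}

/-- The quadratic form of a matrix. -/
def quadForm (G : Matrix (Fin d) (Fin d) ℝ) (v : Coord d) : ℝ :=
  ∑ α, ∑ β, G α β * v α * v β

theorem quadForm_eq_inner (G : Matrix (Fin d) (Fin d) ℝ) (v : Coord d) :
    quadForm G v = inner ℝ v (Matrix.toEuclideanCLM (n := Fin d) (𝕜 := ℝ) G v) := by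
  simp only [quadForm, PiLp.inner_apply, RCLike.inner_apply, conj_trivial,
    Matrix.ofLp_toEuclideanCLM, Matrix.mulVec, dotProduct]
  refine Finset.sum_congr rfl fun i _ => ?_
  rw [Finset.sum_mul]
  exact Finset.sum_congr rfl fun j _ => by ring

theorem det_toEuclideanCLM (G : Matrix (Fin d) (Fin d) ℝ) :
    (Matrix.toEuclideanCLM (n := Fin d) (𝕜 := ℝ) G).det = G.det := by
  rw [ContinuousLinearMap.det, Matrix.coe_toEuclideanCLM_eq_toEuclideanLin,
    Matrix.toEuclideanLin_eq_toLin, LinearMap.det_toLin]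

/-- `C` is the positive square root; `det G = (det C)²` gives the last identity without deciding the
sign of `det C`. -/
theorem exists_symmetric_sqrt {G : Matrix (Fin d) (Fin d) ℝ} (hG : G.PosDef) :
    ∃ C : Matrix (Fin d) (Fin d) ℝ, Cᵀ = C ∧ C * C = G ∧ |C.det| = Real.sqrt G.det := by
  refine ⟨CFC.sqrt G, ?_, CFC.sqrt_mul_sqrt_self _ hG.posSemidef.nonneg, ?_⟩
  · have := (Matrix.nonneg_iff_posSemidef.1 (CFC.sqrt_nonneg G)).isHermitian
    rwa [Matrix.IsHermitian, Matrix.conjTranspose_eq_transpose_of_trivial] at this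
  · rw [← Real.sqrt_sq_eq_abs, sq, ← Matrix.det_mul, CFC.sqrt_mul_sqrt_self _ hG.posSemidef.nonneg]

theorem integral_comp_clm_of_det_ne_zero {E F : Type*} [NormedAddCommGroup E] [NormedSpace ℝ E]
    [FiniteDimensional ℝ E] [MeasurableSpace E] [BorelSpace E] (μ : Measure E) [μ.IsAddHaarMeasure]
    [NormedAddCommGroup F] [NormedSpace ℝ F] (L : E →L[ℝ] E) (hL : L.det ≠ 0) (f : E → F) :
    ∫ x, f x ∂μ = |L.det| • ∫ x, f (L x) ∂μ := by
  have hbij : Function.Bijective L := by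
    exact (LinearEquiv.ofIsUnitDet (f := (L : E →ₗ[ℝ] E)) (v := Module.finBasis ℝ E)
      (v' := Module.finBasis ℝ E)
      (by rw [LinearMap.det_toMatrix]; exact isUnit_iff_ne_zero.2 hL)).bijective
  have h := integral_image_eq_integral_abs_det_fderiv_smul μ MeasurableSet.univ
    (fun x _ => L.hasFDerivAt.hasFDerivWithinAt) hbij.1.injOn f
  rw [image_univ, hbij.2.range_eq, setIntegral_univ, setIntegral_univ, integral_smul] at h
  exact h

/-- With `C` the symmetric root of `G`, the substitution `ξ = Cη` turns `G⁻¹` into the standard form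
and the frequency `v` into `Cv`, whose squared length is `quadForm G v`. -/
theorem integral_gaussian_quadForm {G : Matrix (Fin d) (Fin d) ℝ} (hG : G.PosDef) (v : Coord d)
    {δ : ℝ} (hδ : 0 < δ) :
    ∫ ξ : Coord d, Complex.exp (Complex.I * (inner ℝ ξ v : ℝ)) *
        (Real.exp (-δ * quadForm G⁻¹ ξ) : ℂ) =
      (Real.sqrt G.det * (Real.pi / δ) ^ ((d : ℝ) / 2) *
        Real.exp (-(quadForm G v) / (4 * δ)) : ℝ) := by
  obtain ⟨C, hCt, hCC, hCdet⟩ := exists_symmetric_sqrt hG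
  have hdet : C.det ≠ 0 := by
    have := Real.sqrt_pos.2 hG.det_pos
    rw [← hCdet] at this
    exact abs_pos.1 this
  set T := Matrix.toEuclideanCLM (n := Fin d) (𝕜 := ℝ) C with hT
  have hTdet : T.det = C.det := det_toEuclideanCLM C
  have hTsymm : ∀ x y : Coord d, inner ℝ (T x) y = inner ℝ x (T y) := fun x y => by
    rw [real_inner_comm, hT, Matrix.inner_toEuclideanCLM, Matrix.inner_toEuclideanCLM,
      Matrix.dotProduct_mulVec, ← Matrix.mulVec_transpose, hCt, dotProduct_comm]
  have hq1 : ∀ ξ : Coord d, quadForm G⁻¹ (T ξ) = ‖ξ‖ ^ 2 := fun ξ => by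
    rw [quadForm_eq_inner, hTsymm, hT, ← mul_apply_eq_comp, ← mul_apply_eq_comp,
      ← map_mul, ← map_mul, ← hCC, Matrix.mul_inv_rev]
    have hu : IsUnit C.det := isUnit_iff_ne_zero.2 hdet
    rw [← mul_assoc C, Matrix.mul_nonsing_inv _ hu, one_mul, Matrix.nonsing_inv_mul _ hu, map_one]
    simp
  have hq2 : quadForm G v = ‖T v‖ ^ 2 := by
    rw [quadForm_eq_inner, ← hCC, map_mul, ← real_inner_self_eq_norm_sq]
    exact (hTsymm v _).symm
  rw [integral_comp_clm_of_det_ne_zero volume T (by rw [hTdet]; exact hdet), hTdet, hCdet]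
  have h1 : ∀ ξ : Coord d, Complex.exp (Complex.I * (inner ℝ (T ξ) v : ℝ)) *
      (Real.exp (-δ * quadForm G⁻¹ (T ξ)) : ℂ) =
      Complex.exp (-(δ : ℂ) * ‖ξ‖ ^ 2 + Complex.I * (inner ℝ (T v) ξ : ℝ)) := fun ξ => by
    rw [hq1, hTsymm, real_inner_comm, Complex.ofReal_exp, ← Complex.exp_add, add_comm]
    push_cast; rfl
  simp_rw [h1]
  have h2 := GaussianFourier.integral_cexp_neg_mul_sq_norm_add (V := Coord d) (b := (δ : ℂ)) (by simpa using hδ)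
    Complex.I (T v)
  rw [h2, hq2, finrank_euclideanSpace_fin, Complex.real_smul]
  push_cast
  rw [mul_assoc, Complex.ofReal_cpow (by positivity)]
  push_cast
  congr 3
  rw [Complex.I_sq]; ring

/-- The preceding formula for `G⁻¹` at frequency zero and `δ = 1 / 4`. -/
theorem integral_exp_neg_quadForm {G : Matrix (Fin d) (Fin d) ℝ} (hG : G.PosDef) :
    ∫ w : Coord d, Real.exp (-(quadForm G w) / 4) =
      (4 * Real.pi) ^ ((d : ℝ) / 2) / Real.sqrt G.det := by
  have h := integral_gaussian_quadForm hG.inv 0 (δ := 1 / 4) (by norm_num)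
  have hu : IsUnit G.det := isUnit_iff_ne_zero.2 hG.det_pos.ne'
  rw [Matrix.nonsing_inv_nonsing_inv _ hu, Matrix.det_nonsing_inv, Ring.inverse_eq_inv',
    Real.sqrt_inv] at h
  have h0 : quadForm G⁻¹ (0 : Coord d) = 0 := by simp [quadForm]
  simp only [h0, inner_zero_right, Complex.ofReal_zero, mul_zero, Complex.exp_zero, one_mul,
    neg_zero, zero_div, Real.exp_zero, mul_one] at h
  rw [integral_complex_ofReal] at h
  have h1 := Complex.ofReal_injective h
  rw [div_eq_inv_mul, show 4 * Real.pi = Real.pi / (1 / 4) by ring, ← h1]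
  refine integral_congr_ae (Eventually.of_forall fun w => ?_)
  simp only
  congr 1; ring

/-- Concentration of Gaussian kernels at a point. -/
theorem tendsto_integral_gaussian_kernel {N : Set (Coord d)} (hN : MeasurableSet N) {z₀ : Coord d}
    (hz₀ : N ∈ 𝓝 z₀) {F : Coord d → ℂ} (hFm : AEStronglyMeasurable F (volume.restrict N)) {C : ℝ}
    (hFb : ∀ z ∈ N, ‖F z‖ ≤ C) (hFc : ContinuousAt F z₀) {Q : Coord d → ℝ}
    (hQm : AEStronglyMeasurable Q (volume.restrict N))
    {c : ℝ} (hc : 0 < c) (hQ : ∀ z ∈ N, c * ‖z - z₀‖ ^ 2 ≤ Q z)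
    {G : Matrix (Fin d) (Fin d) ℝ} (hG : G.PosDef)
    (hlim : ∀ w, Tendsto (fun δ : ℝ => Q (z₀ + Real.sqrt δ • w) / δ) (𝓝[>] 0) (𝓝 (quadForm G w))) :
    Tendsto (fun δ : ℝ => ∫ z in N, ((Real.pi / δ) ^ ((d : ℝ) / 2) *
        Real.exp (-(Q z) / (4 * δ)) : ℝ) * F z) (𝓝[>] 0)
      (𝓝 ((((2 * Real.pi) ^ d / Real.sqrt G.det : ℝ) : ℂ) * F z₀)) := by
  -- Substitution `z = z₀ + √δ w`: the Jacobian `δ^(d/2)` cancels the singular prefactor.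
  have hscale : ∀ᶠ δ : ℝ in 𝓝[>] 0, ∫ z in N, ((Real.pi / δ) ^ ((d : ℝ) / 2) *
        Real.exp (-(Q z) / (4 * δ)) : ℝ) * F z = ∫ w : Coord d,
        ((Real.pi ^ ((d : ℝ) / 2) : ℝ) : ℂ) * N.indicator (fun z =>
          (Real.exp (-(Q z) / (4 * δ)) : ℝ) * F z) (z₀ + Real.sqrt δ • w) := by
    filter_upwards [self_mem_nhdsWithin] with δ hδ
    have hδ0 : (0 : ℝ) < δ := hδ
    rw [← integral_indicator hN]
    set f : Coord d → ℂ := N.indicator fun z =>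
      ((Real.pi / δ) ^ ((d : ℝ) / 2) * Real.exp (-(Q z) / (4 * δ)) : ℝ) * F z with hf
    rw [← integral_add_left_eq_self f z₀]
    have h1 := Measure.integral_comp_smul (volume : Measure (Coord d)) (fun w => f (z₀ + w))
      (Real.sqrt δ)
    rw [finrank_euclideanSpace_fin, abs_of_nonneg (by positivity)] at h1
    have h2 : ∫ w, f (z₀ + w) = (Real.sqrt δ) ^ d • ∫ w, f (z₀ + Real.sqrt δ • w) := by
      rw [h1, smul_smul, mul_inv_cancel₀ (by positivity), one_smul]
    rw [h2, ← integral_smul]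
    refine integral_congr_ae (Eventually.of_forall fun w => ?_)
    simp only [hf]
    by_cases hw : z₀ + Real.sqrt δ • w ∈ N
    · rw [indicator_of_mem hw, indicator_of_mem hw, Complex.real_smul, ← mul_assoc, ← mul_assoc,
        ← Complex.ofReal_mul, ← Complex.ofReal_mul, ← mul_assoc]
      congr 3
      rw [Real.div_rpow Real.pi_pos.le hδ0.le, Real.sqrt_eq_rpow, ← Real.rpow_natCast,
        ← Real.rpow_mul hδ0.le, one_div_mul_eq_div]
      have : 0 < δ ^ ((d : ℝ) / 2) := by positivity
      field_simp
    · rw [indicator_of_notMem hw, indicator_of_notMem hw]; simp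
  refine Tendsto.congr' (EventuallyEq.symm hscale) ?_
  -- The constant is `π^(d/2) (4π)^(d/2) = (2π)^d`.
  have hval : ((((2 * Real.pi) ^ d / Real.sqrt G.det : ℝ) : ℂ) * F z₀) =
      ∫ w : Coord d, ((Real.pi ^ ((d : ℝ) / 2) : ℝ) : ℂ) *
        ((Real.exp (-(quadForm G w) / 4) : ℝ) * F z₀) := by
    rw [integral_const_mul, integral_mul_const, integral_complex_ofReal, integral_exp_neg_quadForm hG,
      ← mul_assoc, ← Complex.ofReal_mul]
    congr 2
    rw [← mul_div_assoc, ← Real.mul_rpow Real.pi_pos.le (by positivity)]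
    congr 1
    rw [show Real.pi * (4 * Real.pi) = (2 * Real.pi) ^ 2 by ring, ← Real.rpow_natCast (2 * Real.pi) 2,
      ← Real.rpow_mul (by positivity), ← Real.rpow_natCast]
    congr 1; push_cast; ring
  rw [hval]
  have hgint : Integrable (fun w : Coord d => Real.exp (-(c / 4) * ‖w‖ ^ 2)) := by
    have := (GaussianFourier.integrable_cexp_neg_mul_sq_norm_add (V := Coord d) (b := ((c / 4 : ℝ) : ℂ))
      (by simpa using hc) 0 0).norm
    refine this.congr (Eventually.of_forall fun w => ?_)
    simp only [zero_mul, add_zero, Complex.norm_exp]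
    norm_cast
  have hCF : 0 ≤ C := (norm_nonneg _).trans (hFb z₀ (mem_of_mem_nhds hz₀))
  refine tendsto_integral_filter_of_dominated_convergence
    (fun w => Real.pi ^ ((d : ℝ) / 2) * (C * Real.exp (-(c / 4) * ‖w‖ ^ 2))) ?_ ?_
    ((hgint.const_mul C).const_mul _) ?_
  · filter_upwards [self_mem_nhdsWithin] with δ hδ
    have hδ0 : (0 : ℝ) < δ := hδ
    refine AEStronglyMeasurable.const_mul ?_ _
    have h1 : AEStronglyMeasurable (N.indicator fun z =>
        ((Real.exp (-(Q z) / (4 * δ)) : ℝ) : ℂ) * F z) volume := by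
      rw [aestronglyMeasurable_indicator_iff hN]
      refine AEStronglyMeasurable.mul ?_ hFm
      exact (Complex.continuous_ofReal.comp Real.continuous_exp).comp_aestronglyMeasurable
        (hQm.neg.aemeasurable.div_const _).aestronglyMeasurable
    -- `F` and `Q` are only almost everywhere measurable, so null sets must pull back to null sets
    -- under the dilation.
    have hqm : Measure.QuasiMeasurePreserving (fun w : Coord d => z₀ + Real.sqrt δ • w)
        volume volume := by
      refine (measurePreserving_add_left volume z₀).quasiMeasurePreserving.comp ?_
      refine ⟨by fun_prop, ?_⟩
      rw [Measure.map_addHaar_smul _ (by positivity)]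
      exact Measure.smul_absolutelyContinuous
    exact h1.comp_quasiMeasurePreserving hqm
  · filter_upwards [self_mem_nhdsWithin] with δ hδ
    have hδ0 : (0 : ℝ) < δ := hδ
    refine Eventually.of_forall fun w => ?_
    rw [norm_mul, Complex.norm_real, Real.norm_of_nonneg (by positivity)]
    refine mul_le_mul_of_nonneg_left ?_ (by positivity)
    by_cases hw : z₀ + Real.sqrt δ • w ∈ N
    · rw [indicator_of_mem hw, norm_mul, Complex.norm_real, Real.norm_of_nonneg (Real.exp_pos _).le,
        mul_comm]
      refine mul_le_mul (hFb _ hw) ?_ (Real.exp_pos _).le hCF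
      apply Real.exp_le_exp.2
      have h1 := hQ _ hw
      rw [add_sub_cancel_left, norm_smul, mul_pow, Real.norm_of_nonneg (Real.sqrt_nonneg _),
        Real.sq_sqrt hδ0.le] at h1
      rw [div_le_iff₀ (by positivity)]
      nlinarith
    · rw [indicator_of_notMem hw, norm_zero]; positivity
  · refine Eventually.of_forall fun w => ?_
    have hpath : Tendsto (fun δ : ℝ => z₀ + Real.sqrt δ • w) (𝓝[>] 0) (𝓝 z₀) := by
      have : Continuous fun δ : ℝ => z₀ + Real.sqrt δ • w := by fun_prop
      simpa using (this.tendsto 0).mono_left (nhdsWithin_le_nhds (s := Ioi 0))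
    refine Tendsto.const_mul _ ?_
    have h1 : Tendsto (fun δ : ℝ => ((Real.exp (-(Q (z₀ + Real.sqrt δ • w)) / (4 * δ)) : ℝ) : ℂ) *
        F (z₀ + Real.sqrt δ • w)) (𝓝[>] 0) (𝓝 ((Real.exp (-(quadForm G w) / 4) : ℝ) * F z₀)) := by
      refine Tendsto.mul ?_ (hFc.tendsto.comp hpath)
      have h0 : Tendsto (fun δ : ℝ => -(Q (z₀ + Real.sqrt δ • w)) / (4 * δ)) (𝓝[>] 0)
          (𝓝 (-(quadForm G w) / 4)) := by
        refine ((hlim w).neg.div_const 4).congr fun δ => ?_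
        ring
      exact ((Complex.continuous_ofReal.comp Real.continuous_exp).tendsto _).comp h0
    refine h1.congr' ?_
    filter_upwards [hpath hz₀] with δ hδ
    have hδ' : z₀ + Real.sqrt δ • w ∈ N := hδ
    rw [indicator_of_mem hδ']

end Gaussian

/-! ### Fourier decay, uniform bounds for regularised amplitudes, Fourier inversion. -/

section Asymptotics

variable {E : Type} [NormedAddCommGroup E] [InnerProductSpace ℝ E]
  [MeasurableSpace E] [BorelSpace E] [FiniteDimensional ℝ E]

open FourierTransform in
/-- Decay of the Fourier transform of a smooth function supported in a ball. -/
theorem exists_norm_fourier_le (N : ℕ) (r : ℝ) :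
    ∃ D : ℝ, 0 ≤ D ∧ ∀ (f : E → ℂ) (A : ℝ), ContDiff ℝ ∞ f → (∀ u, r < ‖u‖ → f u = 0) →
      (∀ i ≤ N, ∀ u, ‖iteratedFDeriv ℝ i f u‖ ≤ A) → ∀ ζ : E,
      ‖∫ u, Complex.exp (Complex.I * (inner ℝ ζ u : ℝ)) * f u‖ ≤
        D * A * (1 + ‖ζ‖) ^ (-(N : ℝ)) := by
  set B : Set E := Metric.closedBall 0 r with hB
  set vol : ℝ := volume.real B with hvol
  have hvol0 : 0 ≤ vol := measureReal_nonneg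
  refine ⟨2 ^ N * (vol + (2 * Real.pi) ^ N * (2 ^ N * ((N + 1) * vol))), by positivity,
    fun f A hf hfs hA ζ => ?_⟩
  have hsupp : ∀ i u, u ∉ B → iteratedFDeriv ℝ i f u = 0 := by
    intro i u hu
    have h1 : f =ᶠ[𝓝 u] fun _ => 0 := by
      have : {u : E | r < ‖u‖} ∈ 𝓝 u :=
        (isOpen_lt continuous_const continuous_norm).mem_nhds (by simpa [hB] using hu)
      filter_upwards [this] with u' hu' using hfs u' hu'
    rw [(h1.iteratedFDeriv ℝ i).eq_of_nhds]
    simp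
  have hA0 : 0 ≤ A := (norm_nonneg _).trans (hA 0 (Nat.zero_le _) 0)
  have hind : ∀ i ≤ N, ∀ u, ‖iteratedFDeriv ℝ i f u‖ ≤ B.indicator (fun _ => A) u := by
    intro i hi u
    by_cases hu : u ∈ B
    · rw [indicator_of_mem hu]; exact hA i hi u
    · rw [indicator_of_notMem hu, hsupp i u hu, norm_zero]
  have hBint : Integrable (B.indicator fun _ : E => A) := by
    rw [integrable_indicator_iff Metric.isClosed_closedBall.measurableSet]
    exact integrableOn_const (isCompact_closedBall _ _).measure_lt_top.ne
  have hBval : ∫ u, B.indicator (fun _ : E => A) u = vol * A := by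
    rw [integral_indicator Metric.isClosed_closedBall.measurableSet, setIntegral_const, smul_eq_mul]
  have hcont : ∀ i : ℕ, Continuous (iteratedFDeriv ℝ i f) := fun i =>
    hf.continuous_iteratedFDeriv (by exact_mod_cast le_top)
  have hle : ∀ i ≤ N, ∫ u, ‖iteratedFDeriv ℝ i f u‖ ≤ vol * A := by
    intro i hi
    rw [← hBval]
    exact integral_mono_of_nonneg (Eventually.of_forall fun _ => norm_nonneg _) hBint
      (Eventually.of_forall (hind i hi))
  have hint : ∀ i ≤ N, Integrable (iteratedFDeriv ℝ i f) := fun i hi =>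
    hBint.mono' (hcont i).aestronglyMeasurable (Eventually.of_forall (hind i hi))
  -- The normalisation `e^(-2πi⟨u,w⟩)` of `𝓕` dictates this rescaling.
  set w : E := -(2 * Real.pi)⁻¹ • ζ with hw
  have hfour : ∫ u, Complex.exp (Complex.I * (inner ℝ ζ u : ℝ)) * f u = 𝓕 f w := by
    rw [Real.fourier_eq']
    refine integral_congr_ae (Eventually.of_forall fun u => ?_)
    simp only [smul_eq_mul]
    congr 2
    rw [hw, inner_smul_right, real_inner_comm]
    have : (Real.pi : ℂ) ≠ 0 := by exact_mod_cast Real.pi_ne_zero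
    push_cast
    field_simp
  rw [hfour]
  have h0 : ‖𝓕 f w‖ ≤ vol * A := by
    rw [Real.fourier_eq']
    refine (norm_integral_le_integral_norm _).trans ?_
    refine le_trans (le_of_eq ?_) (hle 0 (Nat.zero_le _))
    refine integral_congr_ae (Eventually.of_forall fun u => ?_)
    simp only [norm_iteratedFDeriv_zero, norm_smul]
    rw [Complex.norm_exp_ofReal_mul_I, one_mul]
  have hN := Real.pow_mul_norm_iteratedFDeriv_fourier_le (K := 0) (N := N) (f := f)
    (hf.of_le (by exact_mod_cast le_top))
    (fun k n hk hn => by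
      have hk0 : k = 0 := by simpa using hk
      have hn' : n ≤ N := by exact_mod_cast hn
      subst hk0
      simpa using (hint n hn').norm)
    (k := 0) (n := N) (by simp) le_rfl w
  simp only [norm_iteratedFDeriv_zero, pow_zero, one_mul, CharP.cast_eq_zero, mul_zero, zero_add] at hN
  have hN2 : ‖w‖ ^ N * ‖𝓕 f w‖ ≤ 2 ^ N * ((N + 1) * (vol * A)) := by
    refine hN.trans (mul_le_mul_of_nonneg_left ?_ (by positivity))
    refine (Finset.sum_le_card_nsmul _ _ (vol * A) fun p hp => ?_).trans (le_of_eq ?_)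
    · simp only [Finset.mem_product, Finset.mem_range] at hp
      have : p.1 = 0 := by omega
      rw [this]
      simpa using hle p.2 (by omega)
    · simp
  have hwn : ‖w‖ = (2 * Real.pi)⁻¹ * ‖ζ‖ := by
    rw [hw, norm_smul, norm_neg, Real.norm_of_nonneg (by positivity)]
  have hN3 : ‖ζ‖ ^ N * ‖𝓕 f w‖ ≤ (2 * Real.pi) ^ N * (2 ^ N * ((N + 1) * (vol * A))) := by
    have h3 : ‖ζ‖ ^ N = (2 * Real.pi) ^ N * ‖w‖ ^ N := by
      rw [hwn, ← mul_pow, ← mul_assoc, mul_inv_cancel₀ (by positivity), one_mul]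
    rw [h3, mul_assoc]
    exact mul_le_mul_of_nonneg_left hN2 (by positivity)
  rw [Real.rpow_neg (by positivity), Real.rpow_natCast, ← div_eq_mul_inv, le_div_iff₀ (by positivity)]
  -- The bounds of order zero and of order `N` are added to replace `‖ζ‖ ^ N` by `(1 + ‖ζ‖) ^ N`.
  have h4 : (1 + ‖ζ‖) ^ N ≤ 2 ^ N * (1 + ‖ζ‖ ^ N) := by
    have h5 := add_pow_le (zero_le_one (α := ℝ)) (norm_nonneg ζ) N
    rw [one_pow] at h5
    refine h5.trans ?_
    gcongr
    · norm_num
    · omega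
  calc ‖𝓕 f w‖ * (1 + ‖ζ‖) ^ N ≤ ‖𝓕 f w‖ * (2 ^ N * (1 + ‖ζ‖ ^ N)) := by gcongr
    _ = 2 ^ N * (‖𝓕 f w‖ + ‖ζ‖ ^ N * ‖𝓕 f w‖) := by ring
    _ ≤ 2 ^ N * (vol * A + (2 * Real.pi) ^ N * (2 ^ N * ((N + 1) * (vol * A)))) := by gcongr
    _ = _ := by ring

/-- The derivatives of the regularising factor are bounded uniformly in `δ`. -/
theorem exists_norm_iteratedFDeriv_regularizer_le {H : E → E → ℝ} (hH : Elliptic univ H) (k : ℕ)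
    (u₀ : E) : ∃ U ∈ 𝓝 u₀, ∃ C : ℝ, 0 ≤ C ∧ ∀ δ ∈ Icc (0 : ℝ) 1, ∀ u ∈ U, ∀ ξ : E, ∀ i ≤ k,
      ‖iteratedFDeriv ℝ i (fun u => (Real.exp (-δ * H u ξ) : ℂ)) u‖ ≤ C := by
  obtain ⟨U, hU, C, hC0, hC⟩ := ((hH.homAmp 0).growthBound isOpen_univ le_rfl k).bound u₀ (mem_univ _)
  obtain ⟨U', hU', c, hc0, hc⟩ := hH.lower u₀ (mem_univ _)
  obtain ⟨D, hD⟩ := exists_polynomial_mul_exp_le k hc0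
  have hD0 : 0 ≤ D := le_trans (by positivity) (hD 0 le_rfl)
  refine ⟨U ∩ U', inter_mem hU hU', k.factorial * ((1 + C) ^ k * D), by positivity,
    fun δ hδ u hu ξ i hi => ?_⟩
  -- In terms of `s = δ‖ξ‖²`, derivatives of the exponent are bounded by a multiple of `2 + 2s`,
  -- whereas the exponential is at most `e^(-cs)`; the product is bounded independently of `δ` and
  -- `ξ`.
  set s : ℝ := δ * ‖ξ‖ ^ 2 with hs
  have hs0 : 0 ≤ s := mul_nonneg hδ.1 (sq_nonneg _)
  have hsm : ContDiff ℝ ∞ (fun u => (H u ξ : ℂ)) := by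
    rw [← contDiffOn_univ]
    exact contDiffOn_slice (a := fun u ξ => (H u ξ : ℂ)) (hH.homAmp 0).smooth ξ
  have hsm' : ContDiff ℝ ∞ (fun u => (-δ) • (H u ξ : ℂ)) := hsm.const_smul (-δ)
  have hfun : (fun u => (Real.exp (-δ * H u ξ) : ℂ)) = Complex.exp ∘ fun u => (-δ) • (H u ξ : ℂ) := by
    funext u; simp
  have hone : 1 ≤ (1 + C) * (2 + 2 * s) := by nlinarith
  rw [hfun]
  refine (norm_iteratedFDeriv_comp_le (Complex.contDiff_exp (𝕜 := ℝ) (n := ∞)) hsm'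
    (by exact_mod_cast le_top) u (C := Real.exp (-(c * s))) (D := (1 + C) * (2 + 2 * s))
    (fun j _ => ?_) (fun j hj1 hj => ?_)).trans ?_
  · refine (norm_iteratedFDeriv_cexp_le j _).trans ?_
    rw [Complex.norm_exp]
    apply Real.exp_le_exp.2
    have h1 := hc u hu.2 ξ
    simp only [Complex.real_smul, Complex.mul_re, Complex.ofReal_re, Complex.ofReal_im, mul_zero,
      sub_zero]
    nlinarith [hδ.1]
  · refine le_trans ?_ (le_self_pow₀ hone (by omega))
    have h2 := iteratedFDeriv_const_smul_apply (𝕜 := ℝ) (a := -δ) (x := u) (i := j)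
      ((hsm.of_le (by exact_mod_cast le_top)).contDiffAt)
    rw [show (fun u => (-δ) • (H u ξ : ℂ)) = (-δ) • fun u => (H u ξ : ℂ) from rfl, h2, norm_smul,
      norm_neg, Real.norm_of_nonneg hδ.1]
    have h3 := hC u hu.1 ξ j (by omega)
    have h4 : (1 + ‖ξ‖) ^ ((2 : ℤ) : ℝ) = (1 + ‖ξ‖) ^ 2 := by
      rw [Real.rpow_intCast]; norm_cast
    rw [h4] at h3
    have h5 : δ * (1 + ‖ξ‖) ^ 2 ≤ 2 + 2 * s := by
      have := hδ.1; have := hδ.2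
      rw [hs]
      nlinarith [sq_nonneg (1 - ‖ξ‖)]
    calc _ ≤ δ * (C * (1 + ‖ξ‖) ^ 2) := mul_le_mul_of_nonneg_left h3 hδ.1
      _ = C * (δ * (1 + ‖ξ‖) ^ 2) := by ring
      _ ≤ C * (2 + 2 * s) := by gcongr
      _ ≤ _ := by nlinarith
  · have h1 : (i.factorial : ℝ) ≤ k.factorial := by exact_mod_cast Nat.factorial_le hi
    calc _ ≤ (k.factorial : ℝ) * Real.exp (-(c * s)) * ((1 + C) * (2 + 2 * s)) ^ k := by gcongr
      _ = k.factorial * ((1 + C) ^ k * ((2 + 2 * s) ^ k * Real.exp (-(c * s)))) := by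
          rw [mul_pow]; ring
      _ ≤ _ := by
          have := hD s hs0
          gcongr

/-- Finitely many neighbourhoods suffice, and constants add. The spectator `y` will stand for the
regularisation parameter, the momentum and the order of differentiation. -/
theorem exists_bound_of_isCompact {X Y : Type*} [TopologicalSpace X] {K : Set X} (hK : IsCompact K)
    {f : X → Y → ℝ} {g : Y → ℝ} (hg : ∀ y, 0 ≤ g y)
    (h : ∀ x ∈ K, ∃ U ∈ 𝓝 x, ∃ C : ℝ, ∀ x' ∈ U, ∀ y, f x' y ≤ C * g y) :
    ∃ C : ℝ, 0 ≤ C ∧ ∀ x ∈ K, ∀ y, f x y ≤ C * g y := by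
  refine hK.induction_on (p := fun s => ∃ C : ℝ, 0 ≤ C ∧ ∀ x ∈ s, ∀ y, f x y ≤ C * g y)
    ⟨0, le_rfl, by simp⟩ ?_ ?_ ?_
  · rintro s t hst ⟨C, hC, hCt⟩
    exact ⟨C, hC, fun x hx => hCt x (hst hx)⟩
  · rintro s t ⟨C, hC, hCs⟩ ⟨D, hD, hDt⟩
    refine ⟨C + D, by positivity, fun x hx y => ?_⟩
    have := hg y
    rcases hx with hx | hx
    · exact (hCs x hx y).trans (by gcongr; linarith)
    · exact (hDt x hx y).trans (by gcongr; linarith)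
  · intro x hx
    obtain ⟨U, hU, C, hC⟩ := h x hx
    refine ⟨U, mem_nhdsWithin_of_mem_nhds hU, max C 0, le_max_right _ _, fun x' hx' y => ?_⟩
    exact (hC x' hx' y).trans (mul_le_mul_of_nonneg_right (le_max_left _ _) (hg y))

/-- The amplitude vanishes outside a ball in `u`, so the local bounds become global by compactness.
-/
theorem exists_uniform_bound_regularized {H : E → E → ℝ} (hH : Elliptic univ H) {k : ℕ} {m : ℝ}
    {b : E → E → ℂ} (hb : GrowthBound univ k m b) {r : ℝ} (hbr : ∀ u ξ, r < ‖u‖ → b u ξ = 0) :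
    ∃ C : ℝ, 0 ≤ C ∧ ∀ δ ∈ Icc (0 : ℝ) 1, ∀ u ξ, ∀ i ≤ k,
      ‖iteratedFDeriv ℝ i (fun u => b u ξ * (Real.exp (-δ * H u ξ) : ℂ)) u‖ ≤
        C * (1 + ‖ξ‖) ^ m := by
  have hsm1 : ∀ ξ, ContDiff ℝ ∞ (fun u => b u ξ) := fun ξ => by
    rw [← contDiffOn_univ]; exact contDiffOn_slice hb.smooth ξ
  have hsm2 : ∀ δ ξ, ContDiff ℝ ∞ (fun u => (Real.exp (-δ * H u ξ) : ℂ)) := fun δ ξ => by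
    have h1 : ContDiff ℝ ∞ (fun u => H u ξ) := by
      rw [← contDiffOn_univ]; exact contDiffOn_slice hH.smooth ξ
    exact Complex.ofRealCLM.contDiff.comp (Real.contDiff_exp.comp (contDiff_const.mul h1))
  obtain ⟨C, hC, h⟩ := exists_bound_of_isCompact (X := E)
    (Y := {p : ℝ × E × ℕ // p.1 ∈ Icc (0 : ℝ) 1 ∧ p.2.2 ≤ k})
    (isCompact_closedBall (0 : E) r) (f := fun u p => ‖iteratedFDeriv ℝ p.1.2.2
      (fun u => b u p.1.2.1 * (Real.exp (-p.1.1 * H u p.1.2.1) : ℂ)) u‖)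
    (g := fun p => (1 + ‖p.1.2.1‖) ^ m) (fun p => by positivity) (fun u₀ _ => by
      obtain ⟨U, hU, A, hA0, hA⟩ := hb.bound u₀ (mem_univ _)
      obtain ⟨U', hU', B, hB0, hB⟩ := exists_norm_iteratedFDeriv_regularizer_le hH k u₀
      refine ⟨U ∩ U', inter_mem hU hU', 2 ^ k * (A * B), ?_⟩
      rintro u ⟨hu, hu'⟩ ⟨⟨δ, ξ, i⟩, hδ, hi⟩
      simp only at hδ hi ⊢
      refine (norm_iteratedFDeriv_mul_le (hsm1 ξ) (hsm2 δ ξ) u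
        (by exact_mod_cast le_top)).trans ?_
      calc _ ≤ ∑ j ∈ Finset.range (i + 1), (i.choose j : ℝ) * (A * (1 + ‖ξ‖) ^ m) * B := by
            refine Finset.sum_le_sum fun j hj => ?_
            have hj' : j ≤ i := by simpa [Nat.lt_succ_iff] using hj
            gcongr
            · exact hA u hu ξ j (by omega)
            · exact hB δ hδ u hu' ξ (i - j) (by omega)
        _ = 2 ^ i * (A * B) * (1 + ‖ξ‖) ^ m := by
            rw [← Finset.sum_mul, ← Finset.sum_mul]
            have : (∑ j ∈ Finset.range (i + 1), (i.choose j : ℝ)) = 2 ^ i := by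
              exact_mod_cast Nat.sum_range_choose i
            rw [this]; ring
        _ ≤ _ := by gcongr; norm_num)
  refine ⟨C, hC, fun δ hδ u ξ i hi => ?_⟩
  by_cases hu : u ∈ Metric.closedBall (0 : E) r
  · exact h u hu ⟨⟨δ, ξ, i⟩, hδ, hi⟩
  · have h1 : (fun u => b u ξ * (Real.exp (-δ * H u ξ) : ℂ)) =ᶠ[𝓝 u] fun _ => 0 := by
      have : {u : E | r < ‖u‖} ∈ 𝓝 u :=
        (isOpen_lt continuous_const continuous_norm).mem_nhds (by simpa using hu)
      filter_upwards [this] with u' hu'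
      rw [hbr u' ξ hu', zero_mul]
    rw [(h1.iteratedFDeriv ℝ i).eq_of_nhds]
    simp only [iteratedFDeriv_fun_zero, Pi.zero_apply, norm_zero]
    positivity

-- Fourier inversion at the origin: up to a constant, `β 0` is the integral of the Fourier transform
-- of `β`. The decay hypothesis supplies the integrability that inversion requires.
open FourierTransform in
theorem eq_zero_of_integral_fourier_eq_zero {β : E → ℂ} (hβ : Continuous β) (hβi : Integrable β)
    {D s : ℝ} (hs : s < -(Module.finrank ℝ E : ℝ))
    (hdec : ∀ ζ : E, ‖∫ u, Complex.exp (Complex.I * (inner ℝ ζ u : ℝ)) * β u‖ ≤ D * (1 + ‖ζ‖) ^ s)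
    (h0 : ∫ ζ : E, ∫ u, Complex.exp (Complex.I * (inner ℝ ζ u : ℝ)) * β u = 0) : β 0 = 0 := by
  set F : E → ℂ := fun ζ => ∫ u, Complex.exp (Complex.I * (inner ℝ ζ u : ℝ)) * β u with hF
  have hfour : ∀ w, 𝓕 β w = F (-(2 * Real.pi) • w) := fun w => by
    rw [Real.fourier_eq']
    refine integral_congr_ae (Eventually.of_forall fun u => ?_)
    simp only [smul_eq_mul]
    congr 2
    rw [inner_smul_left, real_inner_comm]
    simp
    ring
  have hFm : AEStronglyMeasurable F volume := by
    have hc : Continuous (Function.uncurry fun ζ u : E =>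
        Complex.exp (Complex.I * (inner ℝ ζ u : ℝ)) * β u) := by
      unfold Function.uncurry; fun_prop
    exact (hc.stronglyMeasurable.integral_prod_right (ν := (volume : Measure E))).aestronglyMeasurable
  have hFi : Integrable F := by
    have h1 := integrable_one_add_norm (μ := (volume : Measure E)) (r := -s) (by linarith)
    simp only [neg_neg] at h1
    exact (h1.const_mul D).mono' hFm (Eventually.of_forall hdec)
  have hpi : -(2 * Real.pi) ≠ 0 := by simp [Real.pi_ne_zero]
  have hFf : Integrable (𝓕 β) := by
    rw [show 𝓕 β = fun w => F (-(2 * Real.pi) • w) from funext hfour]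
    exact hFi.comp_smul hpi
  have h1 := hβi.fourierInv_fourier_eq hFf (v := 0) hβ.continuousAt
  rw [← h1, Real.fourierInv_eq']
  simp only [inner_zero_right, Complex.ofReal_zero, mul_zero, zero_mul, Complex.exp_zero, one_smul]
  simp_rw [hfour]
  rw [Measure.integral_comp_smul volume F, h0, smul_zero]

end Asymptotics

/-! ### The leading coefficient of an amplitude, read off from its action on plane waves. -/

section LeadingCoefficient

variable {E : Type} [NormedAddCommGroup E] [InnerProductSpace ℝ E]
  [MeasurableSpace E] [BorelSpace E] [FiniteDimensional ℝ E]
  {H : E → E → ℝ} {b : E → E → ℂ} {r : ℝ}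

/-- The Fourier transform in `u` of the regularised amplitude. -/
def amplitudeFourier (H : E → E → ℝ) (b : E → E → ℂ) (δ : ℝ) (ζ ξ : E) : ℂ :=
  ∫ u, Complex.exp (Complex.I * (inner ℝ ζ u : ℝ)) * (b u ξ * (Real.exp (-δ * H u ξ) : ℂ))

theorem continuous_uncurry_of_growthBound {k : ℕ} {m : ℝ} (hb : GrowthBound univ k m b) :
    Continuous fun p : E × E => b p.1 p.2 := by
  rw [← continuousOn_univ, ← univ_prod_univ]
  exact hb.smooth.continuousOn

theorem continuous_uncurry_of_elliptic (hH : Elliptic univ H) :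
    Continuous fun p : E × E => H p.1 p.2 := by
  rw [← continuousOn_univ, ← univ_prod_univ]
  exact hH.smooth.continuousOn

theorem measurable_amplitudeFourier (hH : Elliptic univ H) {k : ℕ} {m : ℝ}
    (hb : GrowthBound univ k m b) (δ : ℝ) (v : E) :
    AEStronglyMeasurable (fun ζ => amplitudeFourier H b δ ζ (ζ + v)) volume := by
  have h1 := continuous_uncurry_of_growthBound hb
  have h2 := continuous_uncurry_of_elliptic hH
  have hc : Continuous (Function.uncurry fun ζ u : E =>
      Complex.exp (Complex.I * (inner ℝ ζ u : ℝ)) *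
        (b u (ζ + v) * (Real.exp (-δ * H u (ζ + v)) : ℂ))) := by
    unfold Function.uncurry
    have h3 : Continuous fun p : E × E => b p.2 (p.1 + v) :=
      h1.comp (f := fun p : E × E => (p.2, p.1 + v)) (by fun_prop)
    have h4 : Continuous fun p : E × E => H p.2 (p.1 + v) :=
      h2.comp (f := fun p : E × E => (p.2, p.1 + v)) (by fun_prop)
    fun_prop
  exact (hc.stronglyMeasurable.integral_prod_right (ν := (volume : Measure E))).aestronglyMeasurable

/-- Derivatives of the regularised amplitude in `u` are bounded uniformly in `δ`, so the decay in
`ζ` is rapid with constants free of `δ`, while the order `-m` in `ξ` is kept. -/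
theorem norm_amplitudeFourier_le (hH : Elliptic univ H) {m : ℕ}
    (hb : ∀ k, GrowthBound univ k (-(m : ℝ)) b) (hbr : ∀ u ξ, r < ‖u‖ → b u ξ = 0) (N : ℕ) :
    ∃ C : ℝ, 0 ≤ C ∧ ∀ δ ∈ Icc (0 : ℝ) 1, ∀ ζ ξ, ‖amplitudeFourier H b δ ζ ξ‖ ≤
      C * (1 + ‖ξ‖) ^ (-(m : ℝ)) * (1 + ‖ζ‖) ^ (-(N : ℝ)) := by
  obtain ⟨C, hC0, hC⟩ := exists_uniform_bound_regularized hH (hb N) hbr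
  obtain ⟨D, hD0, hD⟩ := exists_norm_fourier_le (E := E) N r
  refine ⟨D * C, by positivity, fun δ hδ ζ ξ => ?_⟩
  have hsm : ContDiff ℝ ∞ (fun u => b u ξ * (Real.exp (-δ * H u ξ) : ℂ)) := by
    have h1 : ContDiff ℝ ∞ (fun u => H u ξ) := by
      rw [← contDiffOn_univ]; exact contDiffOn_slice hH.smooth ξ
    have h2 : ContDiff ℝ ∞ (fun u => b u ξ) := by
      rw [← contDiffOn_univ]; exact contDiffOn_slice (hb 0).smooth ξ
    exact h2.mul (Complex.ofRealCLM.contDiff.comp (Real.contDiff_exp.comp (contDiff_const.mul h1)))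
  have := hD _ (C * (1 + ‖ξ‖) ^ (-(m : ℝ))) hsm (fun u hu => by rw [hbr u ξ hu, zero_mul])
    (fun i hi u => hC δ hδ u ξ i hi) ζ
  refine this.trans (le_of_eq (by ring))

theorem tendsto_amplitudeFourier (hH : Elliptic univ H) {m : ℕ}
    (hb : ∀ k, GrowthBound univ k (-(m : ℝ)) b) (hbr : ∀ u ξ, r < ‖u‖ → b u ξ = 0) (ζ ξ : E) :
    Tendsto (fun δ => amplitudeFourier H b δ ζ ξ) (𝓝[>] 0) (𝓝 (amplitudeFourier H b 0 ζ ξ)) := by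
  obtain ⟨C, hC0, hC⟩ := exists_uniform_bound_regularized hH (hb 0) hbr
  set B : Set E := Metric.closedBall 0 r with hB
  have h1 := continuous_uncurry_of_growthBound (hb 0)
  have h2 := continuous_uncurry_of_elliptic hH
  have h3 : Continuous fun u : E => b u ξ := h1.comp (f := fun u : E => (u, ξ)) (by fun_prop)
  have h4 : Continuous fun u : E => H u ξ := h2.comp (f := fun u : E => (u, ξ)) (by fun_prop)
  refine tendsto_integral_filter_of_dominated_convergence
    (B.indicator fun _ => C * (1 + ‖ξ‖) ^ (-(m : ℝ))) ?_ ?_ ?_ ?_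
  · refine Eventually.of_forall fun δ => Continuous.aestronglyMeasurable ?_
    fun_prop
  · filter_upwards [Ioc_mem_nhdsGT (zero_lt_one' ℝ)] with δ hδ
    refine Eventually.of_forall fun u => ?_
    rw [norm_mul, mul_comm Complex.I, Complex.norm_exp_ofReal_mul_I, one_mul]
    by_cases hu : u ∈ B
    · rw [indicator_of_mem hu]
      simpa using hC δ ⟨hδ.1.le, hδ.2⟩ u ξ 0 le_rfl
    · rw [indicator_of_notMem hu, hbr u ξ (by simpa [hB] using hu)]; simp
  · rw [integrable_indicator_iff Metric.isClosed_closedBall.measurableSet]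
    exact integrableOn_const (isCompact_closedBall _ _).measure_lt_top.ne
  · refine Eventually.of_forall fun u => ?_
    have : Continuous fun δ : ℝ => Complex.exp (Complex.I * (inner ℝ ζ u : ℝ)) *
        (b u ξ * (Real.exp (-δ * H u ξ) : ℂ)) := by fun_prop
    exact (this.tendsto 0).mono_left nhdsWithin_le_nhds

/-- Fubini, then the translation `ξ = ζ + v`. The regularisation makes the double integral
absolutely convergent; there is no decay in `ξ` to rely on when `m = 0`. -/
theorem integral_oscIntegral_eq (hH : Elliptic univ H) {m : ℕ}
    (hb : ∀ k, GrowthBound univ k (-(m : ℝ)) b) (hbr : ∀ u ξ, r < ‖u‖ → b u ξ = 0)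
    {δ : ℝ} (hδ : δ ∈ Ioc (0 : ℝ) 1) (v : E) :
    ∫ u, oscIntegral (fun u => u) H b δ u * Complex.exp (-(Complex.I * (inner ℝ v u : ℝ))) =
      ∫ ζ, amplitudeFourier H b δ ζ (ζ + v) := by
  set B : Set E := Metric.closedBall 0 r with hB
  obtain ⟨j, hj⟩ := exists_nat_gt (Module.finrank ℝ E : ℝ)
  set G : E → E → ℂ := fun u ξ => oscIntegrand (fun u => u) H b δ u ξ *
    Complex.exp (-(Complex.I * (inner ℝ v u : ℝ))) with hG
  have hm0 : (0 : ℝ) ≤ m := Nat.cast_nonneg m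
  obtain ⟨C, hC0, hC⟩ := exists_bound_of_isCompact (X := E) (Y := E)
    (isCompact_closedBall (0 : E) r) (f := fun u ξ => ‖(δ : ℂ) ^ j *
      oscIntegrand (fun u => u) H b δ u ξ‖)
    (g := fun ξ => (1 + ‖ξ‖) ^ (-(m : ℝ) - 2 * j)) (fun p => by positivity) (fun u₀ _ => by
      obtain ⟨U, hU, C, hC⟩ := exists_norm_oscIntegrand_le (V := fun u : E => u) hH (hb 0) j
        (mem_univ u₀)
      exact ⟨U, hU, C, fun u hu ξ => hC u hu δ hδ ξ⟩)
  have hnorm : ∀ u ξ, ‖G u ξ‖ = ‖oscIntegrand (fun u => u) H b δ u ξ‖ := fun u ξ => by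
    rw [hG, norm_mul, mul_comm Complex.I, Complex.norm_exp]; simp
  have h1 := continuous_uncurry_of_growthBound (hb 0)
  have h2 := continuous_uncurry_of_elliptic hH
  have hGc : Continuous (Function.uncurry G) := by
    simp only [hG, oscIntegrand, Function.uncurry]; fun_prop
  have hGi : Integrable (Function.uncurry G) (volume.prod volume) := by
    have h3 : Integrable (fun p : E × E => B.indicator (fun _ => C / δ ^ j) p.1 *
        (1 + ‖p.2‖) ^ (-(m : ℝ) - 2 * j)) (volume.prod volume) := by
      refine Integrable.mul_prod (f := B.indicator fun _ => C / δ ^ j)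
        (g := fun ξ : E => (1 + ‖ξ‖) ^ (-(m : ℝ) - 2 * j)) ?_ ?_
      · rw [integrable_indicator_iff Metric.isClosed_closedBall.measurableSet]
        exact integrableOn_const (isCompact_closedBall _ _).measure_lt_top.ne
      · have := integrable_one_add_norm (μ := (volume : Measure E)) (r := -(-(m : ℝ) - 2 * j))
          (by linarith [(Nat.cast_nonneg j : (0 : ℝ) ≤ j)])
        simpa only [neg_neg] using this
    refine h3.mono' hGc.aestronglyMeasurable (Eventually.of_forall fun p => ?_)
    rw [Function.uncurry, hnorm]
    by_cases hu : p.1 ∈ B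
    · rw [indicator_of_mem hu]
      have := hC p.1 hu p.2
      rw [norm_mul, norm_pow, Complex.norm_real, Real.norm_of_nonneg hδ.1.le] at this
      rw [div_mul_eq_mul_div, le_div_iff₀ (pow_pos hδ.1 j)]
      linarith
    · rw [indicator_of_notMem hu, norm_oscIntegrand, hbr p.1 p.2 (by simpa [hB] using hu)]; simp
  have hswap := integral_integral_swap hGi
  have hL : ∀ u, oscIntegral (fun u => u) H b δ u * Complex.exp (-(Complex.I * (inner ℝ v u : ℝ))) =
      ∫ ξ, G u ξ := fun u => by
    rw [oscIntegral, ← integral_mul_const]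
  simp_rw [hL]
  rw [hswap, ← integral_add_right_eq_self _ v]
  refine integral_congr_ae (Eventually.of_forall fun ζ => ?_)
  simp only [amplitudeFourier, hG, oscIntegrand]
  refine integral_congr_ae (Eventually.of_forall fun u => ?_)
  simp only
  rw [inner_add_left, Complex.ofReal_add, mul_add, Complex.exp_add, Complex.exp_neg]
  field_simp [Complex.exp_ne_zero]

/-- If the oscillatory integral with amplitude `b` of order `-m` acts on rapidly oscillating
functions supported near `0` as a smooth kernel, then the leading coefficient of `b` vanishes
at `0`. -/
theorem leading_coefficient_eq_zero (hH : Elliptic univ H) {m : ℕ}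
    (hb : ∀ k, GrowthBound univ k (-(m : ℝ)) b) (hbr : ∀ u ξ, r < ‖u‖ → b u ξ = 0)
    {θ : E} (hθ : θ ≠ 0) {β : E → ℂ} (hβ : Continuous β)
    (hlim : ∀ u ζ, Tendsto (fun τ : ℝ => (τ : ℂ) ^ m * b u (ζ + τ • θ)) atTop (𝓝 (β u)))
    {κ : E → ℂ} (hκ : ContDiff ℝ ∞ κ) (hκr : ∀ u, r < ‖u‖ → κ u = 0)
    (h : ∀ τ : ℝ, 1 ≤ τ → Tendsto (fun δ => ∫ u, oscIntegral (fun u => u) H b δ u *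
      Complex.exp (-(Complex.I * (inner ℝ (τ • θ) u : ℝ)))) (𝓝[>] 0)
      (𝓝 (∫ u, κ u * Complex.exp (-(Complex.I * (inner ℝ (τ • θ) u : ℝ)))))) :
    β 0 = 0 := by
  set d : ℕ := Module.finrank ℝ E with hd
  set B : Set E := Metric.closedBall 0 r with hB
  have hθ0 : 0 < ‖θ‖ := norm_pos_iff.2 hθ
  -- Of the `m + d + 1` powers, `m` pay for the loss in `hpw` and `d + 1` remain for integrability.
  obtain ⟨C, hC0, hC⟩ := norm_amplitudeFourier_le hH hb hbr (m + d + 1)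
  -- Peetre's inequality: `τ‖θ‖ ≤ (1 + ‖ζ + τθ‖)(1 + ‖ζ‖)`, raised to the power `m`.
  have hpw : ∀ (τ : ℝ), 1 ≤ τ → ∀ ζ : E,
      τ ^ m * (1 + ‖ζ + τ • θ‖) ^ (-(m : ℝ)) ≤ ‖θ‖ ^ (-(m : ℝ)) * (1 + ‖ζ‖) ^ (m : ℝ) := by
    intro τ hτ ζ
    have hτ0 : 0 < τ := by linarith
    have h1 : τ * ‖θ‖ ≤ (1 + ‖ζ + τ • θ‖) * (1 + ‖ζ‖) := by
      have h2 : τ * ‖θ‖ ≤ ‖ζ + τ • θ‖ + ‖ζ‖ := by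
        have h3 : τ • θ = (ζ + τ • θ) - ζ := by abel
        calc τ * ‖θ‖ = ‖τ • θ‖ := by rw [norm_smul, Real.norm_of_nonneg hτ0.le]
          _ = ‖(ζ + τ • θ) - ζ‖ := by rw [← h3]
          _ ≤ _ := norm_sub_le _ _
      nlinarith [norm_nonneg ζ, norm_nonneg (ζ + τ • θ)]
    have h4 := pow_le_pow_left₀ (by positivity) h1 m
    rw [mul_pow, mul_pow] at h4
    rw [Real.rpow_neg (by positivity), Real.rpow_neg hθ0.le, Real.rpow_natCast, Real.rpow_natCast,
      Real.rpow_natCast, ← div_eq_mul_inv, ← div_eq_inv_mul, div_le_div_iff₀ (by positivity)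
      (by positivity)]
    linarith
  have hint : ∀ A : ℝ, Integrable (fun ζ : E => A * (1 + ‖ζ‖) ^ (-((d + 1 : ℕ) : ℝ))) := fun A => by
    have h1 := integrable_one_add_norm (μ := (volume : Measure E)) (r := ((d + 1 : ℕ) : ℝ))
      (by push_cast; linarith)
    exact h1.const_mul A
  have hone : ∀ x : E, (1 : ℝ) ≤ 1 + ‖x‖ := fun x => by linarith [norm_nonneg x]
  -- removal of the regularisation
  have hlim0 : ∀ τ : ℝ, 1 ≤ τ → ∫ ζ, amplitudeFourier H b 0 ζ (ζ + τ • θ) =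
      ∫ u, κ u * Complex.exp (-(Complex.I * (inner ℝ (τ • θ) u : ℝ))) := by
    intro τ hτ
    refine tendsto_nhds_unique ?_ (h τ hτ)
    have h1 : Tendsto (fun δ => ∫ ζ, amplitudeFourier H b δ ζ (ζ + τ • θ)) (𝓝[>] 0)
        (𝓝 (∫ ζ, amplitudeFourier H b 0 ζ (ζ + τ • θ))) := by
      refine tendsto_integral_filter_of_dominated_convergence
        (fun ζ : E => C * (1 + ‖ζ‖) ^ (-((d + 1 : ℕ) : ℝ))) ?_ ?_ (hint C) ?_
      · exact Eventually.of_forall fun δ => measurable_amplitudeFourier hH (hb 0) δ _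
      · filter_upwards [Ioc_mem_nhdsGT (zero_lt_one' ℝ)] with δ hδ
        refine Eventually.of_forall fun ζ => (hC δ ⟨hδ.1.le, hδ.2⟩ ζ _).trans ?_
        refine mul_le_mul ?_ ?_ (by positivity) hC0
        · refine mul_le_of_le_one_right hC0 ?_
          exact Real.rpow_le_one_of_one_le_of_nonpos (hone _) (by simp)
        · exact Real.rpow_le_rpow_of_exponent_le (hone _) (by push_cast; linarith [(Nat.cast_nonneg m : (0 : ℝ) ≤ m)])
      · exact Eventually.of_forall fun ζ => tendsto_amplitudeFourier hH hb hbr ζ _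
    refine h1.congr' ?_
    filter_upwards [Ioc_mem_nhdsGT (zero_lt_one' ℝ)] with δ hδ
    exact (integral_oscIntegral_eq hH hb hbr hδ _).symm
  -- the limit `τ → ∞`
  set F : E → ℂ := fun ζ => ∫ u, Complex.exp (Complex.I * (inner ℝ ζ u : ℝ)) * β u with hF
  obtain ⟨C₁, hC₁0, hC₁⟩ := exists_uniform_bound_regularized hH (hb 0) hbr
  have hβr : ∀ u, r < ‖u‖ → β u = 0 := fun u hu =>
    tendsto_nhds_unique (hlim u 0) (by simp [hbr u _ hu])
  have hcb := continuous_uncurry_of_growthBound (hb 0)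
  have hptw : ∀ ζ, Tendsto (fun τ : ℝ => (τ : ℂ) ^ m * amplitudeFourier H b 0 ζ (ζ + τ • θ)) atTop
      (𝓝 (F ζ)) := by
    intro ζ
    simp only [amplitudeFourier, ← integral_const_mul]
    refine tendsto_integral_filter_of_dominated_convergence
      (B.indicator fun _ => C₁ * (‖θ‖ ^ (-(m : ℝ)) * (1 + ‖ζ‖) ^ (m : ℝ))) ?_ ?_ ?_ ?_
    · refine Eventually.of_forall fun τ => Continuous.aestronglyMeasurable ?_
      have h3 : Continuous fun u : E => b u (ζ + τ • θ) :=
        hcb.comp (f := fun u : E => (u, ζ + τ • θ)) (by fun_prop)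
      simp only [neg_zero, zero_mul, Real.exp_zero, Complex.ofReal_one, mul_one]
      fun_prop
    · filter_upwards [eventually_ge_atTop 1] with τ hτ
      refine Eventually.of_forall fun u => ?_
      by_cases hu : u ∈ B
      · rw [indicator_of_mem hu, norm_mul, norm_mul, mul_comm Complex.I,
          Complex.norm_exp_ofReal_mul_I, one_mul, norm_pow, Complex.norm_real,
          Real.norm_of_nonneg (by linarith)]
        have h3 := hC₁ 0 (by simp) u (ζ + τ • θ) 0 le_rfl
        rw [norm_iteratedFDeriv_zero] at h3
        calc _ ≤ τ ^ m * (C₁ * (1 + ‖ζ + τ • θ‖) ^ (-(m : ℝ))) := by gcongr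
          _ = C₁ * (τ ^ m * (1 + ‖ζ + τ • θ‖) ^ (-(m : ℝ))) := by ring
          _ ≤ _ := mul_le_mul_of_nonneg_left (hpw τ hτ ζ) hC₁0
      · rw [indicator_of_notMem hu, hbr u _ (by simpa [hB] using hu)]; simp
    · rw [integrable_indicator_iff Metric.isClosed_closedBall.measurableSet]
      exact integrableOn_const (isCompact_closedBall _ _).measure_lt_top.ne
    · refine Eventually.of_forall fun u => ?_
      refine ((hlim u ζ).const_mul (Complex.exp (Complex.I * (inner ℝ ζ u : ℝ)))).congr fun τ => ?_
      simp only [neg_zero, zero_mul, Real.exp_zero, Complex.ofReal_one, mul_one]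
      ring
  set A : ℝ := C * ‖θ‖ ^ (-(m : ℝ)) with hA
  have hdom : ∀ τ : ℝ, 1 ≤ τ → ∀ ζ : E,
      ‖(τ : ℂ) ^ m * amplitudeFourier H b 0 ζ (ζ + τ • θ)‖ ≤
        A * (1 + ‖ζ‖) ^ (-((d + 1 : ℕ) : ℝ)) := by
    intro τ hτ ζ
    rw [norm_mul, norm_pow, Complex.norm_real, Real.norm_of_nonneg (by linarith)]
    calc _ ≤ τ ^ m * (C * (1 + ‖ζ + τ • θ‖) ^ (-(m : ℝ)) *
          (1 + ‖ζ‖) ^ (-((m + d + 1 : ℕ) : ℝ))) :=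
          mul_le_mul_of_nonneg_left (hC 0 (by simp) ζ _) (by positivity)
      _ = C * (τ ^ m * (1 + ‖ζ + τ • θ‖) ^ (-(m : ℝ))) *
          (1 + ‖ζ‖) ^ (-((m + d + 1 : ℕ) : ℝ)) := by ring
      _ ≤ C * (‖θ‖ ^ (-(m : ℝ)) * (1 + ‖ζ‖) ^ (m : ℝ)) *
          (1 + ‖ζ‖) ^ (-((m + d + 1 : ℕ) : ℝ)) := by
          have := hpw τ hτ ζ
          gcongr
      _ = A * ((1 + ‖ζ‖) ^ (m : ℝ) * (1 + ‖ζ‖) ^ (-((m + d + 1 : ℕ) : ℝ))) := by rw [hA]; ring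
      _ = _ := by
          rw [← Real.rpow_add (by linarith [hone ζ])]
          congr 2; push_cast; ring
  have hFint : Tendsto (fun τ : ℝ => ∫ ζ, (τ : ℂ) ^ m * amplitudeFourier H b 0 ζ (ζ + τ • θ)) atTop
      (𝓝 (∫ ζ, F ζ)) := by
    refine tendsto_integral_filter_of_dominated_convergence
      (fun ζ : E => A * (1 + ‖ζ‖) ^ (-((d + 1 : ℕ) : ℝ))) ?_ ?_ (hint A)
      (Eventually.of_forall hptw)
    · exact Eventually.of_forall fun τ => (measurable_amplitudeFourier hH (hb 0) 0 _).const_mul _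
    · filter_upwards [eventually_ge_atTop 1] with τ hτ using Eventually.of_forall (hdom τ hτ)
  -- the right-hand side is rapidly decreasing
  have hκlim : Tendsto (fun τ : ℝ => (τ : ℂ) ^ m *
      ∫ u, κ u * Complex.exp (-(Complex.I * (inner ℝ (τ • θ) u : ℝ)))) atTop (𝓝 0) := by
    obtain ⟨D, hD0, hD⟩ := exists_norm_fourier_le (E := E) (m + 1) r
    have hcont : ∀ i : ℕ, Continuous (iteratedFDeriv ℝ i κ) := fun i =>
      hκ.continuous_iteratedFDeriv (by exact_mod_cast le_top)
    have hb1 : ∀ i : ℕ, ∃ A : ℝ, 0 ≤ A ∧ ∀ u, ‖iteratedFDeriv ℝ i κ u‖ ≤ A := by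
      intro i
      obtain ⟨A, hA⟩ := (isCompact_closedBall (0 : E) r).bddAbove_image (hcont i).norm.continuousOn
      refine ⟨max A 0, le_max_right _ _, fun u => ?_⟩
      by_cases hu : u ∈ Metric.closedBall (0 : E) r
      · exact (hA (mem_image_of_mem _ hu)).trans (le_max_left _ _)
      · have h1 : κ =ᶠ[𝓝 u] fun _ => 0 := by
          have : {u : E | r < ‖u‖} ∈ 𝓝 u :=
            (isOpen_lt continuous_const continuous_norm).mem_nhds (by simpa using hu)
          filter_upwards [this] with u' hu' using hκr u' hu'
        rw [(h1.iteratedFDeriv ℝ i).eq_of_nhds]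
        simp
    choose A hA0 hA using hb1
    set S := ∑ i ∈ Finset.range (m + 2), A i with hS
    have hS' : ∀ i ≤ m + 1, ∀ u, ‖iteratedFDeriv ℝ i κ u‖ ≤ S := fun i hi u =>
      (hA i u).trans (Finset.single_le_sum (f := A) (fun i _ => hA0 i) (by simp; omega))
    have hS0 : 0 ≤ S := Finset.sum_nonneg fun i _ => hA0 i
    rw [tendsto_zero_iff_norm_tendsto_zero]
    have hz : Tendsto (fun τ : ℝ => D * S * (‖θ‖⁻¹) ^ (m + 1) * τ⁻¹) atTop (𝓝 0) := by
      simpa using tendsto_inv_atTop_zero.const_mul (D * S * (‖θ‖⁻¹) ^ (m + 1))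
    refine squeeze_zero' (Eventually.of_forall fun _ => norm_nonneg _) ?_ hz
    filter_upwards [eventually_ge_atTop 1] with τ hτ
    have hτ0 : 0 < τ := by linarith
    have h1 := hD κ S hκ hκr hS' (-(τ • θ))
    rw [norm_neg, norm_smul, Real.norm_of_nonneg hτ0.le] at h1
    have h2 : ∫ u, κ u * Complex.exp (-(Complex.I * (inner ℝ (τ • θ) u : ℝ))) =
        ∫ u, Complex.exp (Complex.I * (inner ℝ (-(τ • θ)) u : ℝ)) * κ u := by
      refine integral_congr_ae (Eventually.of_forall fun u => ?_)
      simp only [inner_neg_left, Complex.ofReal_neg, mul_neg]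
      ring
    rw [norm_mul, norm_pow, Complex.norm_real, Real.norm_of_nonneg hτ0.le, h2]
    have h3 : (1 + τ * ‖θ‖) ^ (-((m + 1 : ℕ) : ℝ)) ≤ (τ * ‖θ‖)⁻¹ ^ (m + 1) := by
      rw [Real.rpow_neg (by positivity), Real.rpow_natCast, inv_pow]
      gcongr
      linarith
    calc _ ≤ τ ^ m * (D * S * (τ * ‖θ‖)⁻¹ ^ (m + 1)) := by
          refine mul_le_mul_of_nonneg_left (h1.trans ?_) (by positivity)
          gcongr
      _ = _ := by
          have h4 : τ ^ m * τ⁻¹ ^ m = 1 := by rw [← mul_pow, mul_inv_cancel₀ hτ0.ne', one_pow]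
          rw [mul_inv, mul_pow, pow_succ τ⁻¹ m]
          linear_combination (D * S * ‖θ‖⁻¹ ^ (m + 1) * τ⁻¹) * h4
  have hF0 : ∫ ζ, F ζ = 0 := by
    refine tendsto_nhds_unique hFint (hκlim.congr' ?_)
    filter_upwards [eventually_ge_atTop 1] with τ hτ
    rw [← hlim0 τ hτ, integral_const_mul]
  -- The dominating bound passes to the limit, which gives the decay needed for Fourier inversion.
  have hFdec : ∀ ζ, ‖F ζ‖ ≤ A * (1 + ‖ζ‖) ^ (-((d + 1 : ℕ) : ℝ)) := fun ζ =>
    le_of_tendsto (hptw ζ).norm (by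
      filter_upwards [eventually_ge_atTop 1] with τ hτ using hdom τ hτ ζ)
  have hβi : Integrable β := by
    refine hβ.integrable_of_hasCompactSupport ?_
    refine HasCompactSupport.intro (isCompact_closedBall (0 : E) r) fun u hu => hβr u ?_
    simpa using hu
  exact eq_zero_of_integral_fourier_eq_zero hβ hβi (D := A) (s := -((d + 1 : ℕ) : ℝ))
    (by push_cast; linarith) hFdec hF0

end LeadingCoefficient

/-! ### Charts and changes of coordinates. -/

section Coordinates

variable {d : ℕ} {M : Type*} [TopologicalSpace M] [ChartedSpace (Coord d) M]

theorem pt_mem_source {p : M} {z : Coord d} (hz : z ∈ (chartAt (Coord d) p).target) :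
    pt p z ∈ (chartAt (Coord d) p).source := (chartAt (Coord d) p).map_target hz

theorem chartAt_pt {p : M} {z : Coord d} (hz : z ∈ (chartAt (Coord d) p).target) :
    chartAt (Coord d) p (pt p z) = z := (chartAt (Coord d) p).right_inv hz

theorem pt_chartAt {p y : M} (hy : y ∈ (chartAt (Coord d) p).source) :
    pt p (chartAt (Coord d) p y) = y := (chartAt (Coord d) p).left_inv hy

theorem continuousOn_pt (p : M) : ContinuousOn (pt p) (chartAt (Coord d) p).target :=
  (chartAt (Coord d) p).continuousOn_symm

/-- The change of coordinates from the chart at `p` to the chart at `q`. -/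
def transition (p q : M) (z : Coord d) : Coord d := chartAt (Coord d) q (pt p z)

/-- The domain of the change of coordinates from the chart at `p` to the chart at `q`. -/
def overlap (p q : M) : Set (Coord d) :=
  (chartAt (Coord d) p).target ∩ pt p ⁻¹' (chartAt (Coord d) q).source

theorem isOpen_overlap (p q : M) : IsOpen (overlap p q : Set (Coord d)) :=
  (continuousOn_pt p).isOpen_inter_preimage (chartAt (Coord d) p).open_target
    (chartAt (Coord d) q).open_source

theorem mem_overlap_chartAt {p q y : M} (hp : y ∈ (chartAt (Coord d) p).source)
    (hq : y ∈ (chartAt (Coord d) q).source) :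
    chartAt (Coord d) p y ∈ (overlap p q : Set (Coord d)) :=
  ⟨(chartAt (Coord d) p).map_source hp, by rwa [mem_preimage, pt_chartAt hp]⟩

theorem transition_mem_overlap {p q : M} {z : Coord d} (hz : z ∈ overlap p q) :
    transition p q z ∈ (overlap q p : Set (Coord d)) :=
  mem_overlap_chartAt hz.2 (pt_mem_source hz.1)

theorem transition_transition {p q : M} {z : Coord d} (hz : z ∈ overlap p q) :
    transition q p (transition p q z) = z := by
  rw [transition, transition, pt_chartAt hz.2, chartAt_pt hz.1]

theorem pt_transition {p q : M} {z : Coord d} (hz : z ∈ overlap p q) :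
    pt q (transition p q z) = pt p z := pt_chartAt hz.2

variable [IsManifold (𝓡 d) ∞ M]

theorem contDiffOn_transition (p q : M) :
    ContDiffOn ℝ ∞ (transition p q : Coord d → Coord d) (overlap p q) := by
  have h := contDiffOn_ext_coord_change (I := 𝓡 d) (n := ∞) (M := M) q p
  refine h.mono fun z hz => ?_
  simpa [overlap, pt] using hz

theorem tangentCoordChange_eq_fderiv (p q y : M) :
    tangentCoordChange (𝓡 d) p q y = fderiv ℝ (transition p q) (chartAt (Coord d) p y) := by
  rw [tangentCoordChange_def]
  simp only [ModelWithCorners.range_eq_univ, fderivWithin_univ]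
  congr 1

theorem hasFDerivAt_transition {p q : M} {z : Coord d} (hz : z ∈ overlap p q) :
    HasFDerivAt (transition p q) (tangentCoordChange (𝓡 d) p q (pt p z)) z := by
  rw [tangentCoordChange_eq_fderiv, chartAt_pt hz.1]
  exact (((contDiffOn_transition p q).differentiableOn (by simp)).differentiableAt
    ((isOpen_overlap p q).mem_nhds hz)).hasFDerivAt

theorem tangentCoordChange_self' {p y : M} (hy : y ∈ (chartAt (Coord d) p).source) :
    tangentCoordChange (𝓡 d) p p y = ContinuousLinearMap.id ℝ (Coord d) := by
  ext1 v
  exact tangentCoordChange_self (by simpa using hy)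

theorem tangentCoordChange_comp' {a b c y : M} (ha : y ∈ (chartAt (Coord d) a).source)
    (hb : y ∈ (chartAt (Coord d) b).source) (hc : y ∈ (chartAt (Coord d) c).source) (v : Coord d) :
    tangentCoordChange (𝓡 d) b c y (tangentCoordChange (𝓡 d) a b y v) =
      tangentCoordChange (𝓡 d) a c y v :=
  tangentCoordChange_comp (by simp [ha, hb, hc])

theorem tangentCoordChange_inverse {p q y : M} (hp : y ∈ (chartAt (Coord d) p).source)
    (hq : y ∈ (chartAt (Coord d) q).source) (v : Coord d) :
    tangentCoordChange (𝓡 d) q p y (tangentCoordChange (𝓡 d) p q y v) = v := by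
  rw [tangentCoordChange_comp' hp hq hp, tangentCoordChange_self' hp]
  rfl

theorem det_tangentCoordChange_mul {p q y : M} (hp : y ∈ (chartAt (Coord d) p).source)
    (hq : y ∈ (chartAt (Coord d) q).source) :
    (tangentCoordChange (𝓡 d) q p y).det * (tangentCoordChange (𝓡 d) p q y).det = 1 := by
  have h : (tangentCoordChange (𝓡 d) q p y).comp (tangentCoordChange (𝓡 d) p q y) =
      ContinuousLinearMap.id ℝ (Coord d) := by
    ext1 v
    exact tangentCoordChange_inverse hp hq v
  have h2 := congrArg ContinuousLinearMap.det h
  simp only [ContinuousLinearMap.det, ContinuousLinearMap.toLinearMap_comp,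
    LinearMap.det_comp] at h2
  rw [ContinuousLinearMap.det, ContinuousLinearMap.det, h2]
  simp

theorem det_tangentCoordChange_ne_zero {p q y : M} (hp : y ∈ (chartAt (Coord d) p).source)
    (hq : y ∈ (chartAt (Coord d) q).source) : (tangentCoordChange (𝓡 d) p q y).det ≠ 0 :=
  right_ne_zero_of_mul_eq_one (det_tangentCoordChange_mul hp hq)

theorem coord_eq_sum (u : Coord d) : u = ∑ i, u i • (stdVec i : Coord d) := by
  ext j
  simp [stdVec, Finset.sum_apply, Pi.single_apply]

theorem clm_eq_sum {V : Type*} [NormedAddCommGroup V] [NormedSpace ℝ V] (L : Coord d →L[ℝ] V)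
    (u : Coord d) : L u = ∑ i, u i • L (stdVec i) := by
  conv_lhs => rw [coord_eq_sum u]
  simp

theorem inner_stdVec (ξ : Coord d) (i : Fin d) : inner ℝ ξ (stdVec i) = ξ i := by
  simp [stdVec, EuclideanSpace.inner_single_right]

/-! ### Covectors -/

theorem covec_apply (p y : M) (ξ : Coord d) (v : Coord d) :
    covec p y ξ v = inner ℝ ξ (tangentCoordChange (𝓡 d) y p y v) := rfl

theorem covec_smul (p y : M) (a : ℝ) (ξ : Coord d) : covec p y (a • ξ) = a • covec p y ξ := by
  ext v
  exact real_inner_smul_left ξ (tangentCoordChange (𝓡 d) y p y v : Coord d) a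

theorem covec_apply_vec {p y : M} (hy : y ∈ (chartAt (Coord d) p).source) (ξ u : Coord d) :
    covec p y ξ (tangentCoordChange (𝓡 d) p y y u : Coord d) = inner ℝ ξ u := by
  rw [covec_apply, tangentCoordChange_inverse hy (mem_chart_source _ y)]

theorem covec_frame {p y : M} (hy : y ∈ (chartAt (Coord d) p).source) (ξ : Coord d) (i : Fin d) :
    covec p y ξ (frame p y i) = ξ i := by
  rw [frame, covec_apply_vec hy, inner_stdVec]

theorem covec_self (y : M) (ξ : Coord d) : (covec y y ξ : Coord d →L[ℝ] ℝ) = innerSL ℝ ξ := by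
  ext v
  change inner ℝ ξ (tangentCoordChange (𝓡 d) y y y v) = inner ℝ ξ v
  rw [tangentCoordChange_self' (mem_chart_source _ y)]
  rfl

theorem covec_injective {p y : M} (hy : y ∈ (chartAt (Coord d) p).source) :
    Function.Injective (covec (d := d) p y) := fun ξ ξ' h => by
  ext i
  rw [← covec_frame hy ξ i, h, covec_frame hy]

theorem covec_ne_zero {p y : M} (hy : y ∈ (chartAt (Coord d) p).source) {ξ : Coord d}
    (hξ : ξ ≠ 0) : covec p y ξ ≠ 0 := fun h => hξ <| covec_injective hy <| by
  rw [h]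
  ext v
  exact (inner_zero_left (tangentCoordChange (𝓡 d) y p y v : Coord d)).symm

/-- Covector components transform contragrediently to vector components: by the adjoint of the
Jacobian, in the opposite direction. -/
theorem covec_change {p q y : M} (hp : y ∈ (chartAt (Coord d) p).source)
    (hq : y ∈ (chartAt (Coord d) q).source) (ξ : Coord d) :
    covec q y ξ = covec p y ((tangentCoordChange (𝓡 d) p q y).adjoint ξ) := by
  ext v
  change inner ℝ ξ (tangentCoordChange (𝓡 d) y q y v) =
    inner ℝ ((tangentCoordChange (𝓡 d) p q y).adjoint ξ) (tangentCoordChange (𝓡 d) y p y v)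
  rw [ContinuousLinearMap.adjoint_inner_left]
  exact congrArg (inner ℝ ξ) (tangentCoordChange_comp' (mem_chart_source _ y) hp hq v).symm

theorem exists_covec_self_eq (y : M) (η : Cotangent d y) : ∃ ξ : Coord d, covec y y ξ = η := by
  let η' : Coord d →L[ℝ] ℝ := η
  refine ⟨(InnerProductSpace.toDual ℝ (Coord d)).symm η', (covec_self y _).trans ?_⟩
  ext v
  exact InnerProductSpace.toDual_symm_apply (𝕜 := ℝ) (E := Coord d)

theorem exists_covec_eq {p y : M} (hy : y ∈ (chartAt (Coord d) p).source) (η : Cotangent d y) :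
    ∃ ξ : Coord d, covec p y ξ = η := by
  obtain ⟨ξ, rfl⟩ := exists_covec_self_eq y η
  exact ⟨_, (covec_change hy (mem_chart_source _ y) ξ).symm⟩

end Coordinates

/-! ### The metric in a chart. -/

section MetricCoordinates

variable {d : ℕ} {M : Type*} [TopologicalSpace M] [ChartedSpace (Coord d) M]
  [IsManifold (𝓡 d) ∞ M] (g : Metric d M)

/-- The metric in the chart at `p`, as a bilinear form. -/
def metricForm (p : M) (z u w : Coord d) : ℝ :=
  g.inner (pt p z) (tangentCoordChange (𝓡 d) p (pt p z) (pt p z) u : Coord d)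
    (tangentCoordChange (𝓡 d) p (pt p z) (pt p z) w : Coord d)

/-- The vector fields with constant components are images of constants under the inverse
trivialisation of the tangent bundle, hence smooth sections; the metric is a smooth bilinear bundle
map. -/
theorem contDiffOn_metricForm (p : M) (u w : Coord d) :
    ContDiffOn ℝ ∞ (fun z => metricForm g p z u w) (chartAt (Coord d) p).target := by
  have hsec : ∀ u : Coord d, ContMDiffOn (𝓡 d) ((𝓡 d).prod 𝓘(ℝ, Coord d)) ∞
      (fun y : M => (⟨y, (tangentCoordChange (𝓡 d) p y y u : Coord d)⟩ : TangentBundle (𝓡 d) M))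
      (chartAt (Coord d) p).source := fun u => by
    have h1 := (trivializationAt (Coord d) (TangentSpace (𝓡 d) : M → Type _) p).contMDiffOn_symm
      (IB := 𝓡 d) (n := ∞)
    have h2 : ContMDiffOn (𝓡 d) ((𝓡 d).prod 𝓘(ℝ, Coord d)) ∞ (fun y : M => (y, u))
      (chartAt (Coord d) p).source := contMDiffOn_id.prodMk contMDiffOn_const
    refine (h1.comp h2 fun y hy => ?_).congr fun y hy => ?_
    · simpa [Bundle.Trivialization.mem_target] using hy
    · have hb : y ∈ (trivializationAt (Coord d) (TangentSpace (𝓡 d) : M → Type _) p).baseSet := by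
        simpa using hy
      refine Eq.trans ?_ (Bundle.Trivialization.mk_symm _ hb u)
      have e := DFunLike.congr_fun
        (TangentBundle.symmL_trivializationAt_eq_core (I := 𝓡 d) hy).symm u
      rw [Bundle.Trivialization.symmL_apply _ hb] at e
      exact congrArg (fun v => (⟨y, v⟩ : TangentBundle (𝓡 d) M)) e
  have h : ContMDiffOn (𝓡 d) ((𝓡 d).prod 𝓘(ℝ, ℝ)) ∞
      (fun y : M => (Bundle.TotalSpace.mk' ℝ (E := Bundle.Trivial M ℝ) y (g.inner y
        (tangentCoordChange (𝓡 d) p y y u : Coord d)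
        (tangentCoordChange (𝓡 d) p y y w : Coord d)))) (chartAt (Coord d) p).source :=
    ContMDiffOn.clm_bundle_apply₂ (F₁ := Coord d) (F₂ := Coord d) (b := fun y : M => y)
      g.contMDiff.contMDiffOn (hsec u) (hsec w)
  have h3 := h.comp (contMDiffOn_chart_symm (I := 𝓡 d) (n := ∞) (x := p))
    fun z hz => (chartAt (Coord d) p).map_target hz
  intro z hz
  have h4 := (Bundle.contMDiffWithinAt_totalSpace.1 (h3 z hz)).2
  exact contMDiffWithinAt_iff_contDiffWithinAt.1 h4

theorem metricForm_stdVec (p : M) (z : Coord d) (i j : Fin d) :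
    metricForm g p z (stdVec i) (stdVec j) = gram g p z i j := rfl

/-- The bilinear form of the metric in the chart at `p`, as a continuous bilinear map. -/
def metricCLM (p : M) (z : Coord d) : Coord d →L[ℝ] Coord d →L[ℝ] ℝ :=
  (show Coord d →L[ℝ] Coord d →L[ℝ] ℝ from g.inner (pt p z)).bilinearComp
    (tangentCoordChange (𝓡 d) p (pt p z) (pt p z)) (tangentCoordChange (𝓡 d) p (pt p z) (pt p z))

theorem metricCLM_apply (p : M) (z u w : Coord d) :
    metricCLM g p z u w = metricForm g p z u w := rfl

theorem metricForm_eq_sum (p : M) (z u w : Coord d) :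
    metricForm g p z u w = ∑ i, ∑ j, gram g p z i j * u i * w j := by
  rw [← metricCLM_apply, clm_eq_sum (metricCLM g p z) u, sum_apply]
  refine Finset.sum_congr rfl fun i _ => ?_
  rw [smul_apply, clm_eq_sum (metricCLM g p z (stdVec i)) w, Finset.smul_sum]
  refine Finset.sum_congr rfl fun j _ => ?_
  rw [metricCLM_apply, metricForm_stdVec, smul_eq_mul, smul_eq_mul]
  ring

theorem metricForm_symm (p : M) (z u w : Coord d) :
    metricForm g p z u w = metricForm g p z w u := g.symm _ _ _

theorem metricForm_self_eq_quadForm (p : M) (z u : Coord d) :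
    metricForm g p z u u = quadForm (gram g p z) u := metricForm_eq_sum g p z u u

theorem inner_eq_metricForm {p y : M} (hy : y ∈ (chartAt (Coord d) p).source) (u w : Coord d) :
    g.inner y (tangentCoordChange (𝓡 d) p y y u : Coord d)
      (tangentCoordChange (𝓡 d) p y y w : Coord d) =
      metricForm g p (chartAt (Coord d) p y) u w := by
  rw [metricForm, pt_chartAt hy]

theorem metricForm_transition {p q : M} {z : Coord d} (hz : z ∈ overlap p q) (u w : Coord d) :
    metricForm g p z u w = metricForm g q (transition p q z)
      (tangentCoordChange (𝓡 d) p q (pt p z) u) (tangentCoordChange (𝓡 d) p q (pt p z) w) := by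
  rw [metricForm, metricForm, pt_transition hz,
    tangentCoordChange_comp' (pt_mem_source hz.1) hz.2 (mem_chart_source _ _),
    tangentCoordChange_comp' (pt_mem_source hz.1) hz.2 (mem_chart_source _ _)]

theorem metricForm_pos {p : M} {z u : Coord d} (hz : z ∈ (chartAt (Coord d) p).target)
    (hu : u ≠ 0) : 0 < metricForm g p z u u := by
  refine g.pos _ _ fun h => hu ?_
  have := tangentCoordChange_inverse (d := d) (pt_mem_source hz) (mem_chart_source _ (pt p z)) u
  rw [← this]
  have h' : (tangentCoordChange (𝓡 d) p (pt p z) (pt p z) u : Coord d) = 0 := h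
  rw [h', map_zero]

open scoped Matrix in
theorem posDef_gram {p : M} {z : Coord d} (hz : z ∈ (chartAt (Coord d) p).target) :
    (gram g p z).PosDef := by
  refine Matrix.PosDef.of_dotProduct_mulVec_pos ?_ fun x hx => ?_
  · ext i j
    exact g.symm _ _ _
  · have h := metricForm_pos g hz (u := WithLp.toLp 2 x) (fun h => hx (by simpa using h))
    rw [metricForm_self_eq_quadForm, quadForm_eq_inner, Matrix.inner_toEuclideanCLM] at h
    simpa using h

theorem contDiffOn_gram (p : M) (i j : Fin d) :
    ContDiffOn ℝ ∞ (fun z => gram g p z i j) (chartAt (Coord d) p).target :=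
  contDiffOn_metricForm g p (stdVec i) (stdVec j)

end MetricCoordinates

/-! ### The metric as an operator; densities and the Hamiltonian. -/

section MetricOperator

variable {d : ℕ} {M : Type*} [TopologicalSpace M] [ChartedSpace (Coord d) M]
  [IsManifold (𝓡 d) ∞ M] (g : Metric d M)

/-- The matrix of the metric in the chart at `p`, as an operator on `ℝᵈ`. -/
def metricOp (p : M) (z : Coord d) : Coord d →L[ℝ] Coord d :=
  Matrix.toEuclideanCLM (n := Fin d) (𝕜 := ℝ) (gram g p z)

theorem inner_metricOp (p : M) (z u w : Coord d) :
    inner ℝ u (metricOp g p z w) = metricForm g p z u w := by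
  rw [metricOp, Matrix.inner_toEuclideanCLM, metricForm_eq_sum, dotProduct]
  refine Finset.sum_congr rfl fun i _ => ?_
  rw [Matrix.mulVec, dotProduct, Finset.mul_sum]
  exact Finset.sum_congr rfl fun j _ => by ring

theorem det_metricOp (p : M) (z : Coord d) : (metricOp g p z).det = (gram g p z).det :=
  det_toEuclideanCLM _

theorem metricOp_transition {p q : M} {z : Coord d} (hz : z ∈ overlap p q) :
    metricOp g p z = ((tangentCoordChange (𝓡 d) p q (pt p z)).adjoint.comp
      (metricOp g q (transition p q z))).comp (tangentCoordChange (𝓡 d) p q (pt p z)) := by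
  ext1 w
  refine ext_inner_left ℝ fun u => ?_
  rw [inner_metricOp, metricForm_transition g hz, ← inner_metricOp,
    ContinuousLinearMap.comp_apply, ContinuousLinearMap.comp_apply,
    ContinuousLinearMap.adjoint_inner_right]

theorem det_adjoint (L : Coord d →L[ℝ] Coord d) : L.adjoint.det = L.det := by
  obtain ⟨A, rfl⟩ : ∃ A, Matrix.toEuclideanCLM (n := Fin d) (𝕜 := ℝ) A = L :=
    EquivLike.surjective (Matrix.toEuclideanCLM (n := Fin d) (𝕜 := ℝ)) L
  rw [← ContinuousLinearMap.star_eq_adjoint, ← map_star, det_toEuclideanCLM, det_toEuclideanCLM,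
    Matrix.star_eq_conjTranspose, Matrix.det_conjTranspose]
  rfl

theorem det_gram_transition {p q : M} {z : Coord d} (hz : z ∈ overlap p q) :
    (gram g p z).det = (tangentCoordChange (𝓡 d) p q (pt p z)).det ^ 2 *
      (gram g q (transition p q z)).det := by
  rw [← det_metricOp, metricOp_transition g hz, ← det_metricOp]
  have h : ∀ A B : Coord d →L[ℝ] Coord d, (A.comp B).det = A.det * B.det := fun A B => by
    simp [ContinuousLinearMap.det, LinearMap.det_comp]
  rw [h, h, det_adjoint]
  ring

theorem density_transition {p q : M} {z : Coord d} (hz : z ∈ overlap p q) :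
    density g p z = |(tangentCoordChange (𝓡 d) p q (pt p z)).det| *
      density g q (transition p q z) := by
  rw [density, det_gram_transition g hz, Real.sqrt_mul (sq_nonneg _), Real.sqrt_sq_eq_abs, density]

theorem density_pos {p : M} {z : Coord d} (hz : z ∈ (chartAt (Coord d) p).target) :
    0 < density g p z := Real.sqrt_pos.2 (posDef_gram g hz).det_pos

theorem contDiffOn_density (p : M) : ContDiffOn ℝ ∞ (density g p) (chartAt (Coord d) p).target := by
  refine ContDiffOn.sqrt ?_ fun z hz => (posDef_gram g hz).det_pos.ne'
  simp_rw [Matrix.det_apply]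
  refine ContDiffOn.sum fun σ _ => ?_
  refine ContDiffOn.const_smul _ ?_
  exact contDiffOn_prod fun i _ => contDiffOn_gram g p _ _

theorem contDiffOn_metricOp (p : M) :
    ContDiffOn ℝ ∞ (metricOp g p) (chartAt (Coord d) p).target := by
  have h : metricOp g p = fun z => ∑ i, ∑ j, gram g p z i j •
      Matrix.toEuclideanCLM (n := Fin d) (𝕜 := ℝ) (Matrix.single i j 1) := by
    funext z
    rw [metricOp]
    conv_lhs => rw [Matrix.matrix_eq_sum_single (gram g p z)]
    simp only [map_sum]
    refine Finset.sum_congr rfl fun i _ => Finset.sum_congr rfl fun j _ => ?_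
    rw [← map_smul, Matrix.smul_single, smul_eq_mul, mul_one]
  rw [h]
  exact ContDiffOn.sum fun i _ => ContDiffOn.sum fun j _ =>
    (contDiffOn_gram g p i j).smul contDiffOn_const

/-- Trades the inverse matrix for a solution of `G w = ξ`, so that the transformation law of the
inverse metric is never needed. -/
theorem quadForm_inv_of_eq {G : Matrix (Fin d) (Fin d) ℝ} (hG : G.det ≠ 0) {w ξ : Coord d}
    (h : Matrix.toEuclideanCLM (n := Fin d) (𝕜 := ℝ) G w = ξ) : quadForm G⁻¹ ξ = inner ℝ ξ w := by
  rw [quadForm_eq_inner, ← h, ← mul_apply_eq_comp, ← map_mul,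
    Matrix.nonsing_inv_mul _ (isUnit_iff_ne_zero.2 hG), map_one]
  rfl

theorem exists_metricOp_eq {p : M} {z : Coord d} (hz : z ∈ (chartAt (Coord d) p).target)
    (ξ : Coord d) : ∃ w, metricOp g p z w = ξ := by
  refine ⟨Matrix.toEuclideanCLM (n := Fin d) (𝕜 := ℝ) (gram g p z)⁻¹ ξ, ?_⟩
  rw [metricOp, ← mul_apply_eq_comp, ← map_mul,
    Matrix.mul_nonsing_inv _ (isUnit_iff_ne_zero.2 (posDef_gram g hz).det_pos.ne'), map_one]
  rfl

/-- `hamiltonian` is defined through the chart at `y`. The solutions of `G w = ξ` in two charts are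
Jacobian images of each other, and the pairing `⟨ξ, w⟩` does not depend on the chart. -/
theorem hamiltonian_sq {p y : M} (hy : y ∈ (chartAt (Coord d) p).source) (ξ : Coord d) :
    hamiltonian g y (covec p y ξ) ^ 2 = quadForm (gram g p (chartAt (Coord d) p y))⁻¹ ξ := by
  have hyy := mem_chart_source (Coord d) y
  set A := tangentCoordChange (𝓡 d) y p y with hA
  have hov : chartAt (Coord d) y y ∈ (overlap y p : Set (Coord d)) := mem_overlap_chartAt hyy hy
  have hz := (chartAt (Coord d) p).map_source hy
  have hzy := (chartAt (Coord d) y).map_source hyy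
  have h1 : ∑ α, ∑ β, (gram g y (chartAt (Coord d) y y))⁻¹ α β *
      covec p y ξ (frame y y α) * covec p y ξ (frame y y β) =
      quadForm (gram g y (chartAt (Coord d) y y))⁻¹ (A.adjoint ξ) := by
    rw [covec_change hyy hy]
    simp only [covec_frame hyy]
    rfl
  obtain ⟨w, hw⟩ := exists_metricOp_eq g hzy (A.adjoint ξ)
  obtain ⟨u, hu⟩ := exists_metricOp_eq g hz ξ
  have hw' : w = tangentCoordChange (𝓡 d) p y y u := by
    have hAu : metricOp g y (chartAt (Coord d) y y) (tangentCoordChange (𝓡 d) p y y u) =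
        A.adjoint ξ := by
      rw [metricOp_transition g hov, ContinuousLinearMap.comp_apply,
        ContinuousLinearMap.comp_apply, pt_chartAt hyy, transition, pt_chartAt hyy,
        tangentCoordChange_inverse hy hyy, hu]
    by_contra hne
    have h0 : metricOp g y (chartAt (Coord d) y y) (w - tangentCoordChange (𝓡 d) p y y u) = 0 := by
      rw [map_sub, hw, hAu, sub_self]
    have h2 := metricForm_pos g hzy (sub_ne_zero.2 hne)
    rw [← inner_metricOp, h0, inner_zero_right] at h2
    exact lt_irrefl _ h2
  have h2 : quadForm (gram g y (chartAt (Coord d) y y))⁻¹ (A.adjoint ξ) = inner ℝ ξ u := by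
    rw [quadForm_inv_of_eq (posDef_gram g hzy).det_pos.ne' hw, hw',
      ContinuousLinearMap.adjoint_inner_left, hA, tangentCoordChange_inverse hy hyy]
  have h3 := quadForm_inv_of_eq (posDef_gram g hz).det_pos.ne' hu
  have h4 : 0 ≤ inner ℝ ξ u := by
    rw [← hu, real_inner_comm, inner_metricOp]
    rcases eq_or_ne u 0 with rfl | h
    · rw [← inner_metricOp, inner_zero_left]
    · exact (metricForm_pos g hz h).le
  rw [hamiltonian, h1, h2, h3, Real.sq_sqrt h4]

theorem hamiltonian_nonneg (y : M) (η : Cotangent d y) : 0 ≤ hamiltonian g y η := Real.sqrt_nonneg _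

theorem hamiltonian_smul (y : M) (η : Cotangent d y) {a : ℝ} (ha : 0 ≤ a) :
    hamiltonian g y (a • η) = a * hamiltonian g y η := by
  rw [hamiltonian, hamiltonian, ← Real.sqrt_sq ha, ← Real.sqrt_mul (sq_nonneg _),
    Finset.mul_sum, Real.sqrt_sq ha]
  congr 1
  refine Finset.sum_congr rfl fun i _ => ?_
  rw [Finset.mul_sum]
  refine Finset.sum_congr rfl fun j _ => ?_
  simp only [smul_apply, smul_eq_mul]
  ring

/-- `h(y, η)²` in the chart at `p`. -/
def hamSq (p : M) (z ξ : Coord d) : ℝ := quadForm (gram g p z)⁻¹ ξ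

theorem hamSq_eq {p : M} {z : Coord d} (hz : z ∈ (chartAt (Coord d) p).target) (ξ : Coord d) :
    hamSq g p z ξ = hamiltonian g (pt p z) (covec p (pt p z) ξ) ^ 2 := by
  rw [hamiltonian_sq g (pt_mem_source hz), chartAt_pt hz, hamSq]

/-- Inversion of operators is smooth at invertible ones, so the inverse matrix is rewritten as the
inverse of `metricOp`. -/
theorem contDiffOn_hamSq (p : M) : ContDiffOn ℝ ∞ (fun q : Coord d × Coord d => hamSq g p q.1 q.2)
    ((chartAt (Coord d) p).target ×ˢ univ) := by
  have hinv : ∀ z ∈ (chartAt (Coord d) p).target, (metricOp g p z).inverse =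
      Matrix.toEuclideanCLM (n := Fin d) (𝕜 := ℝ) (gram g p z)⁻¹ ∧
      ContDiffAt ℝ ∞ ContinuousLinearMap.inverse (metricOp g p z) := fun z hz => by
    have hu := isUnit_iff_ne_zero.2 (posDef_gram g hz).det_pos.ne'
    let e : Coord d ≃L[ℝ] Coord d := ContinuousLinearEquiv.equivOfInverse (metricOp g p z)
      (Matrix.toEuclideanCLM (n := Fin d) (𝕜 := ℝ) (gram g p z)⁻¹)
      (fun v => by
        rw [metricOp, ← mul_apply_eq_comp, ← map_mul, Matrix.nonsing_inv_mul _ hu, map_one]; rfl)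
      (fun v => by
        rw [metricOp, ← mul_apply_eq_comp, ← map_mul, Matrix.mul_nonsing_inv _ hu, map_one]; rfl)
    have he : metricOp g p z = (e : Coord d →L[ℝ] Coord d) := rfl
    refine ⟨?_, ?_⟩
    · rw [he, ContinuousLinearMap.inverse_equiv]
      rfl
    · rw [he]
      exact contDiffAt_map_inverse e
  have h1 : ContDiffOn ℝ ∞ (fun z => (metricOp g p z).inverse) (chartAt (Coord d) p).target :=
    fun z hz => (hinv z hz).2.comp_contDiffWithinAt z (contDiffOn_metricOp g p z hz)
  have h2 : ContDiffOn ℝ ∞ (fun q : Coord d × Coord d => inner ℝ q.2 ((metricOp g p q.1).inverse q.2))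
      ((chartAt (Coord d) p).target ×ˢ univ) :=
    contDiff_snd.contDiffOn.inner ℝ
      ((h1.comp contDiff_fst.contDiffOn fun q hq => hq.1).clm_apply contDiff_snd.contDiffOn)
  refine h2.congr fun q hq => ?_
  rw [(hinv q.1 hq.1).1, hamSq, quadForm_eq_inner]

theorem hamSq_pos {p : M} {z : Coord d} (hz : z ∈ (chartAt (Coord d) p).target) {ξ : Coord d}
    (hξ : ξ ≠ 0) : 0 < hamSq g p z ξ := by
  obtain ⟨u, hu⟩ := exists_metricOp_eq g hz ξ
  rw [hamSq, quadForm_inv_of_eq (posDef_gram g hz).det_pos.ne' hu, ← hu, real_inner_comm,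
    inner_metricOp]
  exact metricForm_pos g hz fun h => hξ (by rw [← hu, h, map_zero])

theorem hamSq_smul (p : M) (z ξ : Coord d) (a : ℝ) :
    hamSq g p z (a • ξ) = a ^ 2 * hamSq g p z ξ := by
  simp only [hamSq, quadForm, Finset.mul_sum, PiLp.smul_apply, smul_eq_mul]
  exact Finset.sum_congr rfl fun i _ => Finset.sum_congr rfl fun j _ => by ring

/-- By compactness of the unit sphere the reciprocal of `hamSq` is bounded there, locally uniformly
in the point; homogeneity does the rest. The summand 1 in `(C + 1)⁻¹` keeps the constant positive.
-/
theorem elliptic_hamSq (p : M) : Elliptic (chartAt (Coord d) p).target (hamSq g p) := by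
  refine ⟨contDiffOn_hamSq g p, fun z _ ξ lam => hamSq_smul g p z ξ lam, fun z₀ hz₀ => ?_⟩
  · have hO := (chartAt (Coord d) p).open_target
    have hf : ContinuousOn (fun q : Coord d × Metric.sphere (0 : Coord d) 1 =>
        (hamSq g p q.1 q.2)⁻¹) ((chartAt (Coord d) p).target ×ˢ univ) := by
      refine ContinuousOn.inv₀ ?_ fun q hq => (hamSq_pos g hq.1 (ne_zero_of_mem_unit_sphere _)).ne'
      exact (contDiffOn_hamSq g p).continuousOn.comp (f := fun q :
        Coord d × Metric.sphere (0 : Coord d) 1 => (q.1, (q.2 : Coord d))) (by fun_prop)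
        fun q hq => ⟨hq.1, mem_univ _⟩
    obtain ⟨C, hC0, hC⟩ := exists_eventually_le_of_isCompact hO hf hz₀ isCompact_univ
    refine ⟨_, hC.and (hO.mem_nhds hz₀), (C + 1)⁻¹, by positivity, fun z hz ξ => ?_⟩
    rcases eq_or_ne ξ 0 with rfl | hξ
    · simp [hamSq, quadForm]
    · have hn : 0 < ‖ξ‖ := norm_pos_iff.2 hξ
      have hs : ‖ξ‖⁻¹ • ξ ∈ Metric.sphere (0 : Coord d) 1 := by
        simp [norm_smul, hn.ne']
      have h1 := hz.1 ⟨_, hs⟩ (mem_univ _)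
      have h2 : hamSq g p z ξ = ‖ξ‖ ^ 2 * hamSq g p z (‖ξ‖⁻¹ • ξ) := by
        rw [← hamSq_smul, smul_smul, mul_inv_cancel₀ hn.ne', one_smul]
      have h3 := hamSq_pos g hz.2 (ne_zero_of_mem_unit_sphere ⟨_, hs⟩)
      rw [h2, mul_comm]
      refine mul_le_mul_of_nonneg_left ?_ (sq_nonneg _)
      have h4 := inv_anti₀ (inv_pos.2 h3) (h1.trans (le_add_of_nonneg_right zero_le_one))
      rwa [inv_inv] at h4

end MetricOperator

/-! ### The Riemannian measure. -/

section RiemannianMeasure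

variable {d : ℕ} {M : Type*} [TopologicalSpace M] [ChartedSpace (Coord d) M]
  [IsManifold (𝓡 d) ∞ M] [MeasurableSpace M] [BorelSpace M] (g : Metric d M)

theorem measurableSet_chart_source (p : M) : MeasurableSet (chartAt (Coord d) p).source :=
  (chartAt (Coord d) p).open_source.measurableSet

theorem measurableSet_chart_target (p : M) : MeasurableSet (chartAt (Coord d) p).target :=
  (chartAt (Coord d) p).open_target.measurableSet

theorem aemeasurable_pt (p : M) :
    AEMeasurable (pt p : Coord d → M) (volume.restrict (chartAt (Coord d) p).target) := by
  have h : Measurable ((chartAt (Coord d) p).target.restrict (pt p)) :=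
    (continuousOn_iff_continuous_restrict.1 (continuousOn_pt p)).measurable
  exact (aemeasurable_restrict_iff_comap_subtype (measurableSet_chart_target p)).2
    h.aemeasurable

theorem measurableSet_target_inter_preimage (p : M) {B : Set M} (hB : MeasurableSet B) :
    MeasurableSet ((chartAt (Coord d) p).target ∩ pt p ⁻¹' B) := by
  have h : Measurable ((chartAt (Coord d) p).target.restrict (pt p)) :=
    (continuousOn_iff_continuous_restrict.1 (continuousOn_pt p)).measurable
  rw [← Subtype.image_preimage_coe]
  exact (measurableSet_chart_target p).subtype_image (h hB)

/-- The measure `ρ(z) dz` on the coordinate space, in the chart at `p`. -/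
def coordMeasure (p : M) : Measure (Coord d) :=
  (volume.restrict (chartAt (Coord d) p).target).withDensity
    (fun z => ENNReal.ofReal (density g p z))

theorem aemeasurable_pt_coordMeasure (p : M) : AEMeasurable (pt p) (coordMeasure g p) :=
  (aemeasurable_pt p).mono_ac (withDensity_absolutelyContinuous _ _)

theorem aemeasurable_density (p : M) : AEMeasurable (fun z => ENNReal.ofReal (density g p z))
    (volume.restrict (chartAt (Coord d) p).target) :=
  ((contDiffOn_density g p).continuousOn.aemeasurable (measurableSet_chart_target p)).ennreal_ofReal

theorem chartVolume_apply (p : M) {B : Set M} (hB : MeasurableSet B) :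
    chartVolume g p B = ∫⁻ z in (chartAt (Coord d) p).target ∩ pt p ⁻¹' B,
      ENNReal.ofReal (density g p z) := by
  have hm : MeasurableSet ((chartAt (Coord d) p).target ∩ pt p ⁻¹' B) :=
    measurableSet_target_inter_preimage p hB
  change (coordMeasure g p).map (pt p) B = _
  rw [Measure.map_apply_of_aemeasurable (aemeasurable_pt_coordMeasure g p) hB]
  have h0 : (coordMeasure g p) (chartAt (Coord d) p).targetᶜ = 0 := by
    refine withDensity_absolutelyContinuous _ _ ?_
    rw [Measure.restrict_apply (measurableSet_chart_target p).compl, compl_inter_self,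
      measure_empty]
  rw [← measure_inter_add_sdiff₀ (pt p ⁻¹' B)
    (measurableSet_chart_target p).nullMeasurableSet,
    measure_mono_null (s := _ \ _) (fun z hz => hz.2) h0, add_zero, inter_comm, coordMeasure,
    withDensity_apply _ hm, Measure.restrict_restrict hm,
    inter_eq_left.2 (inter_subset_left)]

/-- Change of variables: the Jacobian of the transition map is exactly the factor by which the
densities differ. -/
theorem chartVolume_eq_of_subset {p q : M} {B : Set M} (hB : MeasurableSet B)
    (hp : B ⊆ (chartAt (Coord d) p).source) (hq : B ⊆ (chartAt (Coord d) q).source) :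
    chartVolume g p B = chartVolume g q B := by
  set s := (chartAt (Coord d) p).target ∩ pt p ⁻¹' B with hs
  have hm : MeasurableSet s :=
    measurableSet_target_inter_preimage p hB
  have hso : s ⊆ overlap p q := fun z hz => ⟨hz.1, hq hz.2⟩
  have himg : transition p q '' s = (chartAt (Coord d) q).target ∩ pt q ⁻¹' B := by
    ext w
    constructor
    · rintro ⟨z, hz, rfl⟩
      refine ⟨(transition_mem_overlap (hso hz)).1, ?_⟩
      rw [mem_preimage, pt_transition (hso hz)]
      exact hz.2
    · rintro ⟨hw, hwB⟩
      have hw' : w ∈ overlap q p := ⟨hw, hp hwB⟩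
      refine ⟨transition q p w, ⟨(transition_mem_overlap hw').1, ?_⟩, transition_transition hw'⟩
      rw [mem_preimage, pt_transition hw']
      exact hwB
  rw [chartVolume_apply g p hB, chartVolume_apply g q hB, ← himg,
    lintegral_image_eq_lintegral_abs_det_fderiv_mul volume hm
      (fun z hz => (hasFDerivAt_transition (hso hz)).hasFDerivWithinAt)
      (fun z hz w hw h => by
        rw [← transition_transition (hso hz), h, transition_transition (hso hw)])]
  refine setLIntegral_congr_fun hm fun z hz => ?_
  rw [← ENNReal.ofReal_mul (abs_nonneg _), density_transition g (hso hz)]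

theorem chartVolume_restrict_source (p : M) :
    (chartVolume g p).restrict (chartAt (Coord d) p).source = chartVolume g p := by
  ext B hB
  rw [Measure.restrict_apply hB, chartVolume_apply g p hB,
    chartVolume_apply g p (hB.inter (measurableSet_chart_source p))]
  congr 2
  ext z
  exact ⟨fun h => ⟨h.1, h.2.1⟩, fun h => ⟨h.1, h.2, pt_mem_source h.1⟩⟩

/-- A supremum of measures is not computed set by set, so the upper bound is obtained by exhibiting
a measure above all chart volumes: `chartVolume g p` plus the Riemannian measure restricted to the
complement of the chart domain. -/
theorem riemannianMeasure_restrict_source (p : M) :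
    (riemannianMeasure g).restrict (chartAt (Coord d) p).source = chartVolume g p := by
  have hS := measurableSet_chart_source (d := d) p
  apply le_antisymm
  · have h1 : riemannianMeasure g ≤ chartVolume g p +
        (riemannianMeasure g).restrict (chartAt (Coord d) p).sourceᶜ := by
      refine iSup_le fun q => ?_
      rw [← Measure.restrict_add_restrict_compl (μ := chartVolume g q) hS]
      refine add_le_add (Measure.le_iff.2 fun B hB => ?_)
        (Measure.restrict_mono le_rfl (le_iSup (chartVolume g) q))
      rw [← chartVolume_restrict_source g q, Measure.restrict_restrict hS,
        Measure.restrict_apply hB,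
        chartVolume_eq_of_subset g (hB.inter (hS.inter (measurableSet_chart_source q)))
          (fun x hx => hx.2.2) (fun x hx => hx.2.1)]
      exact measure_mono inter_subset_left
    refine (Measure.restrict_mono le_rfl h1).trans ?_
    rw [Measure.restrict_add, chartVolume_restrict_source, Measure.restrict_restrict hS,
      inter_compl_self, Measure.restrict_empty, add_zero]
  · rw [← chartVolume_restrict_source]
    exact Measure.restrict_mono le_rfl (le_iSup (chartVolume g) p)

theorem setIntegral_riemannianMeasure {V : Type*} [NormedAddCommGroup V] [NormedSpace ℝ V]
    (p : M) {B : Set M} (hB : MeasurableSet B)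
    (hBp : B ⊆ (chartAt (Coord d) p).source) {F : M → V}
    (hF : AEStronglyMeasurable F (riemannianMeasure g)) :
    ∫ y in B, F y ∂(riemannianMeasure g) =
      ∫ z in (chartAt (Coord d) p).target ∩ pt p ⁻¹' B, density g p z • F (pt p z) := by
  have hm : MeasurableSet ((chartAt (Coord d) p).target ∩ pt p ⁻¹' B) :=
    measurableSet_target_inter_preimage p hB
  have h1 : (riemannianMeasure g).restrict B =
      (chartVolume g p).restrict B := by
    rw [← riemannianMeasure_restrict_source, Measure.restrict_restrict hB, inter_eq_left.2 hBp]
  have hF' : AEStronglyMeasurable F (chartVolume g p) := by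
    rw [← riemannianMeasure_restrict_source]
    exact hF.restrict
  rw [h1, ← integral_indicator hB]
  change ∫ y, B.indicator F y ∂((coordMeasure g p).map (pt p)) = _
  rw [integral_map (aemeasurable_pt_coordMeasure g p) (hF'.indicator hB), coordMeasure,
    integral_withDensity_eq_integral_toReal_smul₀ (aemeasurable_density g p)
      (ae_of_all _ fun _ => ENNReal.ofReal_lt_top), ← integral_indicator (measurableSet_chart_target p),
    ← integral_indicator hm]
  congr 1
  funext z
  by_cases hz : z ∈ (chartAt (Coord d) p).target
  · rw [indicator_of_mem hz, ENNReal.toReal_ofReal (density_pos g hz).le]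
    by_cases hzB : pt p z ∈ B
    · rw [indicator_of_mem hzB, indicator_of_mem (show z ∈ _ ∩ _ from ⟨hz, hzB⟩)]
    · rw [indicator_of_notMem hzB, indicator_of_notMem fun h => hzB h.2, smul_zero]
  · rw [indicator_of_notMem hz, indicator_of_notMem fun h => hz h.1]

/-- The density is integrable over compact coordinate sets. On compact `M` this makes the total
volume finite and continuous functions integrable. -/
instance [LocallyCompactSpace M] : IsLocallyFiniteMeasure (riemannianMeasure g) := by
  refine ⟨fun y => ?_⟩
  have hy := mem_chart_source (Coord d) y
  obtain ⟨K, hK, hKs, hKc⟩ := local_compact_nhds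
    ((chartAt (Coord d) y).open_target.mem_nhds ((chartAt (Coord d) y).map_source hy))
  have hN : (chartAt (Coord d) y).source ∩ chartAt (Coord d) y ⁻¹' K ∈ 𝓝 y :=
    inter_mem ((chartAt (Coord d) y).open_source.mem_nhds hy)
      ((chartAt (Coord d) y).continuousAt hy hK)
  obtain ⟨N, hNs, hNo, hyN⟩ := mem_nhds_iff.1 hN
  refine ⟨N, hNo.mem_nhds hyN, ?_⟩
  have h1 : riemannianMeasure g N = chartVolume g y N := by
    rw [← riemannianMeasure_restrict_source, Measure.restrict_apply hNo.measurableSet,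
      inter_eq_left.2 fun x hx => (hNs hx).1]
  rw [h1, chartVolume_apply g y hNo.measurableSet]
  have hint : IntegrableOn (density g y) K :=
    ((contDiffOn_density g y).continuousOn.mono hKs).integrableOn_compact hKc
  refine (lintegral_mono_set (fun z hz => ?_)).trans_lt
    hint.lintegral_lt_top
  have := (hNs hz.2).2
  rwa [mem_preimage, chartAt_pt hz.1] at this

end RiemannianMeasure

/-! ### Curves in charts; parallel transport along geodesics. -/

section Curves

variable {d : ℕ} {M : Type*} [TopologicalSpace M] [ChartedSpace (Coord d) M]
  [IsManifold (𝓡 d) ∞ M]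

/-- The components of the velocity of the curve `γ` in the chart at `p`. -/
def chartVel (γ : ℝ → M) (p : M) (t : ℝ) : Coord d :=
  tangentCoordChange (𝓡 d) (γ t) p (γ t) (velocity d γ t)

theorem hasDerivAt_inChart {γ : ℝ → M} (hγ : ContMDiff 𝓘(ℝ, ℝ) (𝓡 d) ∞ γ) (t : ℝ) :
    HasDerivAt (inChart d γ t) (velocity d γ t : Coord d) t := by
  have h := ((hγ.mdifferentiable (by simp)) t).hasMFDerivAt.2
  let L : ℝ →L[ℝ] Coord d := mfderiv 𝓘(ℝ, ℝ) (𝓡 d) γ t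
  have h2 : HasFDerivAt (inChart d γ t) L t := by
    have h3 : HasFDerivWithinAt (inChart d γ t) L univ t := by
      simp [writtenInExtChartAt, Function.comp_def, chartAt_self_eq] at h
      exact h
    exact hasFDerivWithinAt_univ.1 h3
  exact h2.hasDerivAt

theorem hasDerivAt_chart {γ : ℝ → M} (hγ : ContMDiff 𝓘(ℝ, ℝ) (𝓡 d) ∞ γ) {p : M} {t : ℝ}
    (ht : γ t ∈ (chartAt (Coord d) p).source) :
    HasDerivAt (fun τ => chartAt (Coord d) p (γ τ)) (chartVel γ p t) t := by
  have hs := mem_chart_source (Coord d) (γ t)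
  have h1 := (hasDerivAt_inChart hγ t)
  have h2 := hasFDerivAt_transition (d := d) (mem_overlap_chartAt hs ht)
  rw [pt_chartAt hs] at h2
  refine (h2.comp_hasDerivAt t h1).congr_of_eventuallyEq ?_
  filter_upwards [hγ.continuous.continuousAt.preimage_mem_nhds
    ((chartAt (Coord d) (γ t)).open_source.mem_nhds hs)] with τ hτ
  simp only [Function.comp_apply, transition, inChart]
  rw [pt_chartAt hτ]

theorem chartVel_transition (γ : ℝ → M) {p q : M} {t : ℝ}
    (hp : γ t ∈ (chartAt (Coord d) p).source) (hq : γ t ∈ (chartAt (Coord d) q).source) :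
    chartVel γ q t = tangentCoordChange (𝓡 d) p q (γ t) (chartVel γ p t) :=
  (tangentCoordChange_comp' (mem_chart_source _ _) hp hq _).symm

theorem velocity_eq_chartVel (γ : ℝ → M) {p : M} {t : ℝ}
    (hp : γ t ∈ (chartAt (Coord d) p).source) :
    (velocity d γ t : Coord d) = tangentCoordChange (𝓡 d) p (γ t) (γ t) (chartVel γ p t) :=
  (tangentCoordChange_inverse (mem_chart_source _ _) hp _).symm

theorem contDiffAt_chart {γ : ℝ → M} (hγ : ContMDiff 𝓘(ℝ, ℝ) (𝓡 d) ∞ γ) {p : M} {t : ℝ}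
    (ht : γ t ∈ (chartAt (Coord d) p).source) :
    ContDiffAt ℝ ∞ (fun τ => chartAt (Coord d) p (γ τ)) t := by
  rw [← contMDiffAt_iff_contDiffAt]
  exact ((contMDiffOn_chart (I := 𝓡 d) (n := ∞) (x := p)).contMDiffAt
    ((chartAt (Coord d) p).open_source.mem_nhds ht)).comp t hγ.contMDiffAt

theorem eventually_mem_source {γ : ℝ → M} (hγ : ContMDiff 𝓘(ℝ, ℝ) (𝓡 d) ∞ γ) {p : M} {t : ℝ}
    (ht : γ t ∈ (chartAt (Coord d) p).source) :
    ∀ᶠ τ in 𝓝 t, γ τ ∈ (chartAt (Coord d) p).source :=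
  hγ.continuous.continuousAt.preimage_mem_nhds ((chartAt (Coord d) p).open_source.mem_nhds ht)

theorem hasDerivAt_chartVel {γ : ℝ → M} (hγ : ContMDiff 𝓘(ℝ, ℝ) (𝓡 d) ∞ γ) {p : M} {t : ℝ}
    (ht : γ t ∈ (chartAt (Coord d) p).source) :
    HasDerivAt (chartVel γ p) (deriv (deriv fun τ => chartAt (Coord d) p (γ τ)) t) t := by
  have h1 : DifferentiableAt ℝ (deriv fun τ => chartAt (Coord d) p (γ τ)) t := by
    have h := (contDiffAt_chart hγ ht).fderiv_right (m := 1) (by norm_cast)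
    exact ((h.clm_apply contDiffAt_const).differentiableAt (by simp))
  refine h1.hasDerivAt.congr_of_eventuallyEq ?_
  filter_upwards [eventually_mem_source hγ ht] with τ hτ
  exact (hasDerivAt_chart hγ hτ).deriv.symm

theorem covector_velocity_eq_sum (γ : ℝ → M) {p : M} {t : ℝ}
    (hp : γ t ∈ (chartAt (Coord d) p).source) (ζ : Cotangent d (γ t)) :
    ζ (velocity d γ t) = ∑ k, chartVel γ p t k * ζ (frame p (γ t) k) := by
  let ζ' : Coord d →L[ℝ] ℝ := ζ
  have h := clm_eq_sum (ζ'.comp (tangentCoordChange (𝓡 d) p (γ t) (γ t))) (chartVel γ p t)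
  rw [ContinuousLinearMap.comp_apply, ← velocity_eq_chartVel γ hp] at h
  exact h

variable (g : Metric d M)

/-- The Christoffel term of the geodesic equation cancels that of parallel transport, so the
contraction has zero derivative. This is the source of the linearity of the phase in momentum. -/
theorem IsGeodesic.parallel_contraction {γ : ℝ → M} (hγ : IsGeodesic g γ)
    {ζ : (t : ℝ) → Cotangent d (γ t)} (hζ : IsParallelAlong g γ ζ) (t : ℝ) :
    ζ t (velocity d γ t) = ζ 0 (velocity d γ 0) := by
  have hder : ∀ t, HasDerivAt (fun τ => ζ τ (velocity d γ τ)) 0 t := fun t => by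
    have hs := mem_chart_source (Coord d) (γ t)
    have hv := hasDerivAt_chartVel hγ.1 hs
    have hvk : ∀ k, HasDerivAt (fun τ => chartVel γ (γ t) τ k)
        ((deriv (deriv (inChart d γ t)) t) k) t := fun k =>
      (EuclideanSpace.proj (𝕜 := ℝ) k : Coord d →L[ℝ] ℝ).hasFDerivAt.comp_hasDerivAt t hv
    have hsum := HasDerivAt.fun_sum (u := Finset.univ) fun k _ => (hvk k).mul (hζ t k)
    have hyd : deriv (inChart d γ t) t = chartVel γ (γ t) t := (hasDerivAt_chart hγ.1 hs).deriv
    have hzero : ∑ k, ((deriv (deriv (inChart d γ t)) t) k * ζ t (frame (γ t) (γ t) k) +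
        chartVel γ (γ t) t k * ∑ i, ∑ j, christoffel g (γ t) j i k (inChart d γ t t) *
          (deriv (inChart d γ t) t) i * ζ t (frame (γ t) (γ t) j)) = 0 := by
      have h1 : ∀ k, (deriv (deriv (inChart d γ t)) t) k = -∑ i, ∑ j,
          christoffel g (γ t) k i j (inChart d γ t t) *
          (deriv (inChart d γ t) t) i * (deriv (inChart d γ t) t) j := fun k =>
        eq_neg_of_add_eq_zero_left (hγ.2 t k)
      rw [Finset.sum_add_distrib]
      simp_rw [h1, ← hyd, neg_mul, Finset.sum_neg_distrib, Finset.sum_mul, Finset.mul_sum]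
      rw [neg_add_eq_zero]
      -- Both sides are the same triple sum with the indices named in a different order.
      conv_rhs => rw [Finset.sum_comm]; enter [2, i]; rw [Finset.sum_comm]
      rw [Finset.sum_comm]
      refine Finset.sum_congr rfl fun i _ => Finset.sum_congr rfl fun k _ =>
        Finset.sum_congr rfl fun j _ => by ring
    rw [hzero] at hsum
    refine hsum.congr_of_eventuallyEq ?_
    filter_upwards [eventually_mem_source hγ.1 hs] with τ hτ
    exact covector_velocity_eq_sum γ hτ (ζ τ)
  exact is_const_of_deriv_eq_zero (fun t => (hder t).differentiableAt) (fun t => (hder t).deriv) t 0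

/-! ### The geodesic equation in variational form -/

/-- The derivative of the metric in the chart at `p`, in the direction `w`. -/
def dMetricOp (p : M) (z w : Coord d) : Coord d →L[ℝ] Coord d := fderiv ℝ (metricOp g p) z w

theorem hasFDerivAt_metricOp {p : M} {z : Coord d} (hz : z ∈ (chartAt (Coord d) p).target) :
    HasFDerivAt (metricOp g p) (fderiv ℝ (metricOp g p) z) z :=
  (((contDiffOn_metricOp g p).contDiffAt
    ((chartAt (Coord d) p).open_target.mem_nhds hz)).differentiableAt (by simp)).hasFDerivAt

theorem hasFDerivAt_metricForm {p : M} {z : Coord d} (hz : z ∈ (chartAt (Coord d) p).target)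
    (u v : Coord d) : HasFDerivAt (fun z' => metricForm g p z' u v)
      ((innerSL ℝ u).comp ((ContinuousLinearMap.apply ℝ (Coord d) v).comp
        (fderiv ℝ (metricOp g p) z))) z := by
  have h := ((innerSL ℝ u).comp (ContinuousLinearMap.apply ℝ (Coord d) v)).hasFDerivAt.comp z
    (hasFDerivAt_metricOp g hz)
  refine h.congr_of_eventuallyEq (Eventually.of_forall fun z' => ?_)
  beta_reduce
  rw [← inner_metricOp]
  rfl

theorem inner_dMetricOp_stdVec {p : M} {z : Coord d} (hz : z ∈ (chartAt (Coord d) p).target)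
    (k i j : Fin d) : inner ℝ (stdVec i) (dMetricOp g p z (stdVec k) (stdVec j)) =
      dGram g p k i j z := by
  rw [dGram]
  change _ = fderiv ℝ (fun z' => metricForm g p z' (stdVec i) (stdVec j)) z (stdVec k)
  rw [(hasFDerivAt_metricForm g hz (stdVec i) (stdVec j)).fderiv]
  rfl

theorem inner_dMetricOp_eq_sum {p : M} {z : Coord d} (hz : z ∈ (chartAt (Coord d) p).target)
    (w u v : Coord d) : inner ℝ u (dMetricOp g p z w v) =
      ∑ k, ∑ i, ∑ j, dGram g p k i j z * w k * u i * v j := by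
  rw [dMetricOp, clm_eq_sum (fderiv ℝ (metricOp g p) z) w, sum_apply, inner_sum]
  refine Finset.sum_congr rfl fun k _ => ?_
  rw [smul_apply, real_inner_smul_right, ← real_inner_comm,
    ← innerSL_apply_apply ℝ, clm_eq_sum _ u, Finset.mul_sum]
  refine Finset.sum_congr rfl fun i _ => ?_
  rw [innerSL_apply_apply, real_inner_comm, ← innerSL_apply_apply ℝ, ← ContinuousLinearMap.comp_apply,
    clm_eq_sum _ v, Finset.smul_sum, Finset.mul_sum]
  refine Finset.sum_congr rfl fun j _ => ?_
  rw [ContinuousLinearMap.comp_apply, innerSL_apply_apply]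
  change w k * (u i * (v j * inner ℝ (stdVec i) (dMetricOp g p z (stdVec k) (stdVec j)))) = _
  rw [inner_dMetricOp_stdVec g hz]
  ring


theorem inner_metricOp_eq_sum (p : M) (z u w : Coord d) :
    inner ℝ u (metricOp g p z w) = ∑ i, ∑ j, gram g p z i j * u i * w j := by
  rw [inner_metricOp, metricForm_eq_sum]

/-- Lowering the index of the geodesic equation removes the inverse metric. Of the three terms of
the Christoffel symbol, two agree after contraction with the symmetric product of velocities. -/
theorem IsGeodesic.euler_lagrange {γ : ℝ → M} (hγ : IsGeodesic g γ) (t : ℝ) (w : Coord d) :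
    inner ℝ w (metricOp g (γ t) (inChart d γ t t) (deriv (deriv (inChart d γ t)) t)) =
      (1 / 2) * inner ℝ (deriv (inChart d γ t) t)
        (dMetricOp g (γ t) (inChart d γ t t) w (deriv (inChart d γ t) t)) -
      inner ℝ (deriv (inChart d γ t) t)
        (dMetricOp g (γ t) (inChart d γ t t) (deriv (inChart d γ t) t) w) := by
  have hs := mem_chart_source (Coord d) (γ t)
  have hz : inChart d γ t t ∈ (chartAt (Coord d) (γ t)).target :=
    (chartAt (Coord d) (γ t)).map_source hs
  set z := inChart d γ t t
  set q := γ t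
  set a := deriv (inChart d γ t) t
  set b := deriv (deriv (inChart d γ t)) t
  have hb : ∀ k, b k = -∑ i, ∑ j, christoffel g q k i j z * a i * a j := fun k =>
    eq_neg_of_add_eq_zero_left (hγ.2 t k)
  have hinv : gram g q z * (gram g q z)⁻¹ = 1 :=
    Matrix.mul_nonsing_inv _ (isUnit_iff_ne_zero.2 (posDef_gram g hz).det_pos.ne')
  -- Christoffel symbols of the first kind.
  have hlow : ∀ l i j, ∑ k, gram g q z l k * christoffel g q k i j z =
      (1 / 2) * (dGram g q i j l z + dGram g q j i l z - dGram g q l i j z) := fun l i j => by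
    simp only [christoffel, Finset.mul_sum]
    rw [Finset.sum_comm]
    have : ∀ m, ∑ k, gram g q z l k * (1 / 2 * ((gram g q z)⁻¹ k m *
        (dGram g q i j m z + dGram g q j i m z - dGram g q m i j z))) =
        (1 / 2) * (dGram g q i j m z + dGram g q j i m z - dGram g q m i j z) *
          (1 : Matrix (Fin d) (Fin d) ℝ) l m := fun m => by
      rw [← hinv, Matrix.mul_apply, Finset.mul_sum]
      exact Finset.sum_congr rfl fun k _ => by ring
    simp_rw [this, Matrix.one_apply]
    simp
  have hL : inner ℝ w (metricOp g q z b) = -∑ l, ∑ i, ∑ j,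
      ((1 / 2) * (dGram g q i j l z + dGram g q j i l z - dGram g q l i j z)) *
        (a i * a j * w l) := by
    rw [inner_metricOp_eq_sum, ← Finset.sum_neg_distrib]
    refine Finset.sum_congr rfl fun l _ => ?_
    have e1 : ∀ k, gram g q z l k * w l * b k = -∑ i, ∑ j,
        gram g q z l k * christoffel g q k i j z * (a i * a j * w l) := fun k => by
      rw [hb k, mul_neg, Finset.mul_sum]
      congr 1
      refine Finset.sum_congr rfl fun i _ => ?_
      rw [Finset.mul_sum]
      exact Finset.sum_congr rfl fun j _ => by ring
    rw [Finset.sum_congr rfl fun k _ => e1 k, Finset.sum_neg_distrib, Finset.sum_comm]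
    congr 1
    refine Finset.sum_congr rfl fun i _ => ?_
    rw [Finset.sum_comm]
    exact Finset.sum_congr rfl fun j _ => by rw [← hlow, Finset.sum_mul]
  have h1 : inner ℝ a (dMetricOp g q z a w) =
      ∑ l, ∑ i, ∑ j, dGram g q i j l z * (a i * a j * w l) := by
    rw [inner_dMetricOp_eq_sum g hz, Finset.sum_comm' (t' := Finset.univ) (s' := fun _ => Finset.univ) (by simp)]
    conv_rhs => rw [Finset.sum_comm]; enter [2, i]; rw [Finset.sum_comm]
    rw [Finset.sum_comm]
    exact Finset.sum_congr rfl fun i _ => Finset.sum_congr rfl fun j _ =>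
      Finset.sum_congr rfl fun l _ => by ring
  -- The same sum as in `h1` with the velocity indices exchanged; the average of the two is the
  -- shape that occurs in `hL`.
  have h2 : inner ℝ a (dMetricOp g q z a w) = ∑ l, ∑ i, ∑ j, dGram g q j i l z * (a i * a j * w l) := by
    rw [h1]
    refine Finset.sum_congr rfl fun l _ => ?_
    rw [Finset.sum_comm]
    exact Finset.sum_congr rfl fun i _ => Finset.sum_congr rfl fun j _ => by ring
  have h3 : inner ℝ a (dMetricOp g q z w a) = ∑ l, ∑ i, ∑ j, dGram g q l i j z * (a i * a j * w l) := by
    rw [inner_dMetricOp_eq_sum g hz]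
    exact Finset.sum_congr rfl fun i _ => Finset.sum_congr rfl fun j _ =>
      Finset.sum_congr rfl fun l _ => by ring
  have h4 : inner ℝ a (dMetricOp g q z a w) =
      (1 / 2) * ∑ l, ∑ i, ∑ j, dGram g q i j l z * (a i * a j * w l) +
      (1 / 2) * ∑ l, ∑ i, ∑ j, dGram g q j i l z * (a i * a j * w l) := by
    rw [← h1, ← h2]; ring
  rw [hL, h3, h4]
  simp only [Finset.mul_sum, ← Finset.sum_add_distrib, ← Finset.sum_sub_distrib,
    ← Finset.sum_neg_distrib]
  exact Finset.sum_congr rfl fun i _ => Finset.sum_congr rfl fun j _ =>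
    Finset.sum_congr rfl fun l _ => by ring

theorem hasDerivAt_metricForm {p : M} {z a b : ℝ → Coord d} {z' a' b' : Coord d} {t : ℝ}
    (hz : z t ∈ (chartAt (Coord d) p).target) (hz' : HasDerivAt z z' t) (ha : HasDerivAt a a' t)
    (hb : HasDerivAt b b' t) :
    HasDerivAt (fun τ => inner ℝ (a τ) (metricOp g p (z τ) (b τ)))
      (inner ℝ (a t) (dMetricOp g p (z t) z' (b t)) + inner ℝ (a t) (metricOp g p (z t) b') +
        inner ℝ a' (metricOp g p (z t) (b t))) t := by
  have h1 := ((hasFDerivAt_metricOp g hz).comp_hasDerivAt t hz').clm_apply hb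
  have h2 := ha.inner ℝ h1
  rw [inner_add_right] at h2
  exact h2

theorem metricOp_symm (p : M) (z u w : Coord d) :
    inner ℝ u (metricOp g p z w) = inner ℝ w (metricOp g p z u) := by
  rw [inner_metricOp, inner_metricOp, metricForm_symm]

theorem dMetricOp_symm {p : M} {z : Coord d} (hz : z ∈ (chartAt (Coord d) p).target)
    (w u v : Coord d) :
    inner ℝ u (dMetricOp g p z w v) = inner ℝ v (dMetricOp g p z w u) := by
  have h := (hasFDerivAt_metricForm g hz u v).fderiv
  have h2 := (hasFDerivAt_metricForm g hz v u).fderiv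
  simp_rw [metricForm_symm g p _ u v] at h
  exact DFunLike.congr_fun (h.symm.trans h2) w

theorem inner_velocity_eq (γ : ℝ → M) {p : M} {t : ℝ} (hp : γ t ∈ (chartAt (Coord d) p).source) :
    g.inner (γ t) (velocity d γ t) (velocity d γ t) =
      inner ℝ (chartVel γ p t) (metricOp g p (chartAt (Coord d) p (γ t)) (chartVel γ p t)) := by
  rw [inner_metricOp, ← inner_eq_metricForm g hp, ← velocity_eq_chartVel γ hp]

/-- The Euler–Lagrange identity with `w` equal to the velocity: the derivative of the metric along
the curve is cancelled by the two acceleration terms. -/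
theorem IsGeodesic.energy {γ : ℝ → M} (hγ : IsGeodesic g γ) (t : ℝ) :
    g.inner (γ t) (velocity d γ t) (velocity d γ t) =
      g.inner (γ 0) (velocity d γ 0) (velocity d γ 0) := by
  have hder : ∀ t, HasDerivAt (fun τ => g.inner (γ τ) (velocity d γ τ) (velocity d γ τ)) 0 t :=
    fun t => by
    have hs := mem_chart_source (Coord d) (γ t)
    have hz : inChart d γ t t ∈ (chartAt (Coord d) (γ t)).target :=
      (chartAt (Coord d) (γ t)).map_source hs
    have hv := hasDerivAt_chartVel hγ.1 hs
    have hd := hasDerivAt_chart hγ.1 hs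
    have h := hasDerivAt_metricForm g hz hd hv hv
    have hyd : deriv (inChart d γ t) t = chartVel γ (γ t) t := hd.deriv
    have hEL := hγ.euler_lagrange g t (chartVel γ (γ t) t)
    rw [hyd] at hEL
    have h0 : inner ℝ (chartVel γ (γ t) t) (dMetricOp g (γ t) (inChart d γ t t)
        (chartVel γ (γ t) t) (chartVel γ (γ t) t)) +
        inner ℝ (chartVel γ (γ t) t) (metricOp g (γ t) (inChart d γ t t)
          (deriv (deriv (inChart d γ t)) t)) +
        inner ℝ (deriv (deriv (inChart d γ t)) t) (metricOp g (γ t) (inChart d γ t t)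
          (chartVel γ (γ t) t)) = 0 := by
      rw [metricOp_symm g _ _ (deriv (deriv (inChart d γ t)) t), hEL]
      ring
    have h' := h.congr_deriv h0
    refine h'.congr_of_eventuallyEq ?_
    filter_upwards [eventually_mem_source hγ.1 hs] with τ hτ
    exact inner_velocity_eq g γ hτ
  exact is_const_of_deriv_eq_zero (fun t => (hder t).differentiableAt) (fun t => (hder t).deriv) t 0

end Curves

/-! ### Geodesics in a fixed chart and their short-time behaviour. -/

section Geodesics

variable {d : ℕ} {M : Type*} [TopologicalSpace M] [ChartedSpace (Coord d) M]
  [IsManifold (𝓡 d) ∞ M] (g : Metric d M)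

theorem inner_metricOp_transition {p q : M} {z : Coord d} (hz : z ∈ overlap p q) (u w : Coord d) :
    inner ℝ u (metricOp g p z w) =
      inner ℝ (fderiv ℝ (transition p q) z u) (metricOp g q (transition p q z)
        (fderiv ℝ (transition p q) z w)) := by
  rw [(hasFDerivAt_transition hz).fderiv, inner_metricOp, metricForm_transition g hz,
    ← inner_metricOp]

theorem hasDerivAt_clm_comp_apply {J : Coord d → Coord d →L[ℝ] Coord d}
    {J' : Coord d →L[ℝ] Coord d →L[ℝ] Coord d} {x : ℝ → Coord d} {x' : Coord d} {t : ℝ}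
    (hJ : HasFDerivAt J J' (x t)) (hx : HasDerivAt x x' t) (w : Coord d) :
    HasDerivAt (fun τ => J (x τ) w) (J' x' w) t := by
  have := (hJ.comp_hasDerivAt t hx).clm_apply (hasDerivAt_const t w)
  rw [map_zero, add_zero] at this
  exact this

theorem hasFDerivAt_fderiv_transition {p q : M} {z : Coord d} (hz : z ∈ overlap p q) :
    HasFDerivAt (fderiv ℝ (transition p q : Coord d → Coord d))
      (fderiv ℝ (fderiv ℝ (transition p q : Coord d → Coord d)) z) z :=
  ((((contDiffOn_transition (d := d) p q).contDiffAt
    ((isOpen_overlap p q).mem_nhds hz)).fderiv_right (m := 1) (by norm_cast)).differentiableAt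
      (by simp)).hasFDerivAt

theorem fderiv_fderiv_transition_symm {p q : M} {z : Coord d} (hz : z ∈ overlap p q)
    (v w : Coord d) : fderiv ℝ (fderiv ℝ (transition p q : Coord d → Coord d)) z v w =
      fderiv ℝ (fderiv ℝ (transition p q : Coord d → Coord d)) z w v :=
  (((contDiffOn_transition (d := d) p q).contDiffAt
    ((isOpen_overlap p q).mem_nhds hz)).isSymmSndFDerivAt (by rw [minSmoothness_of_isRCLikeNormedField]; norm_cast)).eq v w

/-- The transformation law of the metric, differentiated along the line `z + s w`; symmetry of the
metric merges the two terms with second derivatives of the transition map. -/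
theorem inner_dMetricOp_transition {p q : M} {z : Coord d} (hz : z ∈ overlap p q)
    (w v : Coord d) :
    inner ℝ v (dMetricOp g p z w v) =
      inner ℝ (fderiv ℝ (transition p q) z v) (dMetricOp g q (transition p q z)
        (fderiv ℝ (transition p q) z w) (fderiv ℝ (transition p q) z v)) +
      2 * inner ℝ (fderiv ℝ (fderiv ℝ (transition p q : Coord d → Coord d)) z w v)
        (metricOp g q (transition p q z) (fderiv ℝ (transition p q) z v)) := by
  have hline : HasDerivAt (fun s : ℝ => z + s • w) w 0 := by
    simpa using ((hasDerivAt_id (0 : ℝ)).smul_const w).const_add z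
  have hline0 : z + (0 : ℝ) • w = z := by simp
  have hL : HasDerivAt (fun s : ℝ => inner ℝ v (metricOp g p (z + s • w) v))
      (inner ℝ v (dMetricOp g p z w v)) 0 := by
    have := hasDerivAt_metricForm g (p := p) (t := (0 : ℝ)) (by rw [hline0]; exact hz.1) hline
      (hasDerivAt_const 0 v) (hasDerivAt_const 0 v)
    rw [map_zero, inner_zero_right, inner_zero_left, add_zero, add_zero, hline0] at this
    exact this
  have hJv := hasDerivAt_clm_comp_apply (x := fun s : ℝ => z + s • w) (t := 0)
    (by rw [hline0]; exact hasFDerivAt_fderiv_transition hz) hline v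
  have hθw : HasDerivAt (fun s : ℝ => transition p q (z + s • w))
      (fderiv ℝ (transition p q) z w) 0 := by
    have : HasFDerivAt (transition p q) (fderiv ℝ (transition p q) z) (z + (0 : ℝ) • w) := by
      rw [hline0]; exact (hasFDerivAt_transition hz).differentiableAt.hasFDerivAt
    exact this.comp_hasDerivAt (0 : ℝ) hline
  have hR := hasDerivAt_metricForm g (p := q) (t := (0 : ℝ))
    (by rw [hline0]; exact (transition_mem_overlap hz).1) hθw hJv hJv
  have hR' := hR.congr_of_eventuallyEq (f₁ := fun s : ℝ => inner ℝ v (metricOp g p (z + s • w) v))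
    (by
      have hc : ContinuousAt (fun s : ℝ => z + s • w) 0 := hline.continuousAt
      filter_upwards [hc.preimage_mem_nhds ((isOpen_overlap p q).mem_nhds
        (by rw [hline0]; exact hz))] with s hs
      exact inner_metricOp_transition g hs v v)
  rw [hL.unique hR', hline0, metricOp_symm g q _ (fderiv ℝ (transition p q) z v)]
  ring

/-- `IsGeodesic` gives the equation at time `t` only in the chart at `γ t`, but estimates over a
time interval need one fixed chart. In momentum form the equation carries over, as the second
derivatives of the transition map on the two sides cancel by their symmetry. -/
theorem IsGeodesic.hasDerivAt_momentum {γ : ℝ → M} (hγ : IsGeodesic g γ) {p : M} {t : ℝ}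
    (ht : γ t ∈ (chartAt (Coord d) p).source) (w : Coord d) :
    HasDerivAt (fun τ => inner ℝ w (metricOp g p (chartAt (Coord d) p (γ τ)) (chartVel γ p τ)))
      ((1 / 2) * inner ℝ (chartVel γ p t)
        (dMetricOp g p (chartAt (Coord d) p (γ t)) w (chartVel γ p t))) t := by
  have hs := mem_chart_source (Coord d) (γ t)
  have hzo : chartAt (Coord d) p (γ t) ∈ (overlap p (γ t) : Set (Coord d)) :=
    mem_overlap_chartAt ht hs
  have hyz : inChart d γ t t ∈ (chartAt (Coord d) (γ t)).target :=
    (chartAt (Coord d) (γ t)).map_source hs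
  have hy := hasDerivAt_chart hγ.1 hs
  have hx := hasDerivAt_chart hγ.1 ht
  have hvq := hasDerivAt_chartVel hγ.1 hs
  have hty : transition p (γ t) (chartAt (Coord d) p (γ t)) = inChart d γ t t := by
    rw [transition, pt_chartAt ht]; rfl
  have hvqeq : chartVel γ (γ t) t =
      fderiv ℝ (transition p (γ t)) (chartAt (Coord d) p (γ t)) (chartVel γ p t) := by
    rw [chartVel_transition γ ht hs, (hasFDerivAt_transition hzo).fderiv, pt_chartAt ht]
  have hJw := hasDerivAt_clm_comp_apply (x := fun τ => chartAt (Coord d) p (γ τ)) (t := t)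
    (hasFDerivAt_fderiv_transition hzo) hx w
  have h1 := hasDerivAt_metricForm g hyz hy hJw hvq
  have hyd : deriv (inChart d γ t) t = _ := hy.deriv.trans hvqeq
  have hEL := hγ.euler_lagrange g t
    (fderiv ℝ (transition p (γ t)) (chartAt (Coord d) p (γ t)) w)
  rw [hyd] at hEL
  have h2 := inner_dMetricOp_transition g hzo w (chartVel γ p t)
  rw [hty, fderiv_fderiv_transition_symm hzo w] at h2
  refine (h1.congr_of_eventuallyEq ?_).congr_deriv ?_
  · filter_upwards [eventually_mem_source hγ.1 ht, eventually_mem_source hγ.1 hs] with τ hτ hτ'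
    have hzo' := mem_overlap_chartAt hτ hτ'
    rw [inner_metricOp_transition g hzo', chartVel_transition γ hτ hτ',
      (hasFDerivAt_transition hzo').fderiv, transition, pt_chartAt hτ]
    rfl
  · rw [h2, hvqeq]
    refine (congrArg₂ (· + ·) (congrArg₂ (· + ·) (dMetricOp_symm g hyz _ _ _) hEL) rfl).trans ?_
    ring

theorem chartVel_of_initial {γ : ℝ → M} {y : M} {v : TangentSpace (𝓡 d) y}
    (h : (⟨γ 0, velocity d γ 0⟩ : TangentBundle (𝓡 d) M) = ⟨y, v⟩) (p : M) :
    γ 0 = y ∧ chartVel γ p 0 = tangentCoordChange (𝓡 d) y p y v := by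
  have key : ∀ b b' : TangentBundle (𝓡 d) M, b = b' → b.1 = b'.1 ∧
      (tangentCoordChange (𝓡 d) b.1 p b.1 b.2 : Coord d) =
        tangentCoordChange (𝓡 d) b'.1 p b'.1 b'.2 := by
    rintro b _ rfl
    exact ⟨rfl, rfl⟩
  exact key _ _ h

theorem exists_metricOp_bounds {p : M} {z₀ : Coord d} (hz₀ : z₀ ∈ (chartAt (Coord d) p).target) :
    ∃ ρ c A D : ℝ, 0 < ρ ∧ 0 < c ∧ 0 < A ∧ 0 ≤ D ∧
      Metric.closedBall z₀ ρ ⊆ (chartAt (Coord d) p).target ∧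
      ∀ z ∈ Metric.closedBall z₀ ρ, (∀ v, c * ‖v‖ ^ 2 ≤ inner ℝ v (metricOp g p z v)) ∧
        ‖metricOp g p z‖ ≤ A ∧ ‖fderiv ℝ (metricOp g p) z‖ ≤ D := by
  have hO := (chartAt (Coord d) p).open_target
  obtain ⟨ρ, hρ, hρt⟩ := Metric.nhds_basis_closedBall.mem_iff.1 (hO.mem_nhds hz₀)
  have hBc := isCompact_closedBall z₀ ρ
  have hM := (contDiffOn_metricOp g p).mono hρt
  obtain ⟨A, hA⟩ := hBc.exists_bound_of_continuousOn hM.continuousOn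
  obtain ⟨D, hD⟩ := hBc.exists_bound_of_continuousOn
    (((contDiffOn_metricOp g p).continuousOn_fderiv_of_isOpen hO (by simp)).mono hρt)
  have hpos : ∀ q ∈ Metric.closedBall z₀ ρ ×ˢ Metric.sphere (0 : Coord d) 1,
      0 < inner ℝ q.2 (metricOp g p q.1 q.2) := fun q hq => by
    rw [inner_metricOp]
    exact metricForm_pos g (hρt hq.1) (ne_zero_of_mem_unit_sphere ⟨q.2, hq.2⟩)
  have hcont : ContinuousOn (fun q : Coord d × Coord d => inner ℝ q.2 (metricOp g p q.1 q.2))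
      (Metric.closedBall z₀ ρ ×ˢ Metric.sphere (0 : Coord d) 1) :=
    continuousOn_snd.inner ((hM.continuousOn.comp continuousOn_fst fun q hq => hq.1).clm_apply
      continuousOn_snd)
  obtain ⟨c, hc, hcb⟩ : ∃ c : ℝ, 0 < c ∧
      ∀ q ∈ Metric.closedBall z₀ ρ ×ˢ Metric.sphere (0 : Coord d) 1,
        c ≤ inner ℝ q.2 (metricOp g p q.1 q.2) := by
    rcases (Metric.closedBall z₀ ρ ×ˢ Metric.sphere (0 : Coord d) 1).eq_empty_or_nonempty with
      h | h
    -- For `d = 0` the sphere is empty and any constant serves.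
    · exact ⟨1, one_pos, fun q hq => by rw [h] at hq; exact absurd hq (notMem_empty q)⟩
    · obtain ⟨q₀, hq₀, hmin⟩ := (hBc.prod (isCompact_sphere _ _)).exists_isMinOn h hcont
      exact ⟨_, hpos q₀ hq₀, fun q hq => hmin hq⟩
  refine ⟨ρ, c, max A 1, max D 0, hρ, hc, by positivity, le_max_right _ _, hρt, fun z hz =>
    ⟨fun v => ?_, (hA z hz).trans (le_max_left _ _), (hD z hz).trans (le_max_left _ _)⟩⟩
  rcases eq_or_ne v 0 with rfl | hv
  · simp
  · have hn : 0 < ‖v‖ := norm_pos_iff.2 hv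
    have hs : ‖v‖⁻¹ • v ∈ Metric.sphere (0 : Coord d) 1 := by simp [norm_smul, hn.ne']
    have h1 := hcb (z, ‖v‖⁻¹ • v) ⟨hz, hs⟩
    simp only [map_smul, real_inner_smul_left, real_inner_smul_right] at h1
    rw [← mul_assoc, ← sq, inv_pow, ← div_eq_inv_mul, le_div_iff₀ (by positivity)] at h1
    exact h1

/-- Conservation of energy bounds the speed by a multiple of `‖u‖`, so the curve stays in a small
ball up to time 1. The momentum then varies by `O(‖u‖²)`, and so does the velocity. The estimate
will give both the value and the differential of `exp_y` at `0`. -/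
theorem IsGeodesic.exists_estimate [T2Space M] {p : M} {z₀ : Coord d}
    (hz₀ : z₀ ∈ (chartAt (Coord d) p).target) :
    ∃ ε C : ℝ, 0 < ε ∧ ∀ (γ : ℝ → M) (u : Coord d), IsGeodesic g γ → ‖u‖ < ε → γ 0 = pt p z₀ →
      chartVel γ p 0 = u → γ 1 ∈ (chartAt (Coord d) p).source ∧
        ‖chartAt (Coord d) p (γ 1) - z₀ - u‖ ≤ C * ‖u‖ ^ 2 := by
  obtain ⟨ρ, c, A, D, hρ, hc, hA, hD, hB, hbd⟩ := exists_metricOp_bounds g hz₀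
  -- Energy at time 0 is at most `A‖u‖²` and at time `t` at least `c` times the squared speed.
  set K := Real.sqrt (A / c) with hK
  have hK2 : K ^ 2 = A / c := Real.sq_sqrt (by positivity)
  have hK0 : 0 < K := Real.sqrt_pos.2 (by positivity)
  have hz₀B : z₀ ∈ Metric.closedBall z₀ ρ := Metric.mem_closedBall_self hρ.le
  refine ⟨ρ / K, 3 / 2 * D * K ^ 2 / c, by positivity, fun γ u hγ hu h0 hv0 => ?_⟩
  have hu' : K * ‖u‖ < ρ := by rwa [lt_div_iff₀ hK0, mul_comm] at hu
  have hpt0 : pt p z₀ ∈ (chartAt (Coord d) p).source := pt_mem_source hz₀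
  have hs0 : γ 0 ∈ (chartAt (Coord d) p).source := by rw [h0]; exact hpt0
  have hx0 : chartAt (Coord d) p (γ 0) = z₀ := by rw [h0, chartAt_pt hz₀]
  have hE : ∀ t, γ t ∈ (chartAt (Coord d) p).source →
      chartAt (Coord d) p (γ t) ∈ Metric.closedBall z₀ ρ → ‖chartVel (d := d) γ p t‖ ≤ K * ‖u‖ := by
    intro t ht hxt
    have h1 := hγ.energy g t
    rw [inner_velocity_eq g γ ht, inner_velocity_eq g γ hs0, hv0, hx0] at h1
    have h2 := (hbd _ hxt).1 (chartVel γ p t)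
    have h3 : inner ℝ u (metricOp g p z₀ u) ≤ A * ‖u‖ ^ 2 := by
      calc inner ℝ u (metricOp g p z₀ u) ≤ ‖u‖ * ‖metricOp g p z₀ u‖ := real_inner_le_norm _ _
        _ ≤ ‖u‖ * (A * ‖u‖) := by
          gcongr
          exact (metricOp g p z₀).le_of_opNorm_le (hbd _ hz₀B).2.1 u
        _ = A * ‖u‖ ^ 2 := by ring
    refine abs_le_of_sq_le_sq' ?_ (by positivity) |>.2
    rw [mul_pow, hK2, div_mul_eq_mul_div, le_div_iff₀ hc]
    linarith
  have hstay : ∀ t ∈ Icc (0 : ℝ) 1, γ t ∈ (chartAt (Coord d) p).source ∧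
      ‖chartAt (Coord d) p (γ t) - z₀‖ ≤ K * ‖u‖ * t := by
    -- Continuity method: the times up to which the bound holds form a closed set which can be
    -- continued to the right. Closedness uses that the image of a compact ball is closed in the
    -- Hausdorff space `M`.
    set S := {t : ℝ | γ t ∈ (chartAt (Coord d) p).source ∧
      ‖chartAt (Coord d) p (γ t) - z₀‖ ≤ K * ‖u‖ * t} with hS
    have hball : IsClosed (pt p '' Metric.closedBall z₀ (K * ‖u‖)) :=
      ((isCompact_closedBall z₀ _).image_of_continuousOn ((continuousOn_pt p).mono
        ((Metric.closedBall_subset_closedBall hu'.le).trans hB))).isClosed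
    have hF : IsClosed (Icc (0 : ℝ) 1 ∩ γ ⁻¹' (pt p '' Metric.closedBall z₀ (K * ‖u‖))) :=
      isClosed_Icc.inter (hball.preimage hγ.1.continuous)
    have hFs : ∀ t ∈ Icc (0 : ℝ) 1 ∩ γ ⁻¹' (pt p '' Metric.closedBall z₀ (K * ‖u‖)),
        γ t ∈ (chartAt (Coord d) p).source := by
      rintro t ⟨-, z, hz, hzt⟩
      rw [← hzt]
      exact pt_mem_source (hB (Metric.closedBall_subset_closedBall hu'.le hz))
    have hcl : IsClosed (S ∩ Icc 0 1) := by
      have h := hF.isClosed_le (f := fun t => ‖chartAt (Coord d) p (γ t) - z₀‖)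
        (g := fun t => K * ‖u‖ * t)
        (fun t ht => ((hasDerivAt_chart (d := d) hγ.1 (hFs t ht)).continuousAt.sub
          continuousAt_const).norm.continuousWithinAt) (by fun_prop)
      convert h using 1
      ext t
      constructor
      · rintro ⟨⟨h1, h2⟩, h3⟩
        refine ⟨⟨h3, chartAt (Coord d) p (γ t), ?_, pt_chartAt (d := d) h1⟩, h2⟩
        rw [mem_closedBall_iff_norm]
        exact h2.trans (mul_le_of_le_one_right (by positivity) h3.2)
      · rintro ⟨h1, h2⟩
        exact ⟨⟨hFs t h1, h2⟩, h1.1⟩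
    refine hcl.Icc_subset_of_forall_mem_nhdsWithin ⟨hs0, by simp [hx0]⟩ fun t ht => ?_
    have hxt : ‖chartAt (Coord d) p (γ t) - z₀‖ < ρ :=
      lt_of_le_of_lt (ht.1.2.trans (mul_le_of_le_one_right (by positivity) ht.2.2.le)) hu'
    have hev : ∀ᶠ τ in 𝓝 t, γ τ ∈ (chartAt (Coord d) p).source ∧
        ‖chartAt (Coord d) p (γ τ) - z₀‖ < ρ :=
      (eventually_mem_source hγ.1 ht.1.1).and
        (((hasDerivAt_chart hγ.1 ht.1.1).continuousAt.sub continuousAt_const).norm.eventually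
          (gt_mem_nhds hxt))
    obtain ⟨e, he, hev⟩ := Metric.eventually_nhds_iff_ball.1 hev
    filter_upwards [Ioo_mem_nhdsGT (show t < t + e by linarith)] with s hs
    have hseg : ∀ τ ∈ Icc t s, γ τ ∈ (chartAt (Coord d) p).source ∧
        ‖chartAt (Coord d) p (γ τ) - z₀‖ < ρ := fun τ hτ => hev τ (by
      rw [Metric.mem_ball, Real.dist_eq, abs_of_nonneg (by linarith [hτ.1])]
      linarith [hτ.2, hs.2])
    have hmv := norm_image_sub_le_of_norm_deriv_le_segment'
      (f := fun τ => chartAt (Coord d) p (γ τ)) (C := K * ‖u‖) (a := t) (b := s)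
      (fun τ hτ => (hasDerivAt_chart hγ.1 (hseg τ hτ).1).hasDerivWithinAt)
      (fun τ hτ => hE τ (hseg τ ⟨hτ.1, hτ.2.le⟩).1
        (mem_closedBall_iff_norm.2 (hseg τ ⟨hτ.1, hτ.2.le⟩).2.le)) s ⟨hs.1.le, le_rfl⟩
    refine ⟨(hseg s ⟨hs.1.le, le_rfl⟩).1, ?_⟩
    have := norm_sub_le_norm_sub_add_norm_sub (chartAt (Coord d) p (γ s))
      (chartAt (Coord d) p (γ t)) z₀
    linarith [ht.1.2]
  have hxB : ∀ t ∈ Icc (0 : ℝ) 1, chartAt (Coord d) p (γ t) ∈ Metric.closedBall z₀ ρ :=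
    fun t ht => mem_closedBall_iff_norm.2
      (((hstay t ht).2.trans (mul_le_of_le_one_right (by positivity) ht.2)).trans hu'.le)
  have hvb : ∀ t ∈ Icc (0 : ℝ) 1, ‖chartVel (d := d) γ p t‖ ≤ K * ‖u‖ :=
    fun t ht => hE t (hstay t ht).1 (hxB t ht)
  -- With `w` the change of velocity, `c‖w‖² ≤ ⟨w, Gw⟩`. The variation of the metric along the curve
  -- contributes `D K² ‖u‖² ‖w‖` and the change of momentum half of that, hence the factor `3 / 2`.
  have hdv : ∀ t ∈ Icc (0 : ℝ) 1, ‖chartVel (d := d) γ p t - u‖ ≤ 3 / 2 * D * K ^ 2 / c * ‖u‖ ^ 2 := by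
    intro t ht
    set w := chartVel (d := d) γ p t - u with hw
    have hP := norm_image_sub_le_of_norm_deriv_le_segment'
      (f := fun τ => inner ℝ w (metricOp g p (chartAt (Coord d) p (γ τ)) (chartVel γ p τ)))
      (C := 1 / 2 * D * K ^ 2 * ‖u‖ ^ 2 * ‖w‖) (a := 0) (b := 1)
      (fun τ hτ => (hγ.hasDerivAt_momentum g (hstay τ hτ).1 w).hasDerivWithinAt)
      (fun τ hτ => by
        have hτ' : τ ∈ Icc (0 : ℝ) 1 := ⟨hτ.1, hτ.2.le⟩
        rw [norm_mul]
        have h1 := norm_inner_le_norm (𝕜 := ℝ) (chartVel γ p τ)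
          (dMetricOp g p (chartAt (Coord d) p (γ τ)) w (chartVel γ p τ))
        have h2 : ‖dMetricOp g p (chartAt (Coord d) p (γ τ)) w (chartVel γ p τ)‖ ≤
            D * ‖w‖ * (K * ‖u‖) :=
          ((dMetricOp g p (chartAt (Coord d) p (γ τ)) w).le_opNorm _).trans
            (mul_le_mul ((fderiv ℝ (metricOp g p) _).le_of_opNorm_le (hbd _ (hxB τ hτ')).2.2 w)
              (hvb τ hτ') (norm_nonneg _) (by positivity))
        have h3 : ‖chartVel γ p τ‖ * ‖dMetricOp g p (chartAt (Coord d) p (γ τ)) w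
            (chartVel γ p τ)‖ ≤ K * ‖u‖ * (D * ‖w‖ * (K * ‖u‖)) :=
          mul_le_mul (hvb τ hτ') h2 (norm_nonneg _) (by positivity)
        have h4 : ‖(1 / 2 : ℝ)‖ = 1 / 2 := by norm_num
        rw [h4]
        nlinarith [h1, h3]) t ht
    simp only [sub_zero] at hP
    rw [hx0, hv0] at hP
    have hLip : ‖metricOp g p z₀ - metricOp g p (chartAt (Coord d) p (γ t))‖ ≤
        D * (K * ‖u‖) := by
      have := (convex_closedBall z₀ ρ).norm_image_sub_le_of_norm_fderiv_le (𝕜 := ℝ)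
        (f := metricOp g p) (C := D)
        (fun z hz => (hasFDerivAt_metricOp g (hB hz)).differentiableAt)
        (fun z hz => (hbd z hz).2.2) (hxB t ht) hz₀B
      refine this.trans ?_
      rw [norm_sub_rev]
      gcongr
      exact (hstay t ht).2.trans (mul_le_of_le_one_right (by positivity) ht.2)
    have hsplit : inner ℝ w (metricOp g p z₀ w) =
        inner ℝ w ((metricOp g p z₀ - metricOp g p (chartAt (Coord d) p (γ t)))
          (chartVel γ p t)) +
        (inner ℝ w (metricOp g p (chartAt (Coord d) p (γ t)) (chartVel γ p t)) -
          inner ℝ w (metricOp g p z₀ u)) := by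
      rw [← inner_sub_right, ← inner_add_right]
      congr 1
      rw [hw, map_sub, sub_apply]
      abel
    have h1 := (hbd _ hz₀B).1 w
    have h2 : inner ℝ w ((metricOp g p z₀ - metricOp g p (chartAt (Coord d) p (γ t)))
          (chartVel γ p t)) ≤ ‖w‖ * (D * (K * ‖u‖) * (K * ‖u‖)) :=
      (real_inner_le_norm _ _).trans (mul_le_mul_of_nonneg_left
        ((ContinuousLinearMap.le_opNorm _ _).trans (mul_le_mul hLip (hvb t ht) (norm_nonneg _)
          (by positivity))) (norm_nonneg _))
    have h3 := (le_abs_self _).trans hP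
    have h4 : 1 / 2 * D * K ^ 2 * ‖u‖ ^ 2 * ‖w‖ * t ≤ 1 / 2 * D * K ^ 2 * ‖u‖ ^ 2 * ‖w‖ :=
      mul_le_of_le_one_right (by positivity) ht.2
    rcases (norm_nonneg w).eq_or_lt with h0w | h0w
    · rw [← h0w]; positivity
    · rw [div_mul_eq_mul_div, le_div_iff₀ hc]
      refine le_of_mul_le_mul_right ?_ h0w
      nlinarith
  have hfin := norm_image_sub_le_of_norm_deriv_le_segment'
    (f := fun τ => chartAt (Coord d) p (γ τ) - τ • u) (C := 3 / 2 * D * K ^ 2 / c * ‖u‖ ^ 2)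
    (a := 0) (b := 1)
    (fun τ hτ => ((hasDerivAt_chart hγ.1 (hstay τ hτ).1).sub
      ((hasDerivAt_id τ).smul_const u)).hasDerivWithinAt)
    (fun τ hτ => by
      rw [one_smul]
      exact hdv τ ⟨hτ.1, hτ.2.le⟩) 1 ⟨zero_le_one, le_rfl⟩
  refine ⟨(hstay 1 ⟨zero_le_one, le_rfl⟩).1, ?_⟩
  simp only [hx0, one_smul, zero_smul, sub_zero, mul_one] at hfin
  rwa [sub_right_comm] at hfin

end Geodesics

/-! ### The exponential map and the phase vector as its inverse. -/

section ExponentialMap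

variable {d : ℕ} {M : Type*} [TopologicalSpace M] [ChartedSpace (Coord d) M]
  [IsManifold (𝓡 d) ∞ M] {g : Metric d M} {r : ℝ} {φ : M → (y : M) → Cotangent d y → ℝ}

/-- The defining property of the phase, applied to any nonzero covector, contains such a geodesic; a
nonzero covector exists because `d ≥ 1`. -/
theorem IsLeviCivitaPhase.exists_geodesic (hφ : IsLeviCivitaPhase g r φ) (hd : 1 ≤ d) {y : M}
    {v : TangentSpace (𝓡 d) y} (hv : normOf g y v < r) :
    ∃ γ : ℝ → M, IsGeodesic g γ ∧
      (⟨γ 0, velocity d γ 0⟩ : TangentBundle (𝓡 d) M) = ⟨y, v⟩ ∧ γ 1 = expMap g y v := by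
  have h1 : (stdVec ⟨0, hd⟩ : Coord d) ≠ 0 := by simp [stdVec]
  obtain ⟨γ, ζ, hγ, h0, h1, -⟩ := hφ.eq_integral y v _
    (covec_ne_zero (mem_chart_source (Coord d) y) h1) hv
  exact ⟨γ, hγ, h0, h1⟩

/-- The integrand of the transport integral is constant along the geodesic and has the value `η v`
at time 0. -/
theorem IsLeviCivitaPhase.apply_expMap (hφ : IsLeviCivitaPhase g r φ) {y : M}
    {v : TangentSpace (𝓡 d) y} (hv : normOf g y v < r) {η : Cotangent d y} (hη : η ≠ 0) :
    φ (expMap g y v) y η = η v := by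
  obtain ⟨γ, ζ, hγ, h0, h1, hζ, hζ0, hc⟩ := hφ.eq_integral y v η hη hv
  rw [hc]
  simp_rw [hγ.parallel_contraction g hζ]
  rw [intervalIntegral.integral_const, sub_zero, one_smul]
  have hy : γ 0 = y := congrArg (fun b : TangentBundle (𝓡 d) M => b.1) h0
  subst hy
  have e1 : velocity d γ 0 = v := by
    simpa using h0
  have e2 : ζ 0 = η := by
    simpa using hζ0
  rw [e1, e2]

/-- The exponential map in the chart at `p`: the point `exp_y v`, where `v` has the components
`q.1` and `y` the coordinates `q.2`. -/
def expCoord (g : Metric d M) (p : M) (q : Coord d × Coord d) : M :=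
  expMap g (pt p q.2) (tangentCoordChange (𝓡 d) p (pt p q.2) (pt p q.2) q.1 : Coord d)

/-- The vector with components `φ(x; y, dyᵝ)`, in the chart at `p`. -/
def phaseVec (φ : M → (y : M) → Cotangent d y → ℝ) (p x y : M) : Coord d :=
  WithLp.toLp 2 fun β => φ x y (covec p y (stdVec β))

theorem normOf_vec {p : M} {z : Coord d} (u : Coord d) :
    normOf g (pt p z) (tangentCoordChange (𝓡 d) p (pt p z) (pt p z) u : Coord d) =
      Real.sqrt (metricForm g p z u u) := rfl

theorem stdVec_ne_zero (β : Fin d) : (stdVec β : Coord d) ≠ 0 := by simp [stdVec]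

theorem IsLeviCivitaPhase.apply_expCoord (hφ : IsLeviCivitaPhase g r φ) {p : M} {u z : Coord d}
    (hz : z ∈ (chartAt (Coord d) p).target) (hu : Real.sqrt (metricForm g p z u u) < r)
    {ξ : Coord d} (hξ : ξ ≠ 0) :
    φ (expCoord g p (u, z)) (pt p z) (covec p (pt p z) ξ) = inner ℝ ξ u := by
  exact (hφ.apply_expMap (v := (tangentCoordChange (𝓡 d) p (pt p z) (pt p z) u : Coord d))
    (by rwa [normOf_vec]) (covec_ne_zero (pt_mem_source hz) hξ)).trans
    (covec_apply_vec (pt_mem_source hz) ξ u)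

/-- Evaluating the phase on the coordinate covectors recovers the components of the initial
velocity. -/
theorem IsLeviCivitaPhase.phaseVec_expCoord (hφ : IsLeviCivitaPhase g r φ) {p : M} {u z : Coord d}
    (hz : z ∈ (chartAt (Coord d) p).target) (hu : Real.sqrt (metricForm g p z u u) < r) :
    phaseVec φ p (expCoord g p (u, z)) (pt p z) = u := by
  ext β
  change φ _ _ _ = _
  rw [hφ.apply_expCoord hz hu (stdVec_ne_zero β), real_inner_comm, inner_stdVec]

theorem IsLeviCivitaPhase.contDiffOn_phaseVec (hφ : IsLeviCivitaPhase g r φ) (q p : M) :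
    ContDiffOn ℝ ∞ (fun w : Coord d × Coord d => phaseVec φ p (pt q w.1) (pt p w.2))
      ((chartAt (Coord d) q).target ×ˢ (chartAt (Coord d) p).target) := by
  rw [contDiffOn_euclidean]
  intro β
  refine (hφ.smooth q p).comp (f := fun w : Coord d × Coord d => (w.1, w.2, stdVec β))
    (by fun_prop) fun w hw => ⟨hw.1, hw.2, stdVec_ne_zero β⟩

theorem IsLeviCivitaPhase.hasFDerivAt_phaseVec (hφ : IsLeviCivitaPhase g r φ) {q p : M}
    {w : Coord d × Coord d}
    (hw : w ∈ (chartAt (Coord d) q).target ×ˢ (chartAt (Coord d) p).target) :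
    ContDiffAt ℝ ∞ (fun w : Coord d × Coord d => phaseVec φ p (pt q w.1) (pt p w.2)) w :=
  (hφ.contDiffOn_phaseVec q p).contDiffAt (((chartAt (Coord d) q).open_target.prod
    (chartAt (Coord d) p).open_target).mem_nhds hw)

/-- `LeInjectivityRadius` controls each `exp_y` separately, so regularity is available in `u` for
fixed `z` only. -/
theorem contDiffAt_chart_expCoord (hinj : LeInjectivityRadius g r) {p q : M} {u z : Coord d}
    (hu : Real.sqrt (metricForm g p z u u) < r)
    (hq : expCoord g p (u, z) ∈ (chartAt (Coord d) q).source) :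
    ContDiffAt ℝ ∞ (fun u' => chartAt (Coord d) q (expCoord g p (u', z))) u ∧
      ContinuousAt (fun u' => expCoord g p (u', z)) u := by
  have h := ((hinj (pt p z)).2 ⟨_, (by rwa [← normOf_vec] at hu)⟩ :
    IsLocalDiffeomorphAt 𝓘(ℝ, Coord d) (𝓡 d) ∞ (fun v : Coord d => expMap g (pt p z) v)
      (tangentCoordChange (𝓡 d) p (pt p z) (pt p z) u)).contMDiffAt
  have hl : ContMDiffAt 𝓘(ℝ, Coord d) 𝓘(ℝ, Coord d) ∞
      (tangentCoordChange (𝓡 d) p (pt p z) (pt p z)) u :=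
    (tangentCoordChange (𝓡 d) p (pt p z) (pt p z)).contDiff.contMDiff.contMDiffAt
  have h2 : ContMDiffAt 𝓘(ℝ, Coord d) (𝓡 d) ∞ (fun u' => expCoord g p (u', z)) u :=
    ContMDiffAt.comp (g := fun v : Coord d => expMap g (pt p z) v) u h hl
  refine ⟨?_, h2.continuousAt⟩
  rw [← contMDiffAt_iff_contDiffAt]
  exact ((contMDiffOn_chart (I := 𝓡 d) (n := ∞) (x := q)).contMDiffAt
    ((chartAt (Coord d) q).open_source.mem_nhds hq)).comp u h2

theorem isOpen_setOf_sqrt_metricForm_lt (g : Metric d M) (p : M) (r : ℝ) :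
    IsOpen {q : Coord d × Coord d | q.2 ∈ (chartAt (Coord d) p).target ∧
      Real.sqrt (metricForm g p q.2 q.1 q.1) < r} := by
  have hc : ContinuousOn (fun q : Coord d × Coord d => Real.sqrt (metricForm g p q.2 q.1 q.1))
      (univ ×ˢ (chartAt (Coord d) p).target) := by
    refine Real.continuous_sqrt.comp_continuousOn ?_
    simp_rw [← inner_metricOp]
    exact continuousOn_fst.inner (((contDiffOn_metricOp g p).continuousOn.comp continuousOn_snd
      fun q hq => hq.2).clm_apply continuousOn_fst)
  have := hc.isOpen_inter_preimage (isOpen_univ.prod (chartAt (Coord d) p).open_target)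
    (isOpen_Iio (a := r))
  convert this using 1
  ext q
  simp [and_comm]

/-- `phaseVec` composed with the exponential map is the identity near `u`, so the chain rule makes
the differential of `phaseVec` in `x` invertible. -/
theorem IsLeviCivitaPhase.det_fderiv_phaseVec_ne_zero (hφ : IsLeviCivitaPhase g r φ)
    (hinj : LeInjectivityRadius g r) {p q : M} {u z : Coord d}
    (hz : z ∈ (chartAt (Coord d) p).target) (hu : Real.sqrt (metricForm g p z u u) < r)
    (hq : expCoord g p (u, z) ∈ (chartAt (Coord d) q).source) :
    (fderiv ℝ (fun a => phaseVec φ p (pt q a) (pt p z))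
      (chartAt (Coord d) q (expCoord g p (u, z)))).det ≠ 0 := by
  set a₀ := chartAt (Coord d) q (expCoord g p (u, z))
  have ha₀ : a₀ ∈ (chartAt (Coord d) q).target := (chartAt (Coord d) q).map_source hq
  have hE := contDiffAt_chart_expCoord hinj hu hq
  have hf : DifferentiableAt ℝ (fun a => phaseVec φ p (pt q a) (pt p z)) a₀ :=
    ((hφ.hasFDerivAt_phaseVec (w := (a₀, z)) ⟨ha₀, hz⟩).differentiableAt (by simp)).comp a₀
      (f := fun a => (a, z)) (by fun_prop)
  have hcomp := hf.hasFDerivAt.comp u (hE.1.differentiableAt (by simp)).hasFDerivAt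
  have hid : HasFDerivAt (fun u' : Coord d => u') (ContinuousLinearMap.id ℝ (Coord d)) u :=
    hasFDerivAt_id u
  have hev : (fun u' : Coord d => u') =ᶠ[𝓝 u] (fun a => phaseVec φ p (pt q a) (pt p z)) ∘
      fun u' => chartAt (Coord d) q (expCoord g p (u', z)) := by
    have ho := (isOpen_setOf_sqrt_metricForm_lt g p r).preimage
      (f := fun u' : Coord d => (u', z)) (by fun_prop)
    filter_upwards [ho.mem_nhds (show u ∈ _ ⁻¹' _ from ⟨hz, hu⟩),
      hE.2.preimage_mem_nhds ((chartAt (Coord d) q).open_source.mem_nhds hq)] with u' h1 h2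
    rw [Function.comp_apply, pt_chartAt h2, hφ.phaseVec_expCoord hz h1.2]
  have heq := hid.unique (hcomp.congr_of_eventuallyEq hev)
  intro h0
  have h2 := congrArg ContinuousLinearMap.det heq
  rw [ContinuousLinearMap.det, ContinuousLinearMap.det, ContinuousLinearMap.toLinearMap_comp,
    LinearMap.det_comp] at h2
  have h3 : LinearMap.det ((fderiv ℝ (fun a => phaseVec φ p (pt q a) (pt p z)) a₀ :
    Coord d →L[ℝ] Coord d) : Coord d →ₗ[ℝ] Coord d) = 0 := h0
  rw [h3, zero_mul] at h2
  simp at h2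

theorem IsLeviCivitaPhase.expCoord_estimate [T2Space M] (hφ : IsLeviCivitaPhase g r φ)
    (hr : 0 < r) (hd : 1 ≤ d) {p : M} {z₀ : Coord d} (hz₀ : z₀ ∈ (chartAt (Coord d) p).target) :
    ∃ ε C : ℝ, 0 < ε ∧ ∀ u : Coord d, ‖u‖ < ε →
      Real.sqrt (metricForm g p z₀ u u) < r ∧
      expCoord g p (u, z₀) ∈ (chartAt (Coord d) p).source ∧
        ‖chartAt (Coord d) p (expCoord g p (u, z₀)) - z₀ - u‖ ≤ C * ‖u‖ ^ 2 := by
  obtain ⟨ε, C, hε, h⟩ := IsGeodesic.exists_estimate g hz₀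
  have ho := (isOpen_setOf_sqrt_metricForm_lt g p r).preimage
      (f := fun u' : Coord d => (u', z₀)) (by fun_prop)
  obtain ⟨ε', hε', hb⟩ := Metric.isOpen_iff.1 ho 0 ⟨hz₀, by
    rw [← inner_metricOp, inner_zero_left, Real.sqrt_zero]; exact hr⟩
  refine ⟨min ε ε', C, lt_min hε hε', fun u hu => ?_⟩
  have hu' := (hb (mem_ball_zero_iff.2 (hu.trans_le (min_le_right _ _)))).2
  obtain ⟨γ, hγ, h0, h1⟩ := hφ.exists_geodesic hd (v := (tangentCoordChange (𝓡 d) p (pt p z₀)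
    (pt p z₀) u : Coord d)) (by rw [normOf_vec]; exact hu')
  obtain ⟨e0, ev⟩ := chartVel_of_initial h0 p
  rw [tangentCoordChange_inverse (pt_mem_source hz₀) (mem_chart_source _ _)] at ev
  have := h γ u hγ (hu.trans_le (min_le_left _ _)) e0 ev
  rw [h1] at this
  exact ⟨hu', this⟩

/-- At `u = 0` the quadratic error term vanishes. -/
theorem IsLeviCivitaPhase.expCoord_zero [T2Space M] (hφ : IsLeviCivitaPhase g r φ)
    (hr : 0 < r) (hd : 1 ≤ d) {p : M} {z : Coord d} (hz : z ∈ (chartAt (Coord d) p).target) :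
    expCoord g p (0, z) = pt p z := by
  obtain ⟨ε, C, hε, h⟩ := hφ.expCoord_estimate hr hd hz
  obtain ⟨-, hs, hC⟩ := h 0 (by simpa using hε)
  have : chartAt (Coord d) p (expCoord g p (0, z)) = z := by
    have h0 : ‖chartAt (Coord d) p (expCoord g p (0, z)) - z - 0‖ ≤ 0 := by simpa using hC
    rw [norm_le_zero_iff, sub_zero, sub_eq_zero] at h0
    exact h0
  rw [← pt_chartAt hs, this]

theorem IsLeviCivitaPhase.phaseVec_self [T2Space M] (hφ : IsLeviCivitaPhase g r φ)
    (hr : 0 < r) (hd : 1 ≤ d) {p : M} {z : Coord d} (hz : z ∈ (chartAt (Coord d) p).target) :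
    phaseVec φ p (pt p z) (pt p z) = 0 := by
  have h := hφ.phaseVec_expCoord (u := 0) hz (by
    rw [← inner_metricOp, inner_zero_left, Real.sqrt_zero]; exact hr)
  rwa [hφ.expCoord_zero hr hd hz] at h

/-- The quadratic estimate says that the exponential map has differential `id` at `0`, and
`phaseVec` is a left inverse of it. -/
theorem IsLeviCivitaPhase.fderiv_phaseVec_self [T2Space M] (hφ : IsLeviCivitaPhase g r φ)
    (hr : 0 < r) (hd : 1 ≤ d) {p : M} {z : Coord d} (hz : z ∈ (chartAt (Coord d) p).target) :
    HasFDerivAt (fun a => phaseVec φ p (pt p a) (pt p z)) (ContinuousLinearMap.id ℝ (Coord d)) z := by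
  have hf : DifferentiableAt ℝ (fun a => phaseVec φ p (pt p a) (pt p z)) z :=
    ((hφ.hasFDerivAt_phaseVec (w := (z, z)) ⟨hz, hz⟩).differentiableAt (by simp)).comp z
      (f := fun a => (a, z)) (by fun_prop)
  obtain ⟨ε, C, hε, h⟩ := hφ.expCoord_estimate hr hd hz
  set E := fun u : Coord d => chartAt (Coord d) p (expCoord g p (u, z)) with hEdef
  have hE0 : E 0 = z := by rw [hEdef]; beta_reduce; rw [hφ.expCoord_zero hr hd hz, chartAt_pt hz]
  have hE : HasFDerivAt E (ContinuousLinearMap.id ℝ (Coord d)) 0 := by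
    rw [hasFDerivAt_iff_isLittleO_nhds_zero, hE0]
    refine Asymptotics.IsBigO.trans_isLittleO (g := fun u : Coord d => ‖u‖ ^ 2) ?_ ?_
    · refine Asymptotics.IsBigO.of_bound C ?_
      filter_upwards [Metric.ball_mem_nhds (0 : Coord d) hε] with u hu
      have := (h u (mem_ball_zero_iff.1 hu)).2.2
      simpa [hEdef] using this
    · simpa using Asymptotics.isLittleO_norm_pow_id (E' := Coord d) one_lt_two
  have hf' : HasFDerivAt (fun a => phaseVec φ p (pt p a) (pt p z))
      (fderiv ℝ (fun a => phaseVec φ p (pt p a) (pt p z)) z) (E 0) := by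
    rw [hE0]; exact hf.hasFDerivAt
  have hcomp := hf'.comp 0 hE
  have hev : (fun u' : Coord d => u') =ᶠ[𝓝 0] (fun a => phaseVec φ p (pt p a) (pt p z)) ∘ E := by
    filter_upwards [Metric.ball_mem_nhds (0 : Coord d) hε] with u hu
    obtain ⟨h1, h2, -⟩ := h u (mem_ball_zero_iff.1 hu)
    rw [Function.comp_apply, hEdef]
    beta_reduce
    rw [pt_chartAt h2, hφ.phaseVec_expCoord hz h1]
  have heq := (hasFDerivAt_id (𝕜 := ℝ) (0 : Coord d)).unique (hcomp.congr_of_eventuallyEq hev)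
  rw [ContinuousLinearMap.comp_id] at heq
  rw [heq]
  exact hf.hasFDerivAt

end ExponentialMap

/-! ### Joint continuity of the exponential map. -/

theorem exists_openPartialHomeomorph_graph {E : Type*} [NormedAddCommGroup E] [NormedSpace ℝ E]
    [FiniteDimensional ℝ E] {f : E × E → E} {w₀ : E × E} (hf : ContDiffAt ℝ ∞ f w₀)
    (hdet : (fderiv ℝ (fun a => f (a, w₀.2)) w₀.1).det ≠ 0) :
    ∃ Φ : OpenPartialHomeomorph (E × E) (E × E), w₀ ∈ Φ.source ∧ ∀ w, Φ w = (f w, w.2) := by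
  haveI : CompleteSpace E := FiniteDimensional.complete ℝ E
  have hF : ContDiffAt ℝ ∞ (fun w : E × E => (f w, w.2)) w₀ := hf.prodMk contDiffAt_snd
  have hfd := (hf.differentiableAt (by simp)).hasFDerivAt
  have hd : HasFDerivAt (fun w : E × E => (f w, w.2))
      ((fderiv ℝ f w₀).prod (ContinuousLinearMap.snd ℝ E E)) w₀ := hfd.prodMk hasFDerivAt_snd
  set L := (fderiv ℝ f w₀).prod (ContinuousLinearMap.snd ℝ E E) with hL
  have hpart : fderiv ℝ (fun a => f (a, w₀.2)) w₀.1 =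
      (fderiv ℝ f w₀).comp (ContinuousLinearMap.inl ℝ E E) :=
    (hfd.comp w₀.1 (f := fun a => (a, w₀.2)) (hasFDerivAt_prodMk_left _ _)).fderiv
  -- The differential is block triangular with identity and the given invertible operator on the
  -- diagonal; in finite dimensions injectivity is enough.
  have hinj : Function.Injective L := by
    rw [injective_iff_map_eq_zero]
    rintro ⟨a, b⟩ h
    have hb : b = 0 := congrArg Prod.snd h
    have ha : fderiv ℝ f w₀ (a, b) = 0 := congrArg Prod.fst h
    subst hb
    have hbij := (LinearMap.isUnit_iff_ker_eq_bot (fderiv ℝ (fun a => f (a, w₀.2)) w₀.1 :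
      E →ₗ[ℝ] E)).1 ((LinearMap.isUnit_iff_isUnit_det _).2 (isUnit_iff_ne_zero.2 hdet))
    have : a ∈ LinearMap.ker (fderiv ℝ (fun a => f (a, w₀.2)) w₀.1 : E →ₗ[ℝ] E) := by
      rw [LinearMap.mem_ker, hpart]
      exact ha
    rw [hbij, Submodule.mem_bot] at this
    rw [this]
    rfl
  let e := (LinearEquiv.ofInjectiveEndo (L : E × E →ₗ[ℝ] E × E) hinj).toContinuousLinearEquiv
  have he : (e : E × E →L[ℝ] E × E) = L :=
    ContinuousLinearMap.ext fun v => rfl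
  have hd' : HasFDerivAt (fun w : E × E => (f w, w.2)) (e : E × E →L[ℝ] E × E) w₀ := by rwa [he]
  exact ⟨hF.toOpenPartialHomeomorph _ hd' (by simp),
    hF.mem_toOpenPartialHomeomorph_source hd' (by simp), fun w => rfl⟩

section ExponentialMap

variable {d : ℕ} {M : Type*} [TopologicalSpace M] [ChartedSpace (Coord d) M]
  [IsManifold (𝓡 d) ∞ M] {g : Metric d M} {r : ℝ} {φ : M → (y : M) → Cotangent d y → ℝ}

/-- The map `(a, z) ↦ (V(a, z), z)` has a continuous local inverse, giving a continuous candidate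
`h` for the exponential map. For fixed `z` the two agree on an open and closed set of `u`.
Continuity in `z` for a single `u₁` thus makes them agree on a full neighbourhood. -/
theorem IsLeviCivitaPhase.expCoord_continuity_step [T2Space M] (hφ : IsLeviCivitaPhase g r φ)
    (hinj : LeInjectivityRadius g r) {p : M} {u₀ z₀ : Coord d}
    (hz₀ : z₀ ∈ (chartAt (Coord d) p).target) (hu₀ : Real.sqrt (metricForm g p z₀ u₀ u₀) < r) :
    ∃ S ∈ 𝓝 u₀, ∀ u₁ ∈ S, ContinuousAt (fun z => expCoord g p (u₁, z)) z₀ →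
      ∀ u ∈ S, ContinuousAt (expCoord g p) (u, z₀) := by
  set q := expCoord g p (u₀, z₀) with hq
  have hqs : expCoord g p (u₀, z₀) ∈ (chartAt (Coord d) q).source := mem_chart_source _ q
  set a₀ := chartAt (Coord d) q q with ha₀
  have ha₀t : a₀ ∈ (chartAt (Coord d) q).target := (chartAt (Coord d) q).map_source hqs
  obtain ⟨Φ₀, hΦ₀, hΦ₀e⟩ := exists_openPartialHomeomorph_graph
    (hφ.hasFDerivAt_phaseVec (q := q) (p := p) (w := (a₀, z₀)) ⟨ha₀t, hz₀⟩)
    (hφ.det_fderiv_phaseVec_ne_zero hinj hz₀ hu₀ hqs)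
  have hOt : IsOpen ((chartAt (Coord d) q).target ×ˢ (chartAt (Coord d) p).target) :=
    (chartAt (Coord d) q).open_target.prod (chartAt (Coord d) p).open_target
  set Φ := Φ₀.restrOpen _ hOt with hΦ
  have hΦs : Φ.source ⊆ (chartAt (Coord d) q).target ×ˢ (chartAt (Coord d) p).target := by
    rw [hΦ, OpenPartialHomeomorph.restrOpen_source]
    exact inter_subset_right
  have hΦm : (a₀, z₀) ∈ Φ.source := by
    rw [hΦ, OpenPartialHomeomorph.restrOpen_source]
    exact ⟨hΦ₀, ha₀t, hz₀⟩
  have hΦe : ∀ w, Φ w = (phaseVec φ p (pt q w.1) (pt p w.2), w.2) := hΦ₀e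
  have hΦ0 : Φ (a₀, z₀) = (u₀, z₀) := by
    rw [hΦe, ha₀, pt_chartAt hqs, hφ.phaseVec_expCoord hz₀ hu₀]
  set T := {w : Coord d × Coord d | w.2 ∈ (chartAt (Coord d) p).target ∧
      Real.sqrt (metricForm g p w.2 w.1 w.1) < r} ∩ Φ.target with hT
  have hTo : IsOpen T := (isOpen_setOf_sqrt_metricForm_lt g p r).inter Φ.open_target
  have hT0 : (u₀, z₀) ∈ T := ⟨⟨hz₀, hu₀⟩, by rw [← hΦ0]; exact Φ.map_source hΦm⟩
  obtain ⟨ρ, hρ, hρT⟩ := Metric.isOpen_iff.1 hTo _ hT0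
  rw [← ball_prod_same] at hρT
  set h := fun w : Coord d × Coord d => pt q (Φ.symm w).1 with hh
  have hsnd : ∀ w ∈ T, (Φ.symm w).2 = w.2 := fun w hw => by
    conv_rhs => rw [← Φ.right_inv hw.2, hΦe]
  have hcont : ContinuousOn h T := (continuousOn_pt q).comp
    (continuous_fst.comp_continuousOn (Φ.continuousOn_symm.mono inter_subset_right))
    fun w hw => (hΦs (Φ.map_target hw.2)).1
  set 𝒪 := {w : M × Coord d | w.1 ∈ (chartAt (Coord d) q).source ∧
    (chartAt (Coord d) q w.1, w.2) ∈ Φ.source} with h𝒪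
  have h𝒪o : IsOpen 𝒪 := by
    have hc : ContinuousOn (fun w : M × Coord d => (chartAt (Coord d) q w.1, w.2))
        ((chartAt (Coord d) q).source ×ˢ univ) :=
      ((chartAt (Coord d) q).continuousOn.comp continuousOn_fst fun w hw => hw.1).prodMk
        continuousOn_snd
    have := hc.isOpen_inter_preimage ((chartAt (Coord d) q).open_source.prod isOpen_univ)
      Φ.open_source
    convert this using 1
    ext w
    simp [h𝒪]
  -- Equality with `h` is rephrased as membership in the open set `𝒪`, on which the graph map is
  -- injective.
  have hgood : ∀ w ∈ T, expCoord g p w = h w ↔ (expCoord g p w, w.2) ∈ 𝒪 := fun w hw => by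
    constructor
    · intro he
      have hs : Φ.symm w ∈ Φ.source := Φ.map_target hw.2
      have h1 : expCoord g p w ∈ (chartAt (Coord d) q).source := by
        rw [he]; exact pt_mem_source (hΦs hs).1
      refine ⟨h1, ?_⟩
      change (chartAt (Coord d) q (expCoord g p w), w.2) ∈ Φ.source
      rw [he, hh]
      beta_reduce
      rw [chartAt_pt (hΦs hs).1, ← hsnd w hw]
      exact hs
    · rintro ⟨h1, h2⟩
      have h3 : Φ (chartAt (Coord d) q (expCoord g p w), w.2) = w := by
        rw [hΦe]
        simp only
        rw [pt_chartAt h1]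
        exact Prod.ext (hφ.phaseVec_expCoord hw.1.1 hw.1.2) rfl
      have h4 := Φ.left_inv h2
      simp only at h3 h4
      rw [h3] at h4
      rw [hh]
      beta_reduce
      rw [h4, pt_chartAt h1]
  have hslice : ∀ u ∈ Metric.ball u₀ ρ, ∀ z ∈ Metric.ball z₀ ρ,
      ContinuousAt (fun u' => expCoord g p (u', z)) u := fun u hu z hz =>
    (contDiffAt_chart_expCoord hinj (hρT (mk_mem_prod hu hz)).1.2 (mem_chart_source _ _)).2
  -- Agreement is an open condition by `hgood`, disagreement is open since `M` is Hausdorff, and the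
  -- ball is connected.
  have hconn : ∀ z ∈ Metric.ball z₀ ρ, ∀ u₁ ∈ Metric.ball u₀ ρ, ∀ u ∈ Metric.ball u₀ ρ,
      expCoord g p (u₁, z) = h (u₁, z) → expCoord g p (u, z) = h (u, z) := by
    intro z hz u₁ hu₁ u hu
    refine (convex_ball u₀ ρ).isPreconnected.induction₂'
      (fun a b => expCoord g p (a, z) = h (a, z) → expCoord g p (b, z) = h (b, z))
      (fun a ha => ?_) (fun a b c _ _ _ h1 h2 h3 => h2 (h1 h3)) hu₁ hu
    have hm := hρT (mk_mem_prod ha hz)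
    have hca := hslice a ha z hz
    have hha : ContinuousAt (fun a' => h (a', z)) a :=
      (hcont.continuousAt (hTo.mem_nhds hm)).comp (f := fun a' => (a', z)) (by fun_prop)
    by_cases heq : expCoord g p (a, z) = h (a, z)
    · have hev : ∀ᶠ b in 𝓝 a, (expCoord g p (b, z), z) ∈ 𝒪 :=
        (hca.prodMk continuousAt_const).preimage_mem_nhds
          (h𝒪o.mem_nhds ((hgood _ hm).1 heq))
      filter_upwards [mem_nhdsWithin_of_mem_nhds hev, self_mem_nhdsWithin] with b hb hbb
      have := (hgood (b, z) (hρT (mk_mem_prod hbb hz))).2 hb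
      exact ⟨fun _ => this, fun _ => heq⟩
    · have hev : ∀ᶠ b in 𝓝 a, expCoord g p (b, z) ≠ h (b, z) := 
        (hca.prodMk hha).preimage_mem_nhds (isClosed_diagonal.isOpen_compl.mem_nhds heq)
      filter_upwards [mem_nhdsWithin_of_mem_nhds hev] with b hb
      exact ⟨fun h' => absurd h' heq, fun h' => absurd h' hb⟩
  refine ⟨Metric.ball u₀ ρ, Metric.ball_mem_nhds _ hρ, fun u₁ hu₁ hC u hu => ?_⟩
  have hz₀b : z₀ ∈ Metric.ball z₀ ρ := Metric.mem_ball_self hρ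
  have h0 : expCoord g p (u₀, z₀) = h (u₀, z₀) :=
    (hgood _ hT0).2 ⟨hqs, hΦm⟩
  have h1 : expCoord g p (u₁, z₀) = h (u₁, z₀) :=
    hconn z₀ hz₀b u₀ (Metric.mem_ball_self hρ) u₁ hu₁ h0
  have hev : ∀ᶠ z in 𝓝 z₀, (expCoord g p (u₁, z), z) ∈ 𝒪 :=
    (hC.prodMk continuousAt_id).preimage_mem_nhds (h𝒪o.mem_nhds
      ((hgood _ (hρT (mk_mem_prod hu₁ hz₀b))).1 h1))
  have hev2 : ∀ᶠ z in 𝓝 z₀, ∀ u ∈ Metric.ball u₀ ρ, expCoord g p (u, z) = h (u, z) := by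
    filter_upwards [hev, Metric.ball_mem_nhds _ hρ] with z hz hzb u hu
    exact hconn z hzb u₁ hu₁ u hu ((hgood (u₁, z) (hρT (mk_mem_prod hu₁ hzb))).2 hz)
  have hm : (u, z₀) ∈ T := hρT (mk_mem_prod hu hz₀b)
  refine (hcont.continuousAt (hTo.mem_nhds hm)).congr ?_
  rw [nhds_prod_eq]
  filter_upwards [prod_mem_prod (Metric.isOpen_ball.mem_nhds hu) hev2]
    with w hw
  exact (hw.2 w.1 hw.1).symm

/-- Continuity in the base point is clear at `u = 0`, where the exponential map returns the point
itself. The previous lemma propagates it along the star-shaped, hence connected, ball of admissible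
velocities. -/
theorem IsLeviCivitaPhase.continuousAt_expCoord [T2Space M] (hφ : IsLeviCivitaPhase g r φ)
    (hinj : LeInjectivityRadius g r) (hr : 0 < r) (hd : 1 ≤ d) {p : M} {u₀ z₀ : Coord d}
    (hz₀ : z₀ ∈ (chartAt (Coord d) p).target) (hu₀ : Real.sqrt (metricForm g p z₀ u₀ u₀) < r) :
    ContinuousAt (expCoord g p) (u₀, z₀) := by
  set B := {u : Coord d | Real.sqrt (metricForm g p z₀ u u) < r} with hB
  have hstar : StarConvex ℝ 0 B := by
    rw [starConvex_zero_iff]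
    intro u hu a ha0 ha1
    have : Real.sqrt (metricForm g p z₀ (a • u) (a • u)) =
        a * Real.sqrt (metricForm g p z₀ u u) := by
      rw [← inner_metricOp, map_smul, real_inner_smul_left, real_inner_smul_right, ← mul_assoc,
        ← sq, Real.sqrt_mul (sq_nonneg a), Real.sqrt_sq ha0, inner_metricOp]
    rw [hB, mem_ofPred_eq, this]
    exact (mul_le_of_le_one_left (Real.sqrt_nonneg _) ha1).trans_lt hu
  have h0B : (0 : Coord d) ∈ B := by
    rw [hB, mem_ofPred_eq, ← inner_metricOp, inner_zero_left, Real.sqrt_zero]; exact hr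
  have hC0 : ContinuousAt (fun z => expCoord g p (0, z)) z₀ := by
    refine ((continuousOn_pt p).continuousAt ((chartAt (Coord d) p).open_target.mem_nhds
      hz₀)).congr ?_
    filter_upwards [(chartAt (Coord d) p).open_target.mem_nhds hz₀] with z hz
    exact (hφ.expCoord_zero hr hd hz).symm
  have hslice : ∀ u, ContinuousAt (expCoord g p) (u, z₀) →
      ContinuousAt (fun z => expCoord g p (u, z)) z₀ := fun u h =>
    ContinuousAt.comp (f := fun z => (u, z)) h (by fun_prop)
  have hC : ContinuousAt (fun z => expCoord g p (u₀, z)) z₀ := by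
    refine (hstar.isPathConnected h0B).isConnected.isPreconnected.induction₂'
      (fun a b => ContinuousAt (fun z => expCoord g p (a, z)) z₀ →
        ContinuousAt (fun z => expCoord g p (b, z)) z₀)
      (fun a ha => ?_) (fun a b c _ _ _ h1 h2 h3 => h2 (h1 h3)) h0B hu₀ hC0
    obtain ⟨S, hS, h⟩ := hφ.expCoord_continuity_step hinj hz₀ ha
    filter_upwards [mem_nhdsWithin_of_mem_nhds hS] with b hb
    exact ⟨fun h1 => hslice b (h a (mem_of_mem_nhds hS) h1 b hb),
      fun h1 => hslice a (h b hb h1 a (mem_of_mem_nhds hS))⟩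
  obtain ⟨S, hS, h⟩ := hφ.expCoord_continuity_step hinj hz₀ hu₀
  exact h u₀ (mem_of_mem_nhds hS) hC u₀ (mem_of_mem_nhds hS)

end ExponentialMap

/-! ### The support of the cut-off. -/

section Support

variable {d : ℕ} {M : Type*} [TopologicalSpace M] [ChartedSpace (Coord d) M]
  [IsManifold (𝓡 d) ∞ M] {g : Metric d M} {r : ℝ} {φ : M → (y : M) → Cotangent d y → ℝ}
  {χ : M → (y : M) → Cotangent d y → ℂ}

/-- The projection to `M × M` of the set where the cut-off does not vanish. -/
def cutoffSupport (χ : M → (y : M) → Cotangent d y → ℂ) : Set (M × M) :=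
  {w | ∃ η : Cotangent d w.2, χ w.1 w.2 η ≠ 0}

theorem hamiltonian_zero (y : M) : hamiltonian g y (0 : Cotangent d y) = 0 := by
  simp [hamiltonian]

theorem IsCutoff.ne_zero (hχ : IsCutoff g r χ) {x y : M} {η : Cotangent d y}
    (h : χ x y η ≠ 0) : η ≠ 0 := by
  rintro rfl
  exact h (hχ.zero_of_le x y 0 (by rw [hamiltonian_zero]; norm_num))

/-- The map `(x, y) ↦ (a, b)` from points to coordinates, in the charts at `p₁` and `p₂`. -/
def chartPair (p₁ p₂ : M) (w : M × M) : Coord d × Coord d :=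
  (chartAt (Coord d) p₁ w.1, chartAt (Coord d) p₂ w.2)

theorem continuousAt_chartPair {p₁ p₂ : M} {w : M × M}
    (h1 : w.1 ∈ (chartAt (Coord d) p₁).source) (h2 : w.2 ∈ (chartAt (Coord d) p₂).source) :
    ContinuousAt (chartPair (d := d) p₁ p₂) w :=
  (((chartAt (Coord d) p₁).continuousAt h1).comp (f := Prod.fst) continuousAt_fst).prodMk
    (((chartAt (Coord d) p₂).continuousAt h2).comp (f := Prod.snd) continuousAt_snd)

theorem eventually_mem_source_prod {p₁ p₂ : M} {w : M × M}
    (h1 : w.1 ∈ (chartAt (Coord d) p₁).source) (h2 : w.2 ∈ (chartAt (Coord d) p₂).source) :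
    ∀ᶠ w' in 𝓝 w, w'.1 ∈ (chartAt (Coord d) p₁).source ∧
      w'.2 ∈ (chartAt (Coord d) p₂).source :=
  (((chartAt (Coord d) p₁).open_source.prod (chartAt (Coord d) p₂).open_source).mem_nhds
    ⟨h1, h2⟩)

/-- A nonzero value of the cut-off persists for nearby points with the same covector components.
Openness upgrades pointwise statements on the support to statements on neighbourhoods, where
derivatives can be taken. -/
theorem isOpen_cutoffSupport (hχ : IsCutoff g r χ) : IsOpen (cutoffSupport χ) := by
  rw [isOpen_iff_mem_nhds]
  rintro ⟨x, y⟩ ⟨η, hη⟩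
  have hx := mem_chart_source (Coord d) x
  have hy := mem_chart_source (Coord d) y
  obtain ⟨ξ, rfl⟩ := exists_covec_eq hy η
  have hξ : ξ ≠ 0 := by
    rintro rfl
    refine hχ.ne_zero hη ?_
    rw [← zero_smul ℝ (0 : Coord d), covec_smul, zero_smul]
  have hc := (hχ.smooth x y).continuousOn.continuousAt (((chartAt (Coord d) x).open_target.prod
    ((chartAt (Coord d) y).open_target.prod isOpen_compl_singleton)).mem_nhds
    (show (chartAt (Coord d) x x, chartAt (Coord d) y y, ξ) ∈ _ from
      ⟨(chartAt (Coord d) x).map_source hx, (chartAt (Coord d) y).map_source hy, hξ⟩))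
  have hm : ContinuousAt (fun w : M × M => (chartAt (Coord d) x w.1, chartAt (Coord d) y w.2, ξ))
      (x, y) := by
    have := continuousAt_chartPair (d := d) (w := (x, y)) hx hy
    exact this.fst.prodMk (this.snd.prodMk continuousAt_const)
  have h0 := (ContinuousAt.comp (f := fun w : M × M =>
    (chartAt (Coord d) x w.1, chartAt (Coord d) y w.2, ξ)) hc hm).eventually_ne (y := 0) (by
      simp only [Function.comp_apply]
      rw [pt_chartAt hx, pt_chartAt hy]
      exact hη)
  filter_upwards [h0, eventually_mem_source_prod (d := d) (w := (x, y)) hx hy] with w hw hws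
  simp only [Function.comp_apply] at hw
  rw [pt_chartAt hws.1, pt_chartAt hws.2] at hw
  exact ⟨_, hw⟩

theorem IsCutoff.diag_mem (hχ : IsCutoff g r χ) (hd : 1 ≤ d) (y : M) :
    (y, y) ∈ cutoffSupport χ := by
  obtain ⟨O, -, hO, h1⟩ := hχ.one_near_diagonal
  have hy := mem_chart_source (Coord d) y
  set ξ₀ : Coord d := stdVec ⟨0, hd⟩
  have h0 : 0 < hamiltonian g y (covec y y ξ₀) := by
    refine lt_of_le_of_ne (hamiltonian_nonneg g y _) fun h => ?_
    have h2 := hamSq_pos g ((chartAt (Coord d) y).map_source hy) (stdVec_ne_zero ⟨0, hd⟩)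
    rw [hamSq_eq g ((chartAt (Coord d) y).map_source hy), pt_chartAt hy, ← h] at h2
    norm_num at h2
  -- A covector normalised to `h = 1`, where the cut-off equals 1 on the diagonal.
  refine ⟨(hamiltonian g y (covec y y ξ₀))⁻¹ • covec y y ξ₀, ?_⟩
  rw [h1 y y _ (hO y) ?_]
  · exact one_ne_zero
  · rw [hamiltonian_smul g y _ (inv_nonneg.2 h0.le), inv_mul_cancel₀ h0.ne']

/-- All points near `x` are of the form `exp_y v` with `|v| < r`. -/
def InteriorExp (g : Metric d M) (r : ℝ) (x y : M) : Prop :=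
  ∀ᶠ x' in 𝓝 x, ∃ v : TangentSpace (𝓡 d) y, normOf g y v < r ∧ expMap g y v = x'

theorem IsCutoff.interiorExp (hχ : IsCutoff g r χ) {x y : M} (h : (x, y) ∈ cutoffSupport χ) :
    InteriorExp g r x y := by
  obtain ⟨r', hr', hs⟩ := hχ.support
  have hc : ContinuousAt (fun x' : M => (x', y)) x := by fun_prop
  filter_upwards [hc.preimage_mem_nhds ((isOpen_cutoffSupport hχ).mem_nhds h)] with x' hx'
  obtain ⟨η, hη⟩ := hx'
  obtain ⟨v, hv, hx⟩ := hs _ _ _ hη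
  exact ⟨v, hv.trans_lt hr', hx⟩

theorem exists_expCoord_eq {p x y : M} (hy : y ∈ (chartAt (Coord d) p).source) {ρ : ℝ}
    {v : TangentSpace (𝓡 d) y} (hv : normOf g y v < ρ) (hx : expMap g y v = x) :
    ∃ u : Coord d, Real.sqrt (metricForm g p (chartAt (Coord d) p y) u u) = normOf g y v ∧
      expCoord g p (u, chartAt (Coord d) p y) = x := by
  refine ⟨tangentCoordChange (𝓡 d) y p y v, ?_, ?_⟩
  · have h := inner_eq_metricForm g hy (tangentCoordChange (𝓡 d) y p y v)
      (tangentCoordChange (𝓡 d) y p y v)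
    have e : (tangentCoordChange (𝓡 d) p y y (tangentCoordChange (𝓡 d) y p y v) : Coord d) = v :=
      tangentCoordChange_inverse (mem_chart_source _ y) hy v
    rw [← h]
    exact congrArg Real.sqrt (congrArg₂ (fun a b : Coord d => g.inner y a b) e e)
  · have e : (tangentCoordChange (𝓡 d) p y y (tangentCoordChange (𝓡 d) y p y v) : Coord d) = v :=
      tangentCoordChange_inverse (mem_chart_source _ y) hy v
    rw [expCoord]
    simp only
    rw [pt_chartAt hy, ← hx]
    exact congrArg (fun v : Coord d => expMap g y v) e

theorem IsLeviCivitaPhase.linear_of_exp (hφ : IsLeviCivitaPhase g r φ) {p x y : M}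
    (hy : y ∈ (chartAt (Coord d) p).source)
    (h : ∃ v : TangentSpace (𝓡 d) y, normOf g y v < r ∧ expMap g y v = x) {ξ : Coord d}
    (hξ : ξ ≠ 0) : φ x y (covec p y ξ) = inner ℝ ξ (phaseVec φ p x y) := by
  obtain ⟨v, hv, hx⟩ := h
  obtain ⟨u, hu, rfl⟩ := exists_expCoord_eq hy hv hx
  have hz := (chartAt (Coord d) p).map_source hy
  have h1 := hφ.apply_expCoord hz (hu.trans_lt hv) hξ
  have h2 := hφ.phaseVec_expCoord hz (hu.trans_lt hv)
  rw [pt_chartAt hy] at h1 h2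
  rw [h1, h2]

theorem IsLeviCivitaPhase.continuousAt_phaseVec (hφ : IsLeviCivitaPhase g r φ) {p : M} {w : M × M}
    (hw : w.2 ∈ (chartAt (Coord d) p).source) :
    ContinuousAt (fun w : M × M => phaseVec φ p w.1 w.2) w := by
  have hx := mem_chart_source (Coord d) w.1
  have h := (hφ.hasFDerivAt_phaseVec (q := w.1) (p := p) (w := chartPair w.1 p w)
    ⟨(chartAt (Coord d) w.1).map_source hx, (chartAt (Coord d) p).map_source hw⟩).continuousAt
  refine (ContinuousAt.comp (f := chartPair w.1 p) h (continuousAt_chartPair hx hw)).congr ?_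
  filter_upwards [eventually_mem_source_prod (d := d) hx hw] with w' hw'
  simp only [Function.comp_apply, chartPair]
  rw [pt_chartAt hw'.1, pt_chartAt hw'.2]

/-- On the support `x` is the exponential of the phase vector, of length at most `r'`. Both facts
pass to limits along an ultrafilter, by joint continuity of the exponential map and because `r' <
r`. -/
theorem IsCutoff.eq_expCoord_of_mem_closure [T2Space M] (hχ : IsCutoff g r χ)
    (hφ : IsLeviCivitaPhase g r φ) (hinj : LeInjectivityRadius g r) (hr : 0 < r) (hd : 1 ≤ d)
    {p x y : M} (h : (x, y) ∈ closure (cutoffSupport χ)) (hy : y ∈ (chartAt (Coord d) p).source) :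
    Real.sqrt (metricForm g p (chartAt (Coord d) p y) (phaseVec φ p x y) (phaseVec φ p x y)) < r ∧
      expCoord g p (phaseVec φ p x y, chartAt (Coord d) p y) = x := by
  obtain ⟨r', hr', hs⟩ := hχ.support
  obtain ⟨F, hFW, hF⟩ := mem_closure_iff_ultrafilter.1 h
  set Ψ := fun w : M × M => (phaseVec φ p w.1 w.2, chartAt (Coord d) p w.2) with hΨ
  have hΨc : ContinuousAt Ψ (x, y) := (hφ.continuousAt_phaseVec (w := (x, y)) hy).prodMk
    (((chartAt (Coord d) p).continuousAt hy).comp (f := Prod.snd) (x := (x, y)) continuousAt_snd)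
  have hz := (chartAt (Coord d) p).map_source hy
  have key : ∀ᶠ w in (F : Filter (M × M)),
      Real.sqrt (metricForm g p (Ψ w).2 (Ψ w).1 (Ψ w).1) ≤ r' ∧ expCoord g p (Ψ w) = w.1 := by
    filter_upwards [hFW, hF (eventually_mem_source_prod (d := d) (w := (x, y))
      (mem_chart_source _ x) hy)] with w hw hws
    obtain ⟨η, hη⟩ := hw
    obtain ⟨v, hv, hx⟩ := hs _ _ _ hη
    obtain ⟨u, hu, hux⟩ := exists_expCoord_eq hws.2 (hv.trans_lt hr') hx
    have h2 := hφ.phaseVec_expCoord ((chartAt (Coord d) p).map_source hws.2)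
      ((hu.trans_le hv).trans_lt hr')
    rw [pt_chartAt hws.2, hux] at h2
    have h3 : Ψ w = (u, chartAt (Coord d) p w.2) := by rw [hΨ]; beta_reduce; rw [h2]
    rw [h3]
    exact ⟨hu.trans_le hv, hux⟩
  have hΨF : Tendsto Ψ F (𝓝 (Ψ (x, y))) := hΨc.tendsto.mono_left hF
  have hm : Real.sqrt (metricForm g p (Ψ (x, y)).2 (Ψ (x, y)).1 (Ψ (x, y)).1) ≤ r' := by
    have hc : ContinuousAt (fun q : Coord d × Coord d => Real.sqrt (metricForm g p q.2 q.1 q.1))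
        (Ψ (x, y)) := by
      refine Real.continuous_sqrt.continuousAt.comp ?_
      simp_rw [← inner_metricOp]
      have hM : ContinuousAt (metricOp g p) (Ψ (x, y)).2 :=
        (contDiffOn_metricOp g p).continuousOn.continuousAt
          ((chartAt (Coord d) p).open_target.mem_nhds hz)
      exact continuousAt_fst.inner (((hM.comp (f := Prod.snd) continuousAt_snd)).clm_apply
        continuousAt_fst)
    exact le_of_tendsto (hc.tendsto.comp hΨF) (key.mono fun w hw => hw.1)
  refine ⟨hm.trans_lt hr', ?_⟩
  have hE := hφ.continuousAt_expCoord hinj hr hd hz (hm.trans_lt hr')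
  have h1 : Tendsto (fun w => expCoord g p (Ψ w)) F (𝓝 (expCoord g p (Ψ (x, y)))) :=
    hE.tendsto.comp hΨF
  have h2 : Tendsto (fun w : M × M => w.1) F (𝓝 x) :=
    (continuous_fst.tendsto (x, y)).mono_left hF
  exact tendsto_nhds_unique (h1.congr' (key.mono fun w hw => hw.2)) h2

/-- A vanishing phase vector would give `x = exp_y 0 = y`. Hence the phase has no critical point in
the momentum away from the diagonal. -/
theorem IsCutoff.phaseVec_ne_zero [T2Space M] (hχ : IsCutoff g r χ)
    (hφ : IsLeviCivitaPhase g r φ) (hinj : LeInjectivityRadius g r) (hr : 0 < r) (hd : 1 ≤ d)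
    {p x y : M} (h : (x, y) ∈ closure (cutoffSupport χ)) (hy : y ∈ (chartAt (Coord d) p).source)
    (hxy : x ≠ y) : phaseVec φ p x y ≠ 0 := fun h0 => by
  have h1 := (hχ.eq_expCoord_of_mem_closure hφ hinj hr hd h hy).2
  rw [h0, hφ.expCoord_zero hr hd ((chartAt (Coord d) p).map_source hy), pt_chartAt hy] at h1
  exact hxy h1.symm

end Support

/-! ### The regularised kernel in arbitrary charts. -/

section KernelIntegral

variable {d : ℕ} {M : Type*} [TopologicalSpace M] [ChartedSpace (Coord d) M]
  [IsManifold (𝓡 d) ∞ M] (g : Metric d M) {r : ℝ} (φ : M → (y : M) → Cotangent d y → ℝ)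
  (a : M → (y : M) → Cotangent d y → ℂ)

/-- The regularised kernel of the oscillatory integral operator with amplitude `a`. -/
def kernelIntegral (x y : M) (δ : ℝ) : ℂ :=
  ∫ ξ : Coord d, Complex.exp (Complex.I * (φ x y (covec y y ξ) : ℂ)) * a x y (covec y y ξ) *
    (weight g φ x y ξ : ℂ) * (Real.exp (-δ * hamiltonian g y (covec y y ξ) ^ 2) : ℂ) *
      (((2 * Real.pi) ^ d)⁻¹ : ℝ)

/-- The vector `φ_η` in the charts at `p₁` and `p₂`. -/
def phaseCoord (p₁ p₂ : M) (q : Coord d × Coord d) : Coord d :=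
  phaseVec φ p₂ (pt p₁ q.1) (pt p₂ q.2)

/-- The matrix `φ_{xη}` in the charts at `p₁` and `p₂`. -/
def hessCoord (p₁ p₂ : M) (q : Coord d × Coord d) : Coord d →L[ℝ] Coord d :=
  fderiv ℝ (fun a => phaseCoord φ p₁ p₂ (a, q.2)) q.1

/-- The weight in the charts at `p₁` and `p₂`. -/
def weightCoord (p₁ p₂ : M) (q : Coord d × Coord d) : ℝ :=
  (density g p₁ q.1) ^ (-(1 / 2) : ℝ) * (density g p₂ q.2) ^ (-(1 / 2) : ℝ) *
    ((hessCoord φ p₁ p₂ q).det ^ 2) ^ (1 / 4 : ℝ)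

/-- The amplitude in the charts at `p₁` and `p₂`, including the weight. -/
def ampCoord (p₁ p₂ : M) (q : Coord d × Coord d) (ξ : Coord d) : ℂ :=
  ((((2 * Real.pi) ^ d)⁻¹ * weightCoord g φ p₁ p₂ q : ℝ) : ℂ) *
    a (pt p₁ q.1) (pt p₂ q.2) (covec p₂ (pt p₂ q.2) ξ)

variable {g φ}

/-- For all points near `x` the phase is linear in `ξ`, so its gradient in `ξ` is the phase vector
and the mixed Hessian is the transpose of the Jacobian of that vector in `x`. `InteriorExp` is what
allows the differentiation in `x`. -/
theorem det_mixedHessian (hφ : IsLeviCivitaPhase g r φ) {x y : M} (h : InteriorExp g r x y)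
    {ξ : Coord d} (hξ : ξ ≠ 0) :
    (mixedHessian φ x y ξ).det =
      (hessCoord φ x y (chartAt (Coord d) x x, chartAt (Coord d) y y)).det := by
  have hx := mem_chart_source (Coord d) x
  have hy := mem_chart_source (Coord d) y
  have ha := (chartAt (Coord d) x).map_source hx
  have hb := (chartAt (Coord d) y).map_source hy
  set L := hessCoord φ x y (chartAt (Coord d) x x, chartAt (Coord d) y y) with hL
  have hdf : DifferentiableAt ℝ (fun a => phaseCoord φ x y (a, chartAt (Coord d) y y))
      (chartAt (Coord d) x x) :=
    ((hφ.hasFDerivAt_phaseVec (w := (chartAt (Coord d) x x, chartAt (Coord d) y y))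
      ⟨ha, hb⟩).differentiableAt (by simp)).comp (chartAt (Coord d) x x)
      (f := fun a => (a, chartAt (Coord d) y y)) (by fun_prop)
  have hent : ∀ α β, mixedHessian φ x y ξ α β = L (stdVec α) β := fun α β => by
    have hpt : ContinuousAt (pt x) (chartAt (Coord d) x x) :=
      (continuousOn_pt x).continuousAt ((chartAt (Coord d) x).open_target.mem_nhds ha)
    have hptx : pt x (chartAt (Coord d) x x) = x := pt_chartAt hx
    have h' : ∀ᶠ x' in 𝓝 (pt x (chartAt (Coord d) x x)), ∃ v : TangentSpace (𝓡 d) y,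
        normOf g y v < r ∧ expMap g y v = x' := by rw [hptx]; exact h
    have hev : (fun z : Coord d => fderiv ℝ (fun ξ' : Coord d => φ (pt x z) y (covec y y ξ')) ξ
        (stdVec β)) =ᶠ[𝓝 (chartAt (Coord d) x x)]
        fun z => phaseCoord φ x y (z, chartAt (Coord d) y y) β := by
      filter_upwards [hpt.eventually h'] with z hz
      have hlin : (fun ξ' : Coord d => φ (pt x z) y (covec y y ξ')) =ᶠ[𝓝 ξ]
          fun ξ' => innerSL ℝ (phaseVec φ y (pt x z) y) ξ' := by
        filter_upwards [isOpen_compl_singleton.mem_nhds (show ξ ∈ ({0}ᶜ : Set (Coord d)) from hξ)]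
          with ξ' hξ'
        rw [hφ.linear_of_exp hy hz hξ', innerSL_apply_apply, real_inner_comm]
      rw [hlin.fderiv_eq, ContinuousLinearMap.fderiv, innerSL_apply_apply, inner_stdVec, phaseCoord,
        pt_chartAt hy]
    have hproj := ((EuclideanSpace.proj (𝕜 := ℝ) β : Coord d →L[ℝ] ℝ).hasFDerivAt.comp _
      hdf.hasFDerivAt).congr_of_eventuallyEq hev
    change fderiv ℝ (fun z : Coord d => fderiv ℝ
      (fun ξ' : Coord d => φ (pt x z) y (covec y y ξ')) ξ (stdVec β)) _ (stdVec α) = _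
    rw [hproj.fderiv]
    rfl
  have hmat : Matrix.toEuclideanCLM (n := Fin d) (𝕜 := ℝ) (mixedHessian φ x y ξ).transpose = L := by
    ext1 v
    ext β
    rw [clm_eq_sum L v, Matrix.ofLp_toEuclideanCLM, Matrix.mulVec, dotProduct]
    simp [hent, mul_comm]
  rw [← hmat, det_toEuclideanCLM, Matrix.det_transpose]

/-- The phase vector is a tangent vector at `y` depending on `x`: chain rule in `x`, vector
transformation in `y`. The latter follows by pairing with covectors, on which the phase is chart
independent. -/
theorem hessCoord_transition (hφ : IsLeviCivitaPhase g r φ) {p₁ p₂ x y : M}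
    (h : InteriorExp g r x y) (hx : x ∈ (chartAt (Coord d) p₁).source)
    (hy : y ∈ (chartAt (Coord d) p₂).source) :
    (hessCoord φ p₁ p₂ (chartAt (Coord d) p₁ x, chartAt (Coord d) p₂ y)).comp
        (tangentCoordChange (𝓡 d) x p₁ x) =
      (tangentCoordChange (𝓡 d) y p₂ y).comp
        (hessCoord φ x y (chartAt (Coord d) x x, chartAt (Coord d) y y)) := by
  have hxx := mem_chart_source (Coord d) x
  have hyy := mem_chart_source (Coord d) y
  have hdf : ∀ {c e : M}, x ∈ (chartAt (Coord d) c).source → y ∈ (chartAt (Coord d) e).source →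
      HasFDerivAt (fun a => phaseCoord φ c e (a, chartAt (Coord d) e y))
      (hessCoord φ c e (chartAt (Coord d) c x, chartAt (Coord d) e y)) (chartAt (Coord d) c x) :=
    fun {c e} hc he => (((hφ.hasFDerivAt_phaseVec
      (w := (chartAt (Coord d) c x, chartAt (Coord d) e y))
      ⟨(chartAt (Coord d) c).map_source hc, (chartAt (Coord d) e).map_source he⟩).differentiableAt
        (by simp)).comp (chartAt (Coord d) c x)
      (f := fun a => (a, chartAt (Coord d) e y)) (by fun_prop)).hasFDerivAt
  have hov : chartAt (Coord d) x x ∈ (overlap x p₁ : Set (Coord d)) := mem_overlap_chartAt hxx hx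
  have hθ := hasFDerivAt_transition (d := d) hov
  rw [pt_chartAt hxx] at hθ
  have hθx : transition x p₁ (chartAt (Coord d) x x) = chartAt (Coord d) p₁ x := by
    rw [transition, pt_chartAt hxx]
  have h1 : HasFDerivAt (fun a => phaseCoord φ p₁ p₂ (a, chartAt (Coord d) p₂ y))
      (hessCoord φ p₁ p₂ (chartAt (Coord d) p₁ x, chartAt (Coord d) p₂ y))
      (transition x p₁ (chartAt (Coord d) x x)) := by
    rw [hθx]; exact hdf hx hy
  have hL := h1.comp _ hθ
  have hR := (tangentCoordChange (𝓡 d) y p₂ y).hasFDerivAt.comp _ (hdf hxx hyy)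
  refine hL.unique (hR.congr_of_eventuallyEq ?_)
  have hpt : ContinuousAt (pt x) (chartAt (Coord d) x x) :=
    (continuousOn_pt x).continuousAt ((chartAt (Coord d) x).open_target.mem_nhds hov.1)
  have hptx : pt x (chartAt (Coord d) x x) = x := pt_chartAt hxx
  have h' : ∀ᶠ x' in 𝓝 (pt x (chartAt (Coord d) x x)), ∃ v : TangentSpace (𝓡 d) y,
      normOf g y v < r ∧ expMap g y v = x' := by rw [hptx]; exact h
  filter_upwards [hpt.eventually h', (isOpen_overlap x p₁).mem_nhds hov] with z hz hzo
  simp only [Function.comp_apply, phaseCoord]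
  rw [pt_transition hzo, pt_chartAt hy, pt_chartAt hyy]
  refine ext_inner_left ℝ fun ξ => ?_
  rcases eq_or_ne ξ 0 with rfl | hξ
  · simp
  · rw [← hφ.linear_of_exp hy hz hξ, ← ContinuousLinearMap.adjoint_inner_left, covec_change hyy hy,
      hφ.linear_of_exp hyy hz]
    intro h0
    refine hξ (covec_injective hy ?_)
    rw [covec_change hyy hy, h0, covec_change hyy hy, map_zero]

/-- Count of exponents: the Jacobian in `x` occurs to the power `-1/2` from the density and `1/2`
from the Hessian; the Jacobian in `y` occurs to the power `-1/2` twice, which the extra determinant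
compensates. -/
theorem weight_mul_det (hφ : IsLeviCivitaPhase g r φ) {p₁ p₂ x y : M}
    (h : InteriorExp g r x y) (hx : x ∈ (chartAt (Coord d) p₁).source)
    (hy : y ∈ (chartAt (Coord d) p₂).source) {ξ : Coord d} (hξ : ξ ≠ 0) :
    |(tangentCoordChange (𝓡 d) y p₂ y).det| * weight g φ x y ξ =
      weightCoord g φ p₁ p₂ (chartAt (Coord d) p₁ x, chartAt (Coord d) p₂ y) := by
  have hxx := mem_chart_source (Coord d) x
  have hyy := mem_chart_source (Coord d) y
  have hT : 0 < |(tangentCoordChange (𝓡 d) x p₁ x).det| :=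
    abs_pos.2 (det_tangentCoordChange_ne_zero hxx hx)
  have hA : 0 < |(tangentCoordChange (𝓡 d) y p₂ y).det| :=
    abs_pos.2 (det_tangentCoordChange_ne_zero hyy hy)
  have hρx : density g x (chartAt (Coord d) x x) =
      |(tangentCoordChange (𝓡 d) x p₁ x).det| * density g p₁ (chartAt (Coord d) p₁ x) := by
    have := density_transition g (mem_overlap_chartAt (d := d) hxx hx)
    rwa [transition, pt_chartAt hxx] at this
  have hρy : density g y (chartAt (Coord d) y y) =
      |(tangentCoordChange (𝓡 d) y p₂ y).det| * density g p₂ (chartAt (Coord d) p₂ y) := by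
    have := density_transition g (mem_overlap_chartAt (d := d) hyy hy)
    rwa [transition, pt_chartAt hyy] at this
  have hdet := congrArg (fun L : Coord d →L[ℝ] Coord d => |L.det|)
    (hessCoord_transition hφ h hx hy)
  have hmul : ∀ A B : Coord d →L[ℝ] Coord d, |(A.comp B).det| = |A.det| * |B.det| := fun A B => by
    rw [← abs_mul]
    simp [ContinuousLinearMap.det, LinearMap.det_comp]
  simp only [hmul] at hdet
  have hquarter : ∀ t : ℝ, (t ^ 2) ^ (1 / 4 : ℝ) = |t| ^ (1 / 2 : ℝ) := fun t => by
    rw [← sq_abs, ← Real.rpow_natCast, ← Real.rpow_mul (abs_nonneg t)]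
    norm_num
  rw [weight, weightCoord, det_mixedHessian hφ h hξ, hquarter, hquarter, hρx, hρy]
  set T := |(tangentCoordChange (𝓡 d) x p₁ x).det|
  set A := |(tangentCoordChange (𝓡 d) y p₂ y).det|
  set N := |(hessCoord φ p₁ p₂ (chartAt (Coord d) p₁ x, chartAt (Coord d) p₂ y)).det|
  set N' := |(hessCoord φ x y (chartAt (Coord d) x x, chartAt (Coord d) y y)).det|
  have hN' : N' = N * T / A := by rw [hdet]; field_simp
  have hρ1 := density_pos g ((chartAt (Coord d) p₁).map_source hx)
  have hρ2 := density_pos g ((chartAt (Coord d) p₂).map_source hy)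
  rw [hN', Real.mul_rpow hT.le hρ1.le, Real.mul_rpow hA.le hρ2.le,
    Real.div_rpow (mul_nonneg (abs_nonneg _) hT.le) hA.le, Real.mul_rpow (abs_nonneg _) hT.le]
  have hTT : T ^ (-(1 / 2) : ℝ) * T ^ (1 / 2 : ℝ) = 1 := by
    rw [← Real.rpow_add hT]; norm_num
  have hAA : A * (A ^ (-(1 / 2) : ℝ) / A ^ (1 / 2 : ℝ)) = 1 := by
    rw [← Real.rpow_sub hA]; norm_num
    rw [Real.rpow_neg_one, mul_inv_cancel₀ hA.ne']
  calc _ = (density g p₁ (chartAt (Coord d) p₁ x)) ^ (-(1 / 2) : ℝ) *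
      (density g p₂ (chartAt (Coord d) p₂ y)) ^ (-(1 / 2) : ℝ) * N ^ (1 / 2 : ℝ) *
      (T ^ (-(1 / 2) : ℝ) * T ^ (1 / 2 : ℝ)) * (A * (A ^ (-(1 / 2) : ℝ) / A ^ (1 / 2 : ℝ))) := by
        ring
    _ = _ := by rw [hTT, hAA, mul_one, mul_one]

/-- The fibre integral is written in the chart at `y`. Substituting the adjoint Jacobian moves it to
the chart at `p₂`, and the resulting determinant is absorbed by the weight. -/
theorem kernelIntegral_eq_oscIntegral (hφ : IsLeviCivitaPhase g r φ) (hd : 1 ≤ d) {p₁ p₂ : M}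
    {q : Coord d × Coord d} (h1 : q.1 ∈ (chartAt (Coord d) p₁).target)
    (h2 : q.2 ∈ (chartAt (Coord d) p₂).target) (h : InteriorExp g r (pt p₁ q.1) (pt p₂ q.2))
    (δ : ℝ) :
    kernelIntegral g φ a (pt p₁ q.1) (pt p₂ q.2) δ =
      oscIntegral (phaseCoord φ p₁ p₂) (fun q => hamSq g p₂ q.2) (ampCoord g φ a p₁ p₂) δ q := by
  set x := pt p₁ q.1
  set y := pt p₂ q.2 with hydef
  have hx := pt_mem_source h1
  have hy := pt_mem_source h2
  have hyy := mem_chart_source (Coord d) y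
  haveI : Nonempty (Fin d) := ⟨⟨0, hd⟩⟩
  have hdet : (tangentCoordChange (𝓡 d) y p₂ y).adjoint.det ≠ 0 := by
    rw [det_adjoint]; exact det_tangentCoordChange_ne_zero hyy hy
  rw [kernelIntegral, integral_comp_clm_of_det_ne_zero volume _ hdet, det_adjoint, oscIntegral,
    ← integral_smul]
  refine integral_congr_ae ?_
  -- Nothing is assumed about the phase at `ξ = 0`; since `d ≥ 1` this is a null set.
  have hne : ∀ᵐ ξ : Coord d, ξ ≠ 0 := by
    rw [ae_iff]
    simp
  filter_upwards [hne] with ξ hξ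
  have hξ' : (tangentCoordChange (𝓡 d) y p₂ y).adjoint ξ ≠ 0 := by
    intro h0
    refine hξ (covec_injective hy ?_)
    rw [covec_change hyy hy, h0, covec_change hyy hy, map_zero]
  rw [← covec_change hyy hy, hφ.linear_of_exp hy h.self_of_nhds hξ, hamiltonian_sq g hy,
    chartAt_pt h2, oscIntegrand, ampCoord, phaseCoord]
  have hw := weight_mul_det hφ h hx hy hξ'
  rw [chartAt_pt h1, chartAt_pt h2] at hw
  rw [← hw, Complex.real_smul, hamSq]
  push_cast
  ring

end KernelIntegral

/-! ### Regularity of amplitudes and kernels in charts. -/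

theorem contDiff_det {d : ℕ} : ContDiff ℝ ∞ fun L : Coord d →L[ℝ] Coord d => L.det := by
  have h : (fun L : Coord d →L[ℝ] Coord d => L.det) =
      fun L => (Matrix.of fun i j => L (stdVec j) i).det := by
    funext L
    have hL : Matrix.toEuclideanCLM (n := Fin d) (𝕜 := ℝ) (Matrix.of fun i j => L (stdVec j) i) =
        L := by
      ext1 v
      ext β
      rw [clm_eq_sum L v, Matrix.ofLp_toEuclideanCLM, Matrix.mulVec, dotProduct]
      simp [mul_comm]
    rw [← det_toEuclideanCLM, hL]
  rw [h]
  simp_rw [Matrix.det_apply]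
  refine ContDiff.sum fun σ _ => ContDiff.const_smul _ (contDiff_prod fun i _ => ?_)
  exact ((EuclideanSpace.proj (𝕜 := ℝ) (σ i) : Coord d →L[ℝ] ℝ).comp
    (ContinuousLinearMap.apply ℝ (Coord d) (stdVec i : Coord d))).contDiff

theorem Elliptic.comp {P P' E : Type} [NormedAddCommGroup P] [NormedSpace ℝ P]
    [NormedAddCommGroup P'] [NormedSpace ℝ P'] [NormedAddCommGroup E] [InnerProductSpace ℝ E]
    {Ω : Set P} {Ω' : Set P'} {H : P → E → ℝ} (hH : Elliptic Ω H) (hΩ' : IsOpen Ω') {κ : P' → P}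
    (hκ : ContDiffOn ℝ ∞ κ Ω') (hmaps : MapsTo κ Ω' Ω) :
    Elliptic Ω' fun q ξ => H (κ q) ξ := by
  refine ⟨?_, fun q hq => hH.homog _ (hmaps hq), fun q hq => ?_⟩
  · exact hH.smooth.comp (f := fun p : P' × E => (κ p.1, p.2))
      ((hκ.comp contDiffOn_fst fun p hp => hp.1).prodMk contDiffOn_snd)
      fun p hp => ⟨hmaps hp.1, mem_univ _⟩
  · obtain ⟨U, hU, c, hc, h⟩ := hH.lower _ (hmaps hq)
    exact ⟨_, (hκ.continuousOn.continuousAt (hΩ'.mem_nhds hq)).preimage_mem_nhds hU, c, hc,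
      fun q' hq' => h _ hq'⟩

theorem HomAmp.restrict {P E : Type} [NormedAddCommGroup P] [NormedSpace ℝ P]
    [NormedAddCommGroup E] [InnerProductSpace ℝ E] {Ω Ω' : Set P} {R : ℝ} {m : ℤ} {a : P → E → ℂ}
    (ha : HomAmp Ω R m a) (h : Ω' ⊆ Ω) : HomAmp Ω' R m a :=
  ⟨ha.smooth.mono (prod_mono h subset_rfl), fun q hq => ha.homog q (h hq)⟩

section Regularity

variable {d : ℕ} {M : Type*} [TopologicalSpace M] [ChartedSpace (Coord d) M]
  [IsManifold (𝓡 d) ∞ M] {g : Metric d M} {r : ℝ} {φ : M → (y : M) → Cotangent d y → ℝ}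
  {χ : M → (y : M) → Cotangent d y → ℂ}

/-- The domain of a pair of charts. -/
def chartDomain (p₁ p₂ : M) : Set (Coord d × Coord d) :=
  (chartAt (Coord d) p₁).target ×ˢ (chartAt (Coord d) p₂).target

theorem isOpen_chartDomain (p₁ p₂ : M) : IsOpen (chartDomain (d := d) p₁ p₂) :=
  (chartAt (Coord d) p₁).open_target.prod (chartAt (Coord d) p₂).open_target

theorem chartPair_mem {p₁ p₂ : M} {w : M × M} (h1 : w.1 ∈ (chartAt (Coord d) p₁).source)
    (h2 : w.2 ∈ (chartAt (Coord d) p₂).source) : chartPair p₁ p₂ w ∈ chartDomain (d := d) p₁ p₂ :=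
  ⟨(chartAt (Coord d) p₁).map_source h1, (chartAt (Coord d) p₂).map_source h2⟩

/-- The pair of points with given coordinates. -/
def ptPair (p₁ p₂ : M) (q : Coord d × Coord d) : M × M := (pt p₁ q.1, pt p₂ q.2)

theorem ptPair_chartPair {p₁ p₂ : M} {w : M × M} (h1 : w.1 ∈ (chartAt (Coord d) p₁).source)
    (h2 : w.2 ∈ (chartAt (Coord d) p₂).source) : ptPair p₁ p₂ (chartPair (d := d) p₁ p₂ w) = w :=
  Prod.ext (pt_chartAt h1) (pt_chartAt h2)

theorem continuousOn_ptPair (p₁ p₂ : M) :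
    ContinuousOn (ptPair p₁ p₂) (chartDomain (d := d) p₁ p₂) :=
  ((continuousOn_pt p₁).comp continuousOn_fst fun _ h => h.1).prodMk
    ((continuousOn_pt p₂).comp continuousOn_snd fun _ h => h.2)

theorem elliptic_hamSq_snd (g : Metric d M) (p₁ p₂ : M) :
    Elliptic (chartDomain (d := d) p₁ p₂) fun q => hamSq g p₂ q.2 :=
  (elliptic_hamSq g p₂).comp (isOpen_chartDomain p₁ p₂) contDiffOn_snd fun _ h => h.2

theorem Elliptic.restrict {P E : Type} [NormedAddCommGroup P] [NormedSpace ℝ P]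
    [NormedAddCommGroup E] [InnerProductSpace ℝ E] {Ω Ω' : Set P} {H : P → E → ℝ}
    (hH : Elliptic Ω H) (h : Ω' ⊆ Ω) : Elliptic Ω' H :=
  ⟨hH.smooth.mono (prod_mono h subset_rfl), fun q hq => hH.homog q (h hq),
    fun q hq => hH.lower q (h hq)⟩

theorem IsLeviCivitaPhase.contDiffOn_phaseCoord (hφ : IsLeviCivitaPhase g r φ) (p₁ p₂ : M) :
    ContDiffOn ℝ ∞ (phaseCoord φ p₁ p₂) (chartDomain p₁ p₂) := hφ.contDiffOn_phaseVec p₁ p₂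

theorem IsLeviCivitaPhase.contDiffOn_hessCoord (hφ : IsLeviCivitaPhase g r φ) (p₁ p₂ : M) :
    ContDiffOn ℝ ∞ (hessCoord φ p₁ p₂) (chartDomain p₁ p₂) := by
  have h := (hφ.contDiffOn_phaseCoord p₁ p₂).fderiv_of_isOpen (m := ∞) (isOpen_chartDomain p₁ p₂)
    (by simp)
  refine (h.clm_comp (contDiffOn_const
    (c := ContinuousLinearMap.inl ℝ (Coord d) (Coord d)))).congr fun q hq => ?_
  have h1 : HasFDerivAt (phaseCoord φ p₁ p₂) (fderiv ℝ (phaseCoord φ p₁ p₂) q) (q.1, q.2) :=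
    (((hφ.contDiffOn_phaseCoord p₁ p₂).contDiffAt
      ((isOpen_chartDomain p₁ p₂).mem_nhds hq)).differentiableAt (by simp)).hasFDerivAt
  have h2 : HasFDerivAt (fun a : Coord d => (a, q.2)) (ContinuousLinearMap.inl ℝ _ _) q.1 :=
    hasFDerivAt_prodMk_left _ _
  exact (h1.comp q.1 h2).fderiv

/-- The part of the domain of a pair of charts where the matrix `φ_{xη}` is invertible. -/
def regularRegion (φ : M → (y : M) → Cotangent d y → ℝ) (p₁ p₂ : M) : Set (Coord d × Coord d) :=
  {q | q ∈ chartDomain p₁ p₂ ∧ (hessCoord φ p₁ p₂ q).det ≠ 0}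

theorem regularRegion_subset (p₁ p₂ : M) : regularRegion φ p₁ p₂ ⊆ chartDomain p₁ p₂ :=
  fun _ h => h.1

theorem IsLeviCivitaPhase.isOpen_regularRegion (hφ : IsLeviCivitaPhase g r φ) (p₁ p₂ : M) :
    IsOpen (regularRegion φ p₁ p₂) :=
  (contDiff_det.continuous.comp_continuousOn
    (hφ.contDiffOn_hessCoord p₁ p₂).continuousOn).isOpen_inter_preimage
      (isOpen_chartDomain p₁ p₂) isOpen_compl_singleton

theorem IsLeviCivitaPhase.contDiffOn_weightCoord (hφ : IsLeviCivitaPhase g r φ) (p₁ p₂ : M) :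
    ContDiffOn ℝ ∞ (weightCoord g φ p₁ p₂) (regularRegion φ p₁ p₂) := by
  refine ContDiffOn.mul (ContDiffOn.mul ?_ ?_) ?_
  · exact ((contDiffOn_density g p₁).comp contDiffOn_fst fun q hq => hq.1.1).rpow_const_of_ne
      fun q hq => (density_pos g hq.1.1).ne'
  · exact ((contDiffOn_density g p₂).comp contDiffOn_snd fun q hq => hq.1.2).rpow_const_of_ne
      fun q hq => (density_pos g hq.1.2).ne'
  · exact ((contDiff_det.comp_contDiffOn ((hφ.contDiffOn_hessCoord p₁ p₂).mono
      (regularRegion_subset p₁ p₂))).pow 2).rpow_const_of_ne fun q hq => pow_ne_zero 2 hq.2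

theorem IsCutoff.chartPair_mem_regularRegion [T2Space M] (hχ : IsCutoff g r χ)
    (hφ : IsLeviCivitaPhase g r φ) (hinj : LeInjectivityRadius g r) (hr : 0 < r) (hd : 1 ≤ d)
    {p₁ p₂ : M} {w : M × M} (h : w ∈ closure (cutoffSupport χ))
    (h1 : w.1 ∈ (chartAt (Coord d) p₁).source) (h2 : w.2 ∈ (chartAt (Coord d) p₂).source) :
    chartPair p₁ p₂ w ∈ regularRegion φ p₁ p₂ := by
  refine ⟨chartPair_mem h1 h2, ?_⟩
  obtain ⟨hu, hx⟩ := hχ.eq_expCoord_of_mem_closure (p := p₂) (x := w.1) (y := w.2) hφ hinj hr hd h h2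
  have := hφ.det_fderiv_phaseVec_ne_zero hinj ((chartAt (Coord d) p₂).map_source h2) hu
    (q := p₁) (by rw [hx]; exact h1)
  rw [hx] at this
  exact this

/-- A function on `M × T'M` in the charts at `p₁` and `p₂`. -/
def pullCoord (a : M → (y : M) → Cotangent d y → ℂ) (p₁ p₂ : M) (q : Coord d × Coord d)
    (ξ : Coord d) : ℂ :=
  a (pt p₁ q.1) (pt p₂ q.2) (covec p₂ (pt p₂ q.2) ξ)

theorem ampCoord_eq (a : M → (y : M) → Cotangent d y → ℂ) (p₁ p₂ : M) (q : Coord d × Coord d)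
    (ξ : Coord d) : ampCoord g φ a p₁ p₂ q ξ =
      ((((2 * Real.pi) ^ d)⁻¹ * weightCoord g φ p₁ p₂ q : ℝ) : ℂ) * pullCoord a p₁ p₂ q ξ := rfl

theorem IsLeviCivitaPhase.contDiffOn_weightFactor (hφ : IsLeviCivitaPhase g r φ) (p₁ p₂ : M) :
    ContDiffOn ℝ ∞ (fun p : (Coord d × Coord d) × Coord d =>
      ((((2 * Real.pi) ^ d)⁻¹ * weightCoord g φ p₁ p₂ p.1 : ℝ) : ℂ))
      (regularRegion φ p₁ p₂ ×ˢ univ) :=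
  Complex.ofRealCLM.contDiff.comp_contDiffOn (contDiffOn_const.mul
    ((hφ.contDiffOn_weightCoord p₁ p₂).comp contDiffOn_fst fun _ h => h.1))

theorem IsLeviCivitaPhase.homAmp_weightFactor (hφ : IsLeviCivitaPhase g r φ) (p₁ p₂ : M) (R : ℝ) :
    HomAmp (regularRegion φ p₁ p₂) R 0 (fun q (_ : Coord d) =>
      ((((2 * Real.pi) ^ d)⁻¹ * weightCoord g φ p₁ p₂ q : ℝ) : ℂ)) :=
  ⟨hφ.contDiffOn_weightFactor p₁ p₂, fun q _ ξ _ lam _ => by simp⟩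

/-- The cut-off is identically zero near the zero section, because it vanishes for `h ≤ 1 / 2`;
smoothness therefore extends across `ξ = 0`. -/
theorem IsCutoff.contDiffOn_pullCoord (hχ : IsCutoff g r χ) (p₁ p₂ : M) :
    ContDiffOn ℝ ∞ (fun p : (Coord d × Coord d) × Coord d => pullCoord χ p₁ p₂ p.1 p.2)
      (chartDomain p₁ p₂ ×ˢ univ) := by
  rintro ⟨q, ξ⟩ ⟨hq, -⟩
  refine ContDiffAt.contDiffWithinAt ?_
  rcases eq_or_ne ξ 0 with rfl | hξ
  · have hH := (contDiffOn_hamSq g p₂).continuousOn.continuousAt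
      (((chartAt (Coord d) p₂).open_target.prod isOpen_univ).mem_nhds
        (show (q.2, (0 : Coord d)) ∈ _ from ⟨hq.2, mem_univ _⟩))
    have hc : ContinuousAt (fun p : (Coord d × Coord d) × Coord d => hamSq g p₂ p.1.2 p.2)
        (q, 0) := ContinuousAt.comp (g := fun q : Coord d × Coord d => hamSq g p₂ q.1 q.2)
      (f := fun p : (Coord d × Coord d) × Coord d => (p.1.2, p.2)) (x := (q, 0)) hH (by fun_prop)
    have h0 : hamSq g p₂ q.2 0 < 1 / 4 := by simp [hamSq, quadForm]
    refine (contDiffAt_const (c := (0 : ℂ))).congr_of_eventuallyEq ?_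
    filter_upwards [hc.eventually_lt continuousAt_const h0,
      (continuousAt_fst (p := (q, (0 : Coord d)))).preimage_mem_nhds
        ((isOpen_chartDomain p₁ p₂).mem_nhds hq)] with p hp hpq
    refine hχ.zero_of_le _ _ _ ?_
    rw [hamSq_eq g hpq.2] at hp
    nlinarith [hamiltonian_nonneg g (pt p₂ p.1.2) (covec p₂ (pt p₂ p.1.2) p.2)]
  · have h := (hχ.smooth p₁ p₂).contDiffAt (((chartAt (Coord d) p₁).open_target.prod
      ((chartAt (Coord d) p₂).open_target.prod isOpen_compl_singleton)).mem_nhds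
      (show (q.1, q.2, ξ) ∈ _ from ⟨hq.1, hq.2, hξ⟩))
    exact h.comp (q, ξ) (f := fun p : (Coord d × Coord d) × Coord d => (p.1.1, p.1.2, p.2))
      (by fun_prop)

theorem exists_one_le_hamiltonian (g : Metric d M) {p : M} {z₀ : Coord d}
    (hz₀ : z₀ ∈ (chartAt (Coord d) p).target) :
    ∃ U ∈ 𝓝 z₀, ∃ R : ℝ, 0 ≤ R ∧ ∀ z ∈ U, ∀ ξ : Coord d, R < ‖ξ‖ →
      1 ≤ hamiltonian g (pt p z) (covec p (pt p z) ξ) := by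
  obtain ⟨U, hU, c, hc, h⟩ := (elliptic_hamSq g p).lower z₀ hz₀
  refine ⟨_, inter_mem hU ((chartAt (Coord d) p).open_target.mem_nhds hz₀), Real.sqrt c⁻¹,
    Real.sqrt_nonneg _, fun z hz ξ hξ => ?_⟩
  have h1 := h z hz.1 ξ
  rw [hamSq_eq g hz.2] at h1
  have h2 : c⁻¹ < ‖ξ‖ ^ 2 := by
    rw [Real.sqrt_lt' ((Real.sqrt_nonneg _).trans_lt hξ)] at hξ
    exact hξ
  have h3 : 1 ≤ c * ‖ξ‖ ^ 2 := by
    have := mul_lt_mul_of_pos_left h2 hc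
    rw [mul_inv_cancel₀ hc.ne'] at this
    exact this.le
  nlinarith [hamiltonian_nonneg g (pt p z) (covec p (pt p z) ξ)]

theorem IsCutoff.exists_homAmp (hχ : IsCutoff g r χ) {p₁ p₂ : M} {q₀ : Coord d × Coord d}
    (hq₀ : q₀ ∈ chartDomain p₁ p₂) : ∃ Ω ⊆ chartDomain p₁ p₂, IsOpen Ω ∧ q₀ ∈ Ω ∧
      ∃ R : ℝ, 0 ≤ R ∧ HomAmp Ω R 0 (pullCoord χ p₁ p₂) ∧ ∀ q ∈ Ω, ∀ ξ : Coord d, R < ‖ξ‖ →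
        1 ≤ hamiltonian g (pt p₂ q.2) (covec p₂ (pt p₂ q.2) ξ) := by
  obtain ⟨U, hU, R, hR, h⟩ := exists_one_le_hamiltonian g hq₀.2
  obtain ⟨U', hU'U, hU'o, hU'⟩ := mem_nhds_iff.1 hU
  refine ⟨chartDomain p₁ p₂ ∩ Prod.snd ⁻¹' U', inter_subset_left,
    (isOpen_chartDomain p₁ p₂).inter (hU'o.preimage continuous_snd), ⟨hq₀, hU'⟩, R, hR,
    ⟨(hχ.contDiffOn_pullCoord p₁ p₂).mono (prod_mono inter_subset_left subset_rfl),
      fun q hq ξ hξ lam hlam => ?_⟩, fun q hq => h _ (hU'U hq.2)⟩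
  rw [pullCoord, covec_smul, hχ.homogeneous _ _ _ (h _ (hU'U hq.2) ξ hξ) lam hlam]
  simp [pullCoord]

theorem IsCutoff.exists_homAmp_ampCoord [T2Space M] (hχ : IsCutoff g r χ)
    (hφ : IsLeviCivitaPhase g r φ) (hinj : LeInjectivityRadius g r) (hr : 0 < r) (hd : 1 ≤ d)
    {w : M × M} (h : w ∈ closure (cutoffSupport χ)) :
    ∃ Ω ⊆ regularRegion φ w.1 w.2, IsOpen Ω ∧ chartPair w.1 w.2 w ∈ Ω ∧ ∃ R : ℝ, 0 ≤ R ∧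
      HomAmp Ω R 0 (ampCoord g φ χ w.1 w.2) ∧ ∀ q ∈ Ω, ∀ ξ : Coord d, R < ‖ξ‖ →
        1 ≤ hamiltonian g (pt w.2 q.2) (covec w.2 (pt w.2 q.2) ξ) := by
  have h1 := mem_chart_source (Coord d) w.1
  have h2 := mem_chart_source (Coord d) w.2
  obtain ⟨Ω, -, hΩ, hw, R, hR, hhom, hone⟩ := hχ.exists_homAmp (chartPair_mem (d := d) h1 h2)
  refine ⟨regularRegion φ w.1 w.2 ∩ Ω, inter_subset_left,
    (hφ.isOpen_regularRegion w.1 w.2).inter hΩ,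
    ⟨hχ.chartPair_mem_regularRegion hφ hinj hr hd h h1 h2, hw⟩, R, hR, ?_, fun q hq => hone q hq.2⟩
  exact ((hφ.homAmp_weightFactor w.1 w.2 R).restrict inter_subset_left).mul
    (hhom.restrict inter_subset_right)

theorem kernelIntegral_eq_zero {a : M → (y : M) → Cotangent d y → ℂ}
    (ha : ∀ x y, (x, y) ∉ cutoffSupport χ → ∀ η : Cotangent d y, a x y η = 0) {x y : M}
    (h : (x, y) ∉ cutoffSupport χ) (δ : ℝ) : kernelIntegral g φ a x y δ = 0 := by
  simp [kernelIntegral, ha x y h]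

/-- Off the support both sides vanish, so the linear form of the phase may be used on the whole
chart domain, including where `φ` is an arbitrary continuation. -/
theorem IsCutoff.kernelIntegral_eq_oscIntegral (hχ : IsCutoff g r χ)
    (hφ : IsLeviCivitaPhase g r φ) (hd : 1 ≤ d) {a : M → (y : M) → Cotangent d y → ℂ}
    (ha : ∀ x y, (x, y) ∉ cutoffSupport χ → ∀ η : Cotangent d y, a x y η = 0) {p₁ p₂ : M}
    {q : Coord d × Coord d} (hq : q ∈ chartDomain p₁ p₂) (δ : ℝ) :
    kernelIntegral g φ a (pt p₁ q.1) (pt p₂ q.2) δ =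
      oscIntegral (phaseCoord φ p₁ p₂) (fun q => hamSq g p₂ q.2) (ampCoord g φ a p₁ p₂) δ q := by
  by_cases h : (pt p₁ q.1, pt p₂ q.2) ∈ cutoffSupport χ
  · exact LeviCivitaPhase.kernelIntegral_eq_oscIntegral a hφ hd hq.1 hq.2 (hχ.interiorExp h) δ
  · rw [kernelIntegral_eq_zero ha h, oscIntegral]
    simp [oscIntegrand, ampCoord, ha _ _ h]

/-- Near `w`, the functions `k(·, ·, δ)` are continuous, are uniformly bounded, and converge to the
smooth function `K`. -/
structure RegularKernelAt (k : M → M → ℝ → ℂ) (K : M → M → ℂ) (w : M × M) : Prop where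
  exists_nhd : ∃ Ω ⊆ chartDomain (d := d) w.1 w.2, IsOpen Ω ∧ chartPair w.1 w.2 w ∈ Ω ∧
    ContDiffOn ℝ ∞ (fun q => K (pt w.1 q.1) (pt w.2 q.2)) Ω ∧
    ConvBdd Ω (fun δ q => k (pt w.1 q.1) (pt w.2 q.2) δ) (fun q => K (pt w.1 q.1) (pt w.2 q.2)) ∧
    ∀ δ > 0, ContinuousOn (fun q => k (pt w.1 q.1) (pt w.2 q.2) δ) Ω

theorem convBdd_zero {P : Type} [NormedAddCommGroup P] [NormedSpace ℝ P] (Ω : Set P) :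
    ConvBdd Ω (fun _ _ => 0) (fun _ => 0) :=
  ⟨fun _ _ => tendsto_const_nhds, fun _ _ => ⟨univ, univ_mem, 0, by simp⟩⟩

theorem RegularKernelAt.of_notMem_closure {a : M → (y : M) → Cotangent d y → ℂ}
    (ha : ∀ x y, (x, y) ∉ cutoffSupport χ → ∀ η : Cotangent d y, a x y η = 0) {w : M × M}
    (h : w ∉ closure (cutoffSupport χ)) {K : M → M → ℂ}
    (hK : ∀ x y, (x, y) ∉ cutoffSupport χ → (x, y) ∉ closure (cutoffSupport χ) → K x y = 0) :
    RegularKernelAt (d := d) (kernelIntegral g φ a) K w := by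
  have h1 := mem_chart_source (Coord d) w.1
  have h2 := mem_chart_source (Coord d) w.2
  have hcl : ∀ q ∈ chartDomain (d := d) w.1 w.2 ∩ ptPair w.1 w.2 ⁻¹' (closure (cutoffSupport χ))ᶜ,
      (pt w.1 q.1, pt w.2 q.2) ∉ cutoffSupport χ ∧
      (pt w.1 q.1, pt w.2 q.2) ∉ closure (cutoffSupport χ) :=
    fun q hq => ⟨fun h => hq.2 (subset_closure h), hq.2⟩
  have hk : ∀ q ∈ chartDomain (d := d) w.1 w.2 ∩ ptPair w.1 w.2 ⁻¹' (closure (cutoffSupport χ))ᶜ,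
      ∀ δ, kernelIntegral g φ a (pt w.1 q.1) (pt w.2 q.2) δ = 0 := fun q hq δ =>
    kernelIntegral_eq_zero ha (hcl q hq).1 δ
  have hΩ := (continuousOn_ptPair (d := d) w.1 w.2).isOpen_inter_preimage
    (t := (closure (cutoffSupport χ))ᶜ)
    (isOpen_chartDomain w.1 w.2) isClosed_closure.isOpen_compl
  refine ⟨_, inter_subset_left, hΩ, ⟨chartPair_mem h1 h2, ?_⟩, ?_, ?_, fun δ _ => ?_⟩
  · rw [mem_preimage, ptPair_chartPair h1 h2]; exact h
  · exact contDiffOn_const.congr fun q hq => hK _ _ (hcl q hq).1 (hcl q hq).2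
  · exact (convBdd_zero _).congr hΩ (fun q hq δ _ => (hk q hq δ).symm)
      fun q hq => (hK _ _ (hcl q hq).1 (hcl q hq).2).symm
  · exact continuousOn_const.congr fun q hq => hk q hq δ

end Regularity

/-- Zero is homogeneous of every degree, so amplitudes vanishing at large momenta have all orders at
once. -/
theorem HomAmp.of_eq_zero {P E : Type} [NormedAddCommGroup P] [NormedSpace ℝ P]
    [NormedAddCommGroup E] [InnerProductSpace ℝ E] {Ω : Set P} {R : ℝ} (hR : 0 ≤ R)
    {a : P → E → ℂ} (ha : ContDiffOn ℝ ∞ (fun p : P × E => a p.1 p.2) (Ω ×ˢ univ))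
    (h0 : ∀ q ∈ Ω, ∀ ξ, R < ‖ξ‖ → a q ξ = 0) (m : ℤ) : HomAmp Ω R m a := by
  refine ⟨ha, fun q hq ξ hξ lam hlam => ?_⟩
  rw [h0 q hq ξ hξ, h0 q hq, mul_zero]
  rw [norm_smul, Real.norm_of_nonneg (by linarith)]
  nlinarith

theorem oscIntegral_add {P E : Type} [NormedAddCommGroup P] [NormedSpace ℝ P]
    [NormedAddCommGroup E] [InnerProductSpace ℝ E] [MeasurableSpace E] [BorelSpace E]
    [FiniteDimensional ℝ E] {Ω : Set P} {V : P → E} {H : P → E → ℝ} (hH : Elliptic Ω H)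
    {m n : ℝ} {k l : ℕ} {a b : P → E → ℂ} (ha : GrowthBound Ω k m a) (hb : GrowthBound Ω l n b)
    {δ : ℝ} (hδ : 0 < δ) {q : P} (hq : q ∈ Ω) :
    oscIntegral V H (fun q ξ => a q ξ + b q ξ) δ q =
      oscIntegral V H a δ q + oscIntegral V H b δ q := by
  rw [oscIntegral, oscIntegral, oscIntegral, ← integral_add
    (integrable_oscIntegrand hH ha hδ hq) (integrable_oscIntegrand hH hb hδ hq)]
  refine integral_congr_ae (.of_forall fun ξ => ?_)
  simp only [oscIntegrand]
  ring

theorem tendsto_rpow_mul_exp_neg_div {c : ℝ} (hc : 0 < c) (s : ℝ) :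
    Tendsto (fun δ : ℝ => (Real.pi / δ) ^ s * Real.exp (-c / (4 * δ))) (𝓝[>] 0) (𝓝 0) := by
  have h := (tendsto_rpow_mul_exp_neg_mul_atTop_nhds_zero s (c / 4) (by positivity)).comp
    tendsto_inv_nhdsGT_zero
  have h2 := h.const_mul (Real.pi ^ s)
  rw [mul_zero] at h2
  refine h2.congr' ?_
  filter_upwards [self_mem_nhdsWithin] with δ hδ
  have hδ' : (0 : ℝ) < δ := hδ
  simp only [Function.comp_apply]
  have h3 : Real.exp (-(c / 4) * δ⁻¹) = Real.exp (-c / (4 * δ)) := by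
    congr 1
    field_simp
  rw [div_eq_mul_inv Real.pi, Real.mul_rpow Real.pi_pos.le (inv_nonneg.2 hδ'.le), mul_assoc, h3]

/-! ### The kernel of the remainder, off and near the diagonal. -/

section Kernels

variable {d : ℕ} {M : Type*} [TopologicalSpace M] [ChartedSpace (Coord d) M]
  [IsManifold (𝓡 d) ∞ M] {g : Metric d M} {r : ℝ} {φ : M → (y : M) → Cotangent d y → ℝ}
  {χ : M → (y : M) → Cotangent d y → ℂ}

theorem RegularKernelAt.of_growthBound (hφ : IsLeviCivitaPhase g r φ)
    {a : M → (y : M) → Cotangent d y → ℂ} {K : M → M → ℂ} {w : M × M}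
    {Ω : Set (Coord d × Coord d)} (hsub : Ω ⊆ chartDomain w.1 w.2) (hΩ : IsOpen Ω)
    (hw : chartPair w.1 w.2 w ∈ Ω)
    (hb : ∀ k N : ℕ, GrowthBound Ω k (-(N : ℝ)) (ampCoord g φ a w.1 w.2))
    (hk : ∀ q ∈ Ω, ∀ δ, kernelIntegral g φ a (pt w.1 q.1) (pt w.2 q.2) δ =
      oscIntegral (phaseCoord φ w.1 w.2) (fun q => hamSq g w.2 q.2) (ampCoord g φ a w.1 w.2) δ q)
    (hK : ∀ q ∈ Ω, K (pt w.1 q.1) (pt w.2 q.2) =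
      kernelIntegral g φ a (pt w.1 q.1) (pt w.2 q.2) 0) :
    RegularKernelAt (d := d) (kernelIntegral g φ a) K w := by
  have hH := (elliptic_hamSq_snd g w.1 w.2).restrict hsub
  have hV := (hφ.contDiffOn_phaseCoord w.1 w.2).mono hsub
  obtain ⟨h1, h2⟩ := exists_smooth_limit_of_growthBound hΩ hH hV hb
  have hK' : ∀ q ∈ Ω, K (pt w.1 q.1) (pt w.2 q.2) = oscIntegral (phaseCoord φ w.1 w.2)
      (fun q => hamSq g w.2 q.2) (ampCoord g φ a w.1 w.2) 0 q := fun q hq => by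
    rw [hK q hq, hk q hq]
  exact ⟨Ω, hsub, hΩ, hw, h1.congr hK', h2.congr hΩ (fun q hq δ _ => (hk q hq δ).symm)
    fun q hq => (hK' q hq).symm, fun δ hδ =>
    (continuousOn_oscIntegral hΩ hH hV (hb 0 0) hδ).congr fun q hq => hk q hq δ⟩

theorem growthBound_ampCoord_one (hφ : IsLeviCivitaPhase g r φ) (p₁ p₂ : M) (k : ℕ) :
    GrowthBound (regularRegion φ p₁ p₂) k 0 (ampCoord g φ (fun _ _ _ => 1) p₁ p₂) := by
  have h := (hφ.homAmp_weightFactor (g := g) p₁ p₂ 0).growthBound (hφ.isOpen_regularRegion p₁ p₂)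
    le_rfl k
  simp only [Int.cast_zero] at h
  have e : ampCoord g φ (fun _ _ _ => 1) p₁ p₂ = fun q (_ : Coord d) =>
      ((((2 * Real.pi) ^ d)⁻¹ * weightCoord g φ p₁ p₂ q : ℝ) : ℂ) := by
    funext q ξ
    rw [ampCoord, mul_one]
  rw [e]
  exact h

/-- A linear phase and a quadratic regulariser: the fibre integral is the Fourier transform of a
Gaussian, and the root of the determinant of the metric appears as the density. -/
theorem kernelIntegral_one (hφ : IsLeviCivitaPhase g r φ) (hd : 1 ≤ d) {p₁ p₂ : M}
    {q : Coord d × Coord d} (hq : q ∈ chartDomain p₁ p₂)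
    (h : InteriorExp g r (pt p₁ q.1) (pt p₂ q.2)) {δ : ℝ} (hδ : 0 < δ) :
    kernelIntegral g φ (fun _ _ _ => 1) (pt p₁ q.1) (pt p₂ q.2) δ =
      ((((2 * Real.pi) ^ d)⁻¹ * weightCoord g φ p₁ p₂ q * density g p₂ q.2 *
        ((Real.pi / δ) ^ ((d : ℝ) / 2) *
          Real.exp (-(quadForm (gram g p₂ q.2) (phaseCoord φ p₁ p₂ q)) / (4 * δ))) : ℝ) : ℂ) := by
  rw [kernelIntegral_eq_oscIntegral _ hφ hd hq.1 hq.2 h, oscIntegral]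
  have hint := integral_gaussian_quadForm (posDef_gram g hq.2) (phaseCoord φ p₁ p₂ q) hδ
  have : ∀ ξ : Coord d, oscIntegrand (phaseCoord φ p₁ p₂) (fun q => hamSq g p₂ q.2)
      (ampCoord g φ (fun _ _ _ => 1) p₁ p₂) δ q ξ =
      ((((2 * Real.pi) ^ d)⁻¹ * weightCoord g φ p₁ p₂ q : ℝ) : ℂ) *
      (Complex.exp (Complex.I * (inner ℝ ξ (phaseCoord φ p₁ p₂ q) : ℝ)) *
        (Real.exp (-δ * quadForm (gram g p₂ q.2)⁻¹ ξ) : ℂ)) := fun ξ => by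
    simp only [oscIntegrand, ampCoord, hamSq]
    ring
  simp_rw [this]
  rw [integral_const_mul, hint, density]
  push_cast
  ring

open Classical in
/-- The kernel of the smoothing operator `𝔍_{φ,1} - Id`. -/
def remainderKernel (g : Metric d M) (φ : M → (y : M) → Cotangent d y → ℝ)
    (χ : M → (y : M) → Cotangent d y → ℂ) (x y : M) : ℂ :=
  if x = y then kernelIntegral g φ (fun x y η => χ x y η - 1) x y 0
  else limUnder (𝓝[>] 0) (kernelIntegral g φ χ x y)

theorem IsCutoff.support_self (x y : M) (h : (x, y) ∉ cutoffSupport χ) (η : Cotangent d y) :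
    χ x y η = 0 := by
  by_contra h0
  exact h ⟨η, h0⟩

/-- Away from the closed support everything vanishes. On it the phase vector is nonzero off the
diagonal, so the oscillatory integral is nonstationary and converges to a smooth function. -/
theorem IsCutoff.regularKernelAt_of_ne [T2Space M] (hχ : IsCutoff g r χ)
    (hφ : IsLeviCivitaPhase g r φ) (hinj : LeInjectivityRadius g r) (hr : 0 < r) (hd : 1 ≤ d)
    {w : M × M} (hw : w.1 ≠ w.2) :
    RegularKernelAt (d := d) (kernelIntegral g φ χ) (remainderKernel g φ χ) w := by
  by_cases hcl : w ∈ closure (cutoffSupport χ)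
  swap
  · refine .of_notMem_closure IsCutoff.support_self hcl fun x y hxy _ => ?_
    have hne : x ≠ y := fun h => hxy (h ▸ hχ.diag_mem hd x)
    rw [remainderKernel, if_neg hne]
    refine Tendsto.limUnder_eq (tendsto_const_nhds.congr fun δ => ?_)
    rw [kernelIntegral_eq_zero IsCutoff.support_self hxy]
  · obtain ⟨Ω₀, hΩ₀sub, hΩ₀, hwΩ₀, R, hR, hhom, -⟩ :=
      hχ.exists_homAmp_ampCoord hφ hinj hr hd hcl
    have h1 := mem_chart_source (Coord d) w.1
    have h2 := mem_chart_source (Coord d) w.2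
    have hsub₀ := hΩ₀sub.trans (regularRegion_subset _ _)
    set Ω := Ω₀ ∩ phaseCoord φ w.1 w.2 ⁻¹' {0}ᶜ
    have hsub : Ω ⊆ chartDomain w.1 w.2 := inter_subset_left.trans hsub₀
    have hV := (hφ.contDiffOn_phaseCoord w.1 w.2).mono hsub
    have hΩ : IsOpen Ω := ((hφ.contDiffOn_phaseCoord w.1 w.2).mono hsub₀).continuousOn.isOpen_inter_preimage
      hΩ₀ isOpen_compl_singleton
    have hwΩ : chartPair w.1 w.2 w ∈ Ω := by
      refine ⟨hwΩ₀, ?_⟩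
      have := hχ.phaseVec_ne_zero (p := w.2) (x := w.1) (y := w.2) hφ hinj hr hd hcl h2 hw
      simp only [mem_preimage, phaseCoord, chartPair, mem_compl_iff, mem_singleton_iff]
      rw [pt_chartAt h1, pt_chartAt h2]
      exact this
    have hH := (elliptic_hamSq_snd g w.1 w.2).restrict hsub
    have hhom' := hhom.restrict (inter_subset_left : Ω ⊆ Ω₀)
    have hk : ∀ q ∈ Ω, ∀ δ, kernelIntegral g φ χ (pt w.1 q.1) (pt w.2 q.2) δ = _ :=
      fun q hq δ => hχ.kernelIntegral_eq_oscIntegral hφ hd IsCutoff.support_self (hsub hq) δ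
    obtain ⟨K, hK, hc⟩ := exists_smooth_limit_of_homAmp hΩ hH hR hV (fun q hq => hq.2) hhom'
    have hKeq : ∀ q ∈ Ω, remainderKernel g φ χ (pt w.1 q.1) (pt w.2 q.2) = K q := fun q hq => by
      -- The phase vector vanishes on the diagonal, so the region where it does not is covered by
      -- the off-diagonal branch of `remainderKernel`.
      have hne : pt w.1 q.1 ≠ pt w.2 q.2 := fun h => hq.2 <| by
        change phaseCoord φ w.1 w.2 q = 0
        rw [phaseCoord, h]
        exact hφ.phaseVec_self hr hd (hsub hq).2
      rw [remainderKernel, if_neg hne]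
      refine Tendsto.limUnder_eq ((hc.1 q hq).congr fun δ => ?_)
      rw [hk q hq]
    refine ⟨Ω, hsub, hΩ, hwΩ, hK.congr hKeq, hc.congr hΩ (fun q hq δ _ => (hk q hq δ).symm)
      fun q hq => (hKeq q hq).symm, fun δ hδ => ?_⟩
    exact (continuousOn_oscIntegral hΩ hH hV (hhom'.growthBound hΩ hR 0) hδ).congr
      fun q hq => hk q hq δ

/-- Near the diagonal `χ - 1` vanishes for large momenta, so its kernel is smooth even without
regularisation. The remaining amplitude 1 gives a Gaussian tending to zero at each point off the
diagonal. Hence both branches of `remainderKernel` coincide with the integral of `χ - 1`. -/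
theorem IsCutoff.exists_diagonal [T2Space M] (hχ : IsCutoff g r χ)
    (hφ : IsLeviCivitaPhase g r φ) (hinj : LeInjectivityRadius g r) (hr : 0 < r) (hd : 1 ≤ d)
    (x : M) : ∃ Ω ⊆ regularRegion φ x x, IsOpen Ω ∧
      (chartAt (Coord d) x x, chartAt (Coord d) x x) ∈ Ω ∧
      (∀ q ∈ Ω, (pt x q.1, pt x q.2) ∈ cutoffSupport χ) ∧
      ContDiffOn ℝ ∞ (fun q => remainderKernel g φ χ (pt x q.1) (pt x q.2)) Ω ∧
      ConvBdd Ω (fun δ q => kernelIntegral g φ (fun x y η => χ x y η - 1) (pt x q.1) (pt x q.2) δ)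
        (fun q => remainderKernel g φ χ (pt x q.1) (pt x q.2)) ∧
      (∀ δ > 0, ContinuousOn (fun q =>
        kernelIntegral g φ (fun x y η => χ x y η - 1) (pt x q.1) (pt x q.2) δ) Ω) ∧
      ∀ q ∈ Ω, ∀ δ > 0, kernelIntegral g φ χ (pt x q.1) (pt x q.2) δ =
        kernelIntegral g φ (fun x y η => χ x y η - 1) (pt x q.1) (pt x q.2) δ +
        kernelIntegral g φ (fun _ _ _ => 1) (pt x q.1) (pt x q.2) δ := by
  obtain ⟨O, hO, hdiag, hone⟩ := hχ.one_near_diagonal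
  have hxx := mem_chart_source (Coord d) x
  obtain ⟨Ω₀, hΩ₀sub, hΩ₀, hwΩ₀, R, hR, hhom, hham⟩ :=
    hχ.exists_homAmp_ampCoord hφ hinj hr hd (w := (x, x)) (subset_closure (hχ.diag_mem hd x))
  simp only at hΩ₀sub hhom hham
  have hsub₀ := hΩ₀sub.trans (regularRegion_subset _ _)
  have hOW : IsOpen (O ∩ cutoffSupport χ) := hO.inter (isOpen_cutoffSupport hχ)
  set Ω := Ω₀ ∩ ptPair x x ⁻¹' (O ∩ cutoffSupport χ)
  have hΩ₁ : Ω ⊆ Ω₀ := inter_subset_left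
  have hreg : Ω ⊆ regularRegion φ x x := hΩ₁.trans hΩ₀sub
  have hsub : Ω ⊆ chartDomain x x := hΩ₁.trans hsub₀
  have hΩ : IsOpen Ω := ((continuousOn_ptPair x x).mono hsub₀).isOpen_inter_preimage hΩ₀ hOW
  have hwΩ : chartPair x x (x, x) ∈ Ω := by
    refine ⟨hwΩ₀, ?_⟩
    rw [mem_preimage, ptPair_chartPair hxx hxx]
    exact ⟨hdiag x, hχ.diag_mem hd x⟩
  have hH := (elliptic_hamSq_snd g x x).restrict hsub
  have hV := (hφ.contDiffOn_phaseCoord x x).mono hsub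
  set a : M → (y : M) → Cotangent d y → ℂ := fun x y η => χ x y η - 1
  have hint : ∀ q ∈ Ω, InteriorExp g r (pt x q.1) (pt x q.2) := fun q hq =>
    hχ.interiorExp hq.2.2
  have ha : ContDiffOn ℝ ∞ (fun p : (Coord d × Coord d) × Coord d => ampCoord g φ a x x p.1 p.2)
      (Ω ×ˢ univ) :=
    ((hφ.contDiffOn_weightFactor (g := g) x x).mono (prod_mono hreg subset_rfl)).mul
      (((hχ.contDiffOn_pullCoord x x).mono (prod_mono hsub subset_rfl)).sub
        (contDiffOn_const (c := (1 : ℂ))))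
  have hb : ∀ k N : ℕ, GrowthBound Ω k (-(N : ℝ)) (ampCoord g φ a x x) := fun k N => by
    have h := (HomAmp.of_eq_zero hR ha (fun q hq ξ hξ => ?_) (-(N : ℤ))).growthBound hΩ hR k
    · simpa using h
    · rw [ampCoord_eq, pullCoord]
      simp only [a]
      rw [hone _ _ _ hq.2.1 (hham q hq.1 ξ hξ)]
      simp
  have hk : ∀ q ∈ Ω, ∀ δ, kernelIntegral g φ a (pt x q.1) (pt x q.2) δ = _ := fun q hq δ =>
    LeviCivitaPhase.kernelIntegral_eq_oscIntegral a hφ hd (hsub hq).1 (hsub hq).2 (hint q hq) δ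
  have hsplit : ∀ q ∈ Ω, ∀ δ > 0, kernelIntegral g φ χ (pt x q.1) (pt x q.2) δ =
      kernelIntegral g φ a (pt x q.1) (pt x q.2) δ +
      kernelIntegral g φ (fun _ _ _ => 1) (pt x q.1) (pt x q.2) δ := fun q hq δ hδ => by
    rw [hk q hq, LeviCivitaPhase.kernelIntegral_eq_oscIntegral χ hφ hd (hsub hq).1 (hsub hq).2 (hint q hq) δ,
      LeviCivitaPhase.kernelIntegral_eq_oscIntegral (fun _ _ _ => 1) hφ hd (hsub hq).1 (hsub hq).2 (hint q hq) δ,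
      ← oscIntegral_add hH (hb 0 0) ((growthBound_ampCoord_one hφ x x 0).restrict hreg) hδ hq]
    congr 1
    funext q ξ
    simp only [ampCoord, a]
    ring
  obtain ⟨hs, hc⟩ := exists_smooth_limit_of_growthBound hΩ hH hV hb
  have hKeq : ∀ q ∈ Ω, remainderKernel g φ χ (pt x q.1) (pt x q.2) =
      oscIntegral (phaseCoord φ x x) (fun q => hamSq g x q.2) (ampCoord g φ a x x) 0 q :=
    fun q hq => by
    by_cases hne : pt x q.1 = pt x q.2
    · rw [remainderKernel, if_pos hne, ← hk q hq]
    · rw [remainderKernel, if_neg hne]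
      refine Tendsto.limUnder_eq ?_
      have hV0 : phaseCoord φ x x q ≠ 0 :=
        hχ.phaseVec_ne_zero hφ hinj hr hd (subset_closure hq.2.2)
          (pt_mem_source (hsub hq).2) hne
      have hpos : 0 < quadForm (gram g x q.2) (phaseCoord φ x x q) := by
        rw [← metricForm_self_eq_quadForm]
        exact metricForm_pos g (hsub hq).2 hV0
      have hg : Tendsto (kernelIntegral g φ (fun _ _ _ => 1) (pt x q.1) (pt x q.2)) (𝓝[>] 0)
          (𝓝 0) := by
        have := ((tendsto_rpow_mul_exp_neg_div hpos ((d : ℝ) / 2)).const_mul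
          (((2 * Real.pi) ^ d)⁻¹ * weightCoord g φ x x q * density g x q.2)).ofReal
        rw [mul_zero, Complex.ofReal_zero] at this
        refine this.congr' ?_
        filter_upwards [self_mem_nhdsWithin] with δ hδ
        rw [kernelIntegral_one hφ hd (hsub hq) (hint q hq) hδ]
      have := (hc.1 q hq).add hg
      rw [add_zero] at this
      refine this.congr' ?_
      filter_upwards [self_mem_nhdsWithin] with δ hδ
      rw [hsplit q hq δ hδ, hk q hq]
  exact ⟨Ω, hreg, hΩ, hwΩ, fun q hq => hq.2.2, hs.congr hKeq,
    hc.congr hΩ (fun q hq δ _ => (hk q hq δ).symm) fun q hq => (hKeq q hq).symm,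
    fun δ hδ => (continuousOn_oscIntegral hΩ hH hV (hb 0 0) hδ).congr fun q hq => hk q hq δ, hsplit⟩

theorem RegularKernelAt.contMDiffAt {k : M → M → ℝ → ℂ} {K : M → M → ℂ} {w : M × M}
    (h : RegularKernelAt (d := d) k K w) :
    ContMDiffAt ((𝓡 d).prod (𝓡 d)) 𝓘(ℝ, ℂ) ∞ (fun q : M × M => K q.1 q.2) w := by
  obtain ⟨Ω, hsub, hΩ, hw, hK, -, -⟩ := h.exists_nhd
  have h1 := mem_chart_source (Coord d) w.1
  have h2 := mem_chart_source (Coord d) w.2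
  have hc1 : ContMDiffAt ((𝓡 d).prod (𝓡 d)) 𝓘(ℝ, Coord d) ∞
      (fun q : M × M => chartAt (Coord d) w.1 q.1) w :=
    (contMDiffAt_extChartAt (I := 𝓡 d) (n := ∞) (x := w.1)).comp w contMDiffAt_fst
  have hc2 : ContMDiffAt ((𝓡 d).prod (𝓡 d)) 𝓘(ℝ, Coord d) ∞
      (fun q : M × M => chartAt (Coord d) w.2 q.2) w :=
    (contMDiffAt_extChartAt (I := 𝓡 d) (n := ∞) (x := w.2)).comp w contMDiffAt_snd
  have hc : ContMDiffAt ((𝓡 d).prod (𝓡 d)) 𝓘(ℝ, Coord d × Coord d) ∞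
      (chartPair (d := d) w.1 w.2) w := hc1.prodMk_space hc2
  refine (((hK.contDiffAt (hΩ.mem_nhds hw)).contMDiffAt).comp w hc).congr_of_eventuallyEq ?_
  filter_upwards [eventually_mem_source_prod (d := d) h1 h2] with q hq
  simp only [Function.comp_apply, chartPair]
  rw [pt_chartAt hq.1, pt_chartAt hq.2]

theorem IsCutoff.contMDiff_remainderKernel [T2Space M] (hχ : IsCutoff g r χ)
    (hφ : IsLeviCivitaPhase g r φ) (hinj : LeInjectivityRadius g r) (hr : 0 < r) (hd : 1 ≤ d) :
    ContMDiff ((𝓡 d).prod (𝓡 d)) 𝓘(ℝ, ℂ) ∞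
      (fun q : M × M => remainderKernel g φ χ q.1 q.2) := by
  rintro ⟨x, y⟩
  rcases eq_or_ne x y with rfl | hne
  · obtain ⟨Ω, hreg, hΩ, hx, -, hs, hc, hcont, -⟩ := hχ.exists_diagonal hφ hinj hr hd x
    exact RegularKernelAt.contMDiffAt (w := (x, x))
      ⟨Ω, hreg.trans (regularRegion_subset _ _), hΩ, hx, hs, hc, hcont⟩
  · exact (hχ.regularKernelAt_of_ne hφ hinj hr hd (w := (x, y)) hne).contMDiffAt

end Kernels

/-! ### Concentration of the Gaussian part on the diagonal. -/

section Limits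

variable {d : ℕ} {M : Type*} [TopologicalSpace M] [ChartedSpace (Coord d) M]
  [IsManifold (𝓡 d) ∞ M] {g : Metric d M} {r : ℝ} {φ : M → (y : M) → Cotangent d y → ℝ}
  {χ : M → (y : M) → Cotangent d y → ℂ}

theorem RegularKernelAt.tendsto {k : M → M → ℝ → ℂ} {K : M → M → ℂ} {w : M × M}
    (h : RegularKernelAt (d := d) k K w) : Tendsto (k w.1 w.2) (𝓝[>] 0) (𝓝 (K w.1 w.2)) := by
  obtain ⟨Ω, -, -, hw, -, hc, -⟩ := h.exists_nhd
  have := hc.1 _ hw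
  simp only [chartPair] at this
  rwa [pt_chartAt (mem_chart_source _ _), pt_chartAt (mem_chart_source _ _)] at this

theorem RegularKernelAt.exists_bound {k : M → M → ℝ → ℂ} {K : M → M → ℂ} {w : M × M}
    (h : RegularKernelAt (d := d) k K w) :
    ∃ U ∈ 𝓝 w, ∃ C : ℝ, ∀ w' ∈ U, ∀ δ ∈ Ioc (0 : ℝ) 1, ‖k w'.1 w'.2 δ‖ ≤ C := by
  obtain ⟨Ω, -, -, hw, -, hc, -⟩ := h.exists_nhd
  obtain ⟨U, hU, C, hC⟩ := hc.2 _ hw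
  have h1 := mem_chart_source (Coord d) w.1
  have h2 := mem_chart_source (Coord d) w.2
  refine ⟨_, inter_mem ((continuousAt_chartPair h1 h2).preimage_mem_nhds hU)
    (eventually_mem_source_prod (d := d) h1 h2), C, fun w' hw' δ hδ => ?_⟩
  have := hC _ hw'.1 δ hδ
  simp only [chartPair] at this
  rwa [pt_chartAt hw'.2.1, pt_chartAt hw'.2.2] at this

theorem IsCutoff.continuousAt_kernelIntegral [T2Space M] (hχ : IsCutoff g r χ)
    (hφ : IsLeviCivitaPhase g r φ) (hd : 1 ≤ d) {a : M → (y : M) → Cotangent d y → ℂ}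
    (ha : ∀ x y, (x, y) ∉ cutoffSupport χ → ∀ η : Cotangent d y, a x y η = 0)
    (hb : ∀ w ∈ closure (cutoffSupport χ), ∃ Ω ⊆ chartDomain w.1 w.2, IsOpen Ω ∧
      chartPair w.1 w.2 w ∈ Ω ∧ ∃ m : ℝ, GrowthBound Ω 0 m (ampCoord g φ a w.1 w.2))
    {δ : ℝ} (hδ : 0 < δ) (w : M × M) :
    ContinuousAt (fun w : M × M => kernelIntegral g φ a w.1 w.2 δ) w := by
  by_cases hcl : w ∈ closure (cutoffSupport χ)
  · obtain ⟨Ω, hsub, hΩ, hw, m, hm⟩ := hb w hcl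
    have h1 := mem_chart_source (Coord d) w.1
    have h2 := mem_chart_source (Coord d) w.2
    have hc := (continuousOn_oscIntegral hΩ ((elliptic_hamSq_snd g w.1 w.2).restrict hsub)
      ((hφ.contDiffOn_phaseCoord w.1 w.2).mono hsub) hm hδ).continuousAt (hΩ.mem_nhds hw)
    refine (ContinuousAt.comp (f := chartPair w.1 w.2) hc
      (continuousAt_chartPair h1 h2)).congr ?_
    filter_upwards [eventually_mem_source_prod (d := d) h1 h2] with w' hw'
    have h := hχ.kernelIntegral_eq_oscIntegral hφ hd ha (chartPair_mem (d := d) hw'.1 hw'.2) δ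
    simp only [chartPair] at h
    rw [pt_chartAt hw'.1, pt_chartAt hw'.2] at h
    rw [h]
    rfl
  · refine (continuousAt_const (y := (0 : ℂ))).congr ?_
    filter_upwards [isClosed_closure.isOpen_compl.mem_nhds hcl] with w' hw'
    rw [kernelIntegral_eq_zero ha fun h => hw' (subset_closure h)]

theorem IsCutoff.continuous_kernelIntegral [T2Space M] (hχ : IsCutoff g r χ)
    (hφ : IsLeviCivitaPhase g r φ) (hinj : LeInjectivityRadius g r) (hr : 0 < r) (hd : 1 ≤ d)
    {δ : ℝ} (hδ : 0 < δ) : Continuous (fun w : M × M => kernelIntegral g φ χ w.1 w.2 δ) := by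
  refine continuous_iff_continuousAt.2 fun w =>
    hχ.continuousAt_kernelIntegral hφ hd IsCutoff.support_self (fun w hw => ?_) hδ w
  obtain ⟨Ω, hsub, hΩ, hwΩ, R, hR, hhom, -⟩ := hχ.exists_homAmp_ampCoord hφ hinj hr hd hw
  exact ⟨Ω, hsub.trans (regularRegion_subset _ _), hΩ, hwΩ, _, hhom.growthBound hΩ hR 0⟩

/-- The phase vector vanishes on the diagonal, so its two partial differentials there add up to
zero, and the one in `x` is the identity. -/
theorem IsLeviCivitaPhase.hasFDerivAt_phaseCoord_snd [T2Space M] (hφ : IsLeviCivitaPhase g r φ)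
    (hr : 0 < r) (hd : 1 ≤ d) {p : M} {z₀ : Coord d} (hz₀ : z₀ ∈ (chartAt (Coord d) p).target) :
    HasFDerivAt (fun z => phaseCoord φ p p (z₀, z)) (-ContinuousLinearMap.id ℝ (Coord d)) z₀ := by
  have hA := (((hφ.contDiffOn_phaseCoord p p).contDiffAt
    ((isOpen_chartDomain p p).mem_nhds (show (z₀, z₀) ∈ _ from ⟨hz₀, hz₀⟩))).differentiableAt
      (by simp)).hasFDerivAt
  set A := fderiv ℝ (phaseCoord φ p p) (z₀, z₀)
  have hfst : HasFDerivAt (fun z => phaseCoord φ p p (z, z₀))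
      (A.comp (ContinuousLinearMap.inl ℝ _ _)) z₀ :=
    hA.comp z₀ (f := fun z => (z, z₀)) (hasFDerivAt_prodMk_left _ _)
  have hsnd : HasFDerivAt (fun z => phaseCoord φ p p (z₀, z))
      (A.comp (ContinuousLinearMap.inr ℝ _ _)) z₀ :=
    hA.comp z₀ (f := fun z => (z₀, z)) (hasFDerivAt_prodMk_right _ _)
  have hdiag : HasFDerivAt (fun z => phaseCoord φ p p (z, z))
      (A.comp ((ContinuousLinearMap.id ℝ _).prod (ContinuousLinearMap.id ℝ _))) z₀ :=
    hA.comp z₀ (f := fun z => (z, z)) ((hasFDerivAt_id _).prodMk (hasFDerivAt_id _))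
  have h0 : (fun z => phaseCoord φ p p (z, z)) =ᶠ[𝓝 z₀] fun _ => 0 := by
    filter_upwards [(chartAt (Coord d) p).open_target.mem_nhds hz₀] with z hz
    exact hφ.phaseVec_self hr hd hz
  have e1 := hfst.unique (hφ.fderiv_phaseVec_self hr hd hz₀)
  have e2 := hdiag.unique ((hasFDerivAt_const 0 z₀).congr_of_eventuallyEq h0)
  refine hsnd.congr_fderiv ?_
  ext1 v
  have a1 := congrArg (fun L : Coord d →L[ℝ] Coord d => L v) e1
  have a2 := congrArg (fun L : Coord d →L[ℝ] Coord d => L v) e2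
  have a3 : A (v, v) = A (v, 0) + A (0, v) := by rw [← map_add]; simp
  have a1' : A (v, 0) = v := a1
  have a2' : A (v, v) = 0 := a2
  rw [a2', a1'] at a3
  change A (0, v) = -v
  exact (neg_eq_of_add_eq_zero_right a3.symm).symm

/-- The set of points of the domain of the chart at `p` with coordinates in a ball. -/
def coordBall (p : M) (z₀ : Coord d) (ε : ℝ) : Set M :=
  (chartAt (Coord d) p).source ∩ chartAt (Coord d) p ⁻¹' Metric.ball z₀ ε

theorem isOpen_coordBall (p : M) (z₀ : Coord d) (ε : ℝ) : IsOpen (coordBall p z₀ ε) :=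
  (chartAt (Coord d) p).isOpen_inter_preimage Metric.isOpen_ball

theorem target_inter_preimage_coordBall {p : M} {z₀ : Coord d} {ε : ℝ}
    (h : Metric.ball z₀ ε ⊆ (chartAt (Coord d) p).target) :
    (chartAt (Coord d) p).target ∩ pt p ⁻¹' coordBall p z₀ ε = Metric.ball z₀ ε := by
  ext z
  constructor
  · rintro ⟨hz, -, hz2⟩
    rwa [mem_preimage, chartAt_pt hz] at hz2
  · intro hz
    refine ⟨h hz, pt_mem_source (h hz), ?_⟩
    rwa [mem_preimage, chartAt_pt (h hz)]

variable [MeasurableSpace M] [BorelSpace M]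

theorem setIntegral_coordBall {V : Type*} [NormedAddCommGroup V] [NormedSpace ℝ V] (g : Metric d M)
    {p : M} {z₀ : Coord d} {ε : ℝ} (h : Metric.ball z₀ ε ⊆ (chartAt (Coord d) p).target) {F : M → V}
    (hF : AEStronglyMeasurable F ((riemannianMeasure g).restrict (coordBall p z₀ ε))) :
    ∫ y in coordBall p z₀ ε, F y ∂(riemannianMeasure g) =
      ∫ z in Metric.ball z₀ ε, density g p z • F (pt p z) := by
  have hN := (isOpen_coordBall p z₀ ε).measurableSet
  have h1 := setIntegral_riemannianMeasure g p hN inter_subset_left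
    (F := (coordBall p z₀ ε).indicator F) ((aestronglyMeasurable_indicator_iff hN).2 hF)
  rw [target_inter_preimage_coordBall h] at h1
  rw [setIntegral_congr_fun hN (g := (coordBall p z₀ ε).indicator F)
    fun y hy => (indicator_of_mem hy F).symm, h1]
  refine setIntegral_congr_fun measurableSet_ball fun z hz => ?_
  have hz' : pt p z ∈ coordBall p z₀ ε :=
    ((target_inter_preimage_coordBall h).symm.subset hz).2
  rw [indicator_of_mem hz']

theorem tendsto_setIntegral_of_bound {μ : Measure M} [IsFiniteMeasure μ] [CompactSpace M]
    {S : Set M} (hS : MeasurableSet S) {k : M → ℝ → ℂ} {K : M → ℂ} {f : M → ℂ} (hf : Continuous f)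
    (hm : ∀ δ > 0, AEStronglyMeasurable (fun y => k y δ) (μ.restrict S)) {C : ℝ}
    (hb : ∀ y ∈ S, ∀ δ ∈ Ioc (0 : ℝ) 1, ‖k y δ‖ ≤ C)
    (hl : ∀ y ∈ S, Tendsto (k y) (𝓝[>] 0) (𝓝 (K y))) :
    Tendsto (fun δ => ∫ y in S, k y δ * f y ∂μ) (𝓝[>] 0) (𝓝 (∫ y in S, K y * f y ∂μ)) := by
  obtain ⟨B, hB⟩ := isCompact_univ.bddAbove_image (f := fun y => ‖f y‖) (by fun_prop)
  have hB' : ∀ y, ‖f y‖ ≤ B := fun y => hB ⟨y, mem_univ _, rfl⟩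
  refine tendsto_integral_filter_of_dominated_convergence (fun _ => C * B) ?_ ?_ ?_ ?_
  · filter_upwards [self_mem_nhdsWithin] with δ hδ
    exact (hm δ hδ).mul hf.aestronglyMeasurable
  · filter_upwards [Ioc_mem_nhdsGT (zero_lt_one' ℝ)] with δ hδ
    filter_upwards [ae_restrict_mem hS] with y hy
    rw [norm_mul]
    exact mul_le_mul (hb y hy δ hδ) (hB' y) (norm_nonneg _) ((norm_nonneg _).trans (hb y hy δ hδ))
  · exact integrable_const _
  · filter_upwards [ae_restrict_mem hS] with y hy
    exact (hl y hy).mul_const _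

/-- The kernel of amplitude 1 is a Gaussian in the phase vector, which behaves like `z₀ - z` near
`z₀`. The concentration lemma applies with `Q` the squared metric length of the phase vector. -/
theorem IsCutoff.tendsto_gaussian [T2Space M] (hχ : IsCutoff g r χ)
    (hφ : IsLeviCivitaPhase g r φ) (hr : 0 < r) (hd : 1 ≤ d) (x : M) {f : M → ℂ}
    (hf : Continuous f) {Ω : Set (Coord d × Coord d)} (hΩ : IsOpen Ω)
    (hsub : Ω ⊆ regularRegion φ x x)
    (hx : (chartAt (Coord d) x x, chartAt (Coord d) x x) ∈ Ω)
    (hW : ∀ q ∈ Ω, (pt x q.1, pt x q.2) ∈ cutoffSupport χ) :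
    ∃ ε₀ > 0, ∀ ε ∈ Ioc 0 ε₀,
      Metric.ball (chartAt (Coord d) x x) ε ⊆ (chartAt (Coord d) x).target ∧
      Tendsto (fun δ => ∫ z in Metric.ball (chartAt (Coord d) x x) ε, density g x z •
        (kernelIntegral g φ (fun _ _ _ => 1) x (pt x z) δ * f (pt x z))) (𝓝[>] 0) (𝓝 (f x)) := by
  have hxx := mem_chart_source (Coord d) x
  set z₀ := chartAt (Coord d) x x with hz₀def
  have hz₀ : z₀ ∈ (chartAt (Coord d) x).target := (chartAt (Coord d) x).map_source hxx
  have hpx : pt x z₀ = x := pt_chartAt hxx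
  set V : Coord d → Coord d := fun z => phaseCoord φ x x (z₀, z) with hVdef
  have hV := hφ.hasFDerivAt_phaseCoord_snd hr hd hz₀
  have hV0 : V z₀ = 0 := hφ.phaseVec_self hr hd hz₀
  obtain ⟨ρ, c, A, D, hρ, hc, -, -, hball, hbd⟩ := exists_metricOp_bounds g hz₀
  have hΩz : ∀ᶠ z in 𝓝 z₀, (z₀, z) ∈ Ω :=
    ContinuousAt.preimage_mem_nhds (f := fun z => (z₀, z)) (by fun_prop) (hΩ.mem_nhds hx)
  -- From `V z = -(z - z₀) + o(‖z - z₀‖)`, with the error bounded by half of `‖z - z₀‖`.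
  have hlow : ∀ᶠ z in 𝓝 z₀, ‖z - z₀‖ ≤ 2 * ‖V z‖ := by
    have h := hV.isLittleO.def (show (0 : ℝ) < 1 / 2 by norm_num)
    filter_upwards [h] with z hz
    have h3 : V z - V z₀ - (-ContinuousLinearMap.id ℝ (Coord d)) (z - z₀) = V z + (z - z₀) := by
      rw [hV0, sub_zero]; exact sub_neg_eq_add _ _
    change ‖V z - V z₀ - (-ContinuousLinearMap.id ℝ (Coord d)) (z - z₀)‖ ≤ _ at hz
    rw [h3] at hz
    have h4 := norm_sub_le (V z + (z - z₀)) (V z)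
    rw [add_sub_cancel_left] at h4
    linarith
  have hreg := hφ.contDiffOn_weightCoord (g := g) x x
  -- One density comes from the Gaussian determinant, the other from the Riemannian measure.
  set F : Coord d → ℂ := fun z => ((((2 * Real.pi) ^ d)⁻¹ * weightCoord g φ x x (z₀, z) *
    density g x z * density g x z : ℝ) : ℂ) * f (pt x z) with hFdef
  have hFc : ∀ z, (z₀, z) ∈ Ω → ContinuousAt F z := fun z hz => by
    have hzt : z ∈ (chartAt (Coord d) x).target := (hsub hz).1.2
    have h1 : ContinuousAt (fun z => weightCoord g φ x x (z₀, z)) z :=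
      ContinuousAt.comp (f := fun z => (z₀, z)) (g := weightCoord g φ x x)
        (hreg.continuousOn.continuousAt ((hφ.isOpen_regularRegion x x).mem_nhds (hsub hz)))
        (by fun_prop)
    have h2 : ContinuousAt (density g x) z := (contDiffOn_density g x).continuousOn.continuousAt
      ((chartAt (Coord d) x).open_target.mem_nhds hzt)
    have h3 : ContinuousAt (pt x) z := (continuousOn_pt x).continuousAt
      ((chartAt (Coord d) x).open_target.mem_nhds hzt)
    exact (Complex.continuous_ofReal.continuousAt.comp
      (((continuousAt_const.mul h1).mul h2).mul h2)).mul (hf.continuousAt.comp h3)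
  have hFbd : ∀ᶠ z in 𝓝 z₀, ‖F z‖ ≤ ‖F z₀‖ + 1 :=
    ((hFc z₀ hx).norm.eventually_lt continuousAt_const (lt_add_one _)).mono fun _ h => h.le
  obtain ⟨ε₁, hε₁, hε₁b⟩ := Metric.eventually_nhds_iff_ball.1
    ((hΩz.and hlow).and (hFbd.and (Metric.closedBall_mem_nhds z₀ hρ)))
  refine ⟨ε₁, hε₁, fun ε hε => ?_⟩
  have hB : ∀ z ∈ Metric.ball z₀ ε, (z₀, z) ∈ Ω ∧ ‖z - z₀‖ ≤ 2 * ‖V z‖ ∧ ‖F z‖ ≤ ‖F z₀‖ + 1 ∧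
      z ∈ Metric.closedBall z₀ ρ := fun z hz => by
    obtain ⟨⟨h1, h2⟩, h3, h4⟩ := hε₁b z (Metric.ball_subset_ball hε.2 hz)
    exact ⟨h1, h2, h3, h4⟩
  refine ⟨fun z hz => (hsub (hB z hz).1).1.2, ?_⟩
  set Q : Coord d → ℝ := fun z => quadForm (gram g x z) (V z) with hQdef
  have hQinner : ∀ z v, quadForm (gram g x z) v = inner ℝ v (metricOp g x z v) := fun z v => by
    rw [inner_metricOp, metricForm_self_eq_quadForm]
  have hVc : ∀ z ∈ Metric.ball z₀ ε, ContinuousAt V z := fun z hz =>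
    ContinuousAt.comp (f := fun z => (z₀, z)) (g := phaseCoord φ x x)
      ((hφ.contDiffOn_phaseCoord x x).continuousOn.continuousAt
        ((isOpen_chartDomain x x).mem_nhds (hsub (hB z hz).1).1)) (by fun_prop)
  have hMc : ∀ z ∈ Metric.ball z₀ ε, ContinuousAt (metricOp g x) z := fun z hz =>
    (contDiffOn_metricOp g x).continuousOn.continuousAt
      ((chartAt (Coord d) x).open_target.mem_nhds (hsub (hB z hz).1).1.2)
  have hz₀B : z₀ ∈ Metric.ball z₀ ε := Metric.mem_ball_self hε.1
  have key := tendsto_integral_gaussian_kernel (N := Metric.ball z₀ ε) measurableSet_ball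
    (z₀ := z₀) (Metric.ball_mem_nhds z₀ hε.1) (F := F) (C := ‖F z₀‖ + 1)
    (ContinuousOn.aestronglyMeasurable
      (fun z hz => (hFc z (hB z hz).1).continuousWithinAt) measurableSet_ball)
    (fun z hz => (hB z hz).2.2.1) (hFc z₀ hx) (Q := Q)
    (ContinuousOn.aestronglyMeasurable (fun z hz => by
      refine ContinuousAt.continuousWithinAt ?_
      simp only [hQdef, hQinner]
      exact (hVc z hz).inner ((hMc z hz).clm_apply (hVc z hz))) measurableSet_ball)
    (c := c / 4) (by positivity)
    (fun z hz => by
      simp only [hQdef, hQinner]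
      obtain ⟨-, h2, -, h4⟩ := hB z hz
      have h5 := (hbd z h4).1 (V z)
      have h6 : ‖z - z₀‖ ^ 2 ≤ 4 * ‖V z‖ ^ 2 := by nlinarith [norm_nonneg (z - z₀)]
      nlinarith)
    (posDef_gram g hz₀)
    (fun w => by
      have hs : Tendsto (fun δ : ℝ => Real.sqrt δ) (𝓝[>] 0) (𝓝[≠] 0) := by
        refine tendsto_nhdsWithin_iff.2 ⟨?_, ?_⟩
        · have := Real.continuous_sqrt.tendsto 0
          rw [Real.sqrt_zero] at this
          exact this.mono_left nhdsWithin_le_nhds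
        · filter_upwards [self_mem_nhdsWithin] with δ hδ
          exact (Real.sqrt_pos.2 hδ).ne'
      have hline : HasDerivAt (fun t : ℝ => V (z₀ + t • w)) (-w) 0 := by
        have h1 : HasDerivAt (fun t : ℝ => z₀ + t • w) w 0 := by
          simpa using ((hasDerivAt_id (0 : ℝ)).smul_const w).const_add z₀
        have h2 : HasFDerivAt V (-ContinuousLinearMap.id ℝ (Coord d)) (z₀ + (0 : ℝ) • w) := by
          rw [zero_smul, add_zero]; exact hV
        exact (h2.comp_hasDerivAt 0 h1).congr_deriv rfl
      have hslope := (hasDerivAt_iff_tendsto_slope_zero.1 hline).comp hs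
      have hzt : Tendsto (fun δ : ℝ => z₀ + Real.sqrt δ • w) (𝓝[>] 0) (𝓝 z₀) := by
        have := ((hs.mono_right nhdsWithin_le_nhds).smul_const w).const_add z₀
        rwa [zero_smul, add_zero] at this
      have hM : Tendsto (fun δ : ℝ => metricOp g x (z₀ + Real.sqrt δ • w)) (𝓝[>] 0)
          (𝓝 (metricOp g x z₀)) := (hMc z₀ hz₀B).tendsto.comp hzt
      have hlim := hslope.inner (𝕜 := ℝ) (((isBoundedBilinearMap_apply (𝕜 := ℝ) (E := Coord d)
        (F := Coord d)).continuous.tendsto (metricOp g x z₀, -w)).comp (hM.prodMk_nhds hslope))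
      have e : quadForm (gram g x z₀) w = inner ℝ (-w) (metricOp g x z₀ (-w)) := by
        rw [hQinner]; simp
      rw [e]
      refine hlim.congr' ?_
      filter_upwards [self_mem_nhdsWithin] with δ hδ
      have hδ' : (0 : ℝ) < δ := hδ
      have hsq : Real.sqrt δ ^ 2 = δ := Real.sq_sqrt hδ'.le
      simp only [Function.comp_apply, zero_add, zero_smul, add_zero, hV0, sub_zero, hQdef, hQinner]
      rw [map_smul, inner_smul_left, inner_smul_right, ← mul_assoc, RCLike.conj_to_real,
        ← mul_inv, ← sq, hsq]
      ring)
  -- The normalisation: on the diagonal the Hessian is the identity, so the weight is `1/ρ`; this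
  -- and the `1/ρ` from the limiting Gaussian integral cancel the two densities in `F`.
  have hval : (((2 * Real.pi) ^ d / Real.sqrt (gram g x z₀).det : ℝ) : ℂ) * F z₀ = f x := by
    have hρ0 := density_pos g hz₀
    have hhess : hessCoord φ x x (z₀, z₀) = ContinuousLinearMap.id ℝ (Coord d) :=
      (hφ.fderiv_phaseVec_self hr hd hz₀).fderiv
    have hw : weightCoord g φ x x (z₀, z₀) = (density g x z₀)⁻¹ := by
      rw [weightCoord, hhess]
      have : (ContinuousLinearMap.id ℝ (Coord d)).det = 1 := by simp [ContinuousLinearMap.det]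
      rw [this, ← Real.rpow_add hρ0]
      norm_num
      rw [Real.rpow_neg_one]
    have hs : Real.sqrt (gram g x z₀).det = density g x z₀ := rfl
    rw [hFdef]
    simp only
    rw [hs, hw, hpx, ← mul_assoc, ← Complex.ofReal_mul]
    have : (2 * Real.pi) ^ d / density g x z₀ * (((2 * Real.pi) ^ d)⁻¹ * (density g x z₀)⁻¹ *
        density g x z₀ * density g x z₀) = 1 := by
      have : (2 * Real.pi) ^ d ≠ 0 := by positivity
      field_simp
    rw [this, Complex.ofReal_one, one_mul]
  rw [hval] at key
  refine key.congr' ?_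
  filter_upwards [self_mem_nhdsWithin] with δ hδ
  refine setIntegral_congr_fun measurableSet_ball fun z hz => ?_
  have hq := (hB z hz).1
  have h1 := kernelIntegral_one hφ hd (hsub hq).1 (hχ.interiorExp (hW _ hq)) hδ
  simp only [hpx] at h1
  simp only [hFdef, hQdef]
  rw [h1, Complex.real_smul]
  push_cast
  ring

end Limits

/-! ### The operator with amplitude `χ` is the identity modulo smoothing. -/

section Identity

variable {d : ℕ} {M : Type*} [TopologicalSpace M] [ChartedSpace (Coord d) M]
  [IsManifold (𝓡 d) ∞ M] {g : Metric d M} {r : ℝ} {φ : M → (y : M) → Cotangent d y → ℝ}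
  {χ : M → (y : M) → Cotangent d y → ℂ} [MeasurableSpace M] [BorelSpace M]

theorem integrable_riemannianMeasure_of_continuous [T2Space M] [CompactSpace M] (g : Metric d M)
    {f : M → ℂ} (hf : Continuous f) : Integrable f (riemannianMeasure g) :=
  hf.integrable_of_hasCompactSupport (HasCompactSupport.of_compactSpace f)

theorem continuous_slice {X Y Z : Type*} [TopologicalSpace X] [TopologicalSpace Y]
    [TopologicalSpace Z] {f : X → Y → Z} (hf : Continuous fun w : X × Y => f w.1 w.2) (x : X) :
    Continuous (f x) := hf.comp (Continuous.prodMk_right x)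

theorem IsCutoff.continuous_kernelIntegral_right [T2Space M] (hχ : IsCutoff g r χ)
    (hφ : IsLeviCivitaPhase g r φ) (hinj : LeInjectivityRadius g r) (hr : 0 < r) (hd : 1 ≤ d)
    {δ : ℝ} (hδ : 0 < δ) (x : M) : Continuous (fun y => kernelIntegral g φ χ x y δ) :=
  continuous_slice (f := fun x y => kernelIntegral g φ χ x y δ)
    (hχ.continuous_kernelIntegral hφ hinj hr hd hδ) x

theorem IsCutoff.continuous_remainderKernel_right [T2Space M] (hχ : IsCutoff g r χ)
    (hφ : IsLeviCivitaPhase g r φ) (hinj : LeInjectivityRadius g r) (hr : 0 < r) (hd : 1 ≤ d)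
    (x : M) : Continuous (fun y => remainderKernel g φ χ x y) :=
  continuous_slice (f := fun x y => remainderKernel g φ χ x y)
    (hχ.contMDiff_remainderKernel hφ hinj hr hd).continuous x

/-- The integral over `y` is split at a coordinate ball about `x`. Outside, the kernels are bounded
and converge. Inside, `χ = (χ - 1) + 1`: the first part is bounded and converges, the second
concentrates and yields `f x`. -/
theorem IsCutoff.tendsto_kernelIntegral [T2Space M] [CompactSpace M] (hχ : IsCutoff g r χ)
    (hφ : IsLeviCivitaPhase g r φ) (hinj : LeInjectivityRadius g r) (hr : 0 < r) (hd : 1 ≤ d)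
    {f : M → ℂ} (hf : Continuous f) (x : M) :
    Tendsto (fun δ => ∫ y, kernelIntegral g φ χ x y δ * f y ∂(riemannianMeasure g)) (𝓝[>] 0)
      (𝓝 (f x + ∫ y, remainderKernel g φ χ x y * f y ∂(riemannianMeasure g))) := by
  have hxx := mem_chart_source (Coord d) x
  set z₀ := chartAt (Coord d) x x with hz₀def
  have hpx : pt x z₀ = x := pt_chartAt hxx
  set μ := riemannianMeasure g
  set a : M → (y : M) → Cotangent d y → ℂ := fun x y η => χ x y η - 1 with hadef
  obtain ⟨Ω, hreg, hΩ, hx, hW, hs, hc, hcont, hsplit⟩ := hχ.exists_diagonal hφ hinj hr hd x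
  obtain ⟨U, hU, C, hC⟩ := hc.2 _ hx
  obtain ⟨ε₀, hε₀, hgauss⟩ := hχ.tendsto_gaussian hφ hr hd x hf hΩ hreg hx hW
  have hUz : ∀ᶠ z in 𝓝 z₀, (z₀, z) ∈ U ∩ Ω :=
    ContinuousAt.preimage_mem_nhds (f := fun z => (z₀, z)) (by fun_prop)
      (inter_mem hU (hΩ.mem_nhds hx))
  obtain ⟨ε₁, hε₁, hε₁b⟩ := Metric.eventually_nhds_iff_ball.1 hUz
  obtain ⟨ε, hε, hεε₀, hεε₁⟩ : ∃ ε, 0 < ε ∧ ε ≤ ε₀ ∧ ε ≤ ε₁ :=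
    ⟨min ε₀ ε₁, lt_min hε₀ hε₁, min_le_left _ _, min_le_right _ _⟩
  obtain ⟨hball, hlim⟩ := hgauss ε ⟨hε, hεε₀⟩
  set N := coordBall x z₀ ε
  have hN : IsOpen N := isOpen_coordBall x z₀ ε
  have hNx : x ∈ N := ⟨hxx, Metric.mem_ball_self hε⟩
  have hNq : ∀ y ∈ N, (z₀, chartAt (Coord d) x y) ∈ U ∩ Ω := fun y hy =>
    hε₁b _ (Metric.ball_subset_ball hεε₁ hy.2)
  have hNpt : ∀ y ∈ N, pt x (chartAt (Coord d) x y) = y := fun y hy => pt_chartAt hy.1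
  have hkc : ∀ δ > 0, Continuous fun y => kernelIntegral g φ χ x y δ := fun δ hδ =>
    hχ.continuous_kernelIntegral_right hφ hinj hr hd hδ x
  have hKc : Continuous fun y => remainderKernel g φ χ x y :=
    hχ.continuous_remainderKernel_right hφ hinj hr hd x
  have hac : ∀ δ > 0, ContinuousOn (fun y => kernelIntegral g φ a x y δ) N := fun δ hδ => by
    have h := (hcont δ hδ).comp (f := fun y => (z₀, chartAt (Coord d) x y)) (s := N)
      (continuousOn_const.prodMk ((chartAt (Coord d) x).continuousOn.mono inter_subset_left))
      fun y hy => (hNq y hy).2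
    refine h.congr fun y hy => ?_
    simp only [Function.comp_apply]
    rw [hpx, hNpt y hy]
  have hbN : ∀ y ∈ N, ∀ δ ∈ Ioc (0 : ℝ) 1, ‖kernelIntegral g φ a x y δ‖ ≤ C :=
    fun y hy δ hδ => by
      have := hC _ (hNq y hy).1 δ hδ
      simp only at this
      rwa [hpx, hNpt y hy] at this
  have hlN : ∀ y ∈ N, Tendsto (kernelIntegral g φ a x y) (𝓝[>] 0)
      (𝓝 (remainderKernel g φ χ x y)) := fun y hy => by
    have := hc.1 _ (hNq y hy).2
    simp only at this
    rwa [hpx, hNpt y hy] at this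
  have hsN : ∀ y ∈ N, ∀ δ > 0, kernelIntegral g φ χ x y δ =
      kernelIntegral g φ a x y δ + kernelIntegral g φ (fun _ _ _ => 1) x y δ := fun y hy δ hδ => by
    have := hsplit _ (hNq y hy).2 δ hδ
    simp only at this
    rwa [hpx, hNpt y hy] at this
  have hreg_off : ∀ y ∈ Nᶜ, RegularKernelAt (d := d) (kernelIntegral g φ χ)
      (remainderKernel g φ χ) (x, y) := fun y hy =>
    hχ.regularKernelAt_of_ne hφ hinj hr hd (w := (x, y)) fun h => hy (by rw [← show x = y from h]; exact hNx)
  obtain ⟨C', hC'⟩ : ∃ C', ∀ y ∈ Nᶜ, ∀ δ ∈ Ioc (0 : ℝ) 1, ‖kernelIntegral g φ χ x y δ‖ ≤ C' := by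
    obtain ⟨C', -, h⟩ := exists_bound_of_isCompact (X := M) (Y := Ioc (0 : ℝ) 1) (g := fun _ => 1)
      hN.isClosed_compl.isCompact (f := fun y δ => ‖kernelIntegral g φ χ x y δ‖)
      (fun _ => zero_le_one) fun y hy => by
        obtain ⟨U, hU, C, hC⟩ := (hreg_off y hy).exists_bound
        refine ⟨_, (Continuous.prodMk_right x).continuousAt.preimage_mem_nhds hU, C,
          fun y' hy' δ => ?_⟩
        rw [mul_one]
        exact hC _ hy' δ δ.2
    exact ⟨C', fun y hy δ hδ => by simpa using h y hy ⟨δ, hδ⟩⟩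
  have l1 := tendsto_setIntegral_of_bound (μ := μ) hN.measurableSet hf
    (fun δ hδ => (hac δ hδ).aestronglyMeasurable hN.measurableSet) hbN hlN
  have l2 := tendsto_setIntegral_of_bound (μ := μ) hN.measurableSet.compl hf
    (fun δ hδ => (hkc δ hδ).aestronglyMeasurable) hC' fun y hy => (hreg_off y hy).tendsto
  have hKint := integral_add_compl (μ := μ) (f := fun y => remainderKernel g φ χ x y * f y)
    hN.measurableSet (integrable_riemannianMeasure_of_continuous g (hKc.mul hf))
  rw [← hKint, ← add_assoc]
  refine ((hlim.add l1).add l2).congr' ?_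
  filter_upwards [Ioc_mem_nhdsGT (zero_lt_one' ℝ)] with δ hδ
  have hi : Integrable (fun y => kernelIntegral g φ χ x y δ * f y) μ :=
    integrable_riemannianMeasure_of_continuous g ((hkc δ hδ.1).mul hf)
  -- Continuity for the amplitude 1 is inferred from the other two, as their difference.
  have h1c : ContinuousOn (fun y => kernelIntegral g φ (fun _ _ _ => 1) x y δ * f y) N := by
    refine (((hkc δ hδ.1).continuousOn.sub (hac δ hδ.1)).congr fun y hy => ?_).mul hf.continuousOn
    rw [Pi.sub_apply, hsN y hy δ hδ.1, add_sub_cancel_left]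
  have hia : IntegrableOn (fun y => kernelIntegral g φ a x y δ * f y) N μ := by
    obtain ⟨B, hB⟩ := isCompact_univ.bddAbove_image (f := fun y => ‖f y‖) (by fun_prop)
    refine IntegrableOn.of_bound (measure_lt_top _ _)
      (((hac δ hδ.1).mul hf.continuousOn).aestronglyMeasurable hN.measurableSet) (C * B) ?_
    filter_upwards [ae_restrict_mem hN.measurableSet] with y hy
    rw [norm_mul]
    exact mul_le_mul (hbN y hy δ hδ) (hB ⟨y, mem_univ _, rfl⟩) (norm_nonneg _)
      ((norm_nonneg _).trans (hbN y hy δ hδ))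
  have hi1 : IntegrableOn (fun y => kernelIntegral g φ (fun _ _ _ => 1) x y δ * f y) N μ := by
    refine (hi.integrableOn.sub hia).congr_fun (fun y hy => ?_) hN.measurableSet
    simp only [Pi.sub_apply]
    rw [hsN y hy δ hδ.1]
    ring
  rw [← integral_add_compl hN.measurableSet hi, ← setIntegral_coordBall g hball
    (h1c.aestronglyMeasurable hN.measurableSet), ← integral_add hi1 hia]
  congr 1
  refine setIntegral_congr_fun hN.measurableSet fun y hy => ?_
  rw [hsN y hy δ hδ.1]
  ring

end Identity

/-! ### Symbols as amplitudes. -/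

section Symbols

variable {d : ℕ} {M : Type*} [TopologicalSpace M] [ChartedSpace (Coord d) M]
  [IsManifold (𝓡 d) ∞ M] {g : Metric d M} {r : ℝ} {φ : M → (y : M) → Cotangent d y → ℝ}
  {χ : M → (y : M) → Cotangent d y → ℂ}

/-- The estimates of a symbol of order `-N` for the derivatives with respect to the point. -/
structure SymbolBound (N : ℕ) (b : (y : M) → Cotangent d y → ℂ) : Prop where
  smooth : SmoothOnCot b
  bound : ∀ (p : M) (Q : Set (Coord d)), IsCompact Q → Q ⊆ (chartAt (Coord d) p).target →
    ∀ i : ℕ, ∃ C : ℝ, ∀ z ∈ Q, ∀ ξ : Coord d, 1 ≤ ‖ξ‖ →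
      ‖iteratedFDeriv ℝ i (fun z' => b (pt p z') (covec p (pt p z') ξ)) z‖ ≤ C * ‖ξ‖ ^ (-(N : ℤ))

theorem IsSymbolOfOrder.symbolBound {N : ℕ} {b : (y : M) → Cotangent d y → ℂ}
    (hb : IsSymbolOfOrder (-(N : ℤ)) b) : SymbolBound N b := by
  refine ⟨hb.1, fun p Q hQ hQt i => ?_⟩
  obtain ⟨C, hC⟩ := hb.2 p Q hQ hQt i 0
  refine ⟨C, fun z hz ξ hξ => ?_⟩
  have := hC z hz ξ hξ
  rw [norm_iteratedFDeriv_zero] at this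
  simpa using this

theorem SymbolBound.congr {N : ℕ} {b c : (y : M) → Cotangent d y → ℂ} (hb : SymbolBound N b)
    (h : ∀ y (η : Cotangent d y), η ≠ 0 → b y η = c y η) : SymbolBound N c := by
  have key : ∀ (p : M) (z : Coord d), z ∈ (chartAt (Coord d) p).target → ∀ ξ : Coord d, ξ ≠ 0 →
      b (pt p z) (covec p (pt p z) ξ) = c (pt p z) (covec p (pt p z) ξ) := fun p z hz ξ hξ =>
    h _ _ (covec_ne_zero (pt_mem_source hz) hξ)
  refine ⟨fun p => (hb.smooth p).congr fun q hq => (key p q.1 hq.1 q.2 hq.2).symm,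
    fun p Q hQ hQt i => ?_⟩
  obtain ⟨C, hC⟩ := hb.bound p Q hQ hQt i
  refine ⟨C, fun z hz ξ hξ => ?_⟩
  have hξ0 : ξ ≠ 0 := by
    rintro rfl
    norm_num at hξ
  have he : (fun z' => c (pt p z') (covec p (pt p z') ξ)) =ᶠ[𝓝 z]
      fun z' => b (pt p z') (covec p (pt p z') ξ) := by
    filter_upwards [(chartAt (Coord d) p).open_target.mem_nhds (hQt hz)] with z' hz'
    exact (key p z' hz' ξ hξ0).symm
  rw [(he.iteratedFDeriv ℝ i).eq_of_nhds]
  exact hC z hz ξ hξ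

theorem SymbolBound.contDiffAt {N : ℕ} {b : (y : M) → Cotangent d y → ℂ} (hb : SymbolBound N b)
    {p : M} {z ξ : Coord d} (hz : z ∈ (chartAt (Coord d) p).target) (hξ : ξ ≠ 0) :
    ContDiffAt ℝ ∞ (fun z' => b (pt p z') (covec p (pt p z') ξ)) z :=
  ((hb.smooth p).contDiffAt (((chartAt (Coord d) p).open_target.prod
    isOpen_compl_singleton).mem_nhds (show (z, ξ) ∈ _ from ⟨hz, hξ⟩))).comp z
    (f := fun z' => (z', ξ)) (by fun_prop)

theorem SymbolBound.sub_one {b : (y : M) → Cotangent d y → ℂ} (hb : SymbolBound 0 b) :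
    SymbolBound 0 (fun y η => b y η - 1) := by
  refine ⟨fun p => (hb.smooth p).sub contDiffOn_const, fun p Q hQ hQt i => ?_⟩
  obtain ⟨C, hC⟩ := hb.bound p Q hQ hQt i
  refine ⟨C + 1, fun z hz ξ hξ => ?_⟩
  have hξ0 : ξ ≠ 0 := by
    rintro rfl
    norm_num at hξ
  have h1 := hC z hz ξ hξ
  have hsm := (hb.contDiffAt (hQt hz) hξ0).of_le (m := (i : WithTop ℕ∞))
    (by exact_mod_cast le_top)
  have e := iteratedFDeriv_sub_apply (i := i) (g := fun _ => (1 : ℂ)) hsm contDiffAt_const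
  change iteratedFDeriv ℝ i (fun z' => b (pt p z') (covec p (pt p z') ξ) - 1) z = _ at e
  rw [e]
  have h2 : ‖iteratedFDeriv ℝ i (fun _ : Coord d => (1 : ℂ)) z‖ ≤ 1 := by
    rcases Nat.eq_zero_or_pos i with rfl | hi
    · simp
    · rw [iteratedFDeriv_const_of_ne hi.ne']; simp
  simp only [Nat.cast_zero, neg_zero, zpow_zero, mul_one] at h1 ⊢
  exact (norm_sub_le _ _).trans (add_le_add h1 h2)

theorem zpow_neg_le_one_add {t : ℝ} (ht : 1 ≤ t) (N : ℕ) :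
    t ^ (-(N : ℤ)) ≤ 2 ^ N * (1 + t) ^ (-(N : ℝ)) := by
  rw [zpow_neg, zpow_natCast, Real.rpow_neg (by linarith), Real.rpow_natCast, ← div_eq_mul_inv,
    inv_eq_one_div, div_le_div_iff₀ (by positivity) (by positivity), one_mul, ← mul_pow]
  exact pow_le_pow_left₀ (by linarith) (by linarith) N

/-- A symbol is uncontrolled at `ξ = 0`; the factor `ψ` removes that region. For `‖ξ‖ ≥ 1` the
symbol estimate applies, for `‖ξ‖ ≤ 1` compactness does, all powers of `1 + ‖ξ‖` being comparable to
constants there. -/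
theorem SymbolBound.growthBound {N : ℕ} {b : (y : M) → Cotangent d y → ℂ} (hb : SymbolBound N b)
    {ψ : Coord d → ℝ} (hψ : ContDiff ℝ ∞ ψ) (hψ0 : ∀ᶠ ξ in 𝓝 0, ψ ξ = 0)
    (hψ1 : ∀ ξ, 1 ≤ ‖ξ‖ → ψ ξ = 1) (p : M) (k : ℕ) :
    GrowthBound (chartAt (Coord d) p).target k (-(N : ℝ))
      (fun z ξ => (ψ ξ : ℂ) * b (pt p z) (covec p (pt p z) ξ)) := by
  have hO := (chartAt (Coord d) p).open_target
  have hsm : ContDiffOn ℝ ∞ (fun q : Coord d × Coord d =>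
      (ψ q.2 : ℂ) * b (pt p q.1) (covec p (pt p q.1) q.2))
      ((chartAt (Coord d) p).target ×ˢ univ) := by
    rintro ⟨z, ξ⟩ ⟨hz, -⟩
    refine ContDiffAt.contDiffWithinAt ?_
    rcases eq_or_ne ξ 0 with rfl | hξ
    · refine (contDiffAt_const (c := (0 : ℂ))).congr_of_eventuallyEq ?_
      filter_upwards [(continuousAt_snd (p := (z, (0 : Coord d)))).eventually hψ0] with q hq
      rw [hq, Complex.ofReal_zero, zero_mul]
    · exact ((Complex.ofRealCLM.contDiff.comp (hψ.comp contDiff_snd)).contDiffAt).mul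
        ((hb.smooth p).contDiffAt ((hO.prod isOpen_compl_singleton).mem_nhds ⟨hz, hξ⟩))
  refine ⟨hsm, fun z₀ hz₀ => ?_⟩
  obtain ⟨ρ, hρ, hρt⟩ := Metric.nhds_basis_closedBall.mem_iff.1 (hO.mem_nhds hz₀)
  have key : ∀ i : ℕ, ∃ C : ℝ, 0 ≤ C ∧ ∀ᶠ z in 𝓝 z₀, ∀ ξ : Coord d,
      ‖iteratedFDeriv ℝ i (fun z => (ψ ξ : ℂ) * b (pt p z) (covec p (pt p z) ξ)) z‖ ≤
        C * (1 + ‖ξ‖) ^ (-(N : ℝ)) := fun i => by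
    obtain ⟨C₁, hC₁⟩ := hb.bound p _ (isCompact_closedBall z₀ ρ) hρt i
    obtain ⟨C₂, hC₂0, hC₂⟩ := exists_eventually_le_of_isCompact hO
      (continuousOn_iteratedFDeriv_partial (F := fun (z ξ : Coord d) =>
        (ψ ξ : ℂ) * b (pt p z) (covec p (pt p z) ξ))
        hO hsm i) hz₀ (isCompact_closedBall (0 : Coord d) 1)
    refine ⟨(|C₁| + C₂) * 2 ^ N, by positivity, ?_⟩
    filter_upwards [hC₂, Metric.closedBall_mem_nhds z₀ hρ] with z hz2 hz1 ξ
    rcases le_total 1 ‖ξ‖ with h | h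
    · have e : (fun z : Coord d => (ψ ξ : ℂ) * b (pt p z) (covec p (pt p z) ξ)) =
          fun z => b (pt p z) (covec p (pt p z) ξ) := by
        funext z
        rw [hψ1 ξ h, Complex.ofReal_one, one_mul]
      rw [e]
      calc _ ≤ C₁ * ‖ξ‖ ^ (-(N : ℤ)) := hC₁ z hz1 ξ h
        _ ≤ (|C₁| + C₂) * ‖ξ‖ ^ (-(N : ℤ)) := by
          gcongr
          exact (le_abs_self _).trans (le_add_of_nonneg_right hC₂0)
        _ ≤ (|C₁| + C₂) * (2 ^ N * (1 + ‖ξ‖) ^ (-(N : ℝ))) := by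
          gcongr
          exact zpow_neg_le_one_add h N
        _ = _ := by ring
    · have h1 := hz2 ξ (by simpa using h)
      refine h1.trans ?_
      have h2 : 1 ≤ 2 ^ N * (1 + ‖ξ‖) ^ (-(N : ℝ)) := by
        rw [Real.rpow_neg (by positivity), Real.rpow_natCast, ← div_eq_mul_inv,
          one_le_div (by positivity)]
        exact pow_le_pow_left₀ (by positivity) (by linarith) N
      calc C₂ ≤ |C₁| + C₂ := le_add_of_nonneg_left (abs_nonneg _)
        _ ≤ (|C₁| + C₂) * (2 ^ N * (1 + ‖ξ‖) ^ (-(N : ℝ))) :=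
          le_mul_of_one_le_right (by positivity) h2
        _ = _ := by ring
  choose C hC0 hC using key
  refine ⟨_, (Finset.eventually_all (Finset.range (k + 1))).2 fun i _ => hC i,
    ∑ i ∈ Finset.range (k + 1), C i, Finset.sum_nonneg fun i _ => hC0 i, fun z hz ξ i hi => ?_⟩
  have hi' := Finset.mem_range_succ_iff.2 hi
  refine (hz i hi' ξ).trans ?_
  gcongr
  exact Finset.single_le_sum (fun i _ => hC0 i) hi'

theorem exists_hamiltonian_le (g : Metric d M) {p : M} {z₀ : Coord d}
    (hz₀ : z₀ ∈ (chartAt (Coord d) p).target) :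
    ∃ U ∈ 𝓝 z₀, ∃ c ∈ Ioc (0 : ℝ) 1, ∀ z ∈ U, ∀ ξ : Coord d, ‖ξ‖ < c →
      hamiltonian g (pt p z) (covec p (pt p z) ξ) ≤ 1 / 2 := by
  have hO := (chartAt (Coord d) p).open_target
  have hH := (contDiffOn_hamSq g p).continuousOn.continuousAt
    ((hO.prod isOpen_univ).mem_nhds (show (z₀, (0 : Coord d)) ∈ _ from ⟨hz₀, mem_univ _⟩))
  have h0 : hamSq g p z₀ 0 < 1 / 4 := by simp [hamSq, quadForm]
  have hlt : ∀ᶠ q in 𝓝 (z₀, (0 : Coord d)), hamSq g p q.1 q.2 < 1 / 4 :=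
    hH.eventually_lt continuousAt_const h0
  rw [nhds_prod_eq, eventually_prod_iff] at hlt
  obtain ⟨P, hU, P', hU', h⟩ := hlt
  obtain ⟨c, hc, hcU⟩ := Metric.mem_nhds_iff.1 hU'
  refine ⟨_, inter_mem hU (hO.mem_nhds hz₀), min c 1, ⟨lt_min hc one_pos, min_le_right _ _⟩,
    fun z hz ξ hξ => ?_⟩
  have h1 : hamSq g p z ξ < 1 / 4 :=
    h hz.1 (hcU (by simpa using hξ.trans_le (min_le_left _ _)))
  rw [hamSq_eq g hz.2] at h1
  nlinarith [hamiltonian_nonneg g (pt p z) (covec p (pt p z) ξ)]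

theorem IsCutoff.exists_growthBound_symbol [T2Space M] (hχ : IsCutoff g r χ)
    (hφ : IsLeviCivitaPhase g r φ) (hinj : LeInjectivityRadius g r) (hr : 0 < r) (hd : 1 ≤ d)
    {w : M × M} (h : w ∈ closure (cutoffSupport χ)) :
    ∃ Ω ⊆ regularRegion φ w.1 w.2, IsOpen Ω ∧ chartPair w.1 w.2 w ∈ Ω ∧
      GrowthBound Ω 0 0 (ampCoord g φ χ w.1 w.2) ∧
      ∀ (N : ℕ) (b : (y : M) → Cotangent d y → ℂ), SymbolBound N b → ∀ k : ℕ,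
        GrowthBound Ω k (-(N : ℝ)) (ampCoord g φ (fun x y η => b y η * χ x y η) w.1 w.2) := by
  obtain ⟨Ω₀, hΩ₀sub, hΩ₀, hwΩ₀, R, hR, hhom, -⟩ := hχ.exists_homAmp_ampCoord hφ hinj hr hd h
  obtain ⟨U, hU, c, hc, hle⟩ := exists_hamiltonian_le g (hΩ₀sub hwΩ₀).1.2
  obtain ⟨U', hU'U, hU'o, hU'⟩ := mem_nhds_iff.1 hU
  set Ω := Ω₀ ∩ Prod.snd ⁻¹' U'
  have hΩ : IsOpen Ω := hΩ₀.inter (hU'o.preimage continuous_snd)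
  have hχb : ∀ k, GrowthBound Ω k 0 (ampCoord g φ χ w.1 w.2) := fun k => by
    simpa using (hhom.growthBound hΩ₀ hR k).restrict (inter_subset_left : Ω ⊆ Ω₀)
  refine ⟨Ω, inter_subset_left.trans hΩ₀sub, hΩ, ⟨hwΩ₀, hU'⟩, hχb 0, fun N b hb k => ?_⟩
  -- `ψ = 1 - B` vanishes near `0` and equals 1 for `‖ξ‖ ≥ c`. For `‖ξ‖ < c` one has `h ≤ 1 / 2`, so
  -- the cut-off vanishes and inserting `ψ` changes nothing.
  let B : ContDiffBump (0 : Coord d) := ⟨c / 2, c, by linarith [hc.1], by linarith [hc.1]⟩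
  set ψ : Coord d → ℝ := fun ξ => 1 - B ξ
  have hψ1 : ∀ ξ, c ≤ ‖ξ‖ → ψ ξ = 1 := fun ξ hξ => by
    simp only [ψ]
    rw [B.zero_of_le_dist (by simpa using hξ), sub_zero]
  have hG := hb.growthBound (ψ := ψ) (contDiff_const.sub B.contDiff) (by
    filter_upwards [Metric.closedBall_mem_nhds (0 : Coord d) B.rIn_pos] with ξ hξ
    simp only [ψ]
    rw [B.one_of_mem_closedBall hξ, sub_self]) (fun ξ hξ => hψ1 ξ (hc.2.trans hξ)) w.2 k
  have hG' := (hG.comp (Ω' := Ω) (chartAt (Coord d) w.2).open_target hΩ contDiffOn_snd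
    fun q hq => (hΩ₀sub hq.1).1.2).mul hΩ (hχb k)
  rw [add_zero] at hG'
  have heq : ∀ q ∈ Ω, ∀ ξ, ampCoord g φ (fun x y η => b y η * χ x y η) w.1 w.2 q ξ =
      (ψ ξ : ℂ) * b (pt w.2 q.2) (covec w.2 (pt w.2 q.2) ξ) * ampCoord g φ χ w.1 w.2 q ξ :=
    fun q hq ξ => by
      simp only [ampCoord]
      rcases lt_or_ge ‖ξ‖ c with hlt | hge
      · rw [hχ.zero_of_le _ _ _ (hle _ (hU'U hq.2) ξ hlt)]
        ring
      · rw [hψ1 ξ hge]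
        push_cast
        ring
  refine ⟨hG'.smooth.congr fun p hp => heq p.1 hp.1 p.2, fun q₀ hq₀ => ?_⟩
  obtain ⟨W, hW, C, hC, hbd⟩ := hG'.bound q₀ hq₀
  refine ⟨_, inter_mem hW (hΩ.mem_nhds hq₀), C, hC, fun q hq ξ i hi => ?_⟩
  have he : (fun q => ampCoord g φ (fun x y η => b y η * χ x y η) w.1 w.2 q ξ) =ᶠ[𝓝 q]
      fun q => (ψ ξ : ℂ) * b (pt w.2 q.2) (covec w.2 (pt w.2 q.2) ξ) *
        ampCoord g φ χ w.1 w.2 q ξ := by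
    filter_upwards [hΩ.mem_nhds hq.2] with q' hq'
    exact heq q' hq' ξ
  rw [(he.iteratedFDeriv ℝ i).eq_of_nhds]
  exact hbd q hq.1 ξ i hi

end Symbols

/-! ### Symbols with trivial expansion give the identity modulo smoothing. -/

section Sufficiency

variable {d : ℕ} {M : Type*} [TopologicalSpace M] [ChartedSpace (Coord d) M]
  [IsManifold (𝓡 d) ∞ M] {g : Metric d M} {r : ℝ} {φ : M → (y : M) → Cotangent d y → ℝ}
  {χ : M → (y : M) → Cotangent d y → ℂ}

/-- The amplitude `b(y, η) χ(x; y, η)`. -/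
def cutAmp (χ : M → (y : M) → Cotangent d y → ℂ) (b : (y : M) → Cotangent d y → ℂ)
    (x y : M) (η : Cotangent d y) : ℂ := b y η * χ x y η

theorem cutAmp_eq_zero (b : (y : M) → Cotangent d y → ℂ) (x y : M)
    (h : (x, y) ∉ cutoffSupport χ) (η : Cotangent d y) : cutAmp χ b x y η = 0 := by
  rw [cutAmp, IsCutoff.support_self x y h, mul_zero]

theorem IsCutoff.continuous_kernelIntegral_cutAmp [T2Space M] (hχ : IsCutoff g r χ)
    (hφ : IsLeviCivitaPhase g r φ) (hinj : LeInjectivityRadius g r) (hr : 0 < r) (hd : 1 ≤ d)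
    {N : ℕ} {b : (y : M) → Cotangent d y → ℂ} (hb : SymbolBound N b) {δ : ℝ} (hδ : 0 < δ) :
    Continuous (fun w : M × M => kernelIntegral g φ (cutAmp χ b) w.1 w.2 δ) := by
  refine continuous_iff_continuousAt.2 fun w =>
    hχ.continuousAt_kernelIntegral hφ hd (cutAmp_eq_zero b) (fun w hw => ?_) hδ w
  obtain ⟨Ω, hsub, hΩ, hwΩ, -, h⟩ := hχ.exists_growthBound_symbol hφ hinj hr hd hw
  exact ⟨Ω, hsub.trans (regularRegion_subset _ _), hΩ, hwΩ, _, h N b hb 0⟩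

/-- Additivity needs integrability of both regularised integrands, which is known in charts around
points of the support; elsewhere all terms vanish. -/
theorem IsCutoff.kernelIntegral_add [T2Space M] (hχ : IsCutoff g r χ)
    (hφ : IsLeviCivitaPhase g r φ) (hinj : LeInjectivityRadius g r) (hr : 0 < r) (hd : 1 ≤ d)
    {N : ℕ} {s : (y : M) → Cotangent d y → ℂ} (hb : SymbolBound N fun y η => s y η - 1) {δ : ℝ}
    (hδ : 0 < δ) (x y : M) : kernelIntegral g φ (cutAmp χ s) x y δ =
      kernelIntegral g φ χ x y δ + kernelIntegral g φ (cutAmp χ fun y η => s y η - 1) x y δ := by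
  by_cases h : (x, y) ∈ cutoffSupport χ
  · obtain ⟨Ω, hsub, hΩ, hwΩ, hG, hGb⟩ :=
      hχ.exists_growthBound_symbol hφ hinj hr hd (subset_closure h)
    have hq := regularRegion_subset _ _ (hsub hwΩ)
    have e : ∀ {a : M → (y : M) → Cotangent d y → ℂ},
        (∀ x y, (x, y) ∉ cutoffSupport χ → ∀ η : Cotangent d y, a x y η = 0) →
        kernelIntegral g φ a x y δ = oscIntegral (phaseCoord φ x y) (fun q => hamSq g y q.2)
          (ampCoord g φ a x y) δ (chartPair x y (x, y)) := fun ha => by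
      have := hχ.kernelIntegral_eq_oscIntegral hφ hd ha hq δ
      simp only [chartPair] at this
      rwa [pt_chartAt (mem_chart_source _ _), pt_chartAt (mem_chart_source _ _)] at this
    rw [e (cutAmp_eq_zero s), e IsCutoff.support_self, e (cutAmp_eq_zero _)]
    have hadd := oscIntegral_add (V := phaseCoord φ x y) ((elliptic_hamSq_snd g x y).restrict
      (hsub.trans (regularRegion_subset _ _))) hG (hGb N _ hb 0) hδ hwΩ
    refine Eq.trans ?_ hadd
    congr 1
    funext q ξ
    simp only [ampCoord, cutAmp]
    ring
  · rw [kernelIntegral_eq_zero (cutAmp_eq_zero s) h,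
      kernelIntegral_eq_zero IsCutoff.support_self h, kernelIntegral_eq_zero (cutAmp_eq_zero _) h,
      add_zero]

/-- An amplitude of every order `-N` is absolutely integrable together with its derivatives, so the
unregularised integral is the smooth limit, on the diagonal as well. -/
theorem IsCutoff.regularKernelAt_symbol [T2Space M] (hχ : IsCutoff g r χ)
    (hφ : IsLeviCivitaPhase g r φ) (hinj : LeInjectivityRadius g r) (hr : 0 < r) (hd : 1 ≤ d)
    {b : (y : M) → Cotangent d y → ℂ} (hb : ∀ N, SymbolBound N b) (w : M × M) :
    RegularKernelAt (d := d) (kernelIntegral g φ (cutAmp χ b))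
      (fun x y => kernelIntegral g φ (cutAmp χ b) x y 0) w := by
  by_cases hcl : w ∈ closure (cutoffSupport χ)
  · obtain ⟨Ω, hsub, hΩ, hwΩ, -, hGb⟩ := hχ.exists_growthBound_symbol hφ hinj hr hd hcl
    have hsub' := hsub.trans (regularRegion_subset _ _)
    exact .of_growthBound hφ hsub' hΩ hwΩ (fun k N => hGb N b (hb N) k)
      (fun q hq δ => hχ.kernelIntegral_eq_oscIntegral hφ hd (cutAmp_eq_zero b) (hsub' hq) δ)
      fun q hq => rfl
  · exact .of_notMem_closure (cutAmp_eq_zero b) hcl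
      fun x y hxy _ => kernelIntegral_eq_zero (cutAmp_eq_zero b) hxy 0

variable [MeasurableSpace M] [BorelSpace M]

theorem integral_add_mul_of_continuous [T2Space M] [CompactSpace M] (g : Metric d M)
    {k l f : M → ℂ} (hk : Continuous k) (hl : Continuous l) (hf : Continuous f) :
    ∫ y, (k y + l y) * f y ∂(riemannianMeasure g) =
      (∫ y, k y * f y ∂(riemannianMeasure g)) + ∫ y, l y * f y ∂(riemannianMeasure g) := by
  have h1 : Integrable (fun y => k y * f y) (riemannianMeasure g) :=
    integrable_riemannianMeasure_of_continuous g (hk.mul hf)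
  have h2 : Integrable (fun y => l y * f y) (riemannianMeasure g) :=
    integrable_riemannianMeasure_of_continuous g (hl.mul hf)
  simp_rw [add_mul]
  exact integral_add h1 h2

theorem regularizedIntegral_eq (s : (y : M) → Cotangent d y → ℂ) (f : M → ℂ) (x : M) (δ : ℝ) :
    regularizedIntegral g φ χ s f x δ =
      ∫ y, kernelIntegral g φ (cutAmp χ s) x y δ * f y ∂(riemannianMeasure g) := by
  rw [regularizedIntegral]
  refine integral_congr_ae (.of_forall fun y => ?_)
  simp only
  rw [kernelIntegral]
  congr 1
  refine integral_congr_ae (.of_forall fun ξ => ?_)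
  simp only [cutAmp]
  ring

theorem tendsto_integral_of_regularKernelAt [T2Space M] [CompactSpace M] {k : M → M → ℝ → ℂ}
    {K : M → M → ℂ} {x : M} (h : ∀ y, RegularKernelAt (d := d) k K (x, y))
    (hc : ∀ δ > 0, Continuous fun y => k x y δ) {f : M → ℂ} (hf : Continuous f) :
    Tendsto (fun δ => ∫ y, k x y δ * f y ∂(riemannianMeasure g)) (𝓝[>] 0)
      (𝓝 (∫ y, K x y * f y ∂(riemannianMeasure g))) := by
  obtain ⟨C, -, hC⟩ := exists_bound_of_isCompact (X := M) (Y := Ioc (0 : ℝ) 1) (g := fun _ => 1)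
    isCompact_univ (f := fun y δ => ‖k x y δ‖) (fun _ => zero_le_one) fun y _ => by
      obtain ⟨U, hU, C, hC⟩ := (h y).exists_bound
      refine ⟨_, (Continuous.prodMk_right x).continuousAt.preimage_mem_nhds hU, C,
        fun y' hy' δ => ?_⟩
      rw [mul_one]
      exact hC _ hy' δ δ.2
  have := tendsto_setIntegral_of_bound (μ := riemannianMeasure g) (S := univ) MeasurableSet.univ
    (k := fun y δ => k x y δ) (K := fun y => K x y) hf
    (fun δ hδ => (hc δ hδ).aestronglyMeasurable) (C := C)
    (fun y _ δ hδ => by simpa using hC y (mem_univ _) ⟨δ, hδ⟩) fun y _ => (h y).tendsto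
  simpa only [Measure.restrict_univ] using this

/-- The part with amplitude `χ` is already known to converge, so the existence and the value of the
limit for `s` are decided by `s - 1` alone. Both directions of the theorem rest on this equivalence.
-/
theorem IsCutoff.tendsto_remainder [T2Space M] [CompactSpace M] (hχ : IsCutoff g r χ)
    (hφ : IsLeviCivitaPhase g r φ) (hinj : LeInjectivityRadius g r) (hr : 0 < r) (hd : 1 ≤ d)
    {N : ℕ} {s : (y : M) → Cotangent d y → ℂ} (hb : SymbolBound N fun y η => s y η - 1)
    {f : M → ℂ} (hf : Continuous f) (x : M) {c : ℂ} :
    HasOscillatoryValue g φ χ s f x c ↔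
      Tendsto (fun δ => ∫ y, kernelIntegral g φ (cutAmp χ fun y η => s y η - 1) x y δ * f y
        ∂(riemannianMeasure g)) (𝓝[>] 0)
        (𝓝 (c - (f x + ∫ y, remainderKernel g φ χ x y * f y ∂(riemannianMeasure g)))) := by
  have h1 := hχ.tendsto_kernelIntegral hφ hinj hr hd hf x
  have hsplit : ∀ δ > 0, regularizedIntegral g φ χ s f x δ =
      (∫ y, kernelIntegral g φ χ x y δ * f y ∂(riemannianMeasure g)) +
      ∫ y, kernelIntegral g φ (cutAmp χ fun y η => s y η - 1) x y δ * f y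
        ∂(riemannianMeasure g) := fun δ hδ => by
    have hc1 := hχ.continuous_kernelIntegral_right hφ hinj hr hd hδ x
    have hc2 := continuous_slice (f := fun x y =>
      kernelIntegral g φ (cutAmp χ fun y η => s y η - 1) x y δ)
      (hχ.continuous_kernelIntegral_cutAmp hφ hinj hr hd hb hδ) x
    rw [regularizedIntegral_eq, ← integral_add_mul_of_continuous g hc1 hc2 hf]
    refine integral_congr_ae (.of_forall fun y => ?_)
    simp only
    rw [hχ.kernelIntegral_add hφ hinj hr hd hb hδ]
  constructor
  · intro h
    refine (Tendsto.sub h h1).congr' ?_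
    filter_upwards [self_mem_nhdsWithin] with δ hδ
    rw [hsplit δ hδ, add_sub_cancel_left]
  · intro h
    have := h.add h1
    rw [sub_add_cancel] at this
    refine this.congr' ?_
    filter_upwards [self_mem_nhdsWithin] with δ hδ
    rw [hsplit δ hδ, add_comm]

theorem IsCutoff.isIdentityModSmoothing [T2Space M] [CompactSpace M] (hχ : IsCutoff g r χ)
    (hφ : IsLeviCivitaPhase g r φ) (hinj : LeInjectivityRadius g r) (hr : 0 < r) (hd : 1 ≤ d)
    {s : (y : M) → Cotangent d y → ℂ} (hb : ∀ N, SymbolBound N fun y η => s y η - 1) :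
    IsIdentityModSmoothing g φ χ s := by
  set b : (y : M) → Cotangent d y → ℂ := fun y η => s y η - 1
  have hreg := hχ.regularKernelAt_symbol hφ hinj hr hd hb
  have hs1 := hχ.contMDiff_remainderKernel hφ hinj hr hd
  have hs2 : ContMDiff ((𝓡 d).prod (𝓡 d)) 𝓘(ℝ, ℂ) ∞
      (fun q : M × M => kernelIntegral g φ (cutAmp χ b) q.1 q.2 0) := fun w => (hreg w).contMDiffAt
  refine ⟨fun x y => remainderKernel g φ χ x y + kernelIntegral g φ (cutAmp χ b) x y 0,
    hs1.add hs2, fun f hf x => ?_⟩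
  have hfc := hf.continuous
  rw [hχ.tendsto_remainder hφ hinj hr hd (hb 0) hfc]
  have h := tendsto_integral_of_regularKernelAt (g := g) (x := x) (fun y => hreg (x, y))
    (fun δ hδ => continuous_slice (f := fun x y => kernelIntegral g φ (cutAmp χ b) x y δ)
      (hχ.continuous_kernelIntegral_cutAmp hφ hinj hr hd (hb 0) hδ) x) hfc
  have hc1 := hχ.continuous_remainderKernel_right hφ hinj hr hd x
  have hc2 := continuous_slice (f := fun x y => kernelIntegral g φ (cutAmp χ b) x y 0)
    hs2.continuous x
  rw [integral_add_mul_of_continuous g hc1 hc2 hfc, ← add_assoc, add_sub_cancel_left]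
  exact h

theorem symbolBound_zero (N : ℕ) :
    SymbolBound N (fun (y : M) (_ : Cotangent d y) => (1 : ℂ) - 1) := by
  simp only [sub_self]
  refine ⟨fun p => contDiffOn_const, fun p Q _ _ i => ⟨0, fun z _ ξ _ => ?_⟩⟩
  have : iteratedFDeriv ℝ i (fun _ : Coord d => (0 : ℂ)) z = 0 := by
    simp [iteratedFDeriv_fun_zero]
  rw [this, norm_zero, zero_mul]

/-- The terms of order above `-m` sum to 1 when `m ≥ 1`, so `s - 1` is the remainder of the
expansion. For `m = 0` nothing is subtracted and 1 is itself of order zero. -/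
theorem IsPolyhomogeneous.symbolBound_sub_one {s : (y : M) → Cotangent d y → ℂ}
    {c : ℕ → (y : M) → Cotangent d y → ℂ} (hs : IsPolyhomogeneous s c) {m : ℕ}
    (h0 : 1 ≤ m → ∀ (y : M) (η : Cotangent d y), η ≠ 0 → c 0 y η = 1)
    (hk : ∀ k : ℕ, 1 ≤ k → k < m → ∀ (y : M) (η : Cotangent d y), η ≠ 0 → c k y η = 0) :
    SymbolBound m fun y η => s y η - 1 := by
  have h := (hs.expansion m).symbolBound
  rcases Nat.eq_zero_or_pos m with rfl | hm
  · simpa using h.sub_one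
  · refine h.congr fun y η hη => ?_
    rw [Finset.sum_eq_single_of_mem 0 (Finset.mem_range.2 hm) fun k hkm hk0 =>
      hk k (Nat.one_le_iff_ne_zero.2 hk0) (Finset.mem_range.1 hkm) y η hη, h0 hm y η hη]

end Sufficiency

/-! ### Smooth local inverses extended to the whole space. -/

section LocalInverse

variable {E : Type} [NormedAddCommGroup E] [InnerProductSpace ℝ E] [FiniteDimensional ℝ E]

/-- `κ` is a smooth map of the whole space, whose restriction to a ball about the origin is the
inverse of `V : D → ball 0 R`. -/
structure IsSmoothInverse (V κ : E → E) (D : Set E) (R : ℝ) : Prop where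
  pos : 0 < R
  isOpen : IsOpen D
  smooth : ContDiff ℝ ∞ κ
  smooth_left : ContDiffOn ℝ ∞ V D
  det_ne_zero : ∀ z ∈ D, (fderiv ℝ V z).det ≠ 0
  maps : ∀ z ∈ D, V z ∈ Metric.ball 0 R
  left_inv : ∀ z ∈ D, κ (V z) = z
  maps_inv : ∀ u ∈ Metric.ball 0 R, κ u ∈ D
  right_inv : ∀ u ∈ Metric.ball 0 R, V (κ u) = u

/-- Inverse function theorem, precomposed with a smooth map of the whole space into the small ball
on which the local inverse is defined. A globally defined `κ` is wanted because
`leading_coefficient_eq_zero` works with amplitudes on all of `E`. -/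
theorem exists_isSmoothInverse {V : E → E} {T : Set E} (hT : IsOpen T) (hV : ContDiffOn ℝ ∞ V T)
    {z₀ : E} (hz₀ : z₀ ∈ T) (hV0 : V z₀ = 0) (hdet : (fderiv ℝ V z₀).det ≠ 0)
    (hdc : Continuous fun L : E →L[ℝ] E => L.det) :
    ∃ κ : E → E, ∃ D ⊆ T, ∃ R : ℝ, IsSmoothInverse V κ D R ∧ κ 0 = z₀ ∧ ∀ u, κ u ∈ T := by
  haveI : CompleteSpace E := FiniteDimensional.complete ℝ E
  have hderiv : ∀ z ∈ T, ∀ h : (fderiv ℝ V z).det ≠ 0, HasFDerivAt V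
      ((fderiv ℝ V z).toContinuousLinearEquivOfDetNeZero h : E →L[ℝ] E) z := fun z hz h => by
    rw [ContinuousLinearMap.coe_toContinuousLinearEquivOfDetNeZero]
    exact ((hV.contDiffAt (hT.mem_nhds hz)).differentiableAt (by simp)).hasFDerivAt
  have hVz₀ := hV.contDiffAt (hT.mem_nhds hz₀)
  set Θ := hVz₀.toOpenPartialHomeomorph V (hderiv z₀ hz₀ hdet) (by simp) with hΘ
  have hΘV : ∀ z, Θ z = V z := fun z => rfl
  have hz₀Θ : z₀ ∈ Θ.source :=
    hVz₀.mem_toOpenPartialHomeomorph_source (hderiv z₀ hz₀ hdet) (by simp)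
  set T' := T ∩ (fun z => (fderiv ℝ V z).det) ⁻¹' {0}ᶜ
  have hT' : IsOpen T' := (hdc.comp_continuousOn
    (hV.continuousOn_fderiv_of_isOpen hT (by simp))).isOpen_inter_preimage hT isOpen_compl_singleton
  have h0t : (0 : E) ∈ Θ.target := by
    rw [← hV0, ← hΘV]
    exact Θ.map_source hz₀Θ
  have hsymm0 : Θ.symm 0 = z₀ := by rw [← hV0, ← hΘV, Θ.left_inv hz₀Θ]
  have hnhd : Θ.target ∩ Θ.symm ⁻¹' T' ∈ 𝓝 (0 : E) := by
    refine (Θ.isOpen_inter_preimage_symm hT').mem_nhds ⟨h0t, ?_⟩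
    rw [mem_preimage, hsymm0]
    exact ⟨hz₀, hdet⟩
  obtain ⟨R, hR, hRb⟩ := Metric.mem_nhds_iff.1 hnhd
  let B : ContDiffBump (0 : E) := ⟨R / 2, R * (3 / 4), by linarith, by linarith⟩
  -- The identity on the ball of radius `R / 2`, with all values in the ball of radius `R`.
  set σ : E → E := fun u => B u • u
  have hσ1 : ∀ u ∈ Metric.ball (0 : E) (R / 2), σ u = u := fun u hu => by
    simp only [σ]
    rw [B.one_of_mem_closedBall (Metric.ball_subset_closedBall hu), one_smul]
  have hσR : ∀ u, σ u ∈ Metric.ball (0 : E) R := fun u => by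
    rw [mem_ball_zero_iff, norm_smul, Real.norm_of_nonneg B.nonneg]
    rcases lt_or_ge ‖u‖ (R * (3 / 4)) with h | h
    · calc B u * ‖u‖ ≤ 1 * ‖u‖ := mul_le_mul_of_nonneg_right B.le_one (norm_nonneg _)
        _ < R := by linarith
    · rw [B.zero_of_le_dist (by simpa using h), zero_mul]
      exact hR
  have hsmooth : ContDiffOn ℝ ∞ Θ.symm (Metric.ball 0 R) := fun u hu => by
    obtain ⟨hut, huT, hud⟩ := hRb hu
    exact (Θ.contDiffAt_symm hut (hderiv _ huT hud)
      (hV.contDiffAt (hT.mem_nhds huT))).contDiffWithinAt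
  have hsub : Metric.ball (0 : E) (R / 2) ⊆ Metric.ball 0 R :=
    Metric.ball_subset_ball (by linarith)
  have hVc : ContinuousOn V (Θ.source ∩ T') :=
    hV.continuousOn.mono (inter_subset_right.trans inter_subset_left)
  refine ⟨fun u => Θ.symm (σ u), (Θ.source ∩ T') ∩ V ⁻¹' Metric.ball 0 (R / 2),
    fun z hz => hz.1.2.1, R / 2, ⟨by positivity, ?_, ?_, ?_, ?_, ?_, ?_, ?_, ?_⟩, ?_, ?_⟩
  · exact hVc.isOpen_inter_preimage (Θ.open_source.inter hT') Metric.isOpen_ball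
  · rw [← contDiffOn_univ]
    exact hsmooth.comp (B.contDiff.smul contDiff_id).contDiffOn fun u _ => hσR u
  · exact hV.mono fun z hz => hz.1.2.1
  · exact fun z hz => hz.1.2.2
  · exact fun z hz => hz.2
  · intro z hz
    rw [hσ1 _ hz.2, ← hΘV, Θ.left_inv hz.1.1]
  · intro u hu
    rw [hσ1 u hu]
    obtain ⟨hut, huT⟩ := hRb (hsub hu)
    refine ⟨⟨Θ.map_target hut, huT⟩, ?_⟩
    rw [mem_preimage, ← hΘV, Θ.right_inv hut]
    exact hu
  · intro u hu
    rw [hσ1 u hu, ← hΘV, Θ.right_inv (hRb (hsub hu)).1]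
  · simp only [σ, smul_zero]
    exact hsymm0
  · exact fun u => (hRb (hσR u)).2.1

variable [MeasurableSpace E] [BorelSpace E]

theorem IsSmoothInverse.integral_comp {V κ : E → E} {D : Set E} {R : ℝ}
    (h : IsSmoothInverse V κ D R) {F : E → ℂ} (hF : ∀ u, R ≤ ‖u‖ → F u = 0) :
    ∫ z in D, |(fderiv ℝ V z).det| • F (V z) = ∫ u, F u := by
  have himg : V '' D = Metric.ball 0 R := by
    refine Subset.antisymm (image_subset_iff.2 h.maps) fun u hu => ?_
    exact ⟨κ u, h.maps_inv u hu, h.right_inv u hu⟩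
  rw [← integral_image_eq_integral_abs_det_fderiv_smul volume h.isOpen.measurableSet
    (fun z hz => (((h.smooth_left.contDiffAt (h.isOpen.mem_nhds hz)).differentiableAt
      (by simp)).hasFDerivAt).hasFDerivWithinAt)
    (fun z hz z' hz' e => by rw [← h.left_inv z hz, ← h.left_inv z' hz', e]), himg]
  refine setIntegral_eq_integral_of_forall_compl_eq_zero fun u hu => hF u ?_
  simpa using hu

end LocalInverse

/-! ### Test functions on the manifold from functions of the phase vector. -/

section TestFunctions

variable {d : ℕ} {M : Type*} [TopologicalSpace M] [ChartedSpace (Coord d) M]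
  [IsManifold (𝓡 d) ∞ M] {g : Metric d M}

/-- The function `|det DV| ρ⁻¹ G ∘ V`, in the chart at `p`, extended by zero. -/
def testFunction (g : Metric d M) (p : M) (V : Coord d → Coord d) (D : Set (Coord d))
    (G : Coord d → ℂ) : M → ℂ :=
  ((chartAt (Coord d) p).source ∩ chartAt (Coord d) p ⁻¹' D).indicator fun y =>
    ((|(fderiv ℝ V (chartAt (Coord d) p y)).det| * (density g p (chartAt (Coord d) p y))⁻¹ : ℝ) : ℂ)
      * G (V (chartAt (Coord d) p y))

/-- `G ∘ V` is supported in the image of a compact ball under `κ`, a closed subset of the coordinate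
patch since `M` is Hausdorff; extension by zero is therefore smooth. -/
theorem contMDiff_testFunction [T2Space M] {p : M} {V κ : Coord d → Coord d} {D : Set (Coord d)}
    {R r₀ : ℝ} (h : IsSmoothInverse V κ D R) (hD : D ⊆ (chartAt (Coord d) p).target) (hr₀ : r₀ < R)
    {G : Coord d → ℂ} (hG : ContDiff ℝ ∞ G) (hG0 : ∀ u, r₀ < ‖u‖ → G u = 0) :
    ContMDiff (𝓡 d) 𝓘(ℝ, ℂ) ∞ (testFunction g p V D G) := by
  set N := (chartAt (Coord d) p).source ∩ chartAt (Coord d) p ⁻¹' D with hN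
  have hNo : IsOpen N := (chartAt (Coord d) p).isOpen_inter_preimage h.isOpen
  set F : Coord d → ℂ := fun z => ((|(fderiv ℝ V z).det| * (density g p z)⁻¹ : ℝ) : ℂ) * G (V z)
  have hF : ContDiffOn ℝ ∞ F D := by
    have h1 : ContDiffOn ℝ ∞ (fun z => |(fderiv ℝ V z).det|) D :=
      (contDiff_det.comp_contDiffOn (h.smooth_left.fderiv_of_isOpen h.isOpen (by simp))).abs
        h.det_ne_zero
    have h2 : ContDiffOn ℝ ∞ (fun z => (density g p z)⁻¹) D :=
      ((contDiffOn_density g p).mono hD).inv fun z hz => (density_pos g (hD hz)).ne'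
    exact (Complex.ofRealCLM.contDiff.comp_contDiffOn (h1.mul h2)).mul
      (hG.comp_contDiffOn h.smooth_left)
  set Kc := pt p '' (κ '' Metric.closedBall 0 r₀)
  have hsub : κ '' Metric.closedBall 0 r₀ ⊆ D := by
    rintro _ ⟨u, hu, rfl⟩
    exact h.maps_inv u (Metric.closedBall_subset_ball hr₀ hu)
  have hKc : IsClosed Kc := (((isCompact_closedBall 0 r₀).image h.smooth.continuous).image_of_continuousOn
    ((continuousOn_pt p).mono (hsub.trans hD))).isClosed
  have hKN : Kc ⊆ N := by
    rintro _ ⟨z, hz, rfl⟩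
    refine ⟨pt_mem_source (hD (hsub hz)), ?_⟩
    rw [mem_preimage, chartAt_pt (hD (hsub hz))]
    exact hsub hz
  intro y
  by_cases hy : y ∈ N
  · have hc : ContMDiffAt (𝓡 d) 𝓘(ℝ, Coord d) ∞ (chartAt (Coord d) p) y :=
      (contMDiffAt_extChartAt' (I := 𝓡 d) (n := ∞) (x := p) hy.1)
    have hFy : ContMDiffAt 𝓘(ℝ, Coord d) 𝓘(ℝ, ℂ) ∞ F (chartAt (Coord d) p y) :=
      (hF.contDiffAt (h.isOpen.mem_nhds hy.2)).contMDiffAt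
    refine (hFy.comp y hc).congr_of_eventuallyEq ?_
    filter_upwards [hNo.mem_nhds hy] with y' hy'
    exact indicator_of_mem hy' _
  · refine (contMDiffAt_const (c := (0 : ℂ))).congr_of_eventuallyEq ?_
    filter_upwards [hKc.isOpen_compl.mem_nhds fun hyK => hy (hKN hyK)] with y' hy'
    by_cases hy'N : y' ∈ N
    · rw [testFunction, indicator_of_mem hy'N, hG0, mul_zero]
      by_contra! hle
      refine hy' ⟨chartAt (Coord d) p y', ⟨V (chartAt (Coord d) p y'), by simpa using hle,
        h.left_inv _ hy'N.2⟩, pt_chartAt hy'N.1⟩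
    · exact indicator_of_notMem hy'N _

variable [MeasurableSpace M] [BorelSpace M]

/-- The prefactor of `testFunction` cancels the Riemannian density and supplies the Jacobian for the
substitution `u = V z`. -/
theorem integral_mul_testFunction [T2Space M] {p : M} {V κ : Coord d → Coord d}
    {D : Set (Coord d)}
    {R r₀ : ℝ} (h : IsSmoothInverse V κ D R) (hD : D ⊆ (chartAt (Coord d) p).target) (hr₀ : r₀ < R)
    {G : Coord d → ℂ} (hG : ContDiff ℝ ∞ G) (hG0 : ∀ u, r₀ < ‖u‖ → G u = 0) {k : M → ℂ}
    (hk : Continuous k) :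
    ∫ y, k y * testFunction g p V D G y ∂(riemannianMeasure g) =
      ∫ u, k (pt p (κ u)) * G u := by
  set N := (chartAt (Coord d) p).source ∩ chartAt (Coord d) p ⁻¹' D with hN
  have hNo : IsOpen N := (chartAt (Coord d) p).isOpen_inter_preimage h.isOpen
  have hND : (chartAt (Coord d) p).target ∩ pt p ⁻¹' N = D := by
    ext z
    constructor
    · rintro ⟨hz, -, hz2⟩
      rwa [mem_preimage, chartAt_pt hz] at hz2
    · intro hz
      refine ⟨hD hz, pt_mem_source (hD hz), ?_⟩
      rwa [mem_preimage, chartAt_pt (hD hz)]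
  have hc := (contMDiff_testFunction (g := g) h hD hr₀ hG hG0).continuous
  rw [← setIntegral_eq_integral_of_forall_compl_eq_zero (s := N) fun y hy => by
      rw [testFunction, indicator_of_notMem hy, mul_zero],
    setIntegral_riemannianMeasure g p hNo.measurableSet inter_subset_left
      (F := fun y => k y * testFunction g p V D G y) (hk.mul hc).aestronglyMeasurable, hND,
    ← h.integral_comp (F := fun u => k (pt p (κ u)) * G u) fun u hu => by
      rw [hG0 u (hr₀.trans_le hu), mul_zero]]
  refine setIntegral_congr_fun h.isOpen.measurableSet fun z hz => ?_
  have hzN : pt p z ∈ N := (hND.symm.subset hz).2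
  have hρ := density_pos g (hD hz)
  have hρ' : (density g p z : ℂ) ≠ 0 := by exact_mod_cast hρ.ne'
  rw [testFunction, indicator_of_mem hzN, chartAt_pt (hD hz), h.left_inv z hz, Complex.real_smul,
    Complex.real_smul]
  push_cast
  field_simp

end TestFunctions

/-! ### Vanishing of the leading part of the symbol of a smoothing operator. -/

section PrincipalSymbol

variable {d : ℕ} {M : Type*} [TopologicalSpace M] [ChartedSpace (Coord d) M]
  [IsManifold (𝓡 d) ∞ M] {g : Metric d M} {r : ℝ} {φ : M → (y : M) → Cotangent d y → ℝ}
  {χ : M → (y : M) → Cotangent d y → ℂ}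

/-- Writing `ζ + τθ = τ(θ + ζ/τ)`, homogeneity and continuity settle the leading part `e`; the rest
has order `-(m + 1)` and contributes `O(1/τ)`. -/
theorem tendsto_pow_mul_symbol {m : ℕ} {b e : (y : M) → Cotangent d y → ℂ}
    (he : SmoothOnCot e)
    (hom : ∀ (y : M) (η : Cotangent d y), η ≠ 0 → ∀ lam : ℝ, 0 < lam →
      e y (lam • η) = ((lam ^ (-(m : ℤ)) : ℝ) : ℂ) * e y η)
    (hbe : SymbolBound (m + 1) fun y η => b y η - e y η) {p : M} {z : Coord d}
    (hz : z ∈ (chartAt (Coord d) p).target) {θ : Coord d} (hθ : θ ≠ 0) (ζ : Coord d) :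
    Tendsto (fun τ : ℝ => (τ : ℂ) ^ m * b (pt p z) (covec p (pt p z) (ζ + τ • θ))) atTop
      (𝓝 (e (pt p z) (covec p (pt p z) θ))) := by
  have hsrc := pt_mem_source hz
  have hθ0 : 0 < ‖θ‖ := norm_pos_iff.2 hθ
  have hinv : Tendsto (fun τ : ℝ => τ⁻¹ • ζ + θ) atTop (𝓝 θ) := by
    simpa using ((tendsto_inv_atTop_zero (𝕜 := ℝ)).smul_const ζ).add_const θ
  have hscale : ∀ τ : ℝ, 0 < τ → ζ + τ • θ = τ • (τ⁻¹ • ζ + θ) := fun τ hτ => by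
    rw [smul_add, smul_smul, mul_inv_cancel₀ hτ.ne', one_smul]
  have hlarge : ∀ᶠ τ : ℝ in atTop, τ * (‖θ‖ / 2) ≤ ‖ζ + τ • θ‖ := by
    filter_upwards [hinv.norm.eventually_const_lt (half_lt_self hθ0), eventually_gt_atTop 0]
      with τ h1 h0
    rw [hscale τ h0, norm_smul, Real.norm_of_nonneg h0.le]
    gcongr
  have h1 : Tendsto (fun τ : ℝ => e (pt p z) (covec p (pt p z) (τ⁻¹ • ζ + θ))) atTop
      (𝓝 (e (pt p z) (covec p (pt p z) θ))) := by
    have hc := ((he p).continuousOn.continuousAt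
      (((chartAt (Coord d) p).open_target.prod isOpen_compl_singleton).mem_nhds
        (show (z, θ) ∈ _ from ⟨hz, hθ⟩)))
    exact (hc.comp (f := fun ξ => (z, ξ)) (x := θ) (by fun_prop)).tendsto.comp hinv
  have h2 : Tendsto (fun τ : ℝ => (τ : ℂ) ^ m * (b (pt p z) (covec p (pt p z) (ζ + τ • θ)) -
      e (pt p z) (covec p (pt p z) (ζ + τ • θ)))) atTop (𝓝 0) := by
    obtain ⟨C, hC⟩ := hbe.bound p {z} isCompact_singleton (singleton_subset_iff.2 hz) 0
    have h3 : Tendsto (fun τ : ℝ => |C| * (2 / ‖θ‖) ^ (m + 1) * τ⁻¹) atTop (𝓝 0) := by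
      simpa using tendsto_inv_atTop_zero.const_mul (|C| * (2 / ‖θ‖) ^ (m + 1))
    refine squeeze_zero_norm' ?_ h3
    filter_upwards [hlarge, eventually_ge_atTop (2 / ‖θ‖), eventually_gt_atTop 0] with τ hl h2 h0
    have hge : 1 ≤ τ * (‖θ‖ / 2) := by
      rw [div_le_iff₀ hθ0] at h2
      linarith
    have := hC z rfl _ (hge.trans hl)
    rw [norm_iteratedFDeriv_zero] at this
    rw [norm_mul, norm_pow, Complex.norm_real, Real.norm_of_nonneg h0.le]
    calc _ ≤ τ ^ m * (C * ‖ζ + τ • θ‖ ^ (-((m + 1 : ℕ) : ℤ))) := by gcongr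
      _ ≤ τ ^ m * (|C| * (τ * (‖θ‖ / 2)) ^ (-((m + 1 : ℕ) : ℤ))) := by
        rw [zpow_neg, zpow_neg, zpow_natCast, zpow_natCast]
        have hp : 0 < τ * (‖θ‖ / 2) := by positivity
        gcongr
        exact le_abs_self C
      _ = _ := by
        rw [zpow_neg, zpow_natCast, mul_pow, div_pow, div_pow, pow_succ τ m]
        field_simp
  have h3 := h2.add h1
  rw [zero_add] at h3
  refine h3.congr' ?_
  filter_upwards [hinv.eventually_ne hθ, eventually_gt_atTop 0] with τ hne h0
  have e1 : e (pt p z) (covec p (pt p z) (ζ + τ • θ)) =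
      ((τ ^ (-(m : ℤ)) : ℝ) : ℂ) * e (pt p z) (covec p (pt p z) (τ⁻¹ • ζ + θ)) := by
    rw [hscale τ h0, covec_smul, hom _ _ (covec_ne_zero hsrc hne) τ h0]
  have e2 : (τ : ℂ) ^ m * ((τ ^ (-(m : ℤ)) : ℝ) : ℂ) = 1 := by
    have : (τ : ℂ) ≠ 0 := by exact_mod_cast h0.ne'
    push_cast
    rw [zpow_neg, zpow_natCast, mul_inv_cancel₀ (pow_ne_zero m this)]
  rw [mul_sub, e1, ← mul_assoc, e2, one_mul, sub_add_cancel]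

variable [MeasurableSpace M] [BorelSpace M]

/-- For fixed `x` the phase vector is a coordinate `u` for `y` near `x`, in which the phase is
exactly `⟨ξ, u⟩`. Test functions that are localised plane waves in `u` reduce the claim to
`leading_coefficient_eq_zero`. -/
theorem IsCutoff.principal_symbol_eq_zero [T2Space M] [CompactSpace M] (hχ : IsCutoff g r χ)
    (hφ : IsLeviCivitaPhase g r φ) (hinj : LeInjectivityRadius g r) (hr : 0 < r) (hd : 1 ≤ d)
    {m : ℕ} {b e : (y : M) → Cotangent d y → ℂ} (hb : SymbolBound m b) (he : SmoothOnCot e)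
    (hom : ∀ (y : M) (η : Cotangent d y), η ≠ 0 → ∀ lam : ℝ, 0 < lam →
      e y (lam • η) = ((lam ^ (-(m : ℤ)) : ℝ) : ℂ) * e y η)
    (hbe : SymbolBound (m + 1) fun y η => b y η - e y η) {K : M → M → ℂ}
    (hK : ContMDiff ((𝓡 d).prod (𝓡 d)) 𝓘(ℝ, ℂ) ∞ (fun q : M × M => K q.1 q.2))
    (hlim : ∀ f : M → ℂ, ContMDiff (𝓡 d) 𝓘(ℝ, ℂ) ∞ f → ∀ x : M,
      Tendsto (fun δ => ∫ y, kernelIntegral g φ (cutAmp χ b) x y δ * f y ∂(riemannianMeasure g))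
        (𝓝[>] 0) (𝓝 (∫ y, K x y * f y ∂(riemannianMeasure g))))
    (x : M) {η : Cotangent d x} (hη : η ≠ 0) : e x η = 0 := by
  have hxx := mem_chart_source (Coord d) x
  obtain ⟨θ, rfl⟩ := exists_covec_self_eq x η
  have hθ : θ ≠ 0 := by
    rintro rfl
    refine hη ?_
    rw [← zero_smul ℝ (0 : Coord d), covec_smul, zero_smul]
  set z₀ := chartAt (Coord d) x x with hz₀def
  have hz₀ : z₀ ∈ (chartAt (Coord d) x).target := (chartAt (Coord d) x).map_source hxx
  have hpx : pt x z₀ = x := pt_chartAt hxx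
  obtain ⟨O, hO, hdiag, hone⟩ := hχ.one_near_diagonal
  obtain ⟨Ω, hreg, hΩ, hxΩ, -, hGb⟩ :=
    hχ.exists_growthBound_symbol hφ hinj hr hd (w := (x, x)) (subset_closure (hχ.diag_mem hd x))
  have hsub := hreg.trans (regularRegion_subset _ _)
  set Ω₁ := Ω ∩ ptPair x x ⁻¹' O
  have hΩ₁ : IsOpen Ω₁ := ((continuousOn_ptPair x x).mono hsub).isOpen_inter_preimage hΩ hO
  -- Besides regularity of the amplitude, `T` ensures that the cut-off equals 1 at large momenta, so
  -- that it is invisible in the limit `τ → ∞`.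
  set T : Set (Coord d) := (fun z => (z₀, z)) ⁻¹' Ω₁
  have hT : IsOpen T := hΩ₁.preimage (by fun_prop)
  have hz₀T : z₀ ∈ T := by
    refine ⟨hxΩ, ?_⟩
    change (pt x z₀, pt x z₀) ∈ O
    rw [hpx]
    exact hdiag x
  have hTt : T ⊆ (chartAt (Coord d) x).target := fun z hz => (hsub hz.1).2
  set V : Coord d → Coord d := fun z => phaseCoord φ x x (z₀, z) with hVdef
  have hV : ContDiffOn ℝ ∞ V T := (hφ.contDiffOn_phaseCoord x x).comp
    (f := fun z => (z₀, z)) (by fun_prop) fun z hz => hsub hz.1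
  have hV0 : V z₀ = 0 := hφ.phaseVec_self hr hd hz₀
  have hdet : (fderiv ℝ V z₀).det ≠ 0 := by
    rw [(hφ.hasFDerivAt_phaseCoord_snd hr hd hz₀).fderiv]
    intro h0
    have h1 := det_adjoint (-ContinuousLinearMap.id ℝ (Coord d))
    have h2 : (-ContinuousLinearMap.id ℝ (Coord d)).det * (-ContinuousLinearMap.id ℝ (Coord d)).det
        = 1 := by
      rw [ContinuousLinearMap.det, ← LinearMap.det_comp]
      convert LinearMap.det_id (M := Coord d) (A := ℝ)
      ext v i
      simp
    rw [h0, mul_zero] at h2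
    exact zero_ne_one h2
  obtain ⟨κ, D, hDT, R, hinv, hκ0, hκT⟩ :=
    exists_isSmoothInverse hT hV hz₀T hV0 hdet contDiff_det.continuous
  have hR := hinv.pos
  let B : ContDiffBump (0 : Coord d) := ⟨R / 4, R / 2, by linarith, by linarith⟩
  have hB0 : ∀ u, R / 2 < ‖u‖ → B u = 0 := fun u hu =>
    B.zero_of_le_dist (by simpa using hu.le)
  have hκ₂ : ContDiffOn ℝ ∞ (fun u => (z₀, κ u)) univ :=
    (contDiff_const.prodMk hinv.smooth).contDiffOn
  set H : Coord d → Coord d → ℝ := fun u ξ => hamSq g x (κ u) ξ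
  have hH : Elliptic univ H := (elliptic_hamSq g x).comp isOpen_univ hinv.smooth.contDiffOn
    fun u _ => hTt (hκT u)
  set b' : Coord d → Coord d → ℂ := fun u ξ => (B u : ℂ) *
    ampCoord g φ (cutAmp χ b) x x (z₀, κ u) ξ
  have hBG : ∀ k, GrowthBound univ k 0 (fun u (_ : Coord d) => (B u : ℂ)) := fun k => by
    have hh : HomAmp univ 0 0 (fun u (_ : Coord d) => (B u : ℂ)) :=
      ⟨(Complex.ofRealCLM.contDiff.comp (B.contDiff.comp contDiff_fst)).contDiffOn,
        fun q _ ξ _ lam _ => by simp⟩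
    simpa using hh.growthBound isOpen_univ le_rfl k
  have hb' : ∀ k, GrowthBound univ k (-(m : ℝ)) b' := fun k => by
    have := (hBG k).mul isOpen_univ ((hGb m b hb k).comp hΩ isOpen_univ hκ₂
      fun u _ => (hκT u).1)
    rwa [zero_add] at this
  have hbr : ∀ u ξ, R / 2 < ‖u‖ → b' u ξ = 0 := fun u ξ hu => by
    simp only [b']
    rw [hB0 u hu, Complex.ofReal_zero, zero_mul]
  -- The limit of `τ ^ m` times the amplitude; at `u = 0` it is a nonzero multiple of the value of
  -- `e` sought.
  set β : Coord d → ℂ := fun u => (B u : ℂ) *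
    ((((2 * Real.pi) ^ d)⁻¹ * weightCoord g φ x x (z₀, κ u) : ℝ) : ℂ) *
      e (pt x (κ u)) (covec x (pt x (κ u)) θ)
  have hβ : Continuous β := by
    have h1 : Continuous fun u => weightCoord g φ x x (z₀, κ u) := by
      rw [← continuousOn_univ]
      exact (hφ.contDiffOn_weightCoord x x).continuousOn.comp hκ₂.continuousOn
        fun u _ => hreg (hκT u).1
    have h2 : Continuous fun u => e (pt x (κ u)) (covec x (pt x (κ u)) θ) := by
      rw [← continuousOn_univ]
      exact (he x).continuousOn.comp (f := fun u => (κ u, θ))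
        (hinv.smooth.continuous.prodMk continuous_const).continuousOn fun u _ => ⟨hTt (hκT u), hθ⟩
    exact ((Complex.continuous_ofReal.comp B.continuous).mul
      (Complex.continuous_ofReal.comp (continuous_const.mul h1))).mul h2
  have hβlim : ∀ u ζ, Tendsto (fun τ : ℝ => (τ : ℂ) ^ m * b' u (ζ + τ • θ)) atTop (𝓝 (β u)) :=
    fun u ζ => by
      have h1 := (tendsto_pow_mul_symbol he hom hbe (hTt (hκT u)) hθ ζ).const_mul
        ((B u : ℂ) * ((((2 * Real.pi) ^ d)⁻¹ * weightCoord g φ x x (z₀, κ u) : ℝ) : ℂ))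
      refine h1.congr' ?_
      obtain ⟨U, hU, R₀, -, hR₀⟩ := exists_one_le_hamiltonian g (hTt (hκT u))
      have h2 : Tendsto (fun τ : ℝ => ‖ζ + τ • θ‖) atTop atTop := by
        have h3 : Tendsto (fun τ : ℝ => τ * ‖θ‖ - ‖ζ‖) atTop atTop :=
          tendsto_atTop_add_const_right _ _
            (tendsto_id.atTop_mul_const (norm_pos_iff.2 hθ))
        refine tendsto_atTop_mono' _ ?_ h3
        filter_upwards [eventually_ge_atTop 0] with τ hτ
        have := norm_sub_norm_le (τ • θ) (-ζ)
        rw [norm_neg, norm_smul, Real.norm_of_nonneg hτ, sub_neg_eq_add, add_comm (τ • θ)] at this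
        exact this
      filter_upwards [h2.eventually_gt_atTop R₀] with τ hτ
      have h3 : χ x (pt x (κ u)) (covec x (pt x (κ u)) (ζ + τ • θ)) = 1 := by
        have h4 : (pt x z₀, pt x (κ u)) ∈ O := (hκT u).2
        rw [hpx] at h4
        exact hone _ _ _ h4 (hR₀ _ (mem_of_mem_nhds hU) _ hτ)
      simp only [b', ampCoord, cutAmp, hpx, h3]
      ring
  have hpt : ContMDiff 𝓘(ℝ, Coord d) (𝓡 d) ∞ fun u => pt x (κ u) := by
    rw [← contMDiffOn_univ]
    exact (contMDiffOn_extChartAt_symm (I := 𝓡 d) (n := ∞) x).comp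
      hinv.smooth.contMDiff.contMDiffOn fun u _ => by
        rw [mem_preimage, extChartAt_target]
        simpa using hTt (hκT u)
  have hκf : ContDiff ℝ ∞ fun u => K x (pt x (κ u)) * (B u : ℂ) := by
    refine ContDiff.mul ?_ (Complex.ofRealCLM.contDiff.comp B.contDiff)
    rw [← contMDiff_iff_contDiff]
    exact hK.comp (contMDiff_const.prodMk hpt)
  have key := leading_coefficient_eq_zero hH hb' hbr hθ hβ hβlim hκf
    (fun u hu => by rw [hB0 u hu, Complex.ofReal_zero, mul_zero]) fun τ _ => ?_
  · have h1 : (B 0 : ℝ) = 1 := B.one_of_mem_closedBall (Metric.mem_closedBall_self B.rIn_pos.le)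
    have h2 : weightCoord g φ x x (z₀, z₀) ≠ 0 := by
      have hρ := density_pos g hz₀
      have h3 := (hreg hz₀T.1).2
      have h4 : 0 < (hessCoord φ x x (z₀, z₀)).det ^ 2 := by positivity
      rw [weightCoord]
      positivity
    simp only [β, h1, Complex.ofReal_one, one_mul] at key
    have h5 := (mul_eq_zero.1 key).resolve_left (by
      rw [hκ0]
      exact_mod_cast mul_ne_zero (by positivity) h2)
    rwa [hκ0, hpx] at h5
  · set G : Coord d → ℂ := fun u => (B u : ℂ) *
      Complex.exp (-(Complex.I * (inner ℝ (τ • θ) u : ℝ)))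
    have hG : ContDiff ℝ ∞ G := by
      refine (Complex.ofRealCLM.contDiff.comp B.contDiff).mul (Complex.contDiff_exp.comp ?_)
      exact (contDiff_const.mul (Complex.ofRealCLM.contDiff.comp
        (contDiff_const.inner ℝ contDiff_id))).neg
    have hG0 : ∀ u, R / 2 < ‖u‖ → G u = 0 := fun u hu => by
      simp only [G]
      rw [hB0 u hu, Complex.ofReal_zero, zero_mul]
    have hDt := hDT.trans hTt
    have hR2 : R / 2 < R := by linarith
    have h1 := hlim _ (contMDiff_testFunction (g := g) hinv hDt hR2 hG hG0) x
    rw [integral_mul_testFunction hinv hDt hR2 hG hG0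
      (continuous_slice (f := K) hK.continuous x)] at h1
    have e1 : ∫ u, K x (pt x (κ u)) * (B u : ℂ) *
        Complex.exp (-(Complex.I * (inner ℝ (τ • θ) u : ℝ))) =
        ∫ u, K x (pt x (κ u)) * G u := by simp only [G, mul_assoc]
    rw [e1]
    refine h1.congr' ?_
    filter_upwards [self_mem_nhdsWithin] with δ hδ
    rw [integral_mul_testFunction hinv hDt hR2 hG hG0
      (continuous_slice (f := fun x y => kernelIntegral g φ (cutAmp χ b) x y δ)
        (hχ.continuous_kernelIntegral_cutAmp hφ hinj hr hd hb hδ) x)]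
    refine integral_congr_ae (.of_forall fun u => ?_)
    have h2 := hχ.kernelIntegral_eq_oscIntegral hφ hd (cutAmp_eq_zero b) (hsub (hκT u).1) δ
    simp only [hpx] at h2
    simp only [G]
    rw [h2, ← mul_assoc]
    congr 1
    -- On the ball `V ∘ κ` is the identity, so the phases agree; outside it the bump function
    -- vanishes and both sides are zero.
    rcases lt_or_ge ‖u‖ R with hu | hu
    · have h3 : phaseCoord φ x x (z₀, κ u) = u := hinv.right_inv u (by simpa using hu)
      rw [oscIntegral, oscIntegral, ← integral_mul_const]
      refine integral_congr_ae (.of_forall fun ξ => ?_)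
      simp only [oscIntegrand, h3, b', H]
      ring
    · rw [hB0 u (hR2.trans_le hu), Complex.ofReal_zero, mul_zero, oscIntegral]
      simp [oscIntegrand, hbr u _ (hR2.trans_le hu)]

end PrincipalSymbol

/-! ### The expansion of a symbol of the identity is trivial. -/

section Necessity

variable {d : ℕ} {M : Type*} [TopologicalSpace M] [ChartedSpace (Coord d) M]
  [IsManifold (𝓡 d) ∞ M] {g : Metric d M} {r : ℝ} {φ : M → (y : M) → Cotangent d y → ℝ}
  {χ : M → (y : M) → Cotangent d y → ℂ} [MeasurableSpace M] [BorelSpace M]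

/-- Subtracting `remainderKernel` from the given kernel leaves a smooth kernel for the operator with
amplitude `(s - 1)χ`. -/
theorem IsCutoff.tendsto_of_isIdentityModSmoothing [T2Space M] [CompactSpace M]
    (hχ : IsCutoff g r χ)
    (hφ : IsLeviCivitaPhase g r φ) (hinj : LeInjectivityRadius g r) (hr : 0 < r) (hd : 1 ≤ d)
    {N : ℕ} {s : (y : M) → Cotangent d y → ℂ} (hb : SymbolBound N fun y η => s y η - 1)
    (h : IsIdentityModSmoothing g φ χ s) :
    ∃ K : M → M → ℂ, ContMDiff ((𝓡 d).prod (𝓡 d)) 𝓘(ℝ, ℂ) ∞ (fun q : M × M => K q.1 q.2) ∧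
      ∀ f : M → ℂ, ContMDiff (𝓡 d) 𝓘(ℝ, ℂ) ∞ f → ∀ x : M,
      Tendsto (fun δ => ∫ y, kernelIntegral g φ (cutAmp χ fun y η => s y η - 1) x y δ * f y
        ∂(riemannianMeasure g)) (𝓝[>] 0) (𝓝 (∫ y, K x y * f y ∂(riemannianMeasure g))) := by
  obtain ⟨K, hK, hlim⟩ := h
  have hK0 := hχ.contMDiff_remainderKernel hφ hinj hr hd
  have hD := hK.sub hK0
  refine ⟨fun x y => K x y - remainderKernel g φ χ x y, hD, fun f hf x => ?_⟩
  have h1 := (hχ.tendsto_remainder hφ hinj hr hd hb hf.continuous x).1 (hlim f hf x)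
  have h2 := integral_add_mul_of_continuous g
    (continuous_slice (f := fun x y => K x y - remainderKernel g φ χ x y) hD.continuous x)
    (hχ.continuous_remainderKernel_right hφ hinj hr hd x) hf.continuous
  simp only [sub_add_cancel] at h2
  rwa [h2, add_sub_add_left_eq_sub, add_sub_cancel_right] at h1

/-- Strong induction: once the coefficients of lower index are those of 1, `s - 1` has order `-m`
and a smoothing operator, so its leading part vanishes. -/
theorem IsCutoff.coefficient_eq [T2Space M] [CompactSpace M] (hχ : IsCutoff g r χ)
    (hφ : IsLeviCivitaPhase g r φ) (hinj : LeInjectivityRadius g r) (hr : 0 < r) (hd : 1 ≤ d)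
    {s : (y : M) → Cotangent d y → ℂ} {c : ℕ → (y : M) → Cotangent d y → ℂ}
    (hs : IsPolyhomogeneous s c) (h : IsIdentityModSmoothing g φ χ s) (m : ℕ) :
    ∀ (y : M) (η : Cotangent d y), η ≠ 0 → c m y η = if m = 0 then 1 else 0 := by
  induction m using Nat.strong_induction_on with
  | _ m ih =>
  have hb : SymbolBound m fun y η => s y η - 1 := by
    refine hs.symbolBound_sub_one (fun hm y η hη => ?_) fun k hk hkm y η hη => ?_
    · simpa using ih 0 hm y η hη
    · rw [ih k hkm y η hη, if_neg (Nat.one_le_iff_ne_zero.1 hk)]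
  obtain ⟨K, hK, hlim⟩ := hχ.tendsto_of_isIdentityModSmoothing hφ hinj hr hd hb h
  intro y η hη
  -- The leading part of `s - 1` is `c 0 - 1` for `m = 0` and `c m` otherwise; the constant 1 enters
  -- only at degree zero, so homogeneity is preserved.
  refine sub_eq_zero.1 (hχ.principal_symbol_eq_zero hφ hinj hr hd hb
    (e := fun y η => c m y η - if m = 0 then 1 else 0)
    (fun p => (hs.smooth_comp m p).sub contDiffOn_const) (fun y η hη lam hlam => ?_) ?_ hK hlim y hη)
  · rw [hs.homogeneous m y η hη lam hlam]
    split_ifs with hm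
    · simp [hm]
    · simp
  · refine (hs.expansion (m + 1)).symbolBound.congr fun y η hη => ?_
    have hsum : ∑ k ∈ Finset.range m, c k y η = ∑ k ∈ Finset.range m, if k = 0 then 1 else 0 :=
      Finset.sum_congr rfl fun k hk => ih k (Finset.mem_range.1 hk) y η hη
    rw [Finset.sum_range_succ, hsum, Finset.sum_ite_eq']
    rcases Nat.eq_zero_or_pos m with rfl | hm
    · simp
    · rw [if_pos (Finset.mem_range.2 hm), if_neg hm.ne']
      ring

end Necessity

end LeviCivitaPhase

end

theorem lemma6p3 {d : ℕ} (hd : 1 ≤ d)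
    {M : Type*} [TopologicalSpace M] [ChartedSpace (LeviCivitaPhase.Coord d) M]
    [IsManifold (𝓡 d) ∞ M] [T2Space M] [CompactSpace M] [ConnectedSpace M]
    [MeasurableSpace M] [BorelSpace M]
    (g : LeviCivitaPhase.Metric d M)
    (r : ℝ) (hr : 0 < r) (hinj : LeviCivitaPhase.LeInjectivityRadius g r)
    (φ : M → (y : M) → LeviCivitaPhase.Cotangent d y → ℝ)
    (hφ : LeviCivitaPhase.IsLeviCivitaPhase g r φ)
    (χ : M → (y : M) → LeviCivitaPhase.Cotangent d y → ℂ)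
    (hχ : LeviCivitaPhase.IsCutoff g r χ) :
    LeviCivitaPhase.IsIdentityModSmoothing g φ χ (fun _ _ => 1) ∧
    ∀ (s : (y : M) → LeviCivitaPhase.Cotangent d y → ℂ)
      (c : ℕ → (y : M) → LeviCivitaPhase.Cotangent d y → ℂ),
      LeviCivitaPhase.IsPolyhomogeneous s c →
      (LeviCivitaPhase.IsIdentityModSmoothing g φ χ s ↔
        (∀ (y : M) (η : LeviCivitaPhase.Cotangent d y), η ≠ 0 → c 0 y η = 1) ∧
        (∀ k : ℕ, 1 ≤ k → ∀ (y : M) (η : LeviCivitaPhase.Cotangent d y), η ≠ 0 → c k y η = 0)) := by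
  open LeviCivitaPhase in
  refine ⟨hχ.isIdentityModSmoothing hφ hinj hr hd fun N => symbolBound_zero N,
    fun s c hs => ⟨fun h => ⟨fun y η hη => ?_, fun k hk y η hη => ?_⟩, fun h => ?_⟩⟩
  · simpa using hχ.coefficient_eq hφ hinj hr hd hs h 0 y η hη
  · simpa [Nat.one_le_iff_ne_zero.1 hk] using hχ.coefficient_eq hφ hinj hr hd hs h k y η hη
  · exact hχ.isIdentityModSmoothing hφ hinj hr hd fun N =>
      hs.symbolBound_sub_one (fun _ => h.1) fun k hk _ => h.2 k hk
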